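/- Let $X=G/K$ be one of the Riemannian symmetric spaces of non-compact type \[ E_{7(7)}/SU(8),\qquad SO^*(12)/U(6),\qquad SO(6,k)/[SO(6)\times SO(k)]\ (k\ge 2),\qquad SU(3,k)/S[U(3)\times U(k)]\ (k\ge 2), \] equipped with any $G$-invariant Riemannian metric $g$ (here $G/K$ denotes the simply connected space; $G$ and $K$ are understood to be connected and may be replaced by finite quotients or coverings). Let $\mathcal P^\bullet$ be the algebra of all parallel differential forms on $X$ ($\nabla\Omega=0$ for the Levi-Civita connection). For $x\in X$ let \[ \mathfrak a_x=\Big\{A\in \mathrm{End}(T_xX)\ :\ \sum_{l=1}^{k}\Omega_x(v_1,\dots,Av_l,\dots,v_k)=0\ \text{ for all } k,\ \Omega\in\mathcal P^k,\ v_1,\dots,v_k\in T_xX\Big\} \] be the annihilator of $\mathcal P^\bullet$, and let $\mathrm{Sym}^2T_x\subset T_x\otimes T_x\cong\mathrm{End}(T_xX)$ be the space of $g_x$-self-adjoint endomorphisms. Then: (1) $\mathfrak a_x\cap \mathrm{Sym}^2T_x=0$ for every $x\in X$. (2) Let $(Y,h)$ be any smooth finite-dimensional Riemannian manifold and let $f\colon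 X\to Y$ be a tamed map, i.e. a smooth map with $D*(df\wedge\Omega)=0$ for every $\Omega\in\mathcal P^\bullet$, where $*$ is the Hodge star of $(X,g)$ (for either orientation) and $D$ is the exterior covariant derivative on $f^*TY$-valued forms defined by the Levi-Civita connection of $h$. Then $f$ is totally geodesic: in local coordinates \[ D_i\partial_jf^a=\partial_i\partial_jf^a-\gamma^k_{ij}\,\partial_kf^a+\Gamma^a_{bc}\,\partial_if^b\,\partial_jf^c=0\qquad\text{for all } i,j,a, \] where $\gamma$ and $\Gamma$ are the Christoffel symbols of $g$ and $h$. -/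

import Mathlib

open scoped Manifold ContDiff

noncomputable section

namespace Sugra

/-! ### Riemannian geometry in a global coordinate domain

`E` is a finite-dimensional real vector space, regarded as a manifold with one global chart; a
metric on it is a field `g` of bilinear forms. All index formulas below are written in the basis
`Module.finBasis ℝ E`. -/

section Geometry

variable {E : Type*} [NormedAddCommGroup E] [NormedSpace ℝ E] [FiniteDimensional ℝ E]
variable {F : Type*} [NormedAddCommGroup F] [NormedSpace ℝ F] [FiniteDimensional ℝ F]

/-- The components `g_ij(x)` of the metric. -/
def gram (g : E → LinearMap.BilinForm ℝ E) (x : E) :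
    Matrix (Fin (Module.finrank ℝ E)) (Fin (Module.finrank ℝ E)) ℝ :=
  Matrix.of fun i j => g x (Module.finBasis ℝ E i) (Module.finBasis ℝ E j)

/-- The Levi-Civita connection form in coordinates,
`γ(u,v)^k = ½ g^{kl} (∂_u g(v,e_l) + ∂_v g(u,e_l) - ∂_l g(u,v))`, so that `∇_u V = ∂_u V + γ(u,V)`. -/
def christoffel (g : E → LinearMap.BilinForm ℝ E) (x u v : E) : E :=
  ∑ k, (∑ l, (gram g x)⁻¹ k l * (1 / 2 : ℝ) *
    (fderiv ℝ (fun y => g y v (Module.finBasis ℝ E l)) x u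
      + fderiv ℝ (fun y => g y u (Module.finBasis ℝ E l)) x v
      - fderiv ℝ (fun y => g y u v) x (Module.finBasis ℝ E l))) • Module.finBasis ℝ E k

/-- The action of an endomorphism of the tangent space on a `k`-form as a derivation:
`(A ⋆ η)(v₁,…,v_k) = ∑_l η(v₁,…,A v_l,…,v_k)`. -/
def derivAction {k : ℕ} (A : Module.End ℝ E) (η : E [⋀^Fin k]→L[ℝ] ℝ) (v : Fin k → E) : ℝ :=
  ∑ l, η (Function.update v l (A (v l)))

/-- A smooth `k`-form `Ω` with `∇Ω = 0`. -/
def IsParallel (g : E → LinearMap.BilinForm ℝ E) {k : ℕ} (Ω : E → E [⋀^Fin k]→L[ℝ] ℝ) : Prop :=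
  ContDiff ℝ ∞ Ω ∧ ∀ (x w : E) (v : Fin k → E),
    fderiv ℝ Ω x w v - ∑ l, Ω x (Function.update v l (christoffel g x w (v l))) = 0

/-- The annihilator, in `End(T_x) = T_x ⊗ T_x`, of the algebra of all parallel forms. -/
def annihilator (g : E → LinearMap.BilinForm ℝ E) (x : E) : Submodule ℝ (Module.End ℝ E) where
  carrier := {A | ∀ (k : ℕ) (Ω : E → E [⋀^Fin k]→L[ℝ] ℝ), IsParallel g Ω →
    ∀ v : Fin k → E, derivAction A (Ω x) v = 0}
  zero_mem' := by
    intro k Ω _ v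
    refine Finset.sum_eq_zero fun l _ => ?_
    exact (Ω x).map_coord_zero l (by simp)
  add_mem' := by
    intro A B hA hB k Ω hΩ v
    have h : derivAction (A + B) (Ω x) v = derivAction A (Ω x) v + derivAction B (Ω x) v := by
      simp only [derivAction, LinearMap.add_apply, ContinuousAlternatingMap.map_update_add,
        Finset.sum_add_distrib]
    rw [h, hA k Ω hΩ v, hB k Ω hΩ v, add_zero]
  smul_mem' := by
    intro c A hA k Ω hΩ v
    have h : derivAction (c • A) (Ω x) v = c * derivAction A (Ω x) v := by
      simp only [derivAction, LinearMap.smul_apply, ContinuousAlternatingMap.map_update_smul,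
        Finset.mul_sum, smul_eq_mul]
    rw [h, hA k Ω hΩ v, mul_zero]

/-- `Sym² T_x` inside `End(T_x)`: the endomorphisms `A` whose bilinear form `g_x(A ·, ·)` is
symmetric. -/
def symTwo (g : E → LinearMap.BilinForm ℝ E) (x : E) : Submodule ℝ (Module.End ℝ E) where
  carrier := {A | ∀ v w, g x (A v) w = g x (A w) v}
  zero_mem' := by intro v w; simp
  add_mem' := by intro A B hA hB v w; simp [hA v w, hB v w]
  smul_mem' := by intro c A hA v w; simp [hA v w]

/-- The Hodge star of a vector-valued `p`-form at `x`:
`(*α)(v₁,…,v_q) = (1/p!) g^{i₁j₁}⋯g^{i_pj_p} α(e_{i₁},…,e_{i_p}) vol(e_{j₁},…,e_{j_p},v₁,…,v_q)`,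
where `vol = √(det g_ij) e¹ ∧ ⋯ ∧ eᵐ` (the orientation is that of the chosen basis). -/
def hodgeStar (g : E → LinearMap.BilinForm ℝ E) {p q : ℕ} (hpq : p + q = Module.finrank ℝ E)
    (x : E) (α : (Fin p → E) → F) (v : Fin q → E) : F :=
  (1 / (p.factorial : ℝ)) • ∑ i : Fin p → Fin (Module.finrank ℝ E),
    ∑ j : Fin p → Fin (Module.finrank ℝ E),
      ((∏ l, (gram g x)⁻¹ (i l) (j l)) *
        (Real.sqrt (gram g x).det * (Module.finBasis ℝ E).det
          (fun a => Fin.append (fun l => Module.finBasis ℝ E (j l)) v (Fin.cast hpq.symm a)))) •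
        α (fun l => Module.finBasis ℝ E (i l))

/-- The form `du ∧ Ω` for a vector-valued function `u` and a `k`-form `Ω`. -/
def dWedge (u : E → F) {k : ℕ} (Ω : E → E [⋀^Fin k]→L[ℝ] ℝ) (x : E) (v : Fin (k + 1) → E) : F :=
  ∑ i : Fin (k + 1), ((-1 : ℝ) ^ (i : ℕ) * Ω x (i.removeNth v)) • fderiv ℝ u x (v i)

/-- The exterior covariant derivative `Dβ` of a `q`-form `β` with values in the pullback `u^*TF` of
the tangent bundle of `(F, h)` with its Levi-Civita connection. -/
def covExtDeriv (h : F → LinearMap.BilinForm ℝ F) (u : E → F) {q : ℕ}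
    (β : E → (Fin q → E) → F) (x : E) (v : Fin (q + 1) → E) : F :=
  ∑ i : Fin (q + 1), (-1 : ℝ) ^ (i : ℕ) •
    (fderiv ℝ (fun y => β y (i.removeNth v)) x (v i)
      + christoffel h (u x) (fderiv ℝ u x (v i)) (β x (i.removeNth v)))

/-- The second fundamental form
`D_i ∂_j u^a = ∂_i ∂_j u^a - γ^k_ij ∂_k u^a + Γ^a_bc ∂_i u^b ∂_j u^c` of a map
`u : (E, g) → (F, h)`. -/
def secondFundamentalForm (g : E → LinearMap.BilinForm ℝ E) (h : F → LinearMap.BilinForm ℝ F)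
    (u : E → F) (x v w : E) : F :=
  fderiv ℝ (fun y => fderiv ℝ u y w) x v - fderiv ℝ u x (christoffel g x v w)
    + christoffel h (u x) (fderiv ℝ u x v) (fderiv ℝ u x w)

/-! ### Maps into an arbitrary Riemannian manifold -/

variable {n : ℕ} {Y : Type*} [TopologicalSpace Y] [ChartedSpace (EuclideanSpace ℝ (Fin n)) Y]
  [IsManifold (𝓡 n) ∞ Y]

/-- The coordinate frame of the chart of `Y` at `y₀`: the differential at `z` of the inverse of the
chart. -/
def chartFrame (y₀ : Y) (z : EuclideanSpace ℝ (Fin n)) :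
    EuclideanSpace ℝ (Fin n) →L[ℝ] TangentSpace (𝓡 n) ((extChartAt (𝓡 n) y₀).symm z) :=
  mfderiv 𝓘(ℝ, EuclideanSpace ℝ (Fin n)) (𝓡 n) (extChartAt (𝓡 n) y₀).symm z

/-- The metric `h_ab(z)` of `Y` read in the chart at `y₀`. -/
def chartMetric
    (h : Bundle.ContMDiffRiemannianMetric (𝓡 n) ∞ (EuclideanSpace ℝ (Fin n))
      (fun y : Y => TangentSpace (𝓡 n) y)) (y₀ : Y) (z : EuclideanSpace ℝ (Fin n)) :
    LinearMap.BilinForm ℝ (EuclideanSpace ℝ (Fin n)) :=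
  LinearMap.mk₂ ℝ
    (fun a b => h.inner ((extChartAt (𝓡 n) y₀).symm z) (chartFrame y₀ z a) (chartFrame y₀ z b))
    (by intro a b c; rw [map_add, map_add, add_apply])
    (by intro r a b; rw [map_smul, map_smul, smul_apply])
    (by intro a b c; rw [map_add, map_add])
    (by intro r a b; rw [map_smul, map_smul])

/-- A smooth map `f : (E, g) → (Y, h)` is tamed iff `D * (df ∧ Ω) = 0` for all parallel forms `Ω`.
The equation at `x` is written in the chart of `Y` at `f x`. (Forms of degree `k = dim E` need not
be listed, as then `df ∧ Ω = 0`.) -/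
def IsTamed (g : E → LinearMap.BilinForm ℝ E)
    (h : Bundle.ContMDiffRiemannianMetric (𝓡 n) ∞ (EuclideanSpace ℝ (Fin n))
      (fun y : Y => TangentSpace (𝓡 n) y)) (f : E → Y) : Prop :=
  ContMDiff 𝓘(ℝ, E) (𝓡 n) ∞ f ∧
  ∀ (k q : ℕ) (hkq : (k + 1) + q = Module.finrank ℝ E) (Ω : E → E [⋀^Fin k]→L[ℝ] ℝ),
    IsParallel g Ω → ∀ (x : E) (v : Fin (q + 1) → E),
      covExtDeriv (chartMetric h (f x)) (fun y => extChartAt (𝓡 n) (f x) (f y))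
        (fun y => hodgeStar g hkq y (dWedge (fun y' => extChartAt (𝓡 n) (f x) (f y')) Ω y)) x v = 0

/-- A map `f : (E, g) → (Y, h)` is totally geodesic iff its whole second fundamental form
`D_i ∂_j f` vanishes. The equation at `x` is written in the chart of `Y` at `f x`. -/
def IsTotallyGeodesic (g : E → LinearMap.BilinForm ℝ E)
    (h : Bundle.ContMDiffRiemannianMetric (𝓡 n) ∞ (EuclideanSpace ℝ (Fin n))
      (fun y : Y => TangentSpace (𝓡 n) y)) (f : E → Y) : Prop :=
  ∀ x v w : E, secondFundamentalForm g (chartMetric h (f x))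
    (fun y => extChartAt (𝓡 n) (f x) (f y)) x v w = 0

end Geometry

/-! ### Symmetric spaces of non-compact type

`𝔤` is a real Lie algebra of complex matrices which is stable under conjugate transposition, so that
`𝔤 = 𝔨 ⊕ 𝔭` is the splitting in skew-Hermitian and Hermitian matrices and `θ(A) = -Aᴴ` is the Cartan
involution. With `G` the connected group with Lie algebra `𝔤` and `K` its maximal compact subgroup,
`x ↦ exp(x) K` is a diffeomorphism of `𝔭` onto `G/K`. The `G`-invariant metric of `G/K` is
`⟨E⁻¹ dE, E⁻¹ dE⟩_𝔭`, where `E` is a coset representative; in this global chart `E = exp(x)`. -/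

section SymmetricSpace

variable {ι : Type*} [Fintype ι] [DecidableEq ι]

attribute [local instance] Matrix.frobeniusNormedAddCommGroup Matrix.frobeniusNormedSpace
  Matrix.frobeniusNormedRing Matrix.frobeniusNormedAlgebra

/-- The Hermitian part `𝔭` of `𝔤`, which is both the tangent space of `G/K` at the base point and
the domain of the global chart `x ↦ exp(x) K`. -/
def hermPart (𝔤 : Submodule ℝ (Matrix ι ι ℂ)) : Submodule ℝ (Matrix ι ι ℂ) :=
  𝔤 ⊓ (selfAdjoint.submodule ℝ (Matrix ι ι ℂ))

/-- The domain of the global chart of `G/K`. -/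
def Chart (𝔤 : Submodule ℝ (Matrix ι ι ℂ)) : Type _ := hermPart 𝔤

instance (𝔤 : Submodule ℝ (Matrix ι ι ℂ)) : NormedAddCommGroup (Chart 𝔤) :=
  inferInstanceAs (NormedAddCommGroup (hermPart 𝔤))

instance (𝔤 : Submodule ℝ (Matrix ι ι ℂ)) : NormedSpace ℝ (Chart 𝔤) :=
  inferInstanceAs (NormedSpace ℝ (hermPart 𝔤))

instance (𝔤 : Submodule ℝ (Matrix ι ι ℂ)) : FiniteDimensional ℝ (Chart 𝔤) :=
  inferInstanceAs (FiniteDimensional ℝ (hermPart 𝔤))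

/-- The matrix of a point of the chart. -/
def Chart.toMatrix (𝔤 : Submodule ℝ (Matrix ι ι ℂ)) : Chart 𝔤 →ₗ[ℝ] Matrix ι ι ℂ :=
  (hermPart 𝔤).subtype

/-- The Maurer-Cartan form `E⁻¹ dE` at `E = exp(x)`, in the direction `v`. -/
def maurerCartan (𝔤 : Submodule ℝ (Matrix ι ι ℂ)) (x v : Chart 𝔤) : Matrix ι ι ℂ :=
  NormedSpace.exp (-(Chart.toMatrix 𝔤 x)) *
    fderiv ℝ (NormedSpace.exp : Matrix ι ι ℂ → Matrix ι ι ℂ) (Chart.toMatrix 𝔤 x)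
      (Chart.toMatrix 𝔤 v)

/-- The `𝔭`-component (Hermitian part) of the Maurer-Cartan form. -/
def vielbein (𝔤 : Submodule ℝ (Matrix ι ι ℂ)) (x v : Chart 𝔤) : Matrix ι ι ℂ :=
  (1 / 2 : ℝ) • (maurerCartan 𝔤 x v + (maurerCartan 𝔤 x v).conjTranspose)

/-- The `G`-invariant Riemannian metric of `G/K` in the global chart, normalized by `c > 0`. -/
def symmetricMetric (𝔤 : Submodule ℝ (Matrix ι ι ℂ)) (c : ℝ) (x : Chart 𝔤) :
    LinearMap.BilinForm ℝ (Chart 𝔤) :=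
  LinearMap.mk₂ ℝ (fun v w => c * (Matrix.trace (vielbein 𝔤 x v * vielbein 𝔤 x w)).re)
    (by
      intro a b w
      have h : vielbein 𝔤 x (a + b) = vielbein 𝔤 x a + vielbein 𝔤 x b := by
        simp only [vielbein, maurerCartan, map_add, mul_add, Matrix.conjTranspose_add, smul_add]
        abel
      simp [h, add_mul, mul_add])
    (by
      intro r a w
      have h : vielbein 𝔤 x (r • a) = r • vielbein 𝔤 x a := by
        simp only [vielbein, maurerCartan, map_smul, Algebra.mul_smul_comm,
          Matrix.conjTranspose_smul, star_trivial, smul_add, smul_comm r]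
      simp [h, mul_left_comm])
    (by
      intro w a b
      have h : vielbein 𝔤 x (a + b) = vielbein 𝔤 x a + vielbein 𝔤 x b := by
        simp only [vielbein, maurerCartan, map_add, mul_add, Matrix.conjTranspose_add, smul_add]
        abel
      simp [h, mul_add])
    (by
      intro r w a
      have h : vielbein 𝔤 x (r • a) = r • vielbein 𝔤 x a := by
        simp only [vielbein, maurerCartan, map_smul, Algebra.mul_smul_comm,
          Matrix.conjTranspose_smul, star_trivial, smul_add, smul_comm r]
      simp [h, mul_left_comm])

end SymmetricSpace

/-! ### The Lie algebras -/

/-- The diagonal form `I_{a,b}` of signature `(a, b)`. -/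
def sigMat (a b : ℕ) : Matrix (Fin a ⊕ Fin b) (Fin a ⊕ Fin b) ℂ := Matrix.fromBlocks 1 0 0 (-1)

/-- `𝔰𝔬(a,b)`: real matrices with `Aᵀ I_{a,b} + I_{a,b} A = 0`. -/
def soLie (a b : ℕ) : Submodule ℝ (Matrix (Fin a ⊕ Fin b) (Fin a ⊕ Fin b) ℂ) where
  carrier := {A | (∀ i j, (A i j).im = 0) ∧ A.transpose * sigMat a b + sigMat a b * A = 0}
  zero_mem' := by simp
  add_mem' := by
    rintro A B ⟨hA, hA'⟩ ⟨hB, hB'⟩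
    refine ⟨fun i j => by simp [hA i j, hB i j], ?_⟩
    rw [Matrix.transpose_add, add_mul, mul_add, add_add_add_comm, hA', hB', add_zero]
  smul_mem' := by
    rintro c A ⟨hA, hA'⟩
    refine ⟨fun i j => by simp [hA i j], ?_⟩
    rw [Matrix.transpose_smul, smul_mul_assoc, mul_smul_comm, ← smul_add, hA', smul_zero]

/-- `𝔰𝔲(a,b)`: traceless complex matrices with `Aᴴ I_{a,b} + I_{a,b} A = 0`. -/
def suLie (a b : ℕ) : Submodule ℝ (Matrix (Fin a ⊕ Fin b) (Fin a ⊕ Fin b) ℂ) where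
  carrier := {A | A.trace = 0 ∧ A.conjTranspose * sigMat a b + sigMat a b * A = 0}
  zero_mem' := by simp
  add_mem' := by
    rintro A B ⟨hA, hA'⟩ ⟨hB, hB'⟩
    refine ⟨by rw [Matrix.trace_add, hA, hB, add_zero], ?_⟩
    rw [Matrix.conjTranspose_add, add_mul, mul_add, add_add_add_comm, hA', hB', add_zero]
  smul_mem' := by
    rintro c A ⟨hA, hA'⟩
    refine ⟨by rw [Matrix.trace_smul, hA, smul_zero], ?_⟩
    rw [Matrix.conjTranspose_smul, star_trivial, smul_mul_assoc, mul_smul_comm, ← smul_add, hA',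
      smul_zero]

/-- The symplectic matrix `J` of size `2n`. -/
def sympMat (n : ℕ) : Matrix (Fin n ⊕ Fin n) (Fin n ⊕ Fin n) ℂ := Matrix.fromBlocks 0 1 (-1) 0

/-- `𝔰𝔬*(2n)`: complex matrices with `Aᵀ = -A` and `Aᴴ J + J A = 0`. -/
def soStarLie (n : ℕ) : Submodule ℝ (Matrix (Fin n ⊕ Fin n) (Fin n ⊕ Fin n) ℂ) where
  carrier := {A | A.transpose + A = 0 ∧ A.conjTranspose * sympMat n + sympMat n * A = 0}
  zero_mem' := by simp
  add_mem' := by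
    rintro A B ⟨hA, hA'⟩ ⟨hB, hB'⟩
    refine ⟨by rw [Matrix.transpose_add, add_add_add_comm, hA, hB, add_zero], ?_⟩
    rw [Matrix.conjTranspose_add, add_mul, mul_add, add_add_add_comm, hA', hB', add_zero]
  smul_mem' := by
    rintro c A ⟨hA, hA'⟩
    refine ⟨by rw [Matrix.transpose_smul, ← smul_add, hA, smul_zero], ?_⟩
    rw [Matrix.conjTranspose_smul, star_trivial, smul_mul_assoc, mul_smul_comm, ← smul_add, hA',
      smul_zero]

/-- Pairs `a < b`, which index the basis `e_a ∧ e_b` of `Λ²ℂ⁸`. -/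
abbrev Pair8 : Type := {p : Fin 8 × Fin 8 // p.1 < p.2}

/-- The action of `L : Matrix (Fin 8) (Fin 8) ℂ` on `Λ²ℂ⁸`, in the basis `e_a ∧ e_b`, `a < b`. -/
def wedgeTwo (L : Matrix (Fin 8) (Fin 8) ℂ) : Matrix Pair8 Pair8 ℂ :=
  Matrix.of fun p r =>
    L p.1.1 r.1.1 * (if p.1.2 = r.1.2 then 1 else 0)
      + (if p.1.1 = r.1.1 then 1 else 0) * L p.1.2 r.1.2
      - L p.1.1 r.1.2 * (if p.1.2 = r.1.1 then 1 else 0)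
      - (if p.1.1 = r.1.2 then 1 else 0) * L p.1.2 r.1.1

theorem wedgeTwo_add (L M : Matrix (Fin 8) (Fin 8) ℂ) :
    wedgeTwo (L + M) = wedgeTwo L + wedgeTwo M := by
  ext p r
  simp only [wedgeTwo, Matrix.of_apply, Matrix.add_apply]
  ring

theorem wedgeTwo_smul (c : ℝ) (L : Matrix (Fin 8) (Fin 8) ℂ) :
    wedgeTwo (c • L) = c • wedgeTwo L := by
  ext p r
  simp only [wedgeTwo, Matrix.of_apply, Matrix.smul_apply, Complex.real_smul]
  ring

/-- A 4-index tensor `Σ_{abcd}` of `ℂ⁸` which is antisymmetric and self-dual,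
`(Σ_{abcd})^* = (1/4!) ε_{abcdefgh} Σ_{efgh}`: the real representation `𝟕𝟎` of `SU(8)`. By
antisymmetry the duality says `(Σ_{π0 π1 π2 π3})^* = sgn(π) Σ_{π4 π5 π6 π7}` for all permutations. -/
def IsSelfDualFour (t : (Fin 4 → Fin 8) → ℂ) : Prop :=
  (∀ (v : Fin 4 → Fin 8) (s : Equiv.Perm (Fin 4)),
    t (v ∘ s) = ((Equiv.Perm.sign s : ℤ) : ℂ) * t v) ∧
  (∀ s : Equiv.Perm (Fin 8), star (t ![s 0, s 1, s 2, s 3]) =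
    ((Equiv.Perm.sign s : ℤ) : ℂ) * t ![s 4, s 5, s 6, s 7])

/-- The matrix `Σ_{ab,cd}` on `Λ²ℂ⁸`. -/
def fourMat (t : (Fin 4 → Fin 8) → ℂ) : Matrix Pair8 Pair8 ℂ :=
  Matrix.of fun p r => t ![p.1.1, p.1.2, r.1.1, r.1.2]

/-- `𝔢₇₍₇₎` in its fundamental representation `𝟓𝟔 = Λ²ℂ⁸ ⊕ (Λ²ℂ⁸)^*`, in an `SU(8)` basis:
`(z, z̄) ↦ (Λ z + Σ z̄, Σ̄ z + Λ̄ z̄)` with `Λ ∈ 𝔰𝔲(8)` and `Σ` a self-dual 4-form. -/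
def e77Lie : Submodule ℝ (Matrix (Pair8 ⊕ Pair8) (Pair8 ⊕ Pair8) ℂ) where
  carrier := {A | ∃ (L : Matrix (Fin 8) (Fin 8) ℂ) (t : (Fin 4 → Fin 8) → ℂ),
    L.conjTranspose + L = 0 ∧ L.trace = 0 ∧ IsSelfDualFour t ∧
    A = Matrix.fromBlocks (wedgeTwo L) (fourMat t) ((fourMat t).map star) ((wedgeTwo L).map star)}
  zero_mem' := by
    refine ⟨0, 0, by simp, by simp, ⟨by simp, by simp⟩, ?_⟩
    ext (i | i) (j | j) <;> simp [wedgeTwo, fourMat]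
  add_mem' := by
    rintro _ _ ⟨L, t, h1, h2, ⟨h3, h4⟩, rfl⟩ ⟨L', t', h1', h2', ⟨h3', h4'⟩, rfl⟩
    refine ⟨L + L', t + t', ?_, ?_, ⟨?_, ?_⟩, ?_⟩
    · rw [Matrix.conjTranspose_add, add_add_add_comm, h1, h1', add_zero]
    · rw [Matrix.trace_add, h2, h2', add_zero]
    · intro v s; simp only [Pi.add_apply, h3 v s, h3' v s, mul_add]
    · intro s; simp only [Pi.add_apply, star_add, h4 s, h4' s, mul_add]
    · ext (i | i) (j | j) <;> simp [wedgeTwo_add, fourMat]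
  smul_mem' := by
    rintro c _ ⟨L, t, h1, h2, ⟨h3, h4⟩, rfl⟩
    refine ⟨c • L, c • t, ?_, ?_, ⟨?_, ?_⟩, ?_⟩
    · rw [Matrix.conjTranspose_smul, star_trivial, ← smul_add, h1, smul_zero]
    · rw [Matrix.trace_smul, h2, smul_zero]
    · intro v s; simp only [Pi.smul_apply, h3 v s, mul_smul_comm]
    · intro s; simp only [Pi.smul_apply, star_smul, star_trivial, h4 s, mul_smul_comm]
    · ext (i | i) (j | j) <;> simp [wedgeTwo_smul, fourMat]

/-- The non-strict irreducible non-compact symmetric spaces of 4d supergravity with at least three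
supersymmetries:
`E₇₍₇₎/SU(8)`, `SO*(12)/U(6)`, `SO(6,k)/[SO(6)×SO(k)]` and `SU(3,k)/S[U(3)×U(k)]`, `k ≥ 2`. -/
inductive SugraSpace : Type
  | e77 : SugraSpace
  | soStar12 : SugraSpace
  | so6 (k : ℕ) (hk : 2 ≤ k) : SugraSpace
  | su3 (k : ℕ) (hk : 2 ≤ k) : SugraSpace

namespace SugraSpace

/-- The index set of the matrices in the Lie algebra of `G`. -/
def Index : SugraSpace → Type
  | e77 => Pair8 ⊕ Pair8
  | soStar12 => Fin 6 ⊕ Fin 6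
  | so6 k _ => Fin 6 ⊕ Fin k
  | su3 k _ => Fin 3 ⊕ Fin k

instance : (S : SugraSpace) → Fintype S.Index
  | e77 => inferInstanceAs (Fintype (Pair8 ⊕ Pair8))
  | soStar12 => inferInstanceAs (Fintype (Fin 6 ⊕ Fin 6))
  | so6 k _ => inferInstanceAs (Fintype (Fin 6 ⊕ Fin k))
  | su3 k _ => inferInstanceAs (Fintype (Fin 3 ⊕ Fin k))

instance : (S : SugraSpace) → DecidableEq S.Index
  | e77 => inferInstanceAs (DecidableEq (Pair8 ⊕ Pair8))
  | soStar12 => inferInstanceAs (DecidableEq (Fin 6 ⊕ Fin 6))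
  | so6 k _ => inferInstanceAs (DecidableEq (Fin 6 ⊕ Fin k))
  | su3 k _ => inferInstanceAs (DecidableEq (Fin 3 ⊕ Fin k))

/-- The Lie algebra `𝔤` of `G`. -/
def lie : (S : SugraSpace) → Submodule ℝ (Matrix S.Index S.Index ℂ)
  | e77 => e77Lie
  | soStar12 => soStarLie 6
  | so6 k _ => soLie 6 k
  | su3 k _ => suLie 3 k

/-- The manifold `X = G/K`, in its global exponential chart. -/
abbrev Space (S : SugraSpace) : Type := Chart S.lie

/-- The `G`-invariant metric of `X = G/K`, normalized by `c > 0`. -/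
abbrev metric (S : SugraSpace) (c : ℝ) : S.Space → LinearMap.BilinForm ℝ S.Space :=
  symmetricMetric S.lie c

end SugraSpace

end Sugra

end

/-! In the exponential chart the Hermitian part of `E⁻¹ dE` is an orthonormal coframe of the
invariant metric. By the Maurer-Cartan equation, the adjoint action of the skew-Hermitian part is
the Levi-Civita connection in that frame. A form on `𝔭` that is killed by `𝔨` therefore becomes a
parallel form on `G/K` when it is given constant components in the frame. Only this direction is
needed: these parallel forms already suffice for both claims.

Let `f` be tamed and let `φ` be a linear functional on the model space of a chart of `Y`. The dual
of an invariant form is again invariant, so `D * (df ∧ Ω) = 0` becomes purely algebraic: the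
self-adjoint endomorphism `A` representing `φ(Ddf)` acts on `*Ω` as a derivation with result zero.
Derivations satisfy `A ⋆ (*Ω) = *((tr A) Ω - Aᵀ ⋆ Ω)`, and the Hodge dual is injective, hence `A ⋆ Ω
= (tr A) Ω`. The form `Ω = 1` gives `tr A = 0`, so `A` annihilates every invariant form
(`derivAction_secondFundamentalForm_eq_zero`). Both claims are thus reduced to one statement about
the isotropy representation: a self-adjoint endomorphism of `𝔭` which annihilates all `𝔨`-invariant
forms is zero (`annihilator_and_isTotallyGeodesic`).

That statement is proved on the complexification of `𝔭`, with Chern-Weil forms of the curvature `R =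
[·, ·]`. For `SU(3,k)` and `SO*(12)` the Kähler form makes `A` exchange `𝔭⁺` and `𝔭⁻`; evaluating
`tr F²`, respectively `tr F³`, on elementary matrices then isolates every matrix entry of `A`. For
`SO(6,k)` the Euler form (`hafnianForm`) forces `A = s ⊗ 1` with `s` acting on `ℂ⁶`, and the first
Pontryagin form forces `s = 0`.

For `E₇₍₇₎` the form `tr F³` on `Λ²ℂ⁸`, evaluated on weight vectors, gives linear relations between
the diagonal matrix elements of `A`. They are indexed by the points of a Fano plane and have only
the zero solution (`diagCoeff_eq_zero`). The annihilators form an `𝔰𝔲(8)`-module, so raising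
operators carry this vanishing over to all matrix elements (`fourCoeff_complexify_eq_zero`). -/

noncomputable section

namespace Sugra

/-! ### The derivative of the exponential in a Banach algebra and the Maurer-Cartan equation. -/

section BanachExp

variable {𝔸 : Type*} [NormedRing 𝔸] [NormedAlgebra ℝ 𝔸] [CompleteSpace 𝔸]

open NormedSpace

/-- Duhamel's formula: the integrand is the derivative of `exp((1 - s) x) exp(s (x + u))`, a curve
which runs from `exp x` to `exp(x + u)`. -/
theorem exp_add_sub_exp (x u : 𝔸) :
    exp (x + u) - exp x = ∫ s in (0 : ℝ)..1, exp ((1 - s) • x) * u * exp (s • (x + u)) := by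
  have hder : ∀ s : ℝ, HasDerivAt (fun s : ℝ => exp ((1 - s) • x) * exp (s • (x + u)))
      (exp ((1 - s) • x) * u * exp (s • (x + u))) s := by
    intro s
    have h1 : HasDerivAt (fun s : ℝ => exp ((1 - s) • x)) (-(exp ((1 - s) • x) * x)) s := by
      have := (hasDerivAt_exp_smul_const (𝕂 := ℝ) x (1 - s)).scomp s
        ((hasDerivAt_id s).const_sub 1)
      simpa [Function.comp_def] using this
    have h2 : HasDerivAt (fun s : ℝ => exp (s • (x + u))) ((x + u) * exp (s • (x + u))) s :=
      hasDerivAt_exp_smul_const' (𝕂 := ℝ) (x + u) s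
    refine (h1.mul h2).congr_deriv ?_
    noncomm_ring
  let _ : NormedAlgebra ℚ 𝔸 := NormedAlgebra.restrictScalars ℚ ℝ 𝔸
  have hcont : Continuous fun s : ℝ => exp ((1 - s) • x) * u * exp (s • (x + u)) := by
    have he : Continuous (exp : 𝔸 → 𝔸) := exp_continuous
    fun_prop
  rw [intervalIntegral.integral_eq_sub_of_hasDerivAt (fun s _ => hder s)
    (hcont.intervalIntegrable _ _)]
  simp

/-- Duhamel's formula with `u = t v` writes the difference quotient of `exp` as an integral `Φ t`
which is continuous in `t`; the derivative is its value at `t = 0`. -/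
theorem fderiv_exp_apply (x v : 𝔸) :
    fderiv ℝ (exp : 𝔸 → 𝔸) x v = ∫ s in (0 : ℝ)..1, exp ((1 - s) • x) * v * exp (s • x) := by
  have hd : DifferentiableAt ℝ (exp : 𝔸 → 𝔸) x := (exp_analytic (𝕂 := ℝ) x).differentiableAt
  have h1 : HasDerivAt (fun t : ℝ => exp (x + t • v)) (fderiv ℝ (exp : 𝔸 → 𝔸) x v) 0 := by
    have h0 : HasDerivAt (fun t : ℝ => x + t • v) v 0 := by
      simpa using ((hasDerivAt_id (0 : ℝ)).smul_const v).const_add x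
    have hd' : HasFDerivAt (exp : 𝔸 → 𝔸) (fderiv ℝ (exp : 𝔸 → 𝔸) x) (x + (0 : ℝ) • v) := by
      simpa using hd.hasFDerivAt
    exact hd'.comp_hasDerivAt (0 : ℝ) h0
  set Φ : ℝ → 𝔸 := fun t => ∫ s in (0 : ℝ)..1, exp ((1 - s) • x) * v * exp (s • (x + t • v))
    with hΦ
  let _ : NormedAlgebra ℚ 𝔸 := NormedAlgebra.restrictScalars ℚ ℝ 𝔸
  have hΦc : Continuous Φ := by
    apply intervalIntegral.continuous_parametric_intervalIntegral_of_continuous'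
    have he : Continuous (exp : 𝔸 → 𝔸) := exp_continuous
    fun_prop
  have hslope : ∀ t : ℝ, exp (x + t • v) = exp x + t • Φ t := by
    intro t
    rw [← sub_eq_iff_eq_add', exp_add_sub_exp, hΦ, ← intervalIntegral.integral_smul]
    simp only [mul_smul_comm, smul_mul_assoc]
  have h2 : HasDerivAt (fun t : ℝ => exp (x + t • v)) (Φ 0) 0 := by
    rw [hasDerivAt_iff_tendsto_slope]
    have h3 : Filter.Tendsto Φ (nhdsWithin 0 {0}ᶜ) (nhds (Φ 0)) :=
      (hΦc.tendsto 0).mono_left nhdsWithin_le_nhds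
    refine h3.congr' ?_
    filter_upwards [self_mem_nhdsWithin] with t ht
    have ht' : t ≠ 0 := ht
    simp [slope, hslope t, smul_smul, ht']
  rw [h1.unique h2, hΦ]
  simp

theorem exp_neg_mul_fderiv_exp (x v : 𝔸) :
    exp (-x) * fderiv ℝ (exp : 𝔸 → 𝔸) x v =
      ∫ s in (0 : ℝ)..1, exp (-(s • x)) * v * exp (s • x) := by
  let _ : NormedAlgebra ℚ 𝔸 := NormedAlgebra.restrictScalars ℚ ℝ 𝔸
  have hcont : Continuous fun s : ℝ => exp ((1 - s) • x) * v * exp (s • x) := by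
    have he : Continuous (exp : 𝔸 → 𝔸) := exp_continuous
    fun_prop
  rw [fderiv_exp_apply, ← ContinuousLinearMap.mul_apply' ℝ 𝔸,
    ← ContinuousLinearMap.intervalIntegral_comp_comm _ (hcont.intervalIntegrable _ _)]
  congr 1
  ext s
  rw [ContinuousLinearMap.mul_apply', ← mul_assoc, ← mul_assoc, ← exp_add_of_commute]
  · congr 3; module
  · exact ((Commute.refl x).smul_right _).neg_left

/-- `Ad` is the exponential of `ad`, transported along `j`: with `y t = exp(t T) v` the curve `exp(t
x) j(y t) exp(-t x)` has zero derivative. Exponentiating on `E` instead of `𝔸` keeps the orbit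
visibly inside the range of `j`. -/
theorem exp_neg_mul_mul_exp {E : Type*} [NormedAddCommGroup E] [NormedSpace ℝ E]
    [CompleteSpace E] (j : E →L[ℝ] 𝔸) (T : E →L[ℝ] E) (x : 𝔸)
    (hT : ∀ a, j (T a) = j a * x - x * j a) (v : E) :
    exp (-x) * j v * exp x = j (exp T v) := by
  let _ : NormedAlgebra ℚ 𝔸 := NormedAlgebra.restrictScalars ℚ ℝ 𝔸
  let y : ℝ → E := fun t => exp (t • T) v
  have hy : ∀ t, HasDerivAt (fun t => j (y t)) (j (y t) * x - x * j (y t)) t := by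
    intro t
    have h1 : HasDerivAt (fun t : ℝ => exp (t • T)) (T * exp (t • T)) t :=
      hasDerivAt_exp_smul_const' (𝕂 := ℝ) T t
    have h2 := j.hasFDerivAt.comp_hasDerivAt t (h1.clm_apply (hasDerivAt_const t v))
    simp only [mul_apply_eq_comp, map_zero, add_zero, hT] at h2
    exact h2
  have hz : ∀ t, HasDerivAt (fun t : ℝ => exp (t • x) * j (y t) * exp (-(t • x))) 0 t := by
    intro t
    have h1 : HasDerivAt (fun t : ℝ => exp (t • x)) (exp (t • x) * x) t :=
      hasDerivAt_exp_smul_const (𝕂 := ℝ) x t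
    have h2 : HasDerivAt (fun t : ℝ => exp (-(t • x))) (-x * exp (-(t • x))) t := by
      have := hasDerivAt_exp_smul_const' (𝕂 := ℝ) (-x) t
      simpa using this
    refine ((h1.mul (hy t)).mul h2).congr_deriv ?_
    simp only [Pi.mul_apply]
    noncomm_ring
  have hc : exp ((1 : ℝ) • x) * j (y 1) * exp (-((1 : ℝ) • x)) =
      exp ((0 : ℝ) • x) * j (y 0) * exp (-((0 : ℝ) • x)) :=
    is_const_of_deriv_eq_zero (fun t => (hz t).differentiableAt) (fun t => (hz t).deriv) 1 0
  have h0 : y 0 = v := by simp [y]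
  have h1 : y 1 = exp T v := by simp [y]
  have hinv : exp (-x) * exp x = 1 := by
    rw [← exp_add_of_commute ((Commute.refl x).neg_left)]; simp
  rw [h0, h1] at hc
  simp only [one_smul, zero_smul, neg_zero, exp_zero, one_mul, mul_one] at hc
  rw [← hc]
  calc exp (-x) * (exp x * j (exp T v) * exp (-x)) * exp x
      = (exp (-x) * exp x) * j (exp T v) * (exp (-x) * exp x) := by noncomm_ring
    _ = j (exp T v) := by rw [hinv]; simp

/-- By `exp_neg_mul_mul_exp` the integrand is the image of a curve in a coordinate space of `𝔤`, and
integration commutes with the linear inclusion. Coordinates are used so that completeness and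
continuity are automatic. -/
theorem integral_exp_neg_mul_mul_exp_mem (𝔤 : Submodule ℝ 𝔸) [FiniteDimensional ℝ 𝔤] {x v : 𝔸}
    (h𝔤 : ∀ a ∈ 𝔤, a * x - x * a ∈ 𝔤) (hv : v ∈ 𝔤) :
    ∫ s in (0 : ℝ)..1, exp (-(s • x)) * v * exp (s • x) ∈ 𝔤 := by
  let e := (Module.finBasis ℝ 𝔤).equivFun
  let T₀ : 𝔤 →ₗ[ℝ] 𝔤 :=
    ((LinearMap.mulRight ℝ x - LinearMap.mulLeft ℝ x).comp 𝔤.subtype).codRestrict 𝔤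
      (fun a => by simpa using h𝔤 a a.2)
  let j : (Fin (Module.finrank ℝ 𝔤) → ℝ) →L[ℝ] 𝔸 :=
    LinearMap.toContinuousLinearMap (𝔤.subtype.comp e.symm.toLinearMap)
  let T : (Fin (Module.finrank ℝ 𝔤) → ℝ) →L[ℝ] (Fin (Module.finrank ℝ 𝔤) → ℝ) :=
    LinearMap.toContinuousLinearMap ((e.toLinearMap.comp T₀).comp e.symm.toLinearMap)
  have hj : ∀ a, j a = (e.symm a : 𝔤) := fun a => rfl
  have hT : ∀ a, j (T a) = j a * x - x * j a := by
    intro a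
    have : T a = e (T₀ (e.symm a)) := rfl
    rw [hj, this, e.symm_apply_apply, hj]
    rfl
  have hv' : j (e ⟨v, hv⟩) = v := by rw [hj, e.symm_apply_apply]
  have key : ∀ s : ℝ, exp (-(s • x)) * v * exp (s • x) = j (exp (s • T) (e ⟨v, hv⟩)) := by
    intro s
    rw [← exp_neg_mul_mul_exp j (s • T) (s • x), hv']
    intro a
    rw [smul_apply, map_smul, hT, smul_sub, mul_smul_comm, smul_mul_assoc]
  simp only [key]
  have hc : Continuous fun s : ℝ => exp (s • T) (e ⟨v, hv⟩) := by
    have he : Continuous fun s : ℝ => exp (s • T) :=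
      continuous_iff_continuousAt.2 fun t =>
        (hasDerivAt_exp_smul_const' (𝕂 := ℝ) T t).continuousAt
    exact he.clm_apply continuous_const
  rw [ContinuousLinearMap.intervalIntegral_comp_comm _ (hc.intervalIntegrable _ _), hj]
  exact Subtype.mem _

/-- The Maurer-Cartan equation. -/
theorem fderiv_exp_neg_mul_fderiv_exp (x v w : 𝔸) :
    fderiv ℝ (fun y : 𝔸 => exp (-y) * fderiv ℝ (exp : 𝔸 → 𝔸) y v) x w
      - fderiv ℝ (fun y : 𝔸 => exp (-y) * fderiv ℝ (exp : 𝔸 → 𝔸) y w) x v =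
    (exp (-x) * fderiv ℝ (exp : 𝔸 → 𝔸) x v) * (exp (-x) * fderiv ℝ (exp : 𝔸 → 𝔸) x w)
      - (exp (-x) * fderiv ℝ (exp : 𝔸 → 𝔸) x w) *
        (exp (-x) * fderiv ℝ (exp : 𝔸 → 𝔸) x v) := by
  let _ : NormedAlgebra ℚ 𝔸 := NormedAlgebra.restrictScalars ℚ ℝ 𝔸
  have hsm : ContDiff ℝ ω (exp : 𝔸 → 𝔸) :=
    contDiff_iff_contDiffAt.2 fun x => (exp_analytic (𝕂 := ℝ) x).contDiffAt
  have hd1 : Differentiable ℝ (exp : 𝔸 → 𝔸) := hsm.differentiable (by simp)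
  have hd2 : Differentiable ℝ (fderiv ℝ (exp : 𝔸 → 𝔸)) :=
    (hsm.fderiv_right (m := 1) (by simp)).differentiable (by simp)
  have hinv : ∀ y : 𝔸, exp (-y) * exp y = 1 := fun y => by
    rw [← exp_add_of_commute ((Commute.refl y).neg_left)]; simp
  have hinv' : ∀ y : 𝔸, exp y * exp (-y) = 1 := fun y => by simpa using hinv (-y)
  have hdn : Differentiable ℝ (fun y : 𝔸 => exp (-y)) := hd1.comp differentiable_id.neg
  -- The derivative of the inverse, obtained by differentiating `exp(-y) exp(y) = 1`.
  have hn : ∀ a, fderiv ℝ (fun y : 𝔸 => exp (-y)) x a =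
      -(exp (-x) * fderiv ℝ (exp : 𝔸 → 𝔸) x a * exp (-x)) := by
    intro a
    have h1 : HasFDerivAt (fun y : 𝔸 => exp (-y) * exp y) (0 : 𝔸 →L[ℝ] 𝔸) x := by
      simpa only [hinv] using hasFDerivAt_const (1 : 𝔸) x
    have h2 := (hdn x).hasFDerivAt.mul' (hd1 x).hasFDerivAt
    have h3 := congrArg (fun L : 𝔸 →L[ℝ] 𝔸 => L a * exp (-x)) (h2.unique h1)
    simp only [add_apply, smul_apply, smul_eq_mul, zero_apply, zero_mul, add_mul,
      MulOpposite.smul_eq_mul_unop, MulOpposite.unop_op, mul_assoc, hinv', mul_one] at h3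
    rw [mul_assoc, eq_neg_iff_add_eq_zero, add_comm]
    exact h3
  have key : ∀ a b, fderiv ℝ (fun y : 𝔸 => exp (-y) * fderiv ℝ (exp : 𝔸 → 𝔸) y a) x b =
      exp (-x) * fderiv ℝ (fderiv ℝ (exp : 𝔸 → 𝔸)) x b a
        - exp (-x) * fderiv ℝ (exp : 𝔸 → 𝔸) x b * exp (-x) * fderiv ℝ (exp : 𝔸 → 𝔸) x a := by
    intro a b
    have h2 : HasFDerivAt (fun y : 𝔸 => fderiv ℝ (exp : 𝔸 → 𝔸) y a)
        ((ContinuousLinearMap.apply ℝ 𝔸 a).comp (fderiv ℝ (fderiv ℝ (exp : 𝔸 → 𝔸)) x)) x :=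
      (ContinuousLinearMap.apply ℝ 𝔸 a).hasFDerivAt.comp x (hd2 x).hasFDerivAt
    have h3 := (HasFDerivAt.mul' (hdn x).hasFDerivAt h2).fderiv
    refine (congrArg (fun L : 𝔸 →L[ℝ] 𝔸 => L b) h3).trans ?_
    simp only [add_apply, smul_apply, smul_eq_mul, MulOpposite.smul_eq_mul_unop,
      MulOpposite.unop_op, hn, ContinuousLinearMap.comp_apply, ContinuousLinearMap.apply_apply]
    noncomm_ring
  -- The second-order terms are symmetric in `v` and `w`, so they cancel in the difference and leave
  -- the commutator.
  have hsymm : fderiv ℝ (fderiv ℝ (exp : 𝔸 → 𝔸)) x w v =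
      fderiv ℝ (fderiv ℝ (exp : 𝔸 → 𝔸)) x v w :=
    (hsm.contDiffAt.isSymmSndFDerivAt (by simp)) w v
  rw [key, key, hsymm]
  noncomm_ring

end BanachExp

end Sugra

/-! ### Vielbein and spin connection of `G/K` in the exponential chart. -/

namespace Sugra

theorem trace_mul_conjTranspose_re_pos {ι : Type*} [Fintype ι] {A : Matrix ι ι ℂ} (hA : A ≠ 0) :
    0 < (Matrix.trace (A * A.conjTranspose)).re := by
  have h : (Matrix.trace (A * A.conjTranspose)).re = ∑ i, ∑ j, Complex.normSq (A i j) := by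
    simp only [Matrix.trace, Matrix.diag, Matrix.mul_apply, Matrix.conjTranspose_apply,
      Complex.re_sum]
    refine Finset.sum_congr rfl fun i _ => Finset.sum_congr rfl fun j _ => ?_
    rw [Complex.star_def, Complex.mul_conj, Complex.ofReal_re]
  rw [h]
  obtain ⟨i, j, hij⟩ : ∃ i j, A i j ≠ 0 := by
    by_contra! hcon
    exact hA (Matrix.ext hcon)
  refine Finset.sum_pos' (fun _ _ => Finset.sum_nonneg fun _ _ => Complex.normSq_nonneg _)
    ⟨i, Finset.mem_univ _, Finset.sum_pos' (fun _ _ => Complex.normSq_nonneg _)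
      ⟨j, Finset.mem_univ _, Complex.normSq_pos.2 hij⟩⟩

theorem trace_mul_re_nonneg {ι : Type*} [Fintype ι] (A : Matrix ι ι ℂ) :
    0 ≤ (Matrix.trace (A * A.conjTranspose)).re := by
  by_cases hA : A = 0
  · simp [hA]
  · exact (trace_mul_conjTranspose_re_pos hA).le

section ChartGeometry

variable {ι : Type*} [Fintype ι] [DecidableEq ι]

attribute [local instance] Matrix.frobeniusNormedAddCommGroup Matrix.frobeniusNormedSpace
  Matrix.frobeniusNormedRing Matrix.frobeniusNormedAlgebra

open NormedSpace

/-- A real Lie algebra of complex matrices which is stable under conjugate transposition. -/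
structure IsSelfAdjointLie (𝔤 : Submodule ℝ (Matrix ι ι ℂ)) : Prop where
  bracket : ∀ a ∈ 𝔤, ∀ b ∈ 𝔤, a * b - b * a ∈ 𝔤
  conjTranspose : ∀ a ∈ 𝔤, a.conjTranspose ∈ 𝔤

variable {𝔤 : Submodule ℝ (Matrix ι ι ℂ)}

theorem Chart.toMatrix_mem (x : Chart 𝔤) : Chart.toMatrix 𝔤 x ∈ 𝔤 :=
  (Submodule.mem_inf.1 (show (Chart.toMatrix 𝔤 x) ∈ hermPart 𝔤 from x.2)).1

theorem Chart.toMatrix_conjTranspose (x : Chart 𝔤) :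
    (Chart.toMatrix 𝔤 x).conjTranspose = Chart.toMatrix 𝔤 x :=
  (Submodule.mem_inf.1 (show (Chart.toMatrix 𝔤 x) ∈ hermPart 𝔤 from x.2)).2

theorem Chart.toMatrix_injective : Function.Injective (Chart.toMatrix 𝔤) :=
  Subtype.val_injective

/-- The point of the chart with a given Hermitian matrix. -/
def Chart.ofMatrix (A : Matrix ι ι ℂ) (hA : A ∈ 𝔤) (hA' : A.conjTranspose = A) : Chart 𝔤 :=
  ⟨A, Submodule.mem_inf.2 ⟨hA, hA'⟩⟩

@[simp]
theorem Chart.toMatrix_ofMatrix (A : Matrix ι ι ℂ) (hA : A ∈ 𝔤) (hA' : A.conjTranspose = A) :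
    Chart.toMatrix 𝔤 (Chart.ofMatrix A hA hA') = A := rfl

theorem maurerCartan_eq_integral (x v : Chart 𝔤) :
    maurerCartan 𝔤 x v = ∫ s in (0 : ℝ)..1, exp (-(s • Chart.toMatrix 𝔤 x)) *
      Chart.toMatrix 𝔤 v * exp (s • Chart.toMatrix 𝔤 x) :=
  exp_neg_mul_fderiv_exp _ _

/-- Bracketing with `x` preserves `𝔤`, hence so does conjugation by `exp(s x)`, and `E⁻¹ dE` is an
average of such conjugates of `v`. -/
theorem maurerCartan_mem (h𝔤 : IsSelfAdjointLie 𝔤) (x v : Chart 𝔤) :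
    maurerCartan 𝔤 x v ∈ 𝔤 := by
  rw [maurerCartan_eq_integral]
  exact integral_exp_neg_mul_mul_exp_mem 𝔤
    (fun a ha => h𝔤.bracket a ha _ x.toMatrix_mem) v.toMatrix_mem

/-- The `𝔨`-component of the Maurer-Cartan form. -/
def spinConnection (𝔤 : Submodule ℝ (Matrix ι ι ℂ)) (x v : Chart 𝔤) : Matrix ι ι ℂ :=
  (1 / 2 : ℝ) • (maurerCartan 𝔤 x v - (maurerCartan 𝔤 x v).conjTranspose)

theorem vielbein_mem (h𝔤 : IsSelfAdjointLie 𝔤) (x v : Chart 𝔤) : vielbein 𝔤 x v ∈ 𝔤 :=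
  𝔤.smul_mem _ (𝔤.add_mem (maurerCartan_mem h𝔤 x v) (h𝔤.conjTranspose _ (maurerCartan_mem h𝔤 x v)))

theorem spinConnection_mem (h𝔤 : IsSelfAdjointLie 𝔤) (x v : Chart 𝔤) :
    spinConnection 𝔤 x v ∈ 𝔤 :=
  𝔤.smul_mem _ (𝔤.sub_mem (maurerCartan_mem h𝔤 x v) (h𝔤.conjTranspose _ (maurerCartan_mem h𝔤 x v)))

theorem vielbein_conjTranspose (x v : Chart 𝔤) :
    (vielbein 𝔤 x v).conjTranspose = vielbein 𝔤 x v := by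
  simp [vielbein, Matrix.conjTranspose_smul, add_comm]

theorem spinConnection_conjTranspose (x v : Chart 𝔤) :
    (spinConnection 𝔤 x v).conjTranspose = -spinConnection 𝔤 x v := by
  simp [spinConnection, Matrix.conjTranspose_smul, ← smul_neg]

theorem maurerCartan_eq_add (x v : Chart 𝔤) :
    maurerCartan 𝔤 x v = vielbein 𝔤 x v + spinConnection 𝔤 x v := by
  simp only [vielbein, spinConnection]; module

theorem maurerCartan_add (x v w : Chart 𝔤) :
    maurerCartan 𝔤 x (v + w) = maurerCartan 𝔤 x v + maurerCartan 𝔤 x w := by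
  simp only [maurerCartan, map_add, mul_add]

theorem maurerCartan_smul (x : Chart 𝔤) (r : ℝ) (v : Chart 𝔤) :
    maurerCartan 𝔤 x (r • v) = r • maurerCartan 𝔤 x v := by
  simp only [maurerCartan, map_smul, mul_smul_comm]

theorem vielbein_add (x v w : Chart 𝔤) :
    vielbein 𝔤 x (v + w) = vielbein 𝔤 x v + vielbein 𝔤 x w := by
  simp only [vielbein, maurerCartan_add, Matrix.conjTranspose_add]; module

theorem vielbein_smul (x : Chart 𝔤) (r : ℝ) (v : Chart 𝔤) :
    vielbein 𝔤 x (r • v) = r • vielbein 𝔤 x v := by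
  simp only [vielbein, maurerCartan_smul, Matrix.conjTranspose_smul, star_trivial]; module

/-- A linear projection of the space of matrices onto `𝔭`. -/
def Chart.proj (𝔤 : Submodule ℝ (Matrix ι ι ℂ)) : Matrix ι ι ℂ →ₗ[ℝ] Chart 𝔤 :=
  ((Chart.toMatrix 𝔤).exists_leftInverse_of_injective
    (LinearMap.ker_eq_bot.2 Chart.toMatrix_injective)).choose

@[simp]
theorem Chart.proj_toMatrix (v : Chart 𝔤) : Chart.proj 𝔤 (Chart.toMatrix 𝔤 v) = v :=
  LinearMap.congr_fun ((Chart.toMatrix 𝔤).exists_leftInverse_of_injective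
    (LinearMap.ker_eq_bot.2 Chart.toMatrix_injective)).choose_spec v

theorem Chart.toMatrix_proj {A : Matrix ι ι ℂ} (hA : A ∈ 𝔤) (hA' : A.conjTranspose = A) :
    Chart.toMatrix 𝔤 (Chart.proj 𝔤 A) = A := by
  rw [← Chart.toMatrix_ofMatrix A hA hA', Chart.proj_toMatrix]

/-- The vielbein as a field of endomorphisms of `𝔭`. -/
def frame (𝔤 : Submodule ℝ (Matrix ι ι ℂ)) (x : Chart 𝔤) : Chart 𝔤 →L[ℝ] Chart 𝔤 :=
  LinearMap.toContinuousLinearMap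
    ((Chart.proj 𝔤).comp
      ({ toFun := vielbein 𝔤 x, map_add' := vielbein_add x, map_smul' := vielbein_smul x } :
        Chart 𝔤 →ₗ[ℝ] Matrix ι ι ℂ))

theorem toMatrix_frame (h𝔤 : IsSelfAdjointLie 𝔤) (x v : Chart 𝔤) :
    Chart.toMatrix 𝔤 (frame 𝔤 x v) = vielbein 𝔤 x v :=
  Chart.toMatrix_proj (vielbein_mem h𝔤 x v) (vielbein_conjTranspose x v)

/-- The adjoint action of the spin connection on `𝔭`. -/
def frameConnection (𝔤 : Submodule ℝ (Matrix ι ι ℂ)) (x w : Chart 𝔤) : Module.End ℝ (Chart 𝔤) :=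
  (Chart.proj 𝔤).comp ((LinearMap.mulLeft ℝ (spinConnection 𝔤 x w)
    - LinearMap.mulRight ℝ (spinConnection 𝔤 x w)).comp (Chart.toMatrix 𝔤))

theorem toMatrix_frameConnection (h𝔤 : IsSelfAdjointLie 𝔤) (x w v : Chart 𝔤) :
    Chart.toMatrix 𝔤 (frameConnection 𝔤 x w v) =
      spinConnection 𝔤 x w * Chart.toMatrix 𝔤 v - Chart.toMatrix 𝔤 v * spinConnection 𝔤 x w := by
  refine Chart.toMatrix_proj
    (h𝔤.bracket _ (spinConnection_mem h𝔤 x w) _ v.toMatrix_mem) ?_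
  simp [spinConnection_conjTranspose, Chart.toMatrix_conjTranspose, sub_eq_add_neg, add_comm]

theorem contDiff_maurerCartan (v : Chart 𝔤) : ContDiff ℝ ∞ fun x => maurerCartan 𝔤 x v := by
  have hsm : ContDiff ℝ ω (exp : Matrix ι ι ℂ → Matrix ι ι ℂ) :=
    contDiff_iff_contDiffAt.2 fun x => (exp_analytic (𝕂 := ℝ) x).contDiffAt
  have hl : ContDiff ℝ ∞ (Chart.toMatrix 𝔤) :=
    (LinearMap.toContinuousLinearMap (Chart.toMatrix 𝔤)).contDiff
  have h1 : ContDiff ℝ ∞ fun x => exp (-(Chart.toMatrix 𝔤 x)) :=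
    (hsm.of_le (by simp)).comp hl.neg
  have h2 : ContDiff ℝ ∞ fun x => fderiv ℝ (exp : Matrix ι ι ℂ → Matrix ι ι ℂ)
      (Chart.toMatrix 𝔤 x) (Chart.toMatrix 𝔤 v) :=
    ((hsm.fderiv_right (m := ∞) (by simp)).comp hl).clm_apply contDiff_const
  exact h1.mul h2

/-- Conjugate transposition as a continuous real-linear map. -/
def conjTransposeCLM (ι : Type*) [Fintype ι] [DecidableEq ι] : Matrix ι ι ℂ →L[ℝ] Matrix ι ι ℂ :=
  LinearMap.toContinuousLinearMap
    { toFun := Matrix.conjTranspose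
      map_add' := Matrix.conjTranspose_add
      map_smul' := fun r A => by simp }

theorem contDiff_vielbein (v : Chart 𝔤) : ContDiff ℝ ∞ fun x => vielbein 𝔤 x v :=
  ((contDiff_maurerCartan v).add
    ((conjTransposeCLM ι).contDiff.comp (contDiff_maurerCartan v))).const_smul (1 / 2 : ℝ)

theorem contDiff_frame : ContDiff ℝ ∞ (frame 𝔤) :=
  contDiff_clm_apply_iff.2 fun v =>
    (LinearMap.toContinuousLinearMap (Chart.proj 𝔤)).contDiff.comp (contDiff_vielbein v)

theorem fderiv_maurerCartan_sub (x v w : Chart 𝔤) :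
    fderiv ℝ (fun y => maurerCartan 𝔤 y v) x w - fderiv ℝ (fun y => maurerCartan 𝔤 y w) x v =
      maurerCartan 𝔤 x v * maurerCartan 𝔤 x w - maurerCartan 𝔤 x w * maurerCartan 𝔤 x v := by
  have hsm : ContDiff ℝ ω (exp : Matrix ι ι ℂ → Matrix ι ι ℂ) :=
    contDiff_iff_contDiffAt.2 fun x => (exp_analytic (𝕂 := ℝ) x).contDiffAt
  have hd : ∀ V : Matrix ι ι ℂ, Differentiable ℝ
      (fun y : Matrix ι ι ℂ => exp (-y) * fderiv ℝ (exp : Matrix ι ι ℂ → Matrix ι ι ℂ) y V) := by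
    intro V
    have h1 : ContDiff ℝ 1 fun y : Matrix ι ι ℂ => exp (-y) :=
      (hsm.of_le (by simp)).comp contDiff_id.neg
    have h2 : ContDiff ℝ 1 fun y : Matrix ι ι ℂ => fderiv ℝ (exp : Matrix ι ι ℂ → Matrix ι ι ℂ)
        y V := (hsm.fderiv_right (m := 1) (by simp)).clm_apply contDiff_const
    exact (h1.mul h2).differentiable (by simp)
  have hcomp : ∀ a b : Chart 𝔤, fderiv ℝ (fun y => maurerCartan 𝔤 y a) x b =
      fderiv ℝ (fun y : Matrix ι ι ℂ => exp (-y) *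
        fderiv ℝ (exp : Matrix ι ι ℂ → Matrix ι ι ℂ) y (Chart.toMatrix 𝔤 a))
        (Chart.toMatrix 𝔤 x) (Chart.toMatrix 𝔤 b) := by
    intro a b
    have h := ((hd (Chart.toMatrix 𝔤 a)) (Chart.toMatrix 𝔤 x)).hasFDerivAt.comp x
      (LinearMap.toContinuousLinearMap (Chart.toMatrix 𝔤)).hasFDerivAt
    exact congrArg (fun L : Chart 𝔤 →L[ℝ] Matrix ι ι ℂ => L b) h.fderiv
  rw [hcomp, hcomp]
  exact fderiv_exp_neg_mul_fderiv_exp _ _ _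

theorem fderiv_conjTranspose_maurerCartan (x v w : Chart 𝔤) :
    fderiv ℝ (fun y => (maurerCartan 𝔤 y v).conjTranspose) x w =
      (fderiv ℝ (fun y => maurerCartan 𝔤 y v) x w).conjTranspose := by
  have h := (conjTransposeCLM ι).hasFDerivAt.comp x
    ((contDiff_maurerCartan v).differentiable (by simp) x).hasFDerivAt
  exact congrArg (fun L : Chart 𝔤 →L[ℝ] Matrix ι ι ℂ => L w) h.fderiv

theorem fderiv_vielbein (x v w : Chart 𝔤) :
    fderiv ℝ (fun y => vielbein 𝔤 y v) x w = (1 / 2 : ℝ) •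
      (fderiv ℝ (fun y => maurerCartan 𝔤 y v) x w
        + (fderiv ℝ (fun y => maurerCartan 𝔤 y v) x w).conjTranspose) := by
  have h1 := (contDiff_maurerCartan (𝔤 := 𝔤) v).differentiable (by simp) x
  have h2 : DifferentiableAt ℝ (fun y => (maurerCartan 𝔤 y v).conjTranspose) x :=
    (((conjTransposeCLM ι).contDiff.comp (contDiff_maurerCartan v)).differentiable
      (n := ∞) (by simp)) x
  have h3 := ((h1.hasFDerivAt.add h2.hasFDerivAt).const_smul (1 / 2 : ℝ)).fderiv
  refine (congrArg (fun L : Chart 𝔤 →L[ℝ] Matrix ι ι ℂ => L w) h3).trans ?_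
  rw [← fderiv_conjTranspose_maurerCartan]
  rfl

/-- The covariant derivative of the vielbein is symmetric: the connection is torsion-free. -/
theorem frame_torsion_free (h𝔤 : IsSelfAdjointLie 𝔤) (x v w : Chart 𝔤) :
    fderiv ℝ (frame 𝔤) x w v + frameConnection 𝔤 x w (frame 𝔤 x v) =
      fderiv ℝ (frame 𝔤) x v w + frameConnection 𝔤 x v (frame 𝔤 x w) := by
  apply Chart.toMatrix_injective
  have hf : ∀ a b : Chart 𝔤, Chart.toMatrix 𝔤 (fderiv ℝ (frame 𝔤) x b a) =
      fderiv ℝ (fun y => vielbein 𝔤 y a) x b := by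
    intro a b
    have h1 := (contDiff_frame (𝔤 := 𝔤)).differentiable (by simp) x
    have h2 := (LinearMap.toContinuousLinearMap (Chart.toMatrix 𝔤)).hasFDerivAt.comp x
      (h1.hasFDerivAt.clm_apply (hasFDerivAt_const a x))
    have h3 : (LinearMap.toContinuousLinearMap (Chart.toMatrix 𝔤)) ∘ (fun y => frame 𝔤 y a) =
        fun y => vielbein 𝔤 y a := by
      funext y; exact toMatrix_frame h𝔤 y a
    rw [h3] at h2
    refine Eq.trans ?_ (congrArg (fun L : Chart 𝔤 →L[ℝ] Matrix ι ι ℂ => L b) h2.fderiv).symm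
    simp
    rfl
  simp only [map_add, hf, toMatrix_frameConnection h𝔤, toMatrix_frame h𝔤, fderiv_vielbein]
  have h := fderiv_maurerCartan_sub x v w
  -- Averaging the Maurer-Cartan equation with its conjugate transpose extracts the `𝔭`-component:
  -- the brackets `[𝔭,𝔭]` and `[𝔨,𝔨]` drop out and the mixed brackets, which are the connection
  -- terms, remain.
  have h' := congrArg Matrix.conjTranspose h
  simp only [maurerCartan_eq_add, Matrix.conjTranspose_sub, Matrix.conjTranspose_mul,
    Matrix.conjTranspose_add, vielbein_conjTranspose, spinConnection_conjTranspose] at h h'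
  rw [← sub_eq_zero] at h h' ⊢
  have h2 := congrArg₂ (fun a b => (1 / 2 : ℝ) • (a + b)) h h'
  simp only [add_zero, smul_zero] at h2
  rw [← h2]
  simp only [maurerCartan_eq_add, add_mul, mul_add, neg_mul, mul_neg]
  module

/-- Against the Hermitian matrix of `v`, the real part of the trace does not distinguish `E⁻¹ dE`
from its conjugate transpose. The vielbein may thus be replaced by the whole Maurer-Cartan form,
which has an integral formula. -/
theorem trace_vielbein_mul (x v : Chart 𝔤) :
    (Matrix.trace (vielbein 𝔤 x v * Chart.toMatrix 𝔤 v)).re =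
      ∫ s in (0 : ℝ)..1, (Matrix.trace (exp (-(s • Chart.toMatrix 𝔤 x)) * Chart.toMatrix 𝔤 v *
        exp (s • Chart.toMatrix 𝔤 x) * Chart.toMatrix 𝔤 v)).re := by
  let _ : NormedAlgebra ℚ (Matrix ι ι ℂ) := NormedAlgebra.restrictScalars ℚ ℝ _
  set X := Chart.toMatrix 𝔤 x
  set V := Chart.toMatrix 𝔤 v with hV
  have hc : Continuous fun s : ℝ => exp (-(s • X)) * V * exp (s • X) := by
    have he : Continuous (exp : Matrix ι ι ℂ → Matrix ι ι ℂ) := exp_continuous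
    fun_prop
  let L : Matrix ι ι ℂ →L[ℝ] ℝ := LinearMap.toContinuousLinearMap
    (Complex.reLm.comp ((Matrix.traceLinearMap ι ℝ ℂ).comp (LinearMap.mulRight ℝ V)))
  have h1 := L.intervalIntegral_comp_comm (hc.intervalIntegrable 0 1 (μ := MeasureTheory.volume))
  have h2 : (Matrix.trace (vielbein 𝔤 x v * V)).re = L (maurerCartan 𝔤 x v) := by
    have h3 : (Matrix.trace ((maurerCartan 𝔤 x v).conjTranspose * V)).re =
        (Matrix.trace (maurerCartan 𝔤 x v * V)).re := by
      rw [← Complex.conj_re, ← Complex.star_def, ← Matrix.trace_conjTranspose]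
      rw [Matrix.conjTranspose_mul, Matrix.conjTranspose_conjTranspose, hV,
        Chart.toMatrix_conjTranspose, Matrix.trace_mul_comm]
    have h4 : L (maurerCartan 𝔤 x v) = (Matrix.trace (maurerCartan 𝔤 x v * V)).re := rfl
    rw [h4, vielbein, smul_mul_assoc, Matrix.trace_smul, add_mul, Matrix.trace_add,
      Complex.smul_re, Complex.add_re, h3, smul_eq_mul]
    ring
  rw [h2]
  exact (congrArg L (maurerCartan_eq_integral x v)).trans h1.symm

/-- Splitting `exp(± s X)` into two equal factors turns the integrand into the squared Frobenius
norm of `exp(-s X / 2) V exp(s X / 2)`, which is nonnegative and is positive at `s = 0`. This makes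
the vielbein injective at every point of the chart, so the metric is nondegenerate everywhere. -/
theorem trace_vielbein_mul_pos (x : Chart 𝔤) {v : Chart 𝔤} (hv : v ≠ 0) :
    0 < (Matrix.trace (vielbein 𝔤 x v * Chart.toMatrix 𝔤 v)).re := by
  let _ : NormedAlgebra ℚ (Matrix ι ι ℂ) := NormedAlgebra.restrictScalars ℚ ℝ _
  rw [trace_vielbein_mul]
  set X := Chart.toMatrix 𝔤 x with hX
  set V := Chart.toMatrix 𝔤 v with hV
  have hXh : ∀ s : ℝ, (exp (s • X)).conjTranspose = exp (s • X) := fun s => by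
    rw [← Matrix.exp_conjTranspose, Matrix.conjTranspose_smul, hX, Chart.toMatrix_conjTranspose,
      star_trivial]
  have hadd : ∀ s t : ℝ, exp (s • X) * exp (t • X) = exp ((s + t) • X) := fun s t => by
    rw [add_smul]
    exact (Matrix.exp_add_of_commute _ _ (((Commute.refl X).smul_left s).smul_right t)).symm
  have hsq : ∀ s : ℝ, Matrix.trace (exp (-(s • X)) * V * exp (s • X) * V) =
      Matrix.trace ((exp ((-(s / 2)) • X) * V * exp ((s / 2) • X)) *
        (exp ((-(s / 2)) • X) * V * exp ((s / 2) • X)).conjTranspose) := by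
    intro s
    have hVc : V.conjTranspose = V := v.toMatrix_conjTranspose
    simp only [Matrix.conjTranspose_mul, hXh, hVc]
    have e1 : exp (-(s • X)) = exp ((-(s / 2)) • X) * exp ((-(s / 2)) • X) := by
      rw [hadd, ← neg_smul]; congr 2; ring
    have e2 : exp (s • X) = exp ((s / 2) • X) * exp ((s / 2) • X) := by
      rw [hadd]; congr 2; ring
    rw [e1, e2]
    simp only [mul_assoc]
    rw [Matrix.trace_mul_comm]
    simp only [mul_assoc]
  have hV0 : V ≠ 0 := fun h => hv (Chart.toMatrix_injective (by rw [← hV, h, map_zero]))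
  refine intervalIntegral.integral_pos (by norm_num) ?_ ?_ ⟨0, by simp, ?_⟩
  · have he : Continuous (exp : Matrix ι ι ℂ → Matrix ι ι ℂ) := exp_continuous
    refine Continuous.continuousOn ?_
    refine Complex.continuous_re.comp (Continuous.matrix_trace ?_)
    fun_prop
  · intro s _
    rw [hsq]
    exact trace_mul_re_nonneg _
  · have h0 := trace_mul_conjTranspose_re_pos hV0
    rw [show V.conjTranspose = V from v.toMatrix_conjTranspose] at h0
    simpa using h0

theorem frame_injective (h𝔤 : IsSelfAdjointLie 𝔤) (x : Chart 𝔤) :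
    Function.Injective (frame 𝔤 x) := by
  rw [injective_iff_map_eq_zero]
  intro v hv
  by_contra hne
  have h := trace_vielbein_mul_pos x hne
  rw [← toMatrix_frame h𝔤, hv] at h
  simp at h

end ChartGeometry

end Sugra

/-! ### Metrics given by a moving frame: Levi-Civita connection and parallel forms. -/

namespace Sugra

section MovingFrame

set_option linter.unusedSectionVars false

variable {E : Type*} [NormedAddCommGroup E] [NormedSpace ℝ E] [FiniteDimensional ℝ E]

/-- Evaluation on tuples of basis vectors embeds the forms into a finite-dimensional space;
composing with a linear left inverse turns smoothness of the components into smoothness of the form.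
-/
theorem contDiff_alternating_of_apply {X : Type*} [NormedAddCommGroup X] [NormedSpace ℝ X]
    {k : ℕ} {n : WithTop ℕ∞} {Ω : X → E [⋀^Fin k]→L[ℝ] ℝ}
    (h : ∀ v : Fin k → E, ContDiff ℝ n fun x => Ω x v) : ContDiff ℝ n Ω := by
  let b := Module.finBasis ℝ E
  let ev : (E [⋀^Fin k]→L[ℝ] ℝ) →ₗ[ℝ] ((Fin k → Fin (Module.finrank ℝ E)) → ℝ) :=
    { toFun := fun η i => η fun l => b (i l)
      map_add' := fun _ _ => rfl
      map_smul' := fun _ _ => rfl }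
  have hinj : LinearMap.ker ev = ⊥ := by
    rw [LinearMap.ker_eq_bot, injective_iff_map_eq_zero]
    intro η hη
    have : η.toAlternatingMap = 0 :=
      Module.Basis.ext_alternating b fun i _ => congrFun hη i
    ext v
    exact congrArg (fun a : E [⋀^Fin k]→ₗ[ℝ] ℝ => a v) this
  obtain ⟨L, hL⟩ := ev.exists_leftInverse_of_injective hinj
  have hΩ : Ω = (LinearMap.toContinuousLinearMap L) ∘ fun x => ev (Ω x) := by
    funext x
    exact (LinearMap.congr_fun hL (Ω x)).symm
  rw [hΩ]
  exact (LinearMap.toContinuousLinearMap L).contDiff.comp (contDiff_pi.2 fun i => h _)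

/-- A metric connection in a moving frame: a field of isomorphisms `E → E`, viewed as the
orthonormal frame of the metric which it pulls back from a fixed inner product `form`, and a
torsion-free connection form with values in the skew endomorphisms. -/
structure MovingFrame (E : Type*) [NormedAddCommGroup E] [NormedSpace ℝ E] where
  form : LinearMap.BilinForm ℝ E
  form_symm : ∀ u v, form u v = form v u
  form_pos : ∀ u, u ≠ 0 → 0 < form u u
  frame : E → E →L[ℝ] E
  contDiff_frame : ContDiff ℝ ∞ frame
  injective : ∀ x, Function.Injective (frame x)
  conn : E → E → Module.End ℝ E
  conn_skew : ∀ x w u v, form (conn x w u) v = -form u (conn x w v)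
  torsion_free : ∀ x v w, fderiv ℝ frame x w v + conn x w (frame x v) =
    fderiv ℝ frame x v w + conn x v (frame x w)

namespace MovingFrame

variable (Φ : MovingFrame E)

/-- The metric which makes the frame orthonormal. -/
def metric (x : E) : LinearMap.BilinForm ℝ E := Φ.form.comp (Φ.frame x) (Φ.frame x)

theorem metric_apply (x u v : E) : Φ.metric x u v = Φ.form (Φ.frame x u) (Φ.frame x v) := rfl

/-- The frame at `x` as a linear equivalence. -/
def equiv (x : E) : E ≃ₗ[ℝ] E := LinearEquiv.ofInjectiveEndo (Φ.frame x : E →ₗ[ℝ] E) (Φ.injective x)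

@[simp]
theorem equiv_apply (x v : E) : Φ.equiv x v = Φ.frame x v := rfl

@[simp]
theorem frame_equiv_symm (x v : E) : Φ.frame x ((Φ.equiv x).symm v) = v :=
  (Φ.equiv x).apply_symm_apply v

/-- The connection in the coordinate basis, `v ↦ γ(w, v)`. -/
def cov (x w : E) : Module.End ℝ E :=
  (Φ.equiv x).symm.toLinearMap.comp
    ((fderiv ℝ Φ.frame x w : E →ₗ[ℝ] E) + (Φ.conn x w).comp (Φ.frame x : E →ₗ[ℝ] E))

theorem frame_cov (x w v : E) :
    Φ.frame x (Φ.cov x w v) = fderiv ℝ Φ.frame x w v + Φ.conn x w (Φ.frame x v) := by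
  rw [cov, LinearMap.comp_apply, LinearEquiv.coe_coe, frame_equiv_symm]; rfl

theorem cov_symm (x w v : E) : Φ.cov x w v = Φ.cov x v w := by
  apply Φ.injective x
  rw [frame_cov, frame_cov, Φ.torsion_free]

theorem differentiable_frame : Differentiable ℝ Φ.frame :=
  Φ.contDiff_frame.differentiable (by simp)

theorem hasFDerivAt_frame_apply (x v : E) :
    HasFDerivAt (fun y => Φ.frame y v) ((fderiv ℝ Φ.frame x).flip v) x := by
  have h := (Φ.differentiable_frame x).hasFDerivAt.clm_apply (hasFDerivAt_const v x)
  refine h.congr_fderiv ?_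
  ext w; simp

/-- Metric compatibility: the terms which `conn` adds in the two slots cancel because `conn` is skew
for `form`, so only the product rule for the frame is left. -/
theorem fderiv_metric (x u v w : E) :
    fderiv ℝ (fun y => Φ.metric y u v) x w =
      Φ.metric x (Φ.cov x w u) v + Φ.metric x u (Φ.cov x w v) := by
  let L : E →L[ℝ] E →L[ℝ] ℝ := LinearMap.toContinuousLinearMap
    ((LinearMap.toContinuousLinearMap : (E →ₗ[ℝ] ℝ) ≃ₗ[ℝ] E →L[ℝ] ℝ).toLinearMap.comp Φ.form)
  have hL : ∀ a b, L a b = Φ.form a b := fun a b => rfl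
  have h := (L.hasFDerivAt_of_bilinear (Φ.hasFDerivAt_frame_apply x u)
    (Φ.hasFDerivAt_frame_apply x v)).fderiv
  refine (congrArg (fun M : E →L[ℝ] ℝ => M w) h).trans ?_
  have h1 : Φ.form (Φ.frame x u) (fderiv ℝ Φ.frame x w v)
      + Φ.form (fderiv ℝ Φ.frame x w u) (Φ.frame x v) =
    Φ.metric x (Φ.cov x w u) v + Φ.metric x u (Φ.cov x w v) := by
    simp only [metric_apply, frame_cov, map_add, LinearMap.add_apply, Φ.conn_skew]
    ring
  rw [← h1]
  rfl

theorem gram_mulVec_repr (x v : E) (l : Fin (Module.finrank ℝ E)) :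
    (gram Φ.metric x).mulVec ((Module.finBasis ℝ E).repr v) l =
      Φ.metric x v (Module.finBasis ℝ E l) := by
  conv_rhs => rw [← (Module.finBasis ℝ E).sum_repr v]
  simp only [Matrix.mulVec, dotProduct, gram, Matrix.of_apply, map_sum, map_smul,
    LinearMap.sum_apply, LinearMap.smul_apply, smul_eq_mul]
  refine Finset.sum_congr rfl fun i _ => ?_
  rw [metric_apply, metric_apply, Φ.form_symm, mul_comm]

theorem isUnit_det_gram (x : E) : IsUnit (gram Φ.metric x).det := by
  rw [← Matrix.isUnit_iff_isUnit_det, ← Matrix.mulVec_injective_iff_isUnit]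
  change Function.Injective (gram Φ.metric x).mulVecLin
  rw [injective_iff_map_eq_zero]
  intro c hc
  set v := (Module.finBasis ℝ E).equivFun.symm c with hv
  have hcv : c = (Module.finBasis ℝ E).repr v := by
    rw [hv, ← Module.Basis.equivFun_apply, LinearEquiv.apply_symm_apply]
  have h1 : ∀ l, Φ.metric x v (Module.finBasis ℝ E l) = 0 := fun l => by
    rw [← gram_mulVec_repr, ← hcv]; exact congrFun hc l
  have h2 : Φ.metric x v = 0 := (Module.finBasis ℝ E).ext h1
  have h3 : v = 0 := by
    by_contra hne
    have h4 := Φ.form_pos (Φ.frame x v)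
      (fun h => hne (Φ.injective x (by rw [h, map_zero])))
    rw [← metric_apply, h2] at h4
    simp at h4
  rw [hcv, h3]; simp

/-- Koszul's uniqueness argument: for a connection which is metric (`fderiv_metric`) and symmetric
(`cov_symm`), the alternating sum of derivatives of the metric is twice `g(∇_u v, e_l)`. The inverse
Gram matrix then recovers the vector. -/
theorem christoffel_eq_cov (x u v : E) : christoffel Φ.metric x u v = Φ.cov x u v := by
  have hk : ∀ l, (1 / 2 : ℝ) *
      (fderiv ℝ (fun y => Φ.metric y v (Module.finBasis ℝ E l)) x u
        + fderiv ℝ (fun y => Φ.metric y u (Module.finBasis ℝ E l)) x v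
        - fderiv ℝ (fun y => Φ.metric y u v) x (Module.finBasis ℝ E l)) =
      Φ.metric x (Φ.cov x u v) (Module.finBasis ℝ E l) := by
    intro l
    set e := Module.finBasis ℝ E l
    have hs : ∀ a b, Φ.metric x a b = Φ.metric x b a := fun a b => Φ.form_symm _ _
    rw [fderiv_metric, fderiv_metric, fderiv_metric, Φ.cov_symm x e v, Φ.cov_symm x e u,
      Φ.cov_symm x v u, hs u, hs (Φ.cov x u e)]
    ring
  have h1 : christoffel Φ.metric x u v = ∑ k, ((gram Φ.metric x)⁻¹.mulVec
      ((gram Φ.metric x).mulVec ((Module.finBasis ℝ E).repr (Φ.cov x u v)))) k •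
        Module.finBasis ℝ E k := by
    simp only [christoffel, mul_assoc, hk]
    refine Finset.sum_congr rfl fun k _ => ?_
    congr 1
    exact Finset.sum_congr rfl fun l _ => by rw [gram_mulVec_repr]
  rw [h1, Matrix.mulVec_mulVec, Matrix.nonsing_inv_mul _ (Φ.isUnit_det_gram x), Matrix.one_mulVec,
    (Module.finBasis ℝ E).sum_repr]

/-- The field of forms with constant components in the frame. -/
def pull {k : ℕ} (η : E [⋀^Fin k]→L[ℝ] ℝ) (x : E) : E [⋀^Fin k]→L[ℝ] ℝ :=
  η.compContinuousLinearMap (Φ.frame x)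

theorem pull_apply {k : ℕ} (η : E [⋀^Fin k]→L[ℝ] ℝ) (x : E) (v : Fin k → E) :
    Φ.pull η x v = η fun l => Φ.frame x (v l) := rfl

/-- A form which is annihilated by the values of the connection form. -/
def IsInvariant {k : ℕ} (η : E [⋀^Fin k]→L[ℝ] ℝ) : Prop :=
  ∀ x w v, derivAction (Φ.conn x w) η v = 0

theorem contDiff_pull {k : ℕ} (η : E [⋀^Fin k]→L[ℝ] ℝ) : ContDiff ℝ ∞ (Φ.pull η) :=
  contDiff_alternating_of_apply fun _ =>
    η.toContinuousMultilinearMap.contDiff.comp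
      (contDiff_pi.2 fun _ => Φ.contDiff_frame.clm_apply contDiff_const)

/-- The product rule differentiates the frame in each slot in turn. Invariance of `η` allows `conn`
to be added in all slots at no cost, and the two contributions combine to `cov`. -/
theorem fderiv_pull {k : ℕ} {η : E [⋀^Fin k]→L[ℝ] ℝ} (hη : Φ.IsInvariant η) (x w : E)
    (v : Fin k → E) :
    fderiv ℝ (Φ.pull η) x w v = ∑ l, Φ.pull η x (Function.update v l (Φ.cov x w (v l))) := by
  have h := fderiv_continuousAlternatingMapCompContinuousLinearMap
    (differentiableAt_const (x := x) η) (Φ.differentiable_frame x)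
  have h2 : fderiv ℝ (Φ.pull η) x w v =
      ∑ l, η fun j => Function.update (fun _ => Φ.frame x) l (fderiv ℝ Φ.frame x w) j (v j) := by
    rw [show Φ.pull η = fun y => η.compContinuousLinearMap (Φ.frame y) from rfl, h]
    simp
  have h3 := hη x w fun l => Φ.frame x (v l)
  rw [h2, ← add_zero (∑ l, _), ← h3, derivAction, ← Finset.sum_add_distrib]
  refine Finset.sum_congr rfl fun l _ => ?_
  have e1 : (fun j => Function.update (fun _ => Φ.frame x) l (fderiv ℝ Φ.frame x w) j (v j)) =
      Function.update (fun j => Φ.frame x (v j)) l (fderiv ℝ Φ.frame x w (v l)) := by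
    funext j
    by_cases hj : j = l
    · subst hj; simp
    · simp [hj]
  have e2 : (fun j => Φ.frame x (Function.update v l (Φ.cov x w (v l)) j)) =
      Function.update (fun j => Φ.frame x (v j)) l (Φ.frame x (Φ.cov x w (v l))) := by
    funext j
    by_cases hj : j = l
    · subst hj; simp
    · simp [hj]
  rw [pull_apply, e1, e2, frame_cov, ContinuousAlternatingMap.map_update_add]

theorem isParallel_pull {k : ℕ} {η : E [⋀^Fin k]→L[ℝ] ℝ} (hη : Φ.IsInvariant η) :
    IsParallel Φ.metric (Φ.pull η) :=
  ⟨Φ.contDiff_pull η, fun x w _ => by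
    rw [Φ.fderiv_pull hη, sub_eq_zero]
    simp only [christoffel_eq_cov]⟩

end MovingFrame

end MovingFrame

end Sugra

/-! ### Derivations and Hodge duality in linear algebra. -/

namespace Sugra

section HodgeAlgebra

set_option linter.unusedSectionVars false

variable {E : Type*} [NormedAddCommGroup E] [NormedSpace ℝ E] [FiniteDimensional ℝ E]
variable {F : Type*} [AddCommGroup F] [Module ℝ F]

/-- An alternating map on a finite-dimensional space is continuous. -/
def toContinuousAlternating {k : ℕ} (f : E [⋀^Fin k]→ₗ[ℝ] ℝ) : E [⋀^Fin k]→L[ℝ] ℝ where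
  toMultilinearMap := f.toMultilinearMap
  map_eq_zero_of_eq' := f.map_eq_zero_of_eq'
  cont := by
    let b := Module.finBasis ℝ E
    have h : ∀ v : Fin k → E, f v =
        ∑ r : Fin k → Fin (Module.finrank ℝ E), (∏ l, b.repr (v l) (r l)) • f fun l => b (r l) := by
      intro v
      conv_lhs => rw [show v = fun l => ∑ i, b.repr (v l) i • b i from
        funext fun l => (b.sum_repr (v l)).symm]
      refine (f.toMultilinearMap.map_sum _).trans (Finset.sum_congr rfl fun r _ => ?_)
      exact f.toMultilinearMap.map_smul_univ _ _
    have hc : ∀ i, Continuous fun x : E => b.repr x i := fun i =>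
      (LinearMap.toContinuousLinearMap (b.coord i)).continuous
    change Continuous fun v => f v
    rw [show (fun v => f v) = _ from funext h]
    exact continuous_finsetSum _ fun r _ => Continuous.smul
      (continuous_finsetProd _ fun l _ => (hc _).comp (continuous_apply l)) continuous_const

@[simp]
theorem toContinuousAlternating_apply {k : ℕ} (f : E [⋀^Fin k]→ₗ[ℝ] ℝ) (v : Fin k → E) :
    toContinuousAlternating f v = f v := rfl

/-- Exchanging the free index `j` with the entry `I l` is an involution on the pairs `(I, j)`. -/
theorem sum_update_swap {ι κ M : Type*} [Fintype ι] [DecidableEq ι] [Fintype κ] [DecidableEq κ]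
    [AddCommMonoid M] (l : κ) (f : (κ → ι) → ι → M) :
    ∑ I : κ → ι, ∑ j, f I j = ∑ I : κ → ι, ∑ j, f (Function.update I l j) (I l) := by
  rw [← Finset.sum_product', ← Finset.sum_product']
  refine Finset.sum_nbij' (fun p => (Function.update p.1 l p.2, p.1 l))
    (fun p => (Function.update p.1 l p.2, p.1 l)) ?_ ?_ ?_ ?_ ?_ <;> simp

/-- Transposing an endomorphism in a full contraction of two multilinear maps over a basis. -/
theorem sum_mul_update_transpose {ι : Type*} [Fintype ι] [DecidableEq ι]
    (e : Module.Basis ι ℝ E) {A A' : Module.End ℝ E}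
    (hA : ∀ i j, e.repr (A' (e i)) j = e.repr (A (e j)) i) {k : ℕ}
    (f : MultilinearMap ℝ (fun _ : Fin k => E) ℝ) (g : MultilinearMap ℝ (fun _ : Fin k => E) F)
    (l : Fin k) :
    ∑ I : Fin k → ι, f (fun a => e (I a)) • g (Function.update (fun a => e (I a)) l (A (e (I l)))) =
    ∑ I : Fin k → ι, f (Function.update (fun a => e (I a)) l (A' (e (I l)))) •
      g (fun a => e (I a)) := by
  have hu : ∀ (I : Fin k → ι) (j : ι), Function.update (fun a => e (I a)) l (e j) =
      fun a => e (Function.update I l j a) := by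
    intro I j
    funext a
    by_cases ha : a = l
    · subst ha; simp
    · simp [ha]
  have h1 : ∀ I : Fin k → ι, f (fun a => e (I a)) •
      g (Function.update (fun a => e (I a)) l (A (e (I l)))) =
      ∑ j, f (fun a => e (I a)) • e.repr (A (e (I l))) j •
        g (fun a => e (Function.update I l j a)) := by
    intro I
    conv_lhs => rw [← e.sum_repr (A (e (I l)))]
    simp only [MultilinearMap.map_update_sum, MultilinearMap.map_update_smul, hu, Finset.smul_sum]
  have h2 : ∀ I : Fin k → ι, f (Function.update (fun a => e (I a)) l (A' (e (I l)))) •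
      g (fun a => e (I a)) =
      ∑ j, (e.repr (A' (e (I l))) j * f (fun a => e (Function.update I l j a))) •
        g (fun a => e (I a)) := by
    intro I
    conv_lhs => rw [← e.sum_repr (A' (e (I l)))]
    simp only [MultilinearMap.map_update_sum, MultilinearMap.map_update_smul, hu, Finset.sum_smul,
      smul_eq_mul]
  simp only [h1, h2]
  rw [sum_update_swap l]
  refine Finset.sum_congr rfl fun I _ => Finset.sum_congr rfl fun j _ => ?_
  simp only [Function.update_idem, Function.update_self, Function.update_eq_self, hA]
  rw [smul_smul, mul_comm]

/-- The derived form has top degree as well, so it is enough to evaluate on the basis. There an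
off-diagonal entry of `A` produces a repeated vector, and the diagonal entries add up to the trace.
-/
theorem derivAction_apply_basis_det {m : ℕ} (e : Module.Basis (Fin m) ℝ E) (A : Module.End ℝ E)
    (η : E [⋀^Fin m]→L[ℝ] ℝ) (v : Fin m → E) :
    derivAction A η v = LinearMap.trace ℝ E A * η v := by
  let A' : E →L[ℝ] E := LinearMap.toContinuousLinearMap A
  let δ : E [⋀^Fin m]→L[ℝ] ℝ := η.fderivCompContinuousLinearMap (ContinuousLinearMap.id ℝ E) A'
  have hδ : ∀ w, δ w = derivAction A η w := by
    intro w
    rw [ContinuousAlternatingMap.fderivCompContinuousLinearMap_apply, derivAction]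
    refine Finset.sum_congr rfl fun l _ => congrArg η ?_
    funext j
    by_cases hj : j = l
    · subst hj; simp [A']
    · simp [hj]
  have h1 := δ.toAlternatingMap.eq_smul_basis_det e
  have h2 := η.toAlternatingMap.eq_smul_basis_det e
  have h3 : δ v = δ e * e.det v := congrArg (fun a : E [⋀^Fin m]→ₗ[ℝ] ℝ => a v) h1
  have h4 : η v = η e * e.det v := congrArg (fun a : E [⋀^Fin m]→ₗ[ℝ] ℝ => a v) h2
  rw [← hδ, h3, hδ, h4, ← mul_assoc]
  congr 1
  rw [derivAction, LinearMap.trace_eq_matrix_trace ℝ e, Matrix.trace, Finset.sum_mul]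
  refine Finset.sum_congr rfl fun l _ => ?_
  rw [← e.sum_repr (A (e l)), Matrix.diag_apply, LinearMap.toMatrix_apply]
  have h5 : η (Function.update e l (∑ i, e.repr (A (e l)) i • e i)) =
      ∑ i, e.repr (A (e l)) i * η (Function.update e l (e i)) := by
    have := η.toMultilinearMap.map_update_sum Finset.univ l (fun i => e.repr (A (e l)) i • e i) e
    refine this.trans (Finset.sum_congr rfl fun i _ => ?_)
    exact η.toMultilinearMap.map_update_smul _ _ _ _
  rw [h5, Finset.sum_eq_single l]
  · rw [Function.update_eq_self]
  · intro i _ hi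
    rw [η.map_eq_zero_of_eq _ (i := l) (j := i) (by simp [hi]) (Ne.symm hi), mul_zero]
  · simp

/-- The value of an `m`-form on the concatenation of two tuples. -/
def pairing {k r m : ℕ} (h : k + r = m) (D : E [⋀^Fin m]→ₗ[ℝ] ℝ) (v : Fin k → E) (a : Fin r → E) :
    ℝ :=
  D fun i => Fin.append v a (Fin.cast h.symm i)

theorem append_update_left {α : Type*} {k r : ℕ} (v : Fin k → α) (a : Fin r → α) (l : Fin k)
    (x : α) : Fin.append (Function.update v l x) a =
      Function.update (Fin.append v a) (Fin.castAdd r l) x := by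
  funext i
  refine Fin.addCases (fun i => ?_) (fun i => ?_) i
  · by_cases hi : i = l
    · subst hi; simp
    · have : Fin.castAdd r i ≠ Fin.castAdd r l := fun h => hi (Fin.castAdd_injective _ _ h)
      simp [hi, this]
  · have : Fin.natAdd k i ≠ Fin.castAdd r l := by
      intro h; have := congrArg Fin.val h; simp at this; omega
    simp [this]

theorem append_update_right {α : Type*} {k r : ℕ} (v : Fin k → α) (a : Fin r → α) (l : Fin r)
    (x : α) : Fin.append v (Function.update a l x) =
      Function.update (Fin.append v a) (Fin.natAdd k l) x := by
  funext i
  refine Fin.addCases (fun i => ?_) (fun i => ?_) i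
  · have : Fin.castAdd r i ≠ Fin.natAdd k l := by
      intro h; have := congrArg Fin.val h; simp at this; omega
    simp [this]
  · by_cases hi : i = l
    · subst hi; simp
    · have : Fin.natAdd k i ≠ Fin.natAdd k l := fun h => hi (Fin.natAdd_injective _ _ h)
      simp [hi, this]

/-- `pairing` as an alternating map of its left argument. -/
def pairingLeft {k r m : ℕ} (h : k + r = m) (D : E [⋀^Fin m]→ₗ[ℝ] ℝ) (a : Fin r → E) :
    E [⋀^Fin k]→ₗ[ℝ] ℝ where
  toFun v := pairing h D v a
  map_update_add' {inst} v l x y := by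
    subst h
    rw [Subsingleton.elim inst (instDecidableEqFin k)]
    simp [pairing, append_update_left]
  map_update_smul' {inst} v l c x := by
    subst h
    rw [Subsingleton.elim inst (instDecidableEqFin k)]
    simp [pairing, append_update_left]
  map_eq_zero_of_eq' v i j hij hne := by
    subst h
    exact D.map_eq_zero_of_eq _ (i := Fin.castAdd r i) (j := Fin.castAdd r j) (by simpa using hij)
      fun h => hne (Fin.castAdd_injective _ _ h)

/-- `pairing` as an alternating map of its right argument. -/
def pairingRight {k r m : ℕ} (h : k + r = m) (D : E [⋀^Fin m]→ₗ[ℝ] ℝ) (v : Fin k → E) :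
    E [⋀^Fin r]→ₗ[ℝ] ℝ where
  toFun a := pairing h D v a
  map_update_add' {inst} a l x y := by
    subst h
    rw [Subsingleton.elim inst (instDecidableEqFin r)]
    simp [pairing, append_update_right]
  map_update_smul' {inst} a l c x := by
    subst h
    rw [Subsingleton.elim inst (instDecidableEqFin r)]
    simp [pairing, append_update_right]
  map_eq_zero_of_eq' a i j hij hne := by
    subst h
    exact D.map_eq_zero_of_eq _ (i := Fin.natAdd k i) (j := Fin.natAdd k j) (by simpa using hij)
      fun h => hne (Fin.natAdd_injective _ _ h)

/-- The sign is that of carrying `x` past the `k` entries of `v`. -/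
theorem pairing_cons {k r m : ℕ} (h₁ : k + 1 + r = m) (h₂ : k + (r + 1) = m)
    (D : E [⋀^Fin m]→ₗ[ℝ] ℝ) (x : E) (v : Fin k → E) (a : Fin r → E) :
    pairing h₁ D (Matrix.vecCons x v) a = (-1) ^ k * pairing h₂ D v (Matrix.vecCons x a) := by
  obtain rfl : m = k + r + 1 := by omega
  have e1 : (fun i => Fin.append (Matrix.vecCons x v) a (Fin.cast h₁.symm i)) =
      Matrix.vecCons x (Fin.append v a) := by
    funext i
    refine Fin.cases ?_ (fun i => Fin.addCases (fun i => ?_) (fun i => ?_) i) i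
    · rw [show Fin.cast h₁.symm 0 = Fin.castAdd r 0 from Fin.ext (by simp)]
      simp
    · rw [show Fin.cast h₁.symm (Fin.castAdd r i).succ = Fin.castAdd r i.succ from
        Fin.ext (by simp)]
      simp
    · rw [show Fin.cast h₁.symm (Fin.natAdd k i).succ = Fin.natAdd (k + 1) i from
        Fin.ext (by simp; omega)]
      simp
  have e2 : (fun i => Fin.append v (Matrix.vecCons x a) (Fin.cast h₂.symm i)) =
      (⟨k, by omega⟩ : Fin (k + r + 1)).insertNth x (Fin.append v a) := by
    rw [Fin.eq_insertNth_iff]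
    constructor
    · rw [show Fin.cast h₂.symm ⟨k, by omega⟩ = Fin.natAdd k 0 from Fin.ext (by simp)]
      simp
    · funext i
      rw [Fin.removeNth]
      refine Fin.addCases (fun i => ?_) (fun i => ?_) i
      · rw [Fin.succAbove_of_castSucc_lt _ _ (by simp [Fin.lt_def]),
          show Fin.cast h₂.symm (Fin.castAdd r i).castSucc = Fin.castAdd (r + 1) i from
            Fin.ext (by simp)]
        simp
      · rw [Fin.succAbove_of_le_castSucc _ _ (by simp [Fin.le_def]),
          show Fin.cast h₂.symm (Fin.natAdd k i).succ = Fin.natAdd k i.succ from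
            Fin.ext (by simp; omega)]
        simp
  rw [pairing, pairing, e1, e2, AlternatingMap.map_insertNth]
  rcases Nat.even_or_odd k with hk | hk <;> simp [hk.neg_one_pow]

theorem derivation_pairing {k r m : ℕ} (h : k + r = m) (e : Module.Basis (Fin m) ℝ E)
    (A : Module.End ℝ E) (D : E [⋀^Fin m]→ₗ[ℝ] ℝ) (v : Fin k → E) (a : Fin r → E) :
    ∑ l, pairing h D (Function.update v l (A (v l))) a
      + ∑ l, pairing h D v (Function.update a l (A (a l))) =
    LinearMap.trace ℝ E A * pairing h D v a := by
  subst h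
  have := derivAction_apply_basis_det e A (toContinuousAlternating D) (Fin.append v a)
  simp only [derivAction, Fin.sum_univ_add, toContinuousAlternating_apply, Fin.append_left,
    Fin.append_right, ← append_update_left, ← append_update_right] at this
  exact this

/-- The Hodge dual of a form, up to the factor `k!`. -/
def hodgeDual {k r m : ℕ} (h : k + r = m) (e : Module.Basis (Fin m) ℝ E)
    (η : E [⋀^Fin k]→L[ℝ] ℝ) : E [⋀^Fin r]→L[ℝ] ℝ :=
  toContinuousAlternating
    (∑ I : Fin k → Fin m, η (fun l => e (I l)) • pairingRight h e.det fun l => e (I l))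

theorem hodgeDual_apply {k r m : ℕ} (h : k + r = m) (e : Module.Basis (Fin m) ℝ E)
    (η : E [⋀^Fin k]→L[ℝ] ℝ) (a : Fin r → E) :
    hodgeDual h e η a =
      ∑ I : Fin k → Fin m, η (fun l => e (I l)) * pairing h e.det (fun l => e (I l)) a := by
  simp only [hodgeDual, toContinuousAlternating_apply]
  let ev : (E [⋀^Fin r]→ₗ[ℝ] ℝ) →+ ℝ :=
    { toFun := fun f => f a, map_zero' := rfl, map_add' := fun _ _ => rfl }
  exact map_sum ev _ _

/-- This is `A ⋆ (*η) = *((tr A) η - Aᵀ ⋆ η)`. Acting on the free slots of the volume form is the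
trace minus acting on the contracted slots, and contraction over the basis moves that action onto
`η` as the transpose `A'`. -/
theorem derivAction_hodgeDual {k r m : ℕ} (h : k + r = m) (e : Module.Basis (Fin m) ℝ E)
    {A A' : Module.End ℝ E} (hA : ∀ i j, e.repr (A' (e i)) j = e.repr (A (e j)) i)
    (η : E [⋀^Fin k]→L[ℝ] ℝ) (a : Fin r → E) :
    derivAction A (hodgeDual h e η) a = ∑ I : Fin k → Fin m,
      (LinearMap.trace ℝ E A * η (fun l => e (I l)) - derivAction A' η fun l => e (I l)) *
        pairing h e.det (fun l => e (I l)) a := by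
  have h1 : ∀ I : Fin k → Fin m,
      ∑ l, pairing h e.det (fun l => e (I l)) (Function.update a l (A (a l))) =
      LinearMap.trace ℝ E A * pairing h e.det (fun l => e (I l)) a
        - ∑ l, pairing h e.det (Function.update (fun l => e (I l)) l (A (e (I l)))) a := by
    intro I
    rw [← derivation_pairing h e A]
    ring
  have h2 : ∑ I : Fin k → Fin m, η (fun l => e (I l)) *
      ∑ l, pairing h e.det (Function.update (fun l => e (I l)) l (A (e (I l)))) a =
      ∑ I : Fin k → Fin m, derivAction A' η (fun l => e (I l)) *
        pairing h e.det (fun l => e (I l)) a := by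
    simp only [Finset.mul_sum, derivAction, Finset.sum_mul]
    rw [Finset.sum_comm, Finset.sum_comm (s := Finset.univ (α := Fin k → Fin m))]
    refine Finset.sum_congr rfl fun l _ => ?_
    exact sum_mul_update_transpose e hA η.toMultilinearMap
      (pairingLeft h e.det a).toMultilinearMap l
  rw [derivAction]
  simp only [hodgeDual_apply]
  rw [Finset.sum_comm]
  simp only [← Finset.mul_sum, h1, sub_mul, mul_sub, Finset.sum_sub_distrib]
  rw [h2]
  congr 1
  exact Finset.sum_congr rfl fun I _ => by ring

/-- The Hodge dual is injective. -/
theorem eq_zero_of_sum_pairing_eq_zero {k r m : ℕ} (h : k + r = m) (e : Module.Basis (Fin m) ℝ E)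
    (η : E [⋀^Fin k]→ₗ[ℝ] ℝ) (hη : ∀ a : Fin r → E, ∑ I : Fin k → Fin m,
      η (fun l => e (I l)) * pairing h e.det (fun l => e (I l)) a = 0) : η = 0 := by
  subst h
  refine Module.Basis.ext_alternating e fun K hK => ?_
  -- `σ` extends `K` to a permutation; its remaining values, inserted as `a`, select the component
  -- of `η` along `K`.
  obtain ⟨σ, hσ⟩ : ∃ σ : Equiv.Perm (Fin (k + r)), ∀ l, σ (Fin.castAdd r l) = K l := by
    let f := (Equiv.ofInjective _ (Fin.castAdd_injective k r)).symm.trans (Equiv.ofInjective K hK)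
    refine ⟨f.extendSubtype, fun l => ?_⟩
    rw [f.extendSubtype_apply_of_mem _ ⟨l, rfl⟩]
    simp [f, Equiv.ofInjective_symm_apply]
  set a : Fin r → E := fun l => e (σ (Fin.natAdd k l)) with ha
  have hpair : ∀ I : Fin k → Fin (k + r), pairing rfl e.det (fun l => e (I l)) a =
      e.det fun i => e (Fin.append I (fun l => σ (Fin.natAdd k l)) i) := by
    intro I
    refine congrArg e.det (funext fun i => ?_)
    refine Fin.addCases (fun i => ?_) (fun i => ?_) i <;> simp [ha]
  have hKdet : pairing rfl e.det (fun l => e (K l)) a = (Equiv.Perm.sign σ : ℤ) := by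
    rw [hpair]
    have : (fun i => e (Fin.append K (fun l => σ (Fin.natAdd k l)) i)) = fun i => e (σ i) := by
      funext i
      refine Fin.addCases (fun i => ?_) (fun i => ?_) i <;> simp [hσ]
    rw [this]
    have h1 := e.det.map_perm e σ
    rw [e.det_self] at h1
    simpa [Units.smul_def, Function.comp_def] using h1
  -- An index tuple with a nonzero contribution is a rearrangement of `K`, and both factors change
  -- by the same sign. All such terms equal the one of `K`, so multiplying the vanishing sum by it
  -- makes every summand nonnegative.
  have hterm : ∀ I : Fin k → Fin (k + r), 0 ≤
      (η (fun l => e (I l)) * pairing rfl e.det (fun l => e (I l)) a) *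
      (η (fun l => e (K l)) * pairing rfl e.det (fun l => e (K l)) a) := by
    intro I
    by_cases hinj : Function.Injective (Fin.append I fun l => σ (Fin.natAdd k l))
    · obtain ⟨π, hπ⟩ : ∃ π : Equiv.Perm (Fin k), ∀ l, K (π l) = I l := by
        have hex : ∀ l, ∃ l', K l' = I l := by
          intro l
          obtain ⟨i, hi⟩ := σ.surjective (I l)
          revert hi
          refine Fin.addCases (fun i hi => ⟨i, by rw [← hσ, hi]⟩) (fun i hi => ?_) i
          exfalso
          have h2 : Fin.append I (fun l => σ (Fin.natAdd k l)) (Fin.natAdd k i) =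
              Fin.append I (fun l => σ (Fin.natAdd k l)) (Fin.castAdd r l) := by
            simp [hi]
          have h3 := congrArg Fin.val (hinj h2)
          simp at h3
          omega
        choose f hf using hex
        have hfi : Function.Injective f := by
          intro l l' hll
          have h2 : I l = I l' := by rw [← hf, ← hf, hll]
          have h3 : Fin.append I (fun l => σ (Fin.natAdd k l)) (Fin.castAdd r l) =
              Fin.append I (fun l => σ (Fin.natAdd k l)) (Fin.castAdd r l') := by simp [h2]
          exact Fin.castAdd_injective _ _ (hinj h3)
        exact ⟨Equiv.ofBijective f (Finite.injective_iff_bijective.1 hfi), hf⟩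
      have e1 : (fun l => e (I l)) = (fun l => e (K l)) ∘ π := by
        funext l; simp [hπ]
      have h1 : η (fun l => e (I l)) = (Equiv.Perm.sign π : ℤ) * η fun l => e (K l) := by
        rw [e1, η.map_perm]; simp [Units.smul_def]
      have h2 : pairing rfl e.det (fun l => e (I l)) a =
          (Equiv.Perm.sign π : ℤ) * pairing rfl e.det (fun l => e (K l)) a := by
        have := (pairingLeft rfl e.det a).map_perm (fun l => e (K l)) π
        rw [e1]
        simp only [Units.smul_def, zsmul_eq_mul] at this
        exact this
      rw [h1, h2]
      nlinarith [mul_self_nonneg (((Equiv.Perm.sign π : ℤ) : ℝ) * (η (fun l => e (K l)) *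
        pairing rfl e.det (fun l => e (K l)) a))]
    · have : pairing rfl e.det (fun l => e (I l)) a = 0 := by
        rw [hpair]
        simp only [Function.Injective, not_forall] at hinj
        obtain ⟨i, j, hij, hne⟩ := hinj
        exact e.det.map_eq_zero_of_eq _ (by rw [hij]) hne
      rw [this]; simp
  have hsum := congrArg (fun s => s * (η (fun l => e (K l)) *
    pairing rfl e.det (fun l => e (K l)) a)) (hη a)
  simp only [zero_mul, Finset.sum_mul] at hsum
  have hz := (Finset.sum_eq_zero_iff_of_nonneg fun I _ => hterm I).1 hsum K (Finset.mem_univ _)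
  have hz' : η (fun l => e (K l)) * pairing rfl e.det (fun l => e (K l)) a = 0 :=
    mul_self_eq_zero.1 hz
  rw [hKdet] at hz'
  have hs : (((Equiv.Perm.sign σ : ℤ)) : ℝ) ≠ 0 := by
    exact_mod_cast (Equiv.Perm.sign σ).ne_zero
  exact (mul_eq_zero.1 hz').resolve_right hs

end HodgeAlgebra

end Sugra

/-! ### The Hodge star in an orthonormal frame. -/

namespace Sugra

section HodgeStar

set_option linter.unusedSectionVars false

variable {E : Type*} [NormedAddCommGroup E] [NormedSpace ℝ E] [FiniteDimensional ℝ E]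
variable {F : Type*} [NormedAddCommGroup F] [NormedSpace ℝ F] [FiniteDimensional ℝ F]

/-- Multilinear expansion of a full contraction: if `ε_a = ∑ i, N_{ia} b_i`, then
`∑ ∏ (N Nᵀ)_{i_l j_l} f(b_i) g(b_j) = ∑ f(ε_I) g(ε_I)`. -/
theorem sum_prod_mul_eq_sum {ι : Type*} [Fintype ι] [DecidableEq ι] (b : Module.Basis ι ℝ E)
    (ε : ι → E) {p : ℕ} (f : MultilinearMap ℝ (fun _ : Fin p => E) ℝ)
    (g : MultilinearMap ℝ (fun _ : Fin p => E) F) :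
    ∑ i : Fin p → ι, ∑ j : Fin p → ι,
      ((∏ l, ∑ a, b.repr (ε a) (i l) * b.repr (ε a) (j l)) * f fun l => b (j l)) •
        g (fun l => b (i l)) = ∑ I : Fin p → ι, f (fun l => ε (I l)) • g fun l => ε (I l) := by
  have hf : ∀ I : Fin p → ι, f (fun l => ε (I l)) =
      ∑ j : Fin p → ι, (∏ l, b.repr (ε (I l)) (j l)) * f fun l => b (j l) := by
    intro I
    conv_lhs => rw [show (fun l => ε (I l)) = fun l => ∑ i, b.repr (ε (I l)) i • b i from
      funext fun l => (b.sum_repr _).symm]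
    refine (f.map_sum _).trans (Finset.sum_congr rfl fun r _ => ?_)
    exact f.map_smul_univ _ _
  have hg : ∀ I : Fin p → ι, g (fun l => ε (I l)) =
      ∑ j : Fin p → ι, (∏ l, b.repr (ε (I l)) (j l)) • g fun l => b (j l) := by
    intro I
    conv_lhs => rw [show (fun l => ε (I l)) = fun l => ∑ i, b.repr (ε (I l)) i • b i from
      funext fun l => (b.sum_repr _).symm]
    refine (g.map_sum _).trans (Finset.sum_congr rfl fun r _ => ?_)
    exact g.map_smul_univ _ _
  have hp : ∀ i j : Fin p → ι, (∏ l, ∑ a, b.repr (ε a) (i l) * b.repr (ε a) (j l)) =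
      ∑ I : Fin p → ι, (∏ l, b.repr (ε (I l)) (i l)) * ∏ l, b.repr (ε (I l)) (j l) := by
    intro i j
    simp only [← Finset.prod_mul_distrib]
    exact Fintype.prod_sum fun (l : Fin p) a => b.repr (ε a) (i l) * b.repr (ε a) (j l)
  simp only [hf, hg, hp, Finset.sum_smul, Finset.smul_sum, Finset.sum_mul]
  have h1 : ∀ i : Fin p → ι, (∑ j : Fin p → ι, ∑ I : Fin p → ι,
      (((∏ l, b.repr (ε (I l)) (i l)) * ∏ l, b.repr (ε (I l)) (j l)) * f fun l => b (j l)) •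
        g (fun l => b (i l))) = ∑ I : Fin p → ι, ∑ j : Fin p → ι,
      (((∏ l, b.repr (ε (I l)) (i l)) * ∏ l, b.repr (ε (I l)) (j l)) * f fun l => b (j l)) •
        g (fun l => b (i l)) := fun i => Finset.sum_comm
  simp only [h1]
  rw [Finset.sum_comm]
  refine Finset.sum_congr rfl fun I _ => ?_
  refine Finset.sum_congr rfl fun j _ => Finset.sum_congr rfl fun i _ => ?_
  rw [smul_smul]
  congr 1
  ring

/-- `du ∧ Ω` as an alternating map. -/
def dWedgeAlternating (u : E → F) {k : ℕ} (Ω : E → E [⋀^Fin k]→L[ℝ] ℝ) (x : E) :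
    E [⋀^Fin (k + 1)]→ₗ[ℝ] F :=
  let f : E →ₗ[ℝ] E [⋀^Fin k]→ₗ[ℝ] F :=
    { toFun := fun w =>
        (LinearMap.toSpanSingleton ℝ F (fderiv ℝ u x w)).compAlternatingMap (Ω x).toAlternatingMap
      map_add' := fun a b => by ext v; simp
      map_smul' := fun c a => by ext v; simp [smul_comm c] }
  AlternatingMap.alternatizeUncurryFin f

theorem dWedgeAlternating_apply (u : E → F) {k : ℕ} (Ω : E → E [⋀^Fin k]→L[ℝ] ℝ) (x : E)
    (v : Fin (k + 1) → E) : dWedgeAlternating u Ω x v = dWedge u Ω x v := by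
  rw [dWedgeAlternating, AlternatingMap.alternatizeUncurryFin_apply, dWedge]
  refine Finset.sum_congr rfl fun i _ => ?_
  rcases Nat.even_or_odd i with hk | hk <;> simp [hk.neg_one_pow]

theorem sum_insertNth {ι M : Type*} [Fintype ι] [AddCommMonoid M] {k : ℕ} (i : Fin (k + 1))
    (f : (Fin (k + 1) → ι) → M) :
    ∑ I, f I = ∑ j : ι, ∑ I : Fin k → ι, f (i.insertNth j I) := by
  rw [← Fintype.sum_prod_type']
  exact (Equiv.sum_comp (Fin.insertNthEquiv (fun _ => ι) i) f).symm

namespace MovingFrame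

variable (Φ : MovingFrame E)

/-- A basis of `E` which is orthonormal for the form of a moving frame. -/
def IsOrthonormal (e : Module.Basis (Fin (Module.finrank ℝ E)) ℝ E) : Prop :=
  ∀ i j, Φ.form (e i) (e j) = if i = j then 1 else 0

theorem exists_isOrthonormal : ∃ e, Φ.IsOrthonormal e := by
  obtain ⟨b, hb⟩ := LinearMap.BilinForm.exists_orthogonal_basis (B := Φ.form)
    ⟨fun u v => Φ.form_symm u v⟩
  have hpos : ∀ i, 0 < Φ.form (b i) (b i) := fun i => Φ.form_pos _ (b.ne_zero i)
  have hu : ∀ i, IsUnit (Real.sqrt (Φ.form (b i) (b i)))⁻¹ := fun i =>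
    (inv_pos.2 (Real.sqrt_pos.2 (hpos i))).ne'.isUnit
  refine ⟨b.isUnitSMul hu, fun i j => ?_⟩
  simp only [Module.Basis.isUnitSMul_apply, map_smul, LinearMap.smul_apply, smul_eq_mul]
  by_cases hij : i = j
  · subst hij
    have h1 := Real.mul_self_sqrt (hpos i).le
    have h2 := (Real.sqrt_pos.2 (hpos i)).ne'
    rw [if_pos rfl]
    field_simp
    nlinarith
  · have : Φ.form (b i) (b j) = 0 := hb hij
    rw [if_neg hij, this]; simp

variable {Φ} {e : Module.Basis (Fin (Module.finrank ℝ E)) ℝ E}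

theorem IsOrthonormal.repr (he : Φ.IsOrthonormal e) (v : E) (i) :
    e.repr v i = Φ.form v (e i) := by
  conv_rhs => rw [← e.sum_repr v]
  simp only [map_sum, map_smul, LinearMap.sum_apply, LinearMap.smul_apply, he _ _]
  simp

theorem IsOrthonormal.repr_transpose (he : Φ.IsOrthonormal e) {A A' : Module.End ℝ E}
    (hA : ∀ u v, Φ.form (A u) v = Φ.form u (A' v)) (i j) :
    e.repr (A' (e i)) j = e.repr (A (e j)) i := by
  rw [he.repr, he.repr, hA, Φ.form_symm]

/-- The columns of `N` are the coordinates of the orthonormal frame vectors, and expanding a basis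
vector in this frame says `g N Nᵀ = 1`. -/
theorem IsOrthonormal.inv_gram (he : Φ.IsOrthonormal e) (x : E) (i j) :
    (gram Φ.metric x)⁻¹ i j = ∑ a, (Module.finBasis ℝ E).repr ((Φ.equiv x).symm (e a)) i *
      (Module.finBasis ℝ E).repr ((Φ.equiv x).symm (e a)) j := by
  set b := Module.finBasis ℝ E
  let N : Matrix (Fin (Module.finrank ℝ E)) (Fin (Module.finrank ℝ E)) ℝ :=
    Matrix.of fun i a => b.repr ((Φ.equiv x).symm (e a)) i
  have h : gram Φ.metric x * (N * N.transpose) = 1 := by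
    ext l j
    rw [← Matrix.mul_assoc, Matrix.mul_apply]
    have h1 : ∀ a, (gram Φ.metric x * N) l a = e.repr (Φ.frame x (b l)) a := by
      intro a
      have := gram_mulVec_repr Φ x ((Φ.equiv x).symm (e a)) l
      rw [metric_apply, frame_equiv_symm, Φ.form_symm, ← he.repr] at this
      exact this
    have h2 : b l = ∑ a, e.repr (Φ.frame x (b l)) a • (Φ.equiv x).symm (e a) := by
      conv_lhs => rw [← (Φ.equiv x).symm_apply_apply (b l), equiv_apply,
        ← e.sum_repr (Φ.frame x (b l)), map_sum]
      simp only [map_smul]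
    simp only [h1]
    have h3 := congrArg (fun w => b.repr w j) h2
    simp only [map_sum, map_smul, Module.Basis.repr_self, Finsupp.coe_finsetSum,
      Finset.sum_apply, Finsupp.smul_apply, smul_eq_mul] at h3
    refine Eq.trans h3.symm ?_
    rw [Matrix.one_apply, Finsupp.single_apply]
  rw [Matrix.inv_eq_right_inv h]
  rfl

/-- The Gram matrix is `Mᵀ M`, where `M` holds the components of the frame in the basis `e`, so its
determinant is the square of `det M`. -/
theorem IsOrthonormal.sqrt_det_gram (he : Φ.IsOrthonormal e) (x : E) :
    Real.sqrt (gram Φ.metric x).det = |e.det fun i => Φ.frame x (Module.finBasis ℝ E i)| := by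
  have h : gram Φ.metric x = (e.toMatrix fun i => Φ.frame x (Module.finBasis ℝ E i)).transpose *
      e.toMatrix fun i => Φ.frame x (Module.finBasis ℝ E i) := by
    ext i j
    rw [gram, Matrix.of_apply, metric_apply, Matrix.mul_apply]
    conv_lhs => rw [← e.sum_repr (Φ.frame x (Module.finBasis ℝ E j))]
    simp only [map_sum, map_smul, smul_eq_mul, Matrix.transpose_apply, Module.Basis.toMatrix_apply,
      ← he.repr]
    exact Finset.sum_congr rfl fun a _ => mul_comm _ _
  rw [h, Matrix.det_mul, Matrix.det_transpose, Real.sqrt_mul_self_eq_abs, Module.Basis.det_apply]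

theorem det_frame (e : Module.Basis (Fin (Module.finrank ℝ E)) ℝ E) (x : E)
    (w : Fin (Module.finrank ℝ E) → E) : e.det (fun i => Φ.frame x (w i)) =
      (e.det fun i => Φ.frame x (Module.finBasis ℝ E i)) * (Module.finBasis ℝ E).det w := by
  have h := (e.det.compLinearMap (Φ.frame x : E →ₗ[ℝ] E)).eq_smul_basis_det (Module.finBasis ℝ E)
  exact congrArg (fun a : E [⋀^Fin _]→ₗ[ℝ] ℝ => a w) h

theorem det_frame_ne_zero (e : Module.Basis (Fin (Module.finrank ℝ E)) ℝ E) (x : E) :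
    (e.det fun i => Φ.frame x (Module.finBasis ℝ E i)) ≠ 0 := by
  have := det_frame (Φ := Φ) e x fun i => (Φ.equiv x).symm (e i)
  simp only [frame_equiv_symm] at this
  intro h
  rw [h, zero_mul] at this
  exact one_ne_zero (e.det_self.symm.trans this)

/-- The sign which compares the orientations of the coordinates and of the frame. -/
def orientation (Φ : MovingFrame E) (e : Module.Basis (Fin (Module.finrank ℝ E)) ℝ E) (x : E) : ℝ :=
  |e.det fun i => Φ.frame x (Module.finBasis ℝ E i)| /
    e.det fun i => Φ.frame x (Module.finBasis ℝ E i)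

theorem orientation_ne_zero (x : E) : Φ.orientation e x ≠ 0 :=
  div_ne_zero (abs_ne_zero.2 (det_frame_ne_zero e x)) (det_frame_ne_zero e x)

/-- A continuous nonvanishing determinant keeps its sign near a point. This allows the orientation
factor to be treated as a constant under derivatives. -/
theorem eventually_orientation_eq (x : E) :
    ∀ᶠ y in nhds x, Φ.orientation e y = Φ.orientation e x := by
  have hc : Continuous fun y => e.det fun i => Φ.frame y (Module.finBasis ℝ E i) :=
    (toContinuousAlternating e.det).cont.comp
      (continuous_pi fun i => Φ.contDiff_frame.continuous.clm_apply continuous_const)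
  rcases lt_or_gt_of_ne (det_frame_ne_zero (Φ := Φ) e x) with h | h
  · filter_upwards [hc.continuousAt.eventually_lt continuousAt_const h] with y hy
    rw [orientation, orientation, abs_of_neg hy, abs_of_neg h, neg_div_self hy.ne,
      neg_div_self h.ne]
  · filter_upwards [continuousAt_const.eventually_lt hc.continuousAt h] with y hy
    rw [orientation, orientation, abs_of_pos hy, abs_of_pos h, div_self hy.ne', div_self h.ne']

/-- The inverse Gram matrices expand in the orthonormal frame by `inv_gram`, and `√det g` times the
coordinate determinant is the determinant in the frame up to the orientation sign. The star thereby
becomes a contraction over orthonormal vectors. -/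
theorem IsOrthonormal.hodgeStar_eq (he : Φ.IsOrthonormal e) {p q : ℕ}
    (h : p + q = Module.finrank ℝ E) (x : E) (α : MultilinearMap ℝ (fun _ : Fin p => E) F)
    (v : Fin q → E) :
    hodgeStar Φ.metric h x α v = (Φ.orientation e x / p.factorial) •
      ∑ I : Fin p → Fin (Module.finrank ℝ E),
        pairing h e.det (fun l => e (I l)) (fun l => Φ.frame x (v l)) •
          α fun l => (Φ.equiv x).symm (e (I l)) := by
  let f : MultilinearMap ℝ (fun _ : Fin p => E) ℝ := Φ.orientation e x •
    ((pairingLeft h e.det fun l => Φ.frame x (v l)).compLinearMap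
      (Φ.frame x : E →ₗ[ℝ] E)).toMultilinearMap
  have hf : ∀ w : Fin p → E, f w = Real.sqrt (gram Φ.metric x).det *
      (Module.finBasis ℝ E).det fun a => Fin.append w v (Fin.cast h.symm a) := by
    intro w
    have h1 : f w = Φ.orientation e x *
        pairing h e.det (fun l => Φ.frame x (w l)) fun l => Φ.frame x (v l) := rfl
    have h2 : pairing h e.det (fun l => Φ.frame x (w l)) (fun l => Φ.frame x (v l)) =
        e.det fun i => Φ.frame x (Fin.append w v (Fin.cast h.symm i)) := by
      refine congrArg e.det (funext fun i => ?_)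
      generalize Fin.cast h.symm i = i'
      refine Fin.addCases (fun i => ?_) (fun i => ?_) i' <;> simp
    rw [h1, h2, det_frame, he.sqrt_det_gram, orientation, ← mul_assoc,
      div_mul_cancel₀ _ (det_frame_ne_zero e x)]
  have h3 := sum_prod_mul_eq_sum (Module.finBasis ℝ E) (fun a => (Φ.equiv x).symm (e a)) f α
  simp only [← he.inv_gram, hf] at h3
  rw [hodgeStar, h3, show Φ.orientation e x / p.factorial =
    1 / p.factorial * Φ.orientation e x by ring, mul_smul]
  congr 1
  rw [Finset.smul_sum]
  refine Finset.sum_congr rfl fun I _ => ?_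
  rw [← hf, smul_smul]
  congr 1
  change Φ.orientation e x * pairing h e.det _ _ = _
  simp

/-- Up to a constant, `*(du ∧ Ω)` is `*Ω` contracted with `du`. All `k + 1` terms of the wedge
product contribute equally after reindexing, whence the factor `k + 1`; the sign `(-1)^k` comes from
carrying `e j` past the `k` contracted vectors. -/
theorem IsOrthonormal.hodgeStar_dWedge (he : Φ.IsOrthonormal e) {k q : ℕ}
    (h : k + 1 + q = Module.finrank ℝ E) (h' : k + (q + 1) = Module.finrank ℝ E) (x : E)
    (u : E → F) (ψ : E [⋀^Fin k]→L[ℝ] ℝ) (v : Fin q → E) :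
    hodgeStar Φ.metric h x (dWedge u (Φ.pull ψ) x) v =
      (Φ.orientation e x / (k + 1).factorial * ((k + 1) * (-1) ^ k)) •
      ∑ j, hodgeDual h' e ψ (Matrix.vecCons (e j) fun l => Φ.frame x (v l)) •
        fderiv ℝ u x ((Φ.equiv x).symm (e j)) := by
  have h1 : dWedge u (Φ.pull ψ) x = (dWedgeAlternating u (Φ.pull ψ) x).toMultilinearMap :=
    funext fun w => (dWedgeAlternating_apply u (Φ.pull ψ) x w).symm
  rw [h1, he.hodgeStar_eq, mul_smul]
  congr 1
  have h2 : ∀ w, (dWedgeAlternating u (Φ.pull ψ) x).toMultilinearMap w = dWedge u (Φ.pull ψ) x w :=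
    fun w => congrFun h1.symm w
  simp only [h2, dWedge, Finset.smul_sum, smul_smul]
  rw [Finset.sum_comm]
  have h3 : ∀ i : Fin (k + 1), (∑ I : Fin (k + 1) → Fin (Module.finrank ℝ E),
      (pairing h e.det (fun l => e (I l)) (fun l => Φ.frame x (v l)) * ((-1) ^ (i : ℕ) *
        Φ.pull ψ x (i.removeNth fun l => (Φ.equiv x).symm (e (I l))))) •
        fderiv ℝ u x ((Φ.equiv x).symm (e (I i)))) =
      ∑ j, ((-1) ^ k * hodgeDual h' e ψ (Matrix.vecCons (e j) fun l => Φ.frame x (v l))) •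
        fderiv ℝ u x ((Φ.equiv x).symm (e j)) := by
    intro i
    rw [sum_insertNth i]
    refine Finset.sum_congr rfl fun j _ => ?_
    rw [hodgeDual_apply, Finset.mul_sum, Finset.sum_smul]
    refine Finset.sum_congr rfl fun I _ => ?_
    have e1 : (fun l => e (i.insertNth (α := fun _ => Fin (Module.finrank ℝ E)) j I l)) =
        i.insertNth (e j) fun l => e (I l) := by
      rw [Fin.eq_insertNth_iff]
      refine ⟨by simp, ?_⟩
      funext l; simp [Fin.removeNth]
    have e2 : Φ.pull ψ x (i.removeNth fun l => (Φ.equiv x).symm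
        (e (i.insertNth (α := fun _ => Fin (Module.finrank ℝ E)) j I l))) =
        ψ fun l => e (I l) := by
      rw [pull_apply]
      simp [Fin.removeNth]
    have e3 : pairing h e.det (i.insertNth (e j) fun l => e (I l)) (fun l => Φ.frame x (v l)) =
        (-1) ^ (i : ℕ) * ((-1) ^ k * pairing h' e.det (fun l => e (I l))
          (Matrix.vecCons (e j) fun l => Φ.frame x (v l))) := by
      rw [← pairing_cons h h']
      have := (pairingLeft h e.det fun l => Φ.frame x (v l)).map_insertNth i (e j) fun l => e (I l)
      refine Eq.trans this ?_
      rcases Nat.even_or_odd i with hk | hk <;> simp [hk.neg_one_pow] <;> rfl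
    rw [e1, e2, e3, Fin.insertNth_apply_same]
    congr 1
    rcases Nat.even_or_odd i with hk | hk <;> simp [hk.neg_one_pow] <;> ring
  simp only [h3, Finset.sum_const, Finset.card_univ, Fintype.card_fin, ← Nat.cast_smul_eq_nsmul ℝ,
    Finset.smul_sum, smul_smul]
  refine Finset.sum_congr rfl fun j _ => ?_
  congr 1
  push_cast
  ring

end MovingFrame

end HodgeStar

end Sugra

/-! ### The tamed equation as an algebraic condition on the second fundamental form. -/

namespace Sugra

section TamedMaps

set_option linter.unusedSectionVars false

variable {E : Type*} [NormedAddCommGroup E] [NormedSpace ℝ E] [FiniteDimensional ℝ E]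
variable {F : Type*} [NormedAddCommGroup F] [NormedSpace ℝ F] [FiniteDimensional ℝ F]

instance finiteDimensional_continuousAlternatingMap (k : ℕ) :
    FiniteDimensional ℝ (E [⋀^Fin k]→L[ℝ] ℝ) := by
  let b := Module.finBasis ℝ E
  let ev : (E [⋀^Fin k]→L[ℝ] ℝ) →ₗ[ℝ] ((Fin k → Fin (Module.finrank ℝ E)) → ℝ) :=
    { toFun := fun η i => η fun l => b (i l)
      map_add' := fun _ _ => rfl
      map_smul' := fun _ _ => rfl }
  refine Module.Finite.of_injective ev ((injective_iff_map_eq_zero ev).2 fun η hη => ?_)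
  have h : η.toAlternatingMap = 0 := Module.Basis.ext_alternating b fun i _ => congrFun hη i
  ext v
  exact congrArg (fun a : E [⋀^Fin k]→ₗ[ℝ] ℝ => a v) h

/-- The tensor `∑ e_j ⊗ e_j` is invariant under infinitesimal rotations. It serves to discard the
rotation of the frame in a contraction over it. -/
theorem sum_bilin_skew {ι : Type*} [Fintype ι] (e : Module.Basis ι ℝ E) {W : Module.End ℝ E}
    (hW : ∀ i j, e.repr (W (e j)) i = -e.repr (W (e i)) j) (B : E →ₗ[ℝ] E →ₗ[ℝ] F) :
    ∑ j, (B (W (e j)) (e j) + B (e j) (W (e j))) = 0 := by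
  have h1 : ∀ j, B (W (e j)) (e j) = ∑ i, e.repr (W (e j)) i • B (e i) (e j) := fun j => by
    conv_lhs => rw [← e.sum_repr (W (e j))]
    simp only [map_sum, map_smul, LinearMap.sum_apply, LinearMap.smul_apply]
  have h2 : ∀ j, B (e j) (W (e j)) = ∑ i, e.repr (W (e j)) i • B (e j) (e i) := fun j => by
    conv_lhs => rw [← e.sum_repr (W (e j))]
    simp only [map_sum, map_smul]
  rw [Finset.sum_add_distrib]
  simp only [h1, h2]
  rw [Finset.sum_comm, ← Finset.sum_add_distrib]
  refine Finset.sum_eq_zero fun i _ => ?_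
  rw [← Finset.sum_add_distrib]
  exact Finset.sum_eq_zero fun j _ => by rw [← add_smul, hW i j, neg_add_cancel, zero_smul]

/-- A symmetric connection drops out of an exterior derivative. -/
theorem sum_update_symmetric_eq_zero {q : ℕ} (f : E [⋀^Fin q]→L[ℝ] ℝ) {C : E → Module.End ℝ E}
    (hC : ∀ v w, C v w = C w v) (v : Fin (q + 1) → E) :
    ∑ i : Fin (q + 1), (-1 : ℝ) ^ (i : ℕ) * ∑ l, f (Function.update (i.removeNth v) l
      (C (v i) (i.removeNth v l))) = 0 := by
  let C' : E →L[ℝ] E →L[ℝ] E := LinearMap.toContinuousLinearMap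
    ((LinearMap.toContinuousLinearMap : (E →ₗ[ℝ] E) ≃ₗ[ℝ] E →L[ℝ] E).toLinearMap.comp
      (LinearMap.mk₂ ℝ (fun a b => C a b) (fun a b c => by rw [hC, map_add, hC c, hC c])
        (fun r a b => by rw [hC, map_smul, hC b]) (fun a b c => map_add _ _ _)
        (fun r a b => map_smul _ _ _)))
  have hC' : ∀ a b, C' a b = C a b := fun a b => rfl
  have h := ContinuousAlternatingMap.alternatizeUncurryFin_fderivCompContinuousLinearMap_eq_zero f
    (ContinuousLinearMap.id ℝ E) (h := C') fun a b => by rw [hC', hC', hC]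
  have h2 := congrArg (fun a : E [⋀^Fin (q + 1)]→L[ℝ] ℝ => a v) h
  simp only [ContinuousAlternatingMap.alternatizeUncurryFin_apply] at h2
  refine Eq.trans (Finset.sum_congr rfl fun i _ => ?_) h2
  have h3 : ((f.fderivCompContinuousLinearMap (ContinuousLinearMap.id ℝ E)).comp C') (v i)
      (i.removeNth v) = ∑ l, f (Function.update (i.removeNth v) l
      (C (v i) (i.removeNth v l))) := by
    rw [ContinuousLinearMap.comp_apply,
      ContinuousAlternatingMap.fderivCompContinuousLinearMap_apply]
    refine Finset.sum_congr rfl fun l _ => congrArg f ?_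
    funext j
    by_cases hj : j = l
    · subst hj; simp [hC']
    · simp [hj]
  rw [h3]
  rcases Nat.even_or_odd i with hk | hk <;> simp [hk.neg_one_pow]

theorem vecCons_update_succ {α : Type*} {q : ℕ} (a : α) (v : Fin q → α) (l : Fin q) (b : α) :
    Function.update (Matrix.vecCons a v) l.succ b = Matrix.vecCons a (Function.update v l b) := by
  funext i
  refine Fin.cases ?_ (fun i => ?_) i
  · simp [(Fin.succ_ne_zero l).symm]
  · by_cases hi : i = l
    · subst hi; simp
    · simp [hi]

namespace MovingFrame

variable (Φ : MovingFrame E)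

theorem differentiableAt_equiv_symm (x a : E) :
    DifferentiableAt ℝ (fun y => (Φ.equiv y).symm a) x := by
  have h : (fun y => (Φ.equiv y).symm a) = fun y => (Φ.frame y).inverse a := by
    funext y
    have : Φ.frame y = ((Φ.equiv y).toContinuousLinearEquiv : E →L[ℝ] E) := by ext; rfl
    rw [this, ContinuousLinearMap.inverse_equiv]
    rfl
  rw [h]
  have h2 : ContDiffAt ℝ ∞ ContinuousLinearMap.inverse (Φ.frame x) :=
    contDiffAt_map_inverse (Φ.equiv x).toContinuousLinearEquiv
  exact ((h2.comp x Φ.contDiff_frame.contDiffAt).clm_apply contDiffAt_const).differentiableAt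
    (by simp)

/-- Obtained by differentiating the constant `Φ.frame y ((Φ.equiv y).symm a) = a`. In words of
geometry, the covariant derivative of a frame vector is its rotation by `conn`. -/
theorem fderiv_equiv_symm (x a w : E) : fderiv ℝ (fun y => (Φ.equiv y).symm a) x w =
    (Φ.equiv x).symm (Φ.conn x w a) - Φ.cov x w ((Φ.equiv x).symm a) := by
  have h := (Φ.differentiable_frame x).hasFDerivAt.clm_apply
    (Φ.differentiableAt_equiv_symm x a).hasFDerivAt
  simp only [frame_equiv_symm] at h
  have h2 := congrArg (fun L : E →L[ℝ] E => L w) (h.unique (hasFDerivAt_const a x))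
  simp only [add_apply, ContinuousLinearMap.comp_apply, zero_apply,
    ContinuousLinearMap.flip_apply] at h2
  apply Φ.injective x
  rw [map_sub, frame_equiv_symm, frame_cov, frame_equiv_symm, eq_neg_of_add_eq_zero_left h2]
  abel

/-- The function is `Φ.pull η` with a moving frame vector in its first slot. In the product rule the
`cov` term of that slot from `fderiv_pull` cancels the one from `fderiv_equiv_symm`, and only the
rotation of `a` remains there. -/
theorem hasFDerivAt_pull_cons {q : ℕ} {η : E [⋀^Fin (q + 1)]→L[ℝ] ℝ} (hη : Φ.IsInvariant η)
    (x a : E) (v : Fin q → E) :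
    ∃ L : E →L[ℝ] ℝ,
      HasFDerivAt (fun y => η (Matrix.vecCons a fun l => Φ.frame y (v l))) L x ∧
      ∀ w, L w = ∑ l, Φ.pull η x (Matrix.vecCons ((Φ.equiv x).symm a)
        (Function.update v l (Φ.cov x w (v l)))) +
        Φ.pull η x (Matrix.vecCons ((Φ.equiv x).symm (Φ.conn x w a)) v) := by
  have hf : (fun y => η (Matrix.vecCons a fun l => Φ.frame y (v l))) =
      fun y => Φ.pull η y (Matrix.vecCons ((Φ.equiv y).symm a) v) := by
    funext y
    rw [pull_apply]
    congr 1
    funext i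
    refine Fin.cases ?_ (fun i => ?_) i <;> simp
  let M₀ : (E [⋀^Fin (q + 1)]→L[ℝ] ℝ) →ₗ[ℝ] E →ₗ[ℝ] ℝ :=
    LinearMap.mk₂ ℝ (fun f b => f (Matrix.vecCons b v)) (fun _ _ _ => rfl) (fun _ _ _ => rfl)
      (fun f b c => f.toMultilinearMap.cons_add _ _ _)
      (fun r f b => f.toMultilinearMap.cons_smul _ _ _)
  let M : (E [⋀^Fin (q + 1)]→L[ℝ] ℝ) →L[ℝ] E →L[ℝ] ℝ := LinearMap.toContinuousLinearMap
    ((LinearMap.toContinuousLinearMap : (E →ₗ[ℝ] ℝ) ≃ₗ[ℝ] E →L[ℝ] ℝ).toLinearMap.comp M₀)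
  have hM : ∀ f b, M f b = f (Matrix.vecCons b v) := fun _ _ => rfl
  have h2 := M.hasFDerivAt_of_bilinear ((Φ.contDiff_pull η).differentiable (by simp) x).hasFDerivAt
    (Φ.differentiableAt_equiv_symm x a).hasFDerivAt
  refine ⟨_, by rw [hf]; exact h2, fun w => ?_⟩
  have h6 : Function.update (Matrix.vecCons ((Φ.equiv x).symm a) v) 0
      (Φ.cov x w ((Φ.equiv x).symm a)) = Matrix.vecCons (Φ.cov x w ((Φ.equiv x).symm a)) v := by
    funext i
    refine Fin.cases ?_ (fun i => ?_) i <;> simp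
  have h7 : fderiv ℝ (Φ.pull η) x w (Matrix.vecCons ((Φ.equiv x).symm a) v) =
      Φ.pull η x (Matrix.vecCons (Φ.cov x w ((Φ.equiv x).symm a)) v) +
      ∑ l, Φ.pull η x (Matrix.vecCons ((Φ.equiv x).symm a)
        (Function.update v l (Φ.cov x w (v l)))) := by
    rw [Φ.fderiv_pull hη, Fin.sum_univ_succ]
    simp only [vecCons_update_succ, Matrix.cons_val_zero, Matrix.cons_val_succ, h6]
  have h8 : M (Φ.pull η x) (fderiv ℝ (fun y => (Φ.equiv y).symm a) x w) +
      M (fderiv ℝ (Φ.pull η) x w) ((Φ.equiv x).symm a) =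
      ∑ l, Φ.pull η x (Matrix.vecCons ((Φ.equiv x).symm a)
        (Function.update v l (Φ.cov x w (v l)))) +
        Φ.pull η x (Matrix.vecCons ((Φ.equiv x).symm (Φ.conn x w a)) v) := by
    rw [fderiv_equiv_symm, map_sub, hM, hM, hM, h7]
    ring
  exact h8

variable {Φ} {e : Module.Basis (Fin (Module.finrank ℝ E)) ℝ E}

/-- A skew endomorphism has trace zero and is minus its own transpose, so `derivAction_hodgeDual`
carries invariance of `ψ` to its dual. This is the algebraic form of the fact that the star of a
parallel form is parallel. -/
theorem IsOrthonormal.isInvariant_hodgeDual (he : Φ.IsOrthonormal e) {k r : ℕ}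
    (h : k + r = Module.finrank ℝ E) {ψ : E [⋀^Fin k]→L[ℝ] ℝ} (hψ : Φ.IsInvariant ψ) :
    Φ.IsInvariant (hodgeDual h e ψ) := by
  intro x w v
  have hr : ∀ i j, e.repr ((-Φ.conn x w) (e i)) j = e.repr (Φ.conn x w (e j)) i :=
    he.repr_transpose fun u v => by rw [Φ.conn_skew]; simp
  have htr : LinearMap.trace ℝ E (Φ.conn x w) = 0 := by
    rw [LinearMap.trace_eq_matrix_trace ℝ e, Matrix.trace]
    refine Finset.sum_eq_zero fun i _ => ?_
    rw [Matrix.diag_apply, LinearMap.toMatrix_apply]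
    have := hr i i
    simp only [LinearMap.neg_apply, map_neg, Finsupp.coe_neg, Pi.neg_apply] at this
    linarith
  rw [derivAction_hodgeDual h e hr, htr]
  refine Finset.sum_eq_zero fun I _ => ?_
  have h1 := hψ x w fun l => e (I l)
  have h2 : derivAction (-Φ.conn x w) ψ (fun l => e (I l)) =
      -derivAction (Φ.conn x w) ψ fun l => e (I l) := by
    simp only [derivAction, LinearMap.neg_apply, ← Finset.sum_neg_distrib]
    refine Finset.sum_congr rfl fun l _ => ?_
    rw [← neg_one_smul ℝ (Φ.conn x w _), ContinuousAlternatingMap.map_update_smul]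
    simp
  rw [h2, h1]; simp

/-- The covariant derivative of `∑ η(e_j, ·) du(ε_j)` for an invariant form `η`. -/
theorem IsOrthonormal.fderiv_sum_smul (he : Φ.IsOrthonormal e) {q : ℕ}
    {η : E [⋀^Fin (q + 1)]→L[ℝ] ℝ} (hη : Φ.IsInvariant η) {u : E → F} {x : E}
    (hu : ContDiffAt ℝ 2 u x) (v : Fin q → E) (w : E) :
    fderiv ℝ (fun y => ∑ j, η (Matrix.vecCons (e j) fun l => Φ.frame y (v l)) •
      fderiv ℝ u y ((Φ.equiv y).symm (e j))) x w =
    ∑ j, (∑ l, Φ.pull η x (Matrix.vecCons ((Φ.equiv x).symm (e j))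
        (Function.update v l (Φ.cov x w (v l))))) • fderiv ℝ u x ((Φ.equiv x).symm (e j)) +
    ∑ j, η (Matrix.vecCons (e j) fun l => Φ.frame x (v l)) •
      (fderiv ℝ (fun y => fderiv ℝ u y ((Φ.equiv x).symm (e j))) x w -
        fderiv ℝ u x (Φ.cov x w ((Φ.equiv x).symm (e j)))) := by
  have hdu : DifferentiableAt ℝ (fderiv ℝ u) x :=
    (hu.fderiv_right (m := 1) (by norm_num)).differentiableAt (by simp)
  have hd2 : ∀ b : E, fderiv ℝ (fun y => fderiv ℝ u y b) x w = fderiv ℝ (fderiv ℝ u) x w b := by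
    intro b
    have := (hdu.hasFDerivAt.clm_apply (hasFDerivAt_const b x)).fderiv
    refine (congrArg (fun L : E →L[ℝ] F => L w) this).trans ?_
    simp
  choose L hL hLw using fun j => Φ.hasFDerivAt_pull_cons hη x (e j) v
  have h1 : ∀ j, HasFDerivAt (fun y => η (Matrix.vecCons (e j) fun l => Φ.frame y (v l)) •
      fderiv ℝ u y ((Φ.equiv y).symm (e j))) _ x := fun j =>
    (hL j).smul (hdu.hasFDerivAt.clm_apply (Φ.differentiableAt_equiv_symm x (e j)).hasFDerivAt)
  have h2 := (HasFDerivAt.fun_sum fun j (_ : j ∈ Finset.univ) => h1 j).fderiv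
  refine (congrArg (fun L : E →L[ℝ] F => L w) h2).trans ?_
  -- After summation over `j`, the rotation of the frame vector inside `η` cancels the rotation of
  -- the frame vector inside `du`.
  have h3 := sum_bilin_skew e (W := Φ.conn x w) (fun i j => by
      rw [← he.repr_transpose (A := Φ.conn x w) (A' := -Φ.conn x w)
        (fun u v => by rw [Φ.conn_skew]; simp)]; simp)
    (LinearMap.mk₂ ℝ (fun a b => Φ.pull η x (Matrix.vecCons ((Φ.equiv x).symm a) v) •
      fderiv ℝ u x ((Φ.equiv x).symm b))
      (fun a b c => by
        rw [map_add, ← add_smul]; congr 1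
        exact (Φ.pull η x).toMultilinearMap.cons_add _ _ _)
      (fun r a b => by
        rw [map_smul, smul_smul]; congr 1
        exact (Φ.pull η x).toMultilinearMap.cons_smul _ _ _)
      (fun a b c => by rw [map_add, map_add, smul_add])
      (fun r a b => by rw [map_smul, map_smul, smul_comm]))
  simp only [LinearMap.mk₂_apply] at h3
  refine Eq.trans ?_ (add_zero _)
  rw [← h3, ← Finset.sum_add_distrib, ← Finset.sum_add_distrib]
  rw [sum_apply]
  refine Finset.sum_congr rfl fun j _ => ?_
  have h4 : Φ.pull η x (Matrix.vecCons ((Φ.equiv x).symm (e j)) v) =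
      η (Matrix.vecCons (e j) fun l => Φ.frame x (v l)) := by
    rw [pull_apply]
    congr 1
    funext i
    refine Fin.cases ?_ (fun i => ?_) i <;> simp
  simp only [add_apply, smul_apply, ContinuousLinearMap.comp_apply,
    ContinuousLinearMap.flip_apply, ContinuousLinearMap.smulRight_apply, hLw, fderiv_equiv_symm,
    hd2, h4, map_sub, smul_add, add_smul, smul_sub]
  abel

/-- The equation `D * (du ∧ Ω) = 0` at a point, for the parallel form `Ω` with constant components
`ψ`: a contraction of the second fundamental form of `u` with the Hodge dual of `ψ`. -/
theorem IsOrthonormal.sum_hodgeDual_smul_secondFundamentalForm (he : Φ.IsOrthonormal e) {k q : ℕ}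
    (hkq : k + 1 + q = Module.finrank ℝ E) (h' : k + (q + 1) = Module.finrank ℝ E)
    {ψ : E [⋀^Fin k]→L[ℝ] ℝ} (hψ : Φ.IsInvariant ψ) {u : E → F} {x : E}
    (hu : ContDiffAt ℝ 2 u x) {H : F → LinearMap.BilinForm ℝ F} (Γ : F →ₗ[ℝ] F →ₗ[ℝ] F)
    (hΓ : ∀ a b, christoffel H (u x) a b = Γ a b) (v : Fin (q + 1) → E)
    (htamed : covExtDeriv H u
      (fun y => hodgeStar Φ.metric hkq y (dWedge u (Φ.pull ψ) y)) x v = 0) :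
    ∑ i : Fin (q + 1), (-1 : ℝ) ^ (i : ℕ) • ∑ j,
      hodgeDual h' e ψ (Matrix.vecCons (e j) fun l => Φ.frame x (i.removeNth v l)) •
        secondFundamentalForm Φ.metric H u x (v i) ((Φ.equiv x).symm (e j)) = 0 := by
  set η := hodgeDual h' e ψ with hη
  have hinv : Φ.IsInvariant η := he.isInvariant_hodgeDual h' hψ
  set c : ℝ := Φ.orientation e x / (k + 1).factorial * ((k + 1) * (-1) ^ k) with hc
  have hc0 : c ≠ 0 := by
    refine mul_ne_zero (div_ne_zero (orientation_ne_zero x) (by positivity)) (mul_ne_zero ?_ ?_)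
    · positivity
    · exact pow_ne_zero _ (by norm_num)
  have hfd : ∀ (v' : Fin q → E) (w : E), fderiv ℝ (fun y => hodgeStar Φ.metric hkq y
      (dWedge u (Φ.pull ψ) y) v') x w = c • fderiv ℝ (fun y => ∑ j,
      η (Matrix.vecCons (e j) fun l => Φ.frame y (v' l)) •
        fderiv ℝ u y ((Φ.equiv y).symm (e j))) x w := by
    intro v' w
    have h1 : (fun y => hodgeStar Φ.metric hkq y (dWedge u (Φ.pull ψ) y) v') =ᶠ[nhds x]
        fun y => c • ∑ j, η (Matrix.vecCons (e j) fun l => Φ.frame y (v' l)) •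
          fderiv ℝ u y ((Φ.equiv y).symm (e j)) := by
      filter_upwards [eventually_orientation_eq (Φ := Φ) (e := e) x] with y hy
      rw [he.hodgeStar_dWedge hkq h', hy]
    rw [h1.fderiv_eq]
    have := fderiv_const_smul_field (𝕜 := ℝ) (f := fun y => ∑ j,
      η (Matrix.vecCons (e j) fun l => Φ.frame y (v' l)) •
        fderiv ℝ u y ((Φ.equiv y).symm (e j))) (c := c)
    exact congrArg (fun L : E → E →L[ℝ] F => L x w) this
  have hst : ∀ v' : Fin q → E, hodgeStar Φ.metric hkq x (dWedge u (Φ.pull ψ) x) v' =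
      c • ∑ j, η (Matrix.vecCons (e j) fun l => Φ.frame x (v' l)) •
        fderiv ℝ u x ((Φ.equiv x).symm (e j)) := fun v' => he.hodgeStar_dWedge hkq h' x u ψ v'
  -- Up to the constant `c`, the exterior covariant derivative is the contraction with the second
  -- fundamental form plus connection terms on the free arguments of the dual form. Alternation
  -- kills the latter, because `cov` is symmetric.
  have hsum : c • ∑ i : Fin (q + 1), (-1 : ℝ) ^ (i : ℕ) • ∑ j,
      η (Matrix.vecCons (e j) fun l => Φ.frame x (i.removeNth v l)) •
        secondFundamentalForm Φ.metric H u x (v i) ((Φ.equiv x).symm (e j)) +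
      c • ∑ j, (∑ i : Fin (q + 1), (-1 : ℝ) ^ (i : ℕ) * ∑ l,
        (Φ.pull η x).curryLeft ((Φ.equiv x).symm (e j)) (Function.update (i.removeNth v) l
          (Φ.cov x (v i) (i.removeNth v l)))) • fderiv ℝ u x ((Φ.equiv x).symm (e j)) = 0 := by
    rw [← htamed, covExtDeriv]
    simp only [hfd, hst, he.fderiv_sum_smul hinv hu, hΓ, secondFundamentalForm,
      christoffel_eq_cov, Finset.smul_sum, Finset.sum_smul, smul_add, map_sum, map_smul,
      ContinuousAlternatingMap.curryLeft_apply_apply, smul_sub, Finset.mul_sum]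
    rw [Finset.sum_comm (s := Finset.univ (α := Fin (Module.finrank ℝ E))),
      ← Finset.sum_add_distrib]
    refine Finset.sum_congr rfl fun i _ => ?_
    simp only [← Finset.sum_add_distrib]
    refine Finset.sum_congr rfl fun j _ => ?_
    simp only [smul_smul, mul_left_comm c]
    abel
  have hz : ∀ j, ∑ i : Fin (q + 1), (-1 : ℝ) ^ (i : ℕ) * ∑ l,
        (Φ.pull η x).curryLeft ((Φ.equiv x).symm (e j)) (Function.update (i.removeNth v) l
          (Φ.cov x (v i) (i.removeNth v l))) = 0 := fun j =>
    sum_update_symmetric_eq_zero _ (Φ.cov_symm x) v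
  simp only [hz, zero_smul, Finset.sum_const_zero, smul_zero, add_zero] at hsum
  exact (smul_eq_zero.1 hsum).resolve_left hc0

theorem exists_secondFundamentalForm_eq {u : E → F} {x : E} (hu : ContDiffAt ℝ 2 u x)
    {H : F → LinearMap.BilinForm ℝ F} (Γ : F →ₗ[ℝ] F →ₗ[ℝ] F)
    (hΓ : ∀ a b, christoffel H (u x) a b = Γ a b) (hΓs : ∀ a b, Γ a b = Γ b a) :
    ∃ Q : E →ₗ[ℝ] E →ₗ[ℝ] F, (∀ v w, secondFundamentalForm Φ.metric H u x v w = Q v w) ∧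
      ∀ v w, Q v w = Q w v := by
  have hdu : DifferentiableAt ℝ (fderiv ℝ u) x :=
    (hu.fderiv_right (m := 1) (by norm_num)).differentiableAt (by simp)
  have hd2 : ∀ b w : E, fderiv ℝ (fun y => fderiv ℝ u y b) x w = fderiv ℝ (fderiv ℝ u) x w b := by
    intro b w
    have := (hdu.hasFDerivAt.clm_apply (hasFDerivAt_const b x)).fderiv
    refine (congrArg (fun L : E →L[ℝ] F => L w) this).trans ?_
    simp
  let Q : E →ₗ[ℝ] E →ₗ[ℝ] F := LinearMap.mk₂ ℝ (fun v w => fderiv ℝ (fderiv ℝ u) x v w -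
      fderiv ℝ u x (Φ.cov x v w) + Γ (fderiv ℝ u x v) (fderiv ℝ u x w))
    (fun a b w => by
      rw [Φ.cov_symm, Φ.cov_symm x a, Φ.cov_symm x b]
      simp only [map_add, add_apply, LinearMap.add_apply]
      abel)
    (fun r a w => by
      rw [Φ.cov_symm, Φ.cov_symm x a]
      simp only [map_smul, smul_apply, LinearMap.smul_apply, smul_add, smul_sub])
    (fun a b w => by
      simp only [map_add]
      abel)
    (fun r a w => by simp only [map_smul, smul_add, smul_sub])
  have hQ : ∀ v w, Q v w = fderiv ℝ (fderiv ℝ u) x v w -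
      fderiv ℝ u x (Φ.cov x v w) + Γ (fderiv ℝ u x v) (fderiv ℝ u x w) := fun _ _ => rfl
  refine ⟨Q, fun v w => ?_, fun v w => ?_⟩
  · rw [hQ, secondFundamentalForm, hd2, christoffel_eq_cov, hΓ]
  · rw [hQ, hQ, Φ.cov_symm, hΓs, (hu.isSymmSndFDerivAt (by simp)) v w]

/-- The components of the second fundamental form of a tamed map annihilate all invariant forms. -/
theorem derivAction_secondFundamentalForm_eq_zero {u : E → F} {x : E} (hu : ContDiffAt ℝ 2 u x)
    {H : F → LinearMap.BilinForm ℝ F} (Γ : F →ₗ[ℝ] F →ₗ[ℝ] F)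
    (hΓ : ∀ a b, christoffel H (u x) a b = Γ a b) (hΓs : ∀ a b, Γ a b = Γ b a)
    (htamed : ∀ (k q : ℕ) (hkq : k + 1 + q = Module.finrank ℝ E) (Ω : E → E [⋀^Fin k]→L[ℝ] ℝ),
      IsParallel Φ.metric Ω → ∀ v : Fin (q + 1) → E,
        covExtDeriv H u (fun y => hodgeStar Φ.metric hkq y (dWedge u Ω y)) x v = 0)
    (φ : F →ₗ[ℝ] ℝ) :
    ∃ A : Module.End ℝ E, (∀ a b, Φ.form (A (Φ.frame x a)) (Φ.frame x b) =
        φ (secondFundamentalForm Φ.metric H u x a b)) ∧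
      (∀ a b, Φ.form (A a) b = Φ.form a (A b)) ∧
      ∀ (k : ℕ) (ψ : E [⋀^Fin k]→L[ℝ] ℝ), Φ.IsInvariant ψ → ∀ v, derivAction A ψ v = 0 := by
  obtain ⟨e, he⟩ := Φ.exists_isOrthonormal
  obtain ⟨Q, hQ, hQs⟩ := exists_secondFundamentalForm_eq (Φ := Φ) hu Γ hΓ hΓs
  -- `A` represents, with respect to `form` and read in the frame, the symmetric bilinear form
  -- `φ(Ddu)`.
  let A : Module.End ℝ E :=
    ∑ j, ((φ.comp (Q.flip ((Φ.equiv x).symm (e j)))).comp (Φ.equiv x).symm.toLinearMap).smulRight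
      (e j)
  have hA : ∀ a, A a = ∑ j, φ (Q ((Φ.equiv x).symm a) ((Φ.equiv x).symm (e j))) • e j := by
    intro a
    simp only [A, LinearMap.sum_apply]
    rfl
  have hform : ∀ a b, Φ.form (A a) b = φ (Q ((Φ.equiv x).symm a) ((Φ.equiv x).symm b)) := by
    intro a b
    conv_rhs => rw [← e.sum_repr b]
    simp only [hA, map_sum, map_smul, LinearMap.sum_apply, LinearMap.smul_apply, he.repr,
      smul_eq_mul, Φ.form_symm b, mul_comm]
  have hAs : ∀ a b, Φ.form (A a) b = Φ.form a (A b) := fun a b => by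
    rw [Φ.form_symm a, hform, hform, hQs]
  refine ⟨A, fun a b => ?_, hAs, ?_⟩
  · have h1 : ∀ c, (Φ.equiv x).symm (Φ.frame x c) = c := fun c => (Φ.equiv x).symm_apply_apply c
    rw [hform, hQ, h1, h1]
  -- Composed with `φ`, the tamed equation for `ψ` is exactly the derivation of the dual of `ψ` by
  -- `A`.
  have hdual : ∀ {k q : ℕ} (hkq : k + 1 + q = Module.finrank ℝ E)
      (h' : k + (q + 1) = Module.finrank ℝ E) (ψ : E [⋀^Fin k]→L[ℝ] ℝ), Φ.IsInvariant ψ →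
      ∀ a, derivAction A (hodgeDual h' e ψ) a = 0 := by
    intro k q hkq h' ψ hψ a
    have h1 := he.sum_hodgeDual_smul_secondFundamentalForm hkq h' hψ hu Γ hΓ
      (fun l => (Φ.equiv x).symm (a l)) (htamed k q hkq _ (Φ.isParallel_pull hψ) _)
    have h2 := congrArg φ h1
    rw [map_zero] at h2
    rw [← h2, derivAction, map_sum]
    refine Finset.sum_congr rfl fun i _ => ?_
    have h3 : Function.update a i (A (a i)) = i.insertNth (A (a i)) (i.removeNth a) := by
      rw [Fin.insertNth_removeNth]
    rw [h3, ContinuousAlternatingMap.map_insertNth, hA]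
    have h4 : hodgeDual h' e ψ (Matrix.vecCons
        (∑ j, φ (Q ((Φ.equiv x).symm (a i)) ((Φ.equiv x).symm (e j))) • e j) (i.removeNth a)) =
        ∑ j, φ (Q ((Φ.equiv x).symm (a i)) ((Φ.equiv x).symm (e j))) *
          hodgeDual h' e ψ (Matrix.vecCons (e j) (i.removeNth a)) := by
      have : ∀ b, hodgeDual h' e ψ (Matrix.vecCons b (i.removeNth a)) =
          (hodgeDual h' e ψ).curryLeft b (i.removeNth a) := fun _ => rfl
      simp only [this, map_sum, map_smul, ContinuousAlternatingMap.sum_apply,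
        ContinuousAlternatingMap.smul_apply, smul_eq_mul]
    rw [h4]
    have h5 : ∀ j, (Matrix.vecCons (e j) fun l => Φ.frame x
        (i.removeNth (fun l => (Φ.equiv x).symm (a l)) l)) =
        Matrix.vecCons (e j) (i.removeNth a) := by
      intro j
      simp only [Fin.removeNth, frame_equiv_symm]
      rfl
    simp only [h5, hQ, map_smul, map_sum, smul_eq_mul]
    rcases Nat.even_or_odd i with hk | hk <;> simp [hk.neg_one_pow, mul_comm]
  -- Pulling `A`, which is its own transpose, through the injective Hodge dual leaves only a
  -- multiple of `ψ`, in all degrees below the dimension.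
  have hk : ∀ {k q : ℕ} (hkq : k + 1 + q = Module.finrank ℝ E) (ψ : E [⋀^Fin k]→L[ℝ] ℝ),
      Φ.IsInvariant ψ → ∀ v, derivAction A ψ v = LinearMap.trace ℝ E A * ψ v := by
    intro k q hkq ψ hψ v
    have h' : k + (q + 1) = Module.finrank ℝ E := by omega
    let δ : E [⋀^Fin k]→ₗ[ℝ] ℝ := LinearMap.trace ℝ E A • ψ.toAlternatingMap -
      (ψ.fderivCompContinuousLinearMap (ContinuousLinearMap.id ℝ E)
        (LinearMap.toContinuousLinearMap A)).toAlternatingMap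
    have hδ : ∀ w, δ w = LinearMap.trace ℝ E A * ψ w - derivAction A ψ w := by
      intro w
      have h1 : ψ.fderivCompContinuousLinearMap (ContinuousLinearMap.id ℝ E)
          (LinearMap.toContinuousLinearMap A) w = derivAction A ψ w := by
        rw [ContinuousAlternatingMap.fderivCompContinuousLinearMap_apply, derivAction]
        refine Finset.sum_congr rfl fun l _ => congrArg ψ ?_
        funext j
        by_cases hj : j = l
        · subst hj; simp
        · simp [hj]
      rw [← h1]
      rfl
    have hz : δ = 0 := by
      refine eq_zero_of_sum_pairing_eq_zero h' e δ fun a => ?_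
      rw [← hdual hkq h' ψ hψ a, derivAction_hodgeDual h' e (he.repr_transpose hAs)]
      simp only [hδ]
    have := hδ v
    rw [hz] at this
    simp only [AlternatingMap.zero_apply] at this
    linarith
  by_cases hm : Module.finrank ℝ E = 0
  · intro k ψ _ v
    have := Module.finrank_zero_iff.1 hm
    exact Finset.sum_eq_zero fun l _ => ψ.map_coord_zero l (Subsingleton.elim _ _)
  -- The constant `0`-form `1` is invariant and every derivation kills it, so its multiple by the
  -- trace vanishes.
  have htr : LinearMap.trace ℝ E A = 0 := by
    have h1 := hk (k := 0) (q := Module.finrank ℝ E - 1) (by omega)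
      (ContinuousAlternatingMap.constOfIsEmpty ℝ E (Fin 0) (1 : ℝ))
      (fun x w v => by simp [derivAction]) Fin.elim0
    simpa [derivAction] using h1.symm
  intro k ψ hψ v
  rcases lt_trichotomy k (Module.finrank ℝ E) with hlt | heq | hgt
  · obtain ⟨q, hq⟩ := Nat.exists_eq_add_of_lt hlt
    rw [hk (q := q) (by omega) ψ hψ, htr, zero_mul]
  · subst heq
    rw [derivAction_apply_basis_det e, htr, zero_mul]
  · refine Finset.sum_eq_zero fun l _ => ?_
    exact ψ.toAlternatingMap.map_linearDependent _ fun hli => by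
      have := hli.fintype_card_le_finrank
      simp at this
      omega

end MovingFrame

end TamedMaps

end Sugra

/-! ### The target manifold in a chart, and rigidity of a moving frame. -/

namespace Sugra

section Target

set_option linter.unusedSectionVars false

/-- The Christoffel expression is linear in the first derivatives of `H`, so it inherits bilinearity
from the values of `H` and symmetry from their symmetry. -/
theorem exists_christoffel_eq {F : Type*} [NormedAddCommGroup F] [NormedSpace ℝ F]
    [FiniteDimensional ℝ F] {H : F → LinearMap.BilinForm ℝ F} {z : F}
    (hs : ∀ y a b, H y a b = H y b a) (hd : ∀ a b, DifferentiableAt ℝ (fun y => H y a b) z) :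
    ∃ Γ : F →ₗ[ℝ] F →ₗ[ℝ] F, (∀ a b, christoffel H z a b = Γ a b) ∧ ∀ a b, Γ a b = Γ b a := by
  let D : F → F → F → ℝ := fun a b w => fderiv ℝ (fun y => H y a b) z w
  have hDs : ∀ a b w, D a b w = D b a w := fun a b w => by simp only [D, hs _ a b]
  have hDa : ∀ a a' b w, D (a + a') b w = D a b w + D a' b w := fun a a' b w => by
    simp only [D, map_add, LinearMap.add_apply]
    rw [fderiv_fun_add (hd _ _) (hd _ _)]; rfl
  have hDm : ∀ (r : ℝ) a b w, D (r • a) b w = r * D a b w := fun r a b w => by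
    simp only [D, map_smul, LinearMap.smul_apply]
    rw [fderiv_fun_const_smul (hd _ _)]; rfl
  have hDa' : ∀ a b b' w, D a (b + b') w = D a b w + D a b' w := fun a b b' w => by
    rw [hDs, hDa, hDs b, hDs b']
  have hDm' : ∀ (r : ℝ) a b w, D a (r • b) w = r * D a b w := fun r a b w => by
    rw [hDs, hDm, hDs b]
  have hDw : ∀ a b w w', D a b (w + w') = D a b w + D a b w' := fun a b w w' => map_add _ _ _
  have hDmw : ∀ (r : ℝ) a b w, D a b (r • w) = r * D a b w := fun r a b w => map_smul _ _ _
  have hc : ∀ a b, christoffel H z a b = ∑ k, (∑ l, (gram H z)⁻¹ k l * (1 / 2 : ℝ) *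
      (D b (Module.finBasis ℝ F l) a + D a (Module.finBasis ℝ F l) b
        - D a b (Module.finBasis ℝ F l))) • Module.finBasis ℝ F k := fun _ _ => rfl
  have hcs : ∀ a b, christoffel H z a b = christoffel H z b a := fun a b => by
    simp only [hc, hDs b a, add_comm (D b _ a)]
  have hca : ∀ a a' b, christoffel H z (a + a') b = christoffel H z a b + christoffel H z a' b :=
    fun a a' b => by
      simp only [hc, hDa, hDw, ← Finset.sum_add_distrib, ← add_smul]
      refine Finset.sum_congr rfl fun k _ => ?_
      congr 1
      exact Finset.sum_congr rfl fun l _ => by ring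
  have hcm : ∀ (r : ℝ) a b, christoffel H z (r • a) b = r • christoffel H z a b := fun r a b => by
      simp only [hc, hDm, hDmw, Finset.smul_sum, smul_smul]
      refine Finset.sum_congr rfl fun k _ => ?_
      congr 1
      rw [Finset.mul_sum]
      exact Finset.sum_congr rfl fun l _ => by ring
  exact ⟨LinearMap.mk₂ ℝ (fun a b => christoffel H z a b) hca hcm
    (fun a b b' => by rw [hcs, hca, hcs b, hcs b']) (fun r a b => by rw [hcs, hcm, hcs b]),
    fun _ _ => rfl, hcs⟩

variable {n : ℕ} {Y : Type*} [TopologicalSpace Y] [ChartedSpace (EuclideanSpace ℝ (Fin n)) Y]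
  [IsManifold (𝓡 n) ∞ Y]

/-- The coordinate vector field is the tangent map of the inverse chart applied to a constant
section. Inserted in the smooth metric, it makes the components of `chartMetric` differentiable at
the centre of the chart. -/
theorem contMDiffAt_chartFrame (y₀ : Y) (a : EuclideanSpace ℝ (Fin n)) :
    ContMDiffAt 𝓘(ℝ, EuclideanSpace ℝ (Fin n)) (𝓡 n).tangent ∞
      (fun z => (⟨(extChartAt (𝓡 n) y₀).symm z, chartFrame y₀ z a⟩ : TangentBundle (𝓡 n) Y))
      (extChartAt (𝓡 n) y₀ y₀) := by
  set s := (extChartAt (𝓡 n) y₀).target with hs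
  have hso : IsOpen s := isOpen_extChartAt_target y₀
  have hz : extChartAt (𝓡 n) y₀ y₀ ∈ s := mem_extChartAt_target y₀
  have h1 : ContMDiffOn 𝓘(ℝ, EuclideanSpace ℝ (Fin n)) (𝓡 n) ∞ (extChartAt (𝓡 n) y₀).symm s :=
    contMDiffOn_extChartAt_symm y₀
  have h2 := h1.contMDiffOn_tangentMapWithin (m := ∞) (by simp) hso.uniqueMDiffOn
  have h3 : ContMDiff 𝓘(ℝ, EuclideanSpace ℝ (Fin n)) 𝓘(ℝ, EuclideanSpace ℝ (Fin n)).tangent ∞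
      (fun z => (⟨z, a⟩ : TangentBundle 𝓘(ℝ, EuclideanSpace ℝ (Fin n))
        (EuclideanSpace ℝ (Fin n)))) :=
    contMDiff_vectorSpace_iff_contDiff.2 contDiff_const
  have h4 := (h2.comp h3.contMDiffOn (fun z hz => hz) :
    ContMDiffOn _ _ _ _ s).contMDiffAt (hso.mem_nhds hz)
  refine h4.congr_of_eventuallyEq ?_
  filter_upwards [hso.mem_nhds hz] with z hz
  simp only [Function.comp_def, tangentMapWithin, chartFrame, mfderivWithin_of_isOpen hso hz]
  rfl

theorem differentiableAt_chartMetric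
    (h : Bundle.ContMDiffRiemannianMetric (𝓡 n) ∞ (EuclideanSpace ℝ (Fin n))
      (fun y : Y => TangentSpace (𝓡 n) y)) (y₀ : Y) (a b : EuclideanSpace ℝ (Fin n)) :
    DifferentiableAt ℝ (fun z => chartMetric h y₀ z a b) (extChartAt (𝓡 n) y₀ y₀) := by
  have hψ : ContMDiffAt 𝓘(ℝ, EuclideanSpace ℝ (Fin n)) (𝓡 n) ∞ (extChartAt (𝓡 n) y₀).symm
      (extChartAt (𝓡 n) y₀ y₀) := (contMDiffOn_extChartAt_symm y₀).contMDiffAt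
        ((isOpen_extChartAt_target y₀).mem_nhds (mem_extChartAt_target y₀))
  have h1 := ContMDiffAt.clm_bundle_apply₂ (F₁ := EuclideanSpace ℝ (Fin n))
    (F₂ := EuclideanSpace ℝ (Fin n)) (F₃ := ℝ) (E₃ := Bundle.Trivial Y ℝ)
    (h.contMDiff.contMDiffAt.comp _ hψ)
    (contMDiffAt_chartFrame y₀ a) (contMDiffAt_chartFrame y₀ b)
  simp only [Bundle.contMDiffAt_totalSpace] at h1
  have h2 : ContMDiffAt 𝓘(ℝ, EuclideanSpace ℝ (Fin n)) 𝓘(ℝ) ∞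
    (fun z => chartMetric h y₀ z a b) (extChartAt (𝓡 n) y₀ y₀) := h1.2
  exact h2.contDiffAt.differentiableAt (by simp)

theorem contDiffAt_extChartAt_comp {E : Type*} [NormedAddCommGroup E] [NormedSpace ℝ E] {f : E → Y}
    (hf : ContMDiff 𝓘(ℝ, E) (𝓡 n) ∞ f) (x : E) :
    ContDiffAt ℝ ∞ (fun y => extChartAt (𝓡 n) (f x) (f y)) x := by
  have h1 : ContMDiffAt (𝓡 n) 𝓘(ℝ, EuclideanSpace ℝ (Fin n)) ∞ (extChartAt (𝓡 n) (f x)) (f x) :=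
    contMDiffAt_extChartAt
  exact (h1.comp x hf.contMDiffAt).contDiffAt

namespace MovingFrame

variable {E : Type*} [NormedAddCommGroup E] [NormedSpace ℝ E] [FiniteDimensional ℝ E]

/-- No nonzero self-adjoint endomorphism annihilates all invariant forms. -/
def IsRigid (Φ : MovingFrame E) : Prop :=
  ∀ A : Module.End ℝ E, (∀ a b, Φ.form (A a) b = Φ.form a (A b)) →
    (∀ (k : ℕ) (ψ : E [⋀^Fin k]→L[ℝ] ℝ), Φ.IsInvariant ψ → ∀ v, derivAction A ψ v = 0) → A = 0

variable {Φ : MovingFrame E}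

/-- Conjugation by the frame at `x` carries `A` to the model space, where an invariant form `ψ`
corresponds to the parallel form `Φ.pull ψ`. -/
theorem IsRigid.annihilator_inf_symTwo (hΦ : Φ.IsRigid) (x : E) :
    annihilator Φ.metric x ⊓ symTwo Φ.metric x = ⊥ := by
  rw [eq_bot_iff]
  rintro A ⟨hA, hAs⟩
  have hAs' : ∀ v w, Φ.metric x (A v) w = Φ.metric x (A w) v := hAs
  have hA' : ∀ (k : ℕ) (Ω : E → E [⋀^Fin k]→L[ℝ] ℝ), IsParallel Φ.metric Ω →
    ∀ v : Fin k → E, derivAction A (Ω x) v = 0 := hA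
  have h := hΦ ((Φ.equiv x).toLinearMap ∘ₗ A ∘ₗ (Φ.equiv x).symm.toLinearMap) ?_ ?_
  · refine LinearMap.ext fun v => Φ.injective x ?_
    have := LinearMap.congr_fun h (Φ.equiv x v)
    simp only [LinearMap.comp_apply, LinearEquiv.coe_coe, LinearEquiv.symm_apply_apply] at this
    simpa using this
  · intro a b
    have h1 := hAs' ((Φ.equiv x).symm a) ((Φ.equiv x).symm b)
    simp only [metric_apply, frame_equiv_symm] at h1
    simpa [Φ.form_symm a] using h1
  · intro k ψ hψ v
    rw [← hA' k _ (Φ.isParallel_pull hψ) fun l => (Φ.equiv x).symm (v l)]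
    refine Finset.sum_congr rfl fun l _ => ?_
    rw [pull_apply]
    congr 1
    funext j
    by_cases hj : j = l
    · subst hj; simp
    · simp [hj]

/-- Each linear functional of the second fundamental form is represented by a self-adjoint
annihilator of the invariant forms, which rigidity forces to vanish; the coordinate functionals
separate points. -/
theorem IsRigid.isTotallyGeodesic (hΦ : Φ.IsRigid)
    (h : Bundle.ContMDiffRiemannianMetric (𝓡 n) ∞ (EuclideanSpace ℝ (Fin n))
      (fun y : Y => TangentSpace (𝓡 n) y)) {f : E → Y} (hf : IsTamed Φ.metric h f) :
    IsTotallyGeodesic Φ.metric h f := by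
  intro x v w
  obtain ⟨Γ, hΓ, hΓs⟩ := exists_christoffel_eq (H := chartMetric h (f x))
    (z := extChartAt (𝓡 n) (f x) (f x)) (fun y a b => h.symm _ _ _)
    (differentiableAt_chartMetric h (f x))
  have hu := contDiffAt_extChartAt_comp hf.1 x
  have hz : ∀ φ : EuclideanSpace ℝ (Fin n) →ₗ[ℝ] ℝ, φ (secondFundamentalForm Φ.metric
      (chartMetric h (f x)) (fun y => extChartAt (𝓡 n) (f x) (f y)) x v w) = 0 := by
    intro φ
    obtain ⟨A, hA, hAs, hA0⟩ := derivAction_secondFundamentalForm_eq_zero (Φ := Φ)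
      (hu.of_le ENat.LEInfty.out) Γ hΓ hΓs
      (fun k q hkq Ω hΩ v => hf.2 k q hkq Ω hΩ x v) φ
    rw [← hA, hΦ A hAs hA0]
    simp
  ext i
  exact hz (EuclideanSpace.proj i : EuclideanSpace ℝ (Fin n) →L[ℝ] ℝ)

end MovingFrame

end Target

end Sugra

/-! ### Reduction to the isotropy representation on `𝔭`. -/

namespace Sugra

section SymmetricSpaces

variable {ι : Type*} [Fintype ι] [DecidableEq ι] {𝔤 : Submodule ℝ (Matrix ι ι ℂ)}

/-- The derivation of an alternating form by an endomorphism. -/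
def altDerivAction {V M : Type*} [AddCommGroup V] [Module ℝ V] [AddCommGroup M] [Module ℝ M] {k : ℕ}
    (A : Module.End ℝ V) (ψ : V [⋀^Fin k]→ₗ[ℝ] M) (v : Fin k → V) : M :=
  ∑ l, ψ (Function.update v l (A (v l)))

/-- An alternating form on the tangent space `𝔭` which is invariant under `𝔨`. -/
def IsIsotropyInvariant {M : Type*} [AddCommGroup M] [Module ℝ M] {k : ℕ}
    (ψ : Chart 𝔤 [⋀^Fin k]→ₗ[ℝ] M) : Prop :=
  ∀ κ ∈ 𝔤, κ.conjTranspose = -κ → ∀ D : Module.End ℝ (Chart 𝔤),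
    (∀ v, Chart.toMatrix 𝔤 (D v) = κ * Chart.toMatrix 𝔤 v - Chart.toMatrix 𝔤 v * κ) →
    ∀ v, altDerivAction D ψ v = 0

/-- The endomorphisms of `𝔭` which annihilate all `𝔨`-invariant forms and are self-adjoint for the
trace form. -/
structure IsSymmetricAnnihilator (A : Module.End ℝ (Chart 𝔤)) : Prop where
  symm : ∀ a b, (Matrix.trace (Chart.toMatrix 𝔤 (A a) * Chart.toMatrix 𝔤 b)).re =
    (Matrix.trace (Chart.toMatrix 𝔤 a * Chart.toMatrix 𝔤 (A b))).re
  annihilates : ∀ (k : ℕ) (ψ : Chart 𝔤 [⋀^Fin k]→ₗ[ℝ] ℝ), IsIsotropyInvariant ψ →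
    ∀ v, altDerivAction A ψ v = 0

/-- The moving frame of the symmetric space of `𝔤` given by the vielbein and the spin connection. -/
def symmetricFrame (h𝔤 : IsSelfAdjointLie 𝔤) {c : ℝ} (hc : 0 < c) : MovingFrame (Chart 𝔤) where
  form := LinearMap.mk₂ ℝ
    (fun v w => c * (Matrix.trace (Chart.toMatrix 𝔤 v * Chart.toMatrix 𝔤 w)).re)
    (by intro a b w; simp [add_mul, mul_add]) (by intro r a w; simp [mul_left_comm])
    (by intro w a b; simp [mul_add]) (by intro r w a; simp [mul_left_comm])
  form_symm u v := by
    simp only [LinearMap.mk₂_apply]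
    rw [Matrix.trace_mul_comm]
  form_pos u hu := by
    simp only [LinearMap.mk₂_apply]
    refine mul_pos hc ?_
    have h := trace_mul_conjTranspose_re_pos (A := Chart.toMatrix 𝔤 u)
      fun h => hu (Chart.toMatrix_injective (by rw [h, map_zero]))
    rwa [Chart.toMatrix_conjTranspose] at h
  frame := frame 𝔤
  contDiff_frame := contDiff_frame
  injective := frame_injective h𝔤
  conn := frameConnection 𝔤
  conn_skew x w u v := by
    simp only [LinearMap.mk₂_apply, toMatrix_frameConnection h𝔤]
    rw [← mul_neg, ← Complex.neg_re]
    congr 2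
    rw [sub_mul, mul_sub, Matrix.trace_sub, Matrix.trace_sub, neg_sub]
    congr 1
    · rw [Matrix.mul_assoc, Matrix.trace_mul_comm, Matrix.mul_assoc]
    · rw [Matrix.mul_assoc]
  torsion_free := frame_torsion_free h𝔤

theorem symmetricFrame_metric (h𝔤 : IsSelfAdjointLie 𝔤) {c : ℝ} (hc : 0 < c) :
    (symmetricFrame h𝔤 hc).metric = symmetricMetric 𝔤 c := by
  funext x
  refine LinearMap.ext fun v => LinearMap.ext fun w => ?_
  rw [MovingFrame.metric_apply]
  change c * (Matrix.trace (Chart.toMatrix 𝔤 (frame 𝔤 x v) *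
    Chart.toMatrix 𝔤 (frame 𝔤 x w))).re = _
  rw [toMatrix_frame h𝔤, toMatrix_frame h𝔤]
  rfl

/-- The connection form is the adjoint action of elements of `𝔨`, so a `𝔨`-invariant form is
invariant for the moving frame. An endomorphism which annihilates all frame-invariant forms
therefore annihilates all `𝔨`-invariant ones. The scale `c` does not affect self-adjointness. -/
theorem isRigid_symmetricFrame (h𝔤 : IsSelfAdjointLie 𝔤) {c : ℝ} (hc : 0 < c)
    (h : ∀ A : Module.End ℝ (Chart 𝔤), IsSymmetricAnnihilator A → A = 0) :
    (symmetricFrame h𝔤 hc).IsRigid := by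
  intro A hA hA'
  refine h A ⟨fun a b => mul_left_cancel₀ hc.ne' (hA a b), fun k ψ hψ v => ?_⟩
  refine hA' k (toContinuousAlternating ψ) (fun x w v => ?_) v
  exact hψ (spinConnection 𝔤 x w) (spinConnection_mem h𝔤 x w) (spinConnection_conjTranspose x w)
    (frameConnection 𝔤 x w) (toMatrix_frameConnection h𝔤 x w) v

/-- The theorem for a symmetric space whose invariant forms have no nonzero self-adjoint
annihilator. -/
theorem annihilator_and_isTotallyGeodesic (h𝔤 : IsSelfAdjointLie 𝔤) {c : ℝ} (hc : 0 < c)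
    (h : ∀ A : Module.End ℝ (Chart 𝔤), IsSymmetricAnnihilator A → A = 0) :
    (∀ x, annihilator (symmetricMetric 𝔤 c) x ⊓ symTwo (symmetricMetric 𝔤 c) x = ⊥) ∧
    ∀ (n : ℕ) (Y : Type*) [TopologicalSpace Y] [ChartedSpace (EuclideanSpace ℝ (Fin n)) Y]
      [IsManifold (𝓡 n) ∞ Y]
      (h : Bundle.ContMDiffRiemannianMetric (𝓡 n) ∞ (EuclideanSpace ℝ (Fin n))
        (fun y : Y => TangentSpace (𝓡 n) y))
      (f : Chart 𝔤 → Y),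
      IsTamed (symmetricMetric 𝔤 c) h f → IsTotallyGeodesic (symmetricMetric 𝔤 c) h f := by
  have hr := isRigid_symmetricFrame h𝔤 hc h
  rw [← symmetricFrame_metric h𝔤 hc]
  exact ⟨fun x => hr.annihilator_inf_symTwo x, fun n Y _ _ _ h f hf => hr.isTotallyGeodesic h hf⟩

end SymmetricSpaces

end Sugra

/-! ### Complexification of `𝔭` and of its symmetric annihilators. -/

namespace Sugra

section Complexification

variable {ι : Type*} [Fintype ι] [DecidableEq ι] {𝔤 : Submodule ℝ (Matrix ι ι ℂ)}

/-- The adjoint action of a matrix on `𝔭`. -/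
def adjointEnd (𝔤 : Submodule ℝ (Matrix ι ι ℂ)) (κ : Matrix ι ι ℂ) : Module.End ℝ (Chart 𝔤) :=
  (Chart.proj 𝔤).comp ((LinearMap.mulLeft ℝ κ - LinearMap.mulRight ℝ κ).comp (Chart.toMatrix 𝔤))

theorem toMatrix_adjointEnd (h𝔤 : IsSelfAdjointLie 𝔤) {κ : Matrix ι ι ℂ} (hκ : κ ∈ 𝔤)
    (hκ' : κ.conjTranspose = -κ) (v : Chart 𝔤) :
    Chart.toMatrix 𝔤 (adjointEnd 𝔤 κ v) =
      κ * Chart.toMatrix 𝔤 v - Chart.toMatrix 𝔤 v * κ := by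
  refine Chart.toMatrix_proj (h𝔤.bracket _ hκ _ v.toMatrix_mem) ?_
  simp [hκ', Chart.toMatrix_conjTranspose, sub_eq_add_neg, add_comm]

/-- The terms in which `A` and `B` act in different slots occur in both orders and cancel; the terms
in a common slot give the commutator. -/
theorem sum_update_commutator {V M : Type*} [AddCommGroup V] [Module ℝ V] [AddCommGroup M]
    [Module ℝ M] {k : ℕ} (A B : Module.End ℝ V) (ψ : V [⋀^Fin k]→ₗ[ℝ] M) (v : Fin k → V) :
    altDerivAction (A * B - B * A) ψ v =
      ∑ m, altDerivAction A ψ (Function.update v m (B (v m))) -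
      ∑ m, altDerivAction B ψ (Function.update v m (A (v m))) := by
  have h : ∀ A B : Module.End ℝ V, ∀ m, altDerivAction A ψ (Function.update v m (B (v m))) =
      ψ (Function.update v m (A (B (v m)))) + ∑ l ∈ Finset.univ.erase m,
        ψ (Function.update (Function.update v m (B (v m))) l (A (v l))) := by
    intro A B m
    rw [altDerivAction, ← Finset.add_sum_erase _ _ (Finset.mem_univ m)]
    congr 1
    · simp
    · refine Finset.sum_congr rfl fun l hl => ?_
      rw [Function.update_of_ne (Finset.ne_of_mem_erase hl)]
  have hs : ∑ m, ∑ l ∈ Finset.univ.erase m,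
        ψ (Function.update (Function.update v m (B (v m))) l (A (v l))) =
      ∑ m, ∑ l ∈ Finset.univ.erase m,
        ψ (Function.update (Function.update v m (A (v m))) l (B (v l))) := by
    rw [Finset.sum_comm' (t' := Finset.univ) (s' := fun l => Finset.univ.erase l)
      (by simp [eq_comm])]
    refine Finset.sum_congr rfl fun m _ => Finset.sum_congr rfl fun l hl => ?_
    rw [Function.update_comm (Finset.ne_of_mem_erase hl)]
  simp only [h, Finset.sum_add_distrib, hs]
  rw [add_sub_add_right_eq_sub, altDerivAction, ← Finset.sum_sub_distrib]
  refine Finset.sum_congr rfl fun l _ => ?_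
  rw [LinearMap.sub_apply, AlternatingMap.map_update_sub]
  rfl

/-- The symmetric annihilators form a `𝔨`-module. -/
theorem IsSymmetricAnnihilator.commutator (h𝔤 : IsSelfAdjointLie 𝔤) {A : Module.End ℝ (Chart 𝔤)}
    (hA : IsSymmetricAnnihilator A) {κ : Matrix ι ι ℂ} (hκ : κ ∈ 𝔤) (hκ' : κ.conjTranspose = -κ) :
    IsSymmetricAnnihilator (adjointEnd 𝔤 κ * A - A * adjointEnd 𝔤 κ) where
  symm a b := by
    have hD : ∀ u v, (Matrix.trace (Chart.toMatrix 𝔤 (adjointEnd 𝔤 κ u) *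
        Chart.toMatrix 𝔤 v)).re =
        -(Matrix.trace (Chart.toMatrix 𝔤 u * Chart.toMatrix 𝔤 (adjointEnd 𝔤 κ v))).re := by
      intro u v
      simp only [toMatrix_adjointEnd h𝔤 hκ hκ']
      rw [← Complex.neg_re]
      congr 1
      rw [sub_mul, mul_sub, Matrix.trace_sub, Matrix.trace_sub, neg_sub]
      congr 1
      · rw [Matrix.mul_assoc, Matrix.trace_mul_comm, Matrix.mul_assoc]
      · rw [Matrix.mul_assoc]
    simp only [LinearMap.sub_apply, Module.End.mul_apply, map_sub, sub_mul, mul_sub,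
      Matrix.trace_sub, Complex.sub_re]
    rw [hD, hA.symm a, hA.symm, hD a]
    ring
  annihilates k ψ hψ v := by
    have h1 := hψ κ hκ hκ' _ (toMatrix_adjointEnd h𝔤 hκ hκ')
    rw [sum_update_commutator]
    simp only [h1, hA.annihilates k ψ hψ]
    simp

/-- The complexification of `𝔭`, inside the complex matrices. -/
def IsComplexHerm (𝔤 : Submodule ℝ (Matrix ι ι ℂ)) (X : Matrix ι ι ℂ) : Prop :=
  ∃ a b : Chart 𝔤, X = Chart.toMatrix 𝔤 a + Complex.I • Chart.toMatrix 𝔤 b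

/-- The two given matrices are Hermitian, and real multiples of them are the Hermitian `a` and `b`
in `X = a + i b`. -/
theorem isComplexHerm_of_mem {X : Matrix ι ι ℂ} (h1 : X + X.conjTranspose ∈ 𝔤)
    (h2 : Complex.I • (X - X.conjTranspose) ∈ 𝔤) : IsComplexHerm 𝔤 X := by
  refine ⟨(1 / 2 : ℝ) • Chart.ofMatrix _ h1 ?_, (-(1 / 2) : ℝ) • Chart.ofMatrix _ h2 ?_, ?_⟩
  · simp [add_comm]
  · rw [Matrix.conjTranspose_smul, Matrix.conjTranspose_sub, Matrix.conjTranspose_conjTranspose,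
      Complex.star_def, Complex.conj_I]
    module
  · rw [map_smul, map_smul, Chart.toMatrix_ofMatrix, Chart.toMatrix_ofMatrix]
    ext i j
    simp only [Matrix.add_apply, Matrix.smul_apply, Matrix.sub_apply, Complex.real_smul,
      smul_eq_mul]
    push_cast
    linear_combination (1 / 2 : ℂ) * (X i j - X.conjTranspose i j) * Complex.I_mul_I

variable (A : Module.End ℝ (Chart 𝔤))

/-- The complex-linear extension of an endomorphism of `𝔭`. -/
def complexify (X : Matrix ι ι ℂ) : Matrix ι ι ℂ :=
  Chart.toMatrix 𝔤 (A (Chart.proj 𝔤 ((1 / 2 : ℂ) • (X + X.conjTranspose)))) +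
    Complex.I • Chart.toMatrix 𝔤 (A (Chart.proj 𝔤 ((-Complex.I / 2) • (X - X.conjTranspose))))

theorem complexify_apply (a b : Chart 𝔤) :
    complexify A (Chart.toMatrix 𝔤 a + Complex.I • Chart.toMatrix 𝔤 b) =
      Chart.toMatrix 𝔤 (A a) + Complex.I • Chart.toMatrix 𝔤 (A b) := by
  have ha := Chart.toMatrix_conjTranspose a
  have hb := Chart.toMatrix_conjTranspose b
  have h1 : (1 / 2 : ℂ) • (Chart.toMatrix 𝔤 a + Complex.I • Chart.toMatrix 𝔤 b +
      (Chart.toMatrix 𝔤 a + Complex.I • Chart.toMatrix 𝔤 b).conjTranspose) =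
      Chart.toMatrix 𝔤 a := by
    rw [Matrix.conjTranspose_add, Matrix.conjTranspose_smul, ha, hb, Complex.star_def,
      Complex.conj_I]
    module
  have h2 : (-Complex.I / 2) • (Chart.toMatrix 𝔤 a + Complex.I • Chart.toMatrix 𝔤 b -
      (Chart.toMatrix 𝔤 a + Complex.I • Chart.toMatrix 𝔤 b).conjTranspose) =
      Chart.toMatrix 𝔤 b := by
    rw [Matrix.conjTranspose_add, Matrix.conjTranspose_smul, ha, hb, Complex.star_def,
      Complex.conj_I]
    ext i j
    simp only [Matrix.add_apply, Matrix.smul_apply, Matrix.sub_apply, smul_eq_mul]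
    linear_combination -(Chart.toMatrix 𝔤 b i j) * Complex.I_mul_I
  rw [complexify, h1, h2, Chart.proj_toMatrix, Chart.proj_toMatrix]

theorem complexify_toMatrix (a : Chart 𝔤) :
    complexify A (Chart.toMatrix 𝔤 a) = Chart.toMatrix 𝔤 (A a) := by
  have := complexify_apply A a 0
  simpa using this

variable {A}

theorem IsComplexHerm.complexify {X : Matrix ι ι ℂ} (hX : IsComplexHerm 𝔤 X) :
    IsComplexHerm 𝔤 (complexify A X) := by
  obtain ⟨a, b, rfl⟩ := hX
  exact ⟨A a, A b, complexify_apply A a b⟩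

theorem IsComplexHerm.complexify_conjTranspose {X : Matrix ι ι ℂ} (hX : IsComplexHerm 𝔤 X) :
    Sugra.complexify A X.conjTranspose = (Sugra.complexify A X).conjTranspose := by
  obtain ⟨a, b, rfl⟩ := hX
  have h : (Chart.toMatrix 𝔤 a + Complex.I • Chart.toMatrix 𝔤 b).conjTranspose =
      Chart.toMatrix 𝔤 a + Complex.I • Chart.toMatrix 𝔤 (-b) := by
    rw [Matrix.conjTranspose_add, Matrix.conjTranspose_smul, Chart.toMatrix_conjTranspose,
      Chart.toMatrix_conjTranspose]
    simp
  rw [h, complexify_apply, complexify_apply, Matrix.conjTranspose_add, Matrix.conjTranspose_smul,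
    Chart.toMatrix_conjTranspose, Chart.toMatrix_conjTranspose]
  simp

/-- The trace of a product of two Hermitian matrices is real, so self-adjointness for its real part
extends to the complex bilinear trace form. -/
theorem IsSymmetricAnnihilator.trace_complexify_mul (hA : IsSymmetricAnnihilator A)
    {X Y : Matrix ι ι ℂ} (hX : IsComplexHerm 𝔤 X) (hY : IsComplexHerm 𝔤 Y) :
    Matrix.trace (complexify A X * Y) = Matrix.trace (X * complexify A Y) := by
  have hr : ∀ a b : Chart 𝔤, Matrix.trace (Chart.toMatrix 𝔤 a * Chart.toMatrix 𝔤 b) =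
      ((Matrix.trace (Chart.toMatrix 𝔤 a * Chart.toMatrix 𝔤 b)).re : ℂ) := by
    intro a b
    refine (Complex.conj_eq_iff_re.1 ?_).symm
    rw [← Complex.star_def, ← Matrix.trace_conjTranspose, Matrix.conjTranspose_mul,
      Chart.toMatrix_conjTranspose, Chart.toMatrix_conjTranspose, Matrix.trace_mul_comm]
  have hs : ∀ a b : Chart 𝔤, Matrix.trace (Chart.toMatrix 𝔤 (A a) * Chart.toMatrix 𝔤 b) =
      Matrix.trace (Chart.toMatrix 𝔤 a * Chart.toMatrix 𝔤 (A b)) := fun a b => by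
    rw [hr, hr a, hA.symm]
  obtain ⟨a, b, rfl⟩ := hX
  obtain ⟨a', b', rfl⟩ := hY
  simp only [complexify_apply, add_mul, mul_add, smul_mul_assoc, mul_smul_comm, Matrix.trace_add,
    Matrix.trace_smul, hs]

/-- A multilinear map which vanishes on `𝔭` vanishes on its complexification. -/
theorem eq_zero_of_forall_toMatrix {M : Type*} [AddCommGroup M] [Module ℂ M] {k : ℕ}
    (f : (Fin k → Matrix ι ι ℂ) → M)
    (hf : ∀ (v : Fin k → Matrix ι ι ℂ) (l : Fin k) (a b : Chart 𝔤),
      (∀ m, IsComplexHerm 𝔤 (v m)) →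
      f (Function.update v l (Chart.toMatrix 𝔤 a + Complex.I • Chart.toMatrix 𝔤 b)) =
        f (Function.update v l (Chart.toMatrix 𝔤 a)) +
          Complex.I • f (Function.update v l (Chart.toMatrix 𝔤 b)))
    (h0 : ∀ v : Fin k → Chart 𝔤, f (fun l => Chart.toMatrix 𝔤 (v l)) = 0)
    (X : Fin k → Matrix ι ι ℂ) (hX : ∀ l, IsComplexHerm 𝔤 (X l)) : f X = 0 := by
  have hreal : ∀ a : Chart 𝔤, IsComplexHerm 𝔤 (Chart.toMatrix 𝔤 a) := fun a => ⟨a, 0, by simp⟩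
  -- Induction on a set of slots outside of which the arguments are known to lie in `𝔭` itself.
  have key : ∀ s : Finset (Fin k), ∀ X : Fin k → Matrix ι ι ℂ, (∀ l, IsComplexHerm 𝔤 (X l)) →
      (∀ l ∉ s, ∃ a, X l = Chart.toMatrix 𝔤 a) → f X = 0 := by
    intro s
    induction s using Finset.induction_on with
    | empty =>
      intro X _ h
      choose a ha using fun l => h l (by simp)
      rw [show X = fun l => Chart.toMatrix 𝔤 (a l) from funext ha]
      exact h0 a
    | insert l s hl ih =>
      intro X hX h
      obtain ⟨a, b, hab⟩ := hX l
      have hupd : ∀ c : Chart 𝔤, f (Function.update X l (Chart.toMatrix 𝔤 c)) = 0 := by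
        intro c
        refine ih _ (fun m => ?_) fun m hm => ?_
        · by_cases hml : m = l
          · subst hml; simpa using hreal c
          · simpa [hml] using hX m
        · by_cases hml : m = l
          · subst hml; exact ⟨c, by simp⟩
          · simpa [hml] using h m (by simp [hml, hm])
      rw [← Function.update_eq_self l X, hab, hf X l a b hX, hupd, hupd]
      simp
  exact key Finset.univ X hX (by simp)

/-- Annihilation of an invariant form, extended to the complexification of `𝔭`. -/
theorem IsSymmetricAnnihilator.sum_complexify (hA : IsSymmetricAnnihilator A) {k : ℕ}
    (ψ : Matrix ι ι ℂ [⋀^Fin k]→ₗ[ℂ] ℂ)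
    (hψ : ∀ κ ∈ 𝔤, κ.conjTranspose = -κ → ∀ v : Fin k → Chart 𝔤,
      ∑ l, ψ (Function.update (fun m => Chart.toMatrix 𝔤 (v m)) l
        (κ * Chart.toMatrix 𝔤 (v l) - Chart.toMatrix 𝔤 (v l) * κ)) = 0)
    {X : Fin k → Matrix ι ι ℂ} (hX : ∀ l, IsComplexHerm 𝔤 (X l)) :
    ∑ l, ψ (Function.update X l (complexify A (X l))) = 0 := by
  have hu : ∀ (v : Fin k → Chart 𝔤) l x, (fun m => Chart.toMatrix 𝔤 (Function.update v l x m)) =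
      Function.update (fun m => Chart.toMatrix 𝔤 (v m)) l (Chart.toMatrix 𝔤 x) := by
    intro v l x
    funext m
    by_cases hm : m = l
    · subst hm; simp
    · simp [hm]
  let ψr : Chart 𝔤 [⋀^Fin k]→ₗ[ℝ] ℂ :=
    { toFun := fun v => ψ fun m => Chart.toMatrix 𝔤 (v m)
      map_update_add' := fun {inst} v l x y => by
        rw [Subsingleton.elim inst (instDecidableEqFin k)]
        rw [hu, hu, hu, map_add, ψ.map_update_add]
      map_update_smul' := fun {inst} v l c x => by
        rw [Subsingleton.elim inst (instDecidableEqFin k)]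
        rw [hu, hu, map_smul, ← Complex.coe_smul, ψ.map_update_smul, Complex.coe_smul]
      map_eq_zero_of_eq' := fun v i j hij hne =>
        ψ.map_eq_zero_of_eq _ (congrArg (Chart.toMatrix 𝔤) hij) hne }
  have hup : ∀ (v : Fin k → Chart 𝔤) l x, ψr (Function.update v l x) =
      ψ (Function.update (fun m => Chart.toMatrix 𝔤 (v m)) l (Chart.toMatrix 𝔤 x)) := by
    intro v l x
    exact congrArg ψ (hu v l x)
  have hinv : IsIsotropyInvariant ψr := by
    intro κ hκ hκ' D hD v
    rw [altDerivAction, ← hψ κ hκ hκ' v]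
    refine Finset.sum_congr rfl fun l _ => ?_
    rw [hup, hD]
  have hann : ∀ v, altDerivAction A ψr v = 0 := by
    intro v
    -- The annihilation hypothesis concerns real-valued forms, so it is used on real functionals of
    -- `ψr`, in particular on its real and imaginary parts.
    have hcomp : ∀ L : ℂ →ₗ[ℝ] ℝ, L (altDerivAction A ψr v) = 0 := by
      intro L
      rw [← hA.annihilates k (L.compAlternatingMap ψr) (fun κ hκ hκ' D hD w => ?_) v]
      · simp [altDerivAction]
      · have := congrArg L (hinv κ hκ hκ' D hD w)
        simpa [altDerivAction] using this
    exact Complex.ext (hcomp Complex.reLm) (hcomp Complex.imLm)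
  refine eq_zero_of_forall_toMatrix (𝔤 := 𝔤)
    (fun X => ∑ l, ψ (Function.update X l (complexify A (X l)))) ?_ ?_ X hX
  · intro v l a b _
    rw [Finset.smul_sum, ← Finset.sum_add_distrib]
    refine Finset.sum_congr rfl fun m _ => ?_
    by_cases hm : m = l
    · subst hm
      simp only [Function.update_self, Function.update_idem]
      rw [complexify_apply, complexify_toMatrix, complexify_toMatrix, ψ.map_update_add,
        ψ.map_update_smul]
    · simp only [Function.update_of_ne hm, Function.update_comm (Ne.symm hm)]
      rw [ψ.map_update_add, ψ.map_update_smul]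
  · intro v
    rw [← hann v, altDerivAction]
    refine Finset.sum_congr rfl fun l _ => ?_
    rw [hup, complexify_toMatrix]

theorem eq_zero_of_complexify (h : ∀ X, IsComplexHerm 𝔤 X → complexify A X = 0) : A = 0 := by
  refine LinearMap.ext fun v => Chart.toMatrix_injective ?_
  rw [← complexify_toMatrix, h _ ⟨v, 0, by simp⟩]
  simp

end Complexification

end Sugra

set_option linter.unusedSimpArgs false
set_option linter.unusedSectionVars false

namespace Sugra

/-! ### Chern-Weil forms of the curvature `R = [·, ·]`. -/

section CurvatureForms

variable {K V M : Type*} [CommRing K] [AddCommGroup V] [Module K V] [AddCommGroup M] [Module K M]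

/-- The value `T(R ∧ R)` at four vectors. -/
def quarticValue (R : V → V → M) (T : M → M → K) (v : Fin 4 → V) : K :=
  T (R (v 0) (v 1)) (R (v 2) (v 3)) - T (R (v 0) (v 2)) (R (v 1) (v 3)) +
    T (R (v 0) (v 3)) (R (v 1) (v 2))

/-- The three terms are the signed perfect matchings of four slots. With two equal arguments, the
matching which joins them vanishes and the other two cancel by the symmetry of `T`. -/
theorem quarticValue_eq_zero {R : V → V → M} (hR : ∀ x y, R x y = -R y x) (hR' : ∀ x, R x x = 0)
    {T : M → M → K} (hT : ∀ x y, T x y = T y x) (hneg : ∀ x y, T (-x) y = -T x y)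
    (h0 : ∀ x, T 0 x = 0) {v : Fin 4 → V} {i j : Fin 4} (hij : i < j) (h : v i = v j) :
    quarticValue R T v = 0 := by
  have hneg' : ∀ x y, T x (-y) = -T x y := fun x y => by rw [hT, hneg, hT]
  have h0' : ∀ x, T x 0 = 0 := fun x => by rw [hT, h0]
  unfold quarticValue
  fin_cases i <;> fin_cases j <;> simp at hij <;> simp at h <;>
    simp only [← h, hR', hR (v 1) (v 0), hR (v 2) (v 0), hR (v 3) (v 0), hR (v 2) (v 1),
      hR (v 3) (v 1), hR (v 3) (v 2), hneg, hneg', h0, h0'] <;>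
    generalize R (v 0) (v 1) = p01 <;> generalize R (v 0) (v 2) = p02 <;>
    generalize R (v 0) (v 3) = p03 <;> generalize R (v 1) (v 2) = p12 <;>
    generalize R (v 1) (v 3) = p13 <;> generalize R (v 2) (v 3) = p23 <;>
    try simp only [hT]
  all_goals ring

/-- The 4-form `T(R ∧ R)` for a 2-form `R` and a symmetric bilinear form `T`. -/
def quarticForm (R : V →ₗ[K] V →ₗ[K] M) (hR : ∀ x y, R x y = -R y x) (hR' : ∀ x, R x x = 0)
    (T : M →ₗ[K] M →ₗ[K] K) (hT : ∀ x y, T x y = T y x) : V [⋀^Fin 4]→ₗ[K] K where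
  toFun := quarticValue (fun x y => R x y) (fun x y => T x y)
  map_update_add' {inst} v i x y := by
    rw [Subsingleton.elim inst (instDecidableEqFin 4)]
    fin_cases i <;> simp [quarticValue, Function.update, Fin.ext_iff] <;> ring
  map_update_smul' {inst} v i c x := by
    rw [Subsingleton.elim inst (instDecidableEqFin 4)]
    fin_cases i <;> simp [quarticValue, Function.update, Fin.ext_iff] <;> ring
  map_eq_zero_of_eq' v i j hij hne := by
    rcases lt_or_gt_of_ne hne with h | h
    · exact quarticValue_eq_zero hR hR' hT (by simp) (by simp) h hij
    · exact quarticValue_eq_zero hR hR' hT (by simp) (by simp) h hij.symm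

/-- The infinitesimal Chern-Weil principle: `D` acts on `R` through `D'`, and `T` is invariant under
`D'`. The identity is applied once for each of the three matchings. -/
theorem sum_quarticForm_update {R : V →ₗ[K] V →ₗ[K] M} {hR : ∀ x y, R x y = -R y x}
    {hR' : ∀ x, R x x = 0} {T : M →ₗ[K] M →ₗ[K] K} {hT : ∀ x y, T x y = T y x}
    {D : V → V} {D' : M → M} (hD : ∀ x y, R (D x) y + R x (D y) = D' (R x y))
    (hD' : ∀ x y, T (D' x) y + T x (D' y) = 0) (v : Fin 4 → V) :
    ∑ l, quarticForm R hR hR' T hT (Function.update v l (D (v l))) = 0 := by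
  have h : ∀ a b c d, T (R (D a) b) (R c d) + T (R a (D b)) (R c d) +
      (T (R a b) (R (D c) d) + T (R a b) (R c (D d))) = 0 := by
    intro a b c d
    rw [← LinearMap.add_apply, ← map_add, hD, ← map_add, hD, hD']
  rw [Fin.sum_univ_four]
  simp only [quarticForm, AlternatingMap.coe_mk, MultilinearMap.coe_mk, quarticValue]
  simp [Function.update, Fin.ext_iff]
  linear_combination h (v 0) (v 1) (v 2) (v 3) - h (v 0) (v 2) (v 1) (v 3) +
    h (v 0) (v 3) (v 1) (v 2)

/-- The value `T(R ∧ R ∧ R)` at six vectors. -/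
def sexticValue (R : V → V → M) (T : M → M → M → K) (v : Fin 6 → V) : K :=
  T (R (v 0) (v 1)) (R (v 2) (v 3)) (R (v 4) (v 5)) -
  T (R (v 0) (v 1)) (R (v 2) (v 4)) (R (v 3) (v 5)) +
  T (R (v 0) (v 1)) (R (v 2) (v 5)) (R (v 3) (v 4)) -
  T (R (v 0) (v 2)) (R (v 1) (v 3)) (R (v 4) (v 5)) +
  T (R (v 0) (v 2)) (R (v 1) (v 4)) (R (v 3) (v 5)) -
  T (R (v 0) (v 2)) (R (v 1) (v 5)) (R (v 3) (v 4)) +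
  T (R (v 0) (v 3)) (R (v 1) (v 2)) (R (v 4) (v 5)) -
  T (R (v 0) (v 3)) (R (v 1) (v 4)) (R (v 2) (v 5)) +
  T (R (v 0) (v 3)) (R (v 1) (v 5)) (R (v 2) (v 4)) -
  T (R (v 0) (v 4)) (R (v 1) (v 2)) (R (v 3) (v 5)) +
  T (R (v 0) (v 4)) (R (v 1) (v 3)) (R (v 2) (v 5)) -
  T (R (v 0) (v 4)) (R (v 1) (v 5)) (R (v 2) (v 3)) +
  T (R (v 0) (v 5)) (R (v 1) (v 2)) (R (v 3) (v 4)) -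
  T (R (v 0) (v 5)) (R (v 1) (v 3)) (R (v 2) (v 4)) +
  T (R (v 0) (v 5)) (R (v 1) (v 4)) (R (v 2) (v 3))

theorem sexticValue_eq_zero {R : V → V → M} (hR : ∀ x y, R x y = -R y x) (hR' : ∀ x, R x x = 0)
    {T : M → M → M → K} (hT : ∀ x y z, T x y z = T y x z) (hT' : ∀ x y z, T x y z = T x z y)
    (hneg : ∀ x y z, T (-x) y z = -T x y z) (h0 : ∀ x y, T 0 x y = 0)
    {v : Fin 6 → V} {i j : Fin 6} (hij : i < j) (h : v i = v j) :
    sexticValue R T v = 0 := by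
  have hneg' : ∀ x y z, T x (-y) z = -T x y z := fun x y z => by rw [hT, hneg, hT]
  have hneg'' : ∀ x y z, T x y (-z) = -T x y z := fun x y z => by rw [hT', hneg', hT']
  have h0' : ∀ x y, T x 0 y = 0 := fun x y => by rw [hT, h0]
  have h0'' : ∀ x y, T x y 0 = 0 := fun x y => by rw [hT', h0']
  unfold sexticValue
  fin_cases i <;> fin_cases j <;> simp at hij <;> simp at h <;>
    simp only [← h, hR', hR (v 1) (v 0), hR (v 2) (v 0), hR (v 3) (v 0), hR (v 4) (v 0), hR (v 5) (v 0), hR (v 2) (v 1), hR (v 3) (v 1), hR (v 4) (v 1), hR (v 5) (v 1), hR (v 3) (v 2), hR (v 4) (v 2), hR (v 5) (v 2), hR (v 4) (v 3), hR (v 5) (v 3), hR (v 5) (v 4), hneg, hneg', hneg'', h0, h0', h0''] <;>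
    generalize R (v 0) (v 1) = p01 <;> generalize R (v 0) (v 2) = p02 <;>
    generalize R (v 0) (v 3) = p03 <;> generalize R (v 0) (v 4) = p04 <;>
    generalize R (v 0) (v 5) = p05 <;> generalize R (v 1) (v 2) = p12 <;>
    generalize R (v 1) (v 3) = p13 <;> generalize R (v 1) (v 4) = p14 <;>
    generalize R (v 1) (v 5) = p15 <;> generalize R (v 2) (v 3) = p23 <;>
    generalize R (v 2) (v 4) = p24 <;> generalize R (v 2) (v 5) = p25 <;>
    generalize R (v 3) (v 4) = p34 <;> generalize R (v 3) (v 5) = p35 <;>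
    generalize R (v 4) (v 5) = p45 <;>
    try simp only [hT, hT']
  all_goals ring

/-- The 6-form `T(R ∧ R ∧ R)` for a 2-form `R` and a symmetric trilinear form `T`. -/
def sexticForm (R : V →ₗ[K] V →ₗ[K] M) (hR : ∀ x y, R x y = -R y x) (hR' : ∀ x, R x x = 0)
    (T : M →ₗ[K] M →ₗ[K] M →ₗ[K] K) (hT : ∀ x y z, T x y z = T y x z)
    (hT' : ∀ x y z, T x y z = T x z y) : V [⋀^Fin 6]→ₗ[K] K where
  toFun := sexticValue (fun x y => R x y) (fun x y z => T x y z)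
  map_update_add' {inst} v i x y := by
    rw [Subsingleton.elim inst (instDecidableEqFin 6)]
    fin_cases i <;> simp [sexticValue, Function.update, Fin.ext_iff] <;> ring
  map_update_smul' {inst} v i c x := by
    rw [Subsingleton.elim inst (instDecidableEqFin 6)]
    fin_cases i <;> simp [sexticValue, Function.update, Fin.ext_iff] <;> ring
  map_eq_zero_of_eq' v i j hij hne := by
    rcases lt_or_gt_of_ne hne with h | h
    · exact sexticValue_eq_zero hR hR' hT hT' (by simp) (by simp) h hij
    · exact sexticValue_eq_zero hR hR' hT hT' (by simp) (by simp) h hij.symm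

/-- The invariance of `T` is applied once for each of the fifteen signed matchings of six slots. -/
theorem sum_sexticValue_update {R : V → V → M} {T : M → M → M → K} {D : V → V}
    (h : ∀ a b c d e f, T (R (D a) b) (R c d) (R e f) + T (R a (D b)) (R c d) (R e f) +
      (T (R a b) (R (D c) d) (R e f) + T (R a b) (R c (D d)) (R e f)) +
      (T (R a b) (R c d) (R (D e) f) + T (R a b) (R c d) (R e (D f))) = 0) (v : Fin 6 → V) :
    ∑ l, sexticValue R T (Function.update v l (D (v l))) = 0 := by
  rw [Fin.sum_univ_six]
  simp only [sexticValue]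
  simp [Function.update, Fin.ext_iff]
  generalize v 0 = a
  generalize v 1 = b
  generalize v 2 = c
  generalize v 3 = d
  generalize v 4 = e
  generalize v 5 = f
  linear_combination h a b c d e f - h a b c e d f + h a b c f d e - h a c b d e f +
    h a c b e d f - h a c b f d e + h a d b c e f - h a d b e c f + h a d b f c e -
    h a e b c d f + h a e b d c f - h a e b f c d + h a f b c d e - h a f b d c e + h a f b e c d

theorem sum_sexticForm_update {R : V →ₗ[K] V →ₗ[K] M} {hR : ∀ x y, R x y = -R y x}
    {hR' : ∀ x, R x x = 0} {T : M →ₗ[K] M →ₗ[K] M →ₗ[K] K} {hT : ∀ x y z, T x y z = T y x z}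
    {hT' : ∀ x y z, T x y z = T x z y}
    {D : V → V} {D' : M → M} (hD : ∀ x y, R (D x) y + R x (D y) = D' (R x y))
    (hD' : ∀ x y z, T (D' x) y z + T x (D' y) z + T x y (D' z) = 0) (v : Fin 6 → V) :
    ∑ l, sexticForm R hR hR' T hT hT' (Function.update v l (D (v l))) = 0 := by
  refine sum_sexticValue_update (R := fun x y => R x y) (T := fun x y z => T x y z)
    (fun a b c d e f => ?_) v
  have := hD' (R a b) (R c d) (R e f)
  rw [← hD, ← hD, ← hD] at this
  simpa only [map_add, LinearMap.add_apply] using this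

end CurvatureForms

section TraceForms

variable {K ι : Type*} [CommRing K] [Fintype ι] [DecidableEq ι]

/-- The commutator of matrices as a bilinear map. -/
def commutatorMap (K ι : Type*) [CommRing K] [Fintype ι] [DecidableEq ι] :
    Matrix ι ι K →ₗ[K] Matrix ι ι K →ₗ[K] Matrix ι ι K :=
  LinearMap.mul K (Matrix ι ι K) - (LinearMap.mul K (Matrix ι ι K)).flip

@[simp]
theorem commutatorMap_apply (X Y : Matrix ι ι K) : commutatorMap K ι X Y = X * Y - Y * X := rfl

theorem commutatorMap_skew (X Y : Matrix ι ι K) :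
    commutatorMap K ι X Y = -commutatorMap K ι Y X := by simp

theorem commutatorMap_self (X : Matrix ι ι K) : commutatorMap K ι X X = 0 := by simp

/-- The symmetrized trace `tr P(XY + YX)`. -/
def symTrace₂ (P : Matrix ι ι K) : Matrix ι ι K →ₗ[K] Matrix ι ι K →ₗ[K] K :=
  LinearMap.mk₂ K (fun X Y => Matrix.trace (P * (X * Y + Y * X)))
    (fun X X' Y => by rw [← Matrix.trace_add]; congr 1; noncomm_ring)
    (fun c X Y => by simp [mul_add])
    (fun X Y Y' => by rw [← Matrix.trace_add]; congr 1; noncomm_ring)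
    (fun c X Y => by simp [mul_add])

@[simp]
theorem symTrace₂_apply (P X Y : Matrix ι ι K) :
    symTrace₂ P X Y = Matrix.trace (P * (X * Y + Y * X)) := rfl

theorem symTrace₂_comm (P X Y : Matrix ι ι K) : symTrace₂ P X Y = symTrace₂ P Y X := by
  simp [add_comm]

/-- The symmetrized product of three matrices. -/
def symProd₃ (X Y Z : Matrix ι ι K) : Matrix ι ι K :=
  X * Y * Z + X * Z * Y + Y * X * Z + Y * Z * X + Z * X * Y + Z * Y * X

/-- The symmetrized trace of `P X Y Z`. -/
def symTrace₃ (P : Matrix ι ι K) :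
    Matrix ι ι K →ₗ[K] Matrix ι ι K →ₗ[K] Matrix ι ι K →ₗ[K] K :=
  LinearMap.mk₂ K (fun X Y => (Matrix.traceLinearMap ι K K).comp ((LinearMap.mulLeft K P).comp
      ({ toFun := symProd₃ X Y
         map_add' := fun Z Z' => by simp only [symProd₃]; noncomm_ring
         map_smul' := fun c Z => by simp [symProd₃] } : Matrix ι ι K →ₗ[K] Matrix ι ι K)))
    (fun X X' Y => by
      ext1 Z
      simp only [LinearMap.comp_apply, LinearMap.coe_mk, AddHom.coe_mk, LinearMap.add_apply]
      rw [← map_add, ← map_add]; congr 2; simp only [symProd₃]; noncomm_ring)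
    (fun c X Y => by
      ext1 Z
      simp only [LinearMap.comp_apply, LinearMap.coe_mk, AddHom.coe_mk, LinearMap.smul_apply]
      rw [← map_smul, ← map_smul]; congr 2; simp [symProd₃])
    (fun X Y Y' => by
      ext1 Z
      simp only [LinearMap.comp_apply, LinearMap.coe_mk, AddHom.coe_mk, LinearMap.add_apply]
      rw [← map_add, ← map_add]; congr 2; simp only [symProd₃]; noncomm_ring)
    (fun c X Y => by
      ext1 Z
      simp only [LinearMap.comp_apply, LinearMap.coe_mk, AddHom.coe_mk, LinearMap.smul_apply]
      rw [← map_smul, ← map_smul]; congr 2; simp [symProd₃])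

@[simp]
theorem symTrace₃_apply (P X Y Z : Matrix ι ι K) :
    symTrace₃ P X Y Z = Matrix.trace (P * symProd₃ X Y Z) := rfl

theorem symTrace₃_comm (P X Y Z : Matrix ι ι K) : symTrace₃ P X Y Z = symTrace₃ P Y X Z := by
  simp only [symTrace₃_apply, symProd₃]; congr 2; abel

theorem symTrace₃_comm' (P X Y Z : Matrix ι ι K) : symTrace₃ P X Y Z = symTrace₃ P X Z Y := by
  simp only [symTrace₃_apply, symProd₃]; congr 2; abel

/-- The form `tr P[X, Y]`. -/
def traceForm₂ (P : Matrix ι ι K) : Matrix ι ι K [⋀^Fin 2]→ₗ[K] K where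
  toFun v := Matrix.trace (P * commutatorMap K ι (v 0) (v 1))
  map_update_add' {inst} v i x y := by
    rw [Subsingleton.elim inst (instDecidableEqFin 2), ← Matrix.trace_add]
    congr 1
    fin_cases i <;> simp [Function.update, Fin.ext_iff] <;> noncomm_ring
  map_update_smul' {inst} v i c x := by
    rw [Subsingleton.elim inst (instDecidableEqFin 2)]
    fin_cases i <;> simp [Function.update, Fin.ext_iff, mul_sub]
  map_eq_zero_of_eq' v i j hij hne := by
    have : v 0 = v 1 := by
      fin_cases i <;> fin_cases j <;> simp_all
    rw [this, commutatorMap_self]; simp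

/-- The form `tr P(R ∧ R)` with `R = [·, ·]`. -/
def traceForm₄ (P : Matrix ι ι K) : Matrix ι ι K [⋀^Fin 4]→ₗ[K] K :=
  quarticForm (commutatorMap K ι) commutatorMap_skew commutatorMap_self (symTrace₂ P)
    (symTrace₂_comm P)

/-- The form `tr P(R ∧ R ∧ R)` with `R = [·, ·]`. -/
def traceForm₆ (P : Matrix ι ι K) : Matrix ι ι K [⋀^Fin 6]→ₗ[K] K :=
  sexticForm (commutatorMap K ι) commutatorMap_skew commutatorMap_self (symTrace₃ P)
    (symTrace₃_comm P) (symTrace₃_comm' P)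

theorem trace_mul_commutator_eq_zero {P κ : Matrix ι ι K} (h : P * κ = κ * P) (X : Matrix ι ι K) :
    Matrix.trace (P * (κ * X - X * κ)) = 0 := by
  rw [mul_sub, Matrix.trace_sub, ← mul_assoc, h, mul_assoc, Matrix.trace_mul_comm κ, mul_assoc,
    sub_self]

theorem commutatorMap_jacobi (κ X Y : Matrix ι ι K) :
    commutatorMap K ι (κ * X - X * κ) Y + commutatorMap K ι X (κ * Y - Y * κ) =
      κ * commutatorMap K ι X Y - commutatorMap K ι X Y * κ := by
  simp only [commutatorMap_apply]
  noncomm_ring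

/-- Invariance of the forms of degree 2, 4 and 6 needs only that `P` commutes with `κ`. With `P` the
projection to one block they are multiples of the components of the Chern character of the
corresponding homogeneous bundle. -/
theorem sum_traceForm₂_update {P κ : Matrix ι ι K} (h : P * κ = κ * P) (v : Fin 2 → Matrix ι ι K) :
    ∑ l, traceForm₂ P (Function.update v l (κ * v l - v l * κ)) = 0 := by
  rw [Fin.sum_univ_two, ← trace_mul_commutator_eq_zero h (commutatorMap K ι (v 0) (v 1)),
    ← commutatorMap_jacobi, mul_add, Matrix.trace_add]
  simp only [traceForm₂, AlternatingMap.coe_mk, MultilinearMap.coe_mk, Function.update_self,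
    ne_eq, zero_ne_one, one_ne_zero, not_false_eq_true, Function.update_of_ne]

theorem sum_traceForm₄_update {P κ : Matrix ι ι K} (h : P * κ = κ * P) (v : Fin 4 → Matrix ι ι K) :
    ∑ l, traceForm₄ P (Function.update v l (κ * v l - v l * κ)) = 0 := by
  refine sum_quarticForm_update (D := fun X => κ * X - X * κ) (D' := fun X => κ * X - X * κ)
    (commutatorMap_jacobi κ) (fun X Y => ?_) v
  rw [← trace_mul_commutator_eq_zero h (X * Y + Y * X)]
  simp only [symTrace₂_apply]
  rw [← Matrix.trace_add]
  congr 1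
  noncomm_ring

theorem sum_traceForm₆_update {P κ : Matrix ι ι K} (h : P * κ = κ * P) (v : Fin 6 → Matrix ι ι K) :
    ∑ l, traceForm₆ P (Function.update v l (κ * v l - v l * κ)) = 0 := by
  refine sum_sexticForm_update (D := fun X => κ * X - X * κ) (D' := fun X => κ * X - X * κ)
    (commutatorMap_jacobi κ) (fun X Y Z => ?_) v
  rw [← trace_mul_commutator_eq_zero h (symProd₃ X Y Z)]
  simp only [symTrace₃_apply]
  rw [← Matrix.trace_add, ← Matrix.trace_add, ← mul_add, ← mul_add]
  congr 2
  simp only [symProd₃]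
  noncomm_ring

end TraceForms

end Sugra

namespace Sugra

/-! ### The classical algebras are closed under brackets and conjugate transposition. -/

section ClassicalLie

theorem sigMat_mul_self (a b : ℕ) : sigMat a b * sigMat a b = 1 := by
  simp [sigMat, Matrix.fromBlocks_multiply]

theorem sympMat_mul_self (n : ℕ) : sympMat n * sympMat n = -1 := by
  rw [sympMat, Matrix.fromBlocks_multiply, ← Matrix.fromBlocks_one, Matrix.fromBlocks_neg]
  simp

/-- The matrices which are skew for a form `S`, with respect to an anti-involution, are closed under
the commutator. -/
theorem skew_commutator {R : Type*} [Ring R] {S A B A' B' : R} (hA : A' * S + S * A = 0)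
    (hB : B' * S + S * B = 0) : (B' * A' - A' * B') * S + S * (A * B - B * A) = 0 := by
  have h : (B' * A' - A' * B') * S + S * (A * B - B * A) =
      B' * (A' * S + S * A) - (B' * S + S * B) * A - A' * (B' * S + S * B) +
        (A' * S + S * A) * B := by noncomm_ring
  rw [h, hA, hB]
  simp

/-- Multiply the hypothesis by `S` on both sides and use `S² = ±1`. This gives closure under the
anti-involution `A ↦ A'`. -/
theorem skew_swap {R : Type*} [Ring R] {S A A' : R} (hS : S * S = 1 ∨ S * S = -1)
    (hA : A' * S + S * A = 0) : A * S + S * A' = 0 := by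
  have h : S * (A' * S + S * A) * S = S * A' * (S * S) + (S * S) * A * S := by noncomm_ring
  rw [hA] at h
  rcases hS with hS | hS <;> rw [hS] at h <;> simp at h
  · rw [add_comm]; exact h.symm
  · rw [← neg_eq_zero, neg_add, h]; abel

theorem isSelfAdjointLie_suLie (a b : ℕ) : IsSelfAdjointLie (suLie a b) where
  bracket A hA B hB := by
    refine ⟨?_, ?_⟩
    · rw [Matrix.trace_sub, Matrix.trace_mul_comm, sub_self]
    · rw [Matrix.conjTranspose_sub, Matrix.conjTranspose_mul, Matrix.conjTranspose_mul]
      exact skew_commutator hA.2 hB.2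
  conjTranspose A hA := by
    refine ⟨?_, ?_⟩
    · rw [Matrix.trace_conjTranspose, hA.1, star_zero]
    · rw [Matrix.conjTranspose_conjTranspose]
      exact skew_swap (Or.inl (sigMat_mul_self a b)) hA.2

theorem isSelfAdjointLie_soLie (a b : ℕ) : IsSelfAdjointLie (soLie a b) where
  bracket A hA B hB := by
    refine ⟨fun i j => ?_, ?_⟩
    · simp [Matrix.mul_apply, hA.1, hB.1]
    · rw [Matrix.transpose_sub, Matrix.transpose_mul, Matrix.transpose_mul]
      exact skew_commutator hA.2 hB.2
  conjTranspose A hA := by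
    have h : A.conjTranspose = A.transpose := by
      ext i j
      exact Complex.conj_eq_iff_im.2 (hA.1 j i)
    refine ⟨fun i j => by rw [h]; exact hA.1 j i, ?_⟩
    rw [h, Matrix.transpose_transpose]
    exact skew_swap (Or.inl (sigMat_mul_self a b)) hA.2

theorem isSelfAdjointLie_soStarLie (n : ℕ) : IsSelfAdjointLie (soStarLie n) where
  bracket A hA B hB := by
    refine ⟨?_, ?_⟩
    · rw [Matrix.transpose_sub, Matrix.transpose_mul, Matrix.transpose_mul,
        eq_neg_of_add_eq_zero_left hA.1, eq_neg_of_add_eq_zero_left hB.1]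
      noncomm_ring
    · rw [Matrix.conjTranspose_sub, Matrix.conjTranspose_mul, Matrix.conjTranspose_mul]
      exact skew_commutator hA.2 hB.2
  conjTranspose A hA := by
    refine ⟨?_, ?_⟩
    · have := congrArg Matrix.conjTranspose hA.1
      rw [Matrix.conjTranspose_add, Matrix.conjTranspose_zero] at this
      exact this
    · rw [Matrix.conjTranspose_conjTranspose]
      exact skew_swap (Or.inr (sympMat_mul_self n)) hA.2

end ClassicalLie

end Sugra

set_option linter.unusedSimpArgs false
set_option linter.unusedSectionVars false

namespace Sugra

/-! ### Rigidity for `SU(3,k)`. -/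

section SpecialUnitary

variable {ι : Type*} [Fintype ι] [DecidableEq ι] {𝔤 : Submodule ℝ (Matrix ι ι ℂ)}

/-- A symmetric annihilator which vanishes on a spanning family vanishes. -/
theorem IsSymmetricAnnihilator.eq_zero_of_complexify {A : Module.End ℝ (Chart 𝔤)}
    (hA : IsSymmetricAnnihilator A) {S : Set (Matrix ι ι ℂ)} (hS : ∀ Y ∈ S, IsComplexHerm 𝔤 Y)
    (h0 : ∀ Y ∈ S, complexify A Y = 0)
    (hspan : ∀ X, IsComplexHerm 𝔤 X → (∀ Y ∈ S, Matrix.trace (X * Y) = 0) → X = 0) : A = 0 := by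
  refine Sugra.eq_zero_of_complexify fun X hX => hspan _ hX.complexify fun Y hY => ?_
  rw [hA.trace_complexify_mul hX (hS Y hY), h0 Y hY, mul_zero, Matrix.trace_zero]

variable {m n : Type*} [Fintype m] [Fintype n] [DecidableEq m] [DecidableEq n]

/-- The block off-diagonal matrices. -/
abbrev offBlock (Z : Matrix m n ℂ) (V : Matrix n m ℂ) : Matrix (m ⊕ n) (m ⊕ n) ℂ :=
  Matrix.fromBlocks 0 Z V 0

/-- The projection to the first block. -/
abbrev firstProj (m n : Type*) [DecidableEq m] : Matrix (m ⊕ n) (m ⊕ n) ℂ :=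
  Matrix.fromBlocks 1 0 0 0

theorem trace_fromBlocks (x : Matrix m m ℂ) (y : Matrix m n ℂ) (z : Matrix n m ℂ)
    (w : Matrix n n ℂ) : Matrix.trace (Matrix.fromBlocks x y z w) =
      Matrix.trace x + Matrix.trace w := by
  simp [Matrix.trace]

theorem commutatorMap_offBlock (Z Z' : Matrix m n ℂ) (V V' : Matrix n m ℂ) :
    commutatorMap ℂ (m ⊕ n) (offBlock Z V) (offBlock Z' V') =
      Matrix.fromBlocks (Z * V' - Z' * V) 0 0 (V * Z' - V' * Z) := by
  simp [Matrix.fromBlocks_multiply, sub_eq_add_neg, Matrix.fromBlocks_neg, Matrix.fromBlocks_add]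

theorem traceForm₂_offBlock (Z Z' : Matrix m n ℂ) (V V' : Matrix n m ℂ) :
    traceForm₂ (firstProj m n) ![offBlock Z V, offBlock Z' V'] =
      Matrix.trace (Z * V') - Matrix.trace (Z' * V) := by
  rw [← Matrix.trace_sub]
  change Matrix.trace (firstProj m n * commutatorMap ℂ (m ⊕ n) (offBlock Z V) (offBlock Z' V')) = _
  rw [commutatorMap_offBlock]
  simp [Matrix.fromBlocks_multiply, trace_fromBlocks]

theorem symTrace₂_fromBlocks (x y : Matrix m m ℂ) (x' y' : Matrix n n ℂ) :
    symTrace₂ (firstProj m n) (Matrix.fromBlocks x 0 0 x') (Matrix.fromBlocks y 0 0 y') =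
      2 * Matrix.trace (x * y) := by
  simp [Matrix.fromBlocks_multiply, trace_fromBlocks, Matrix.fromBlocks_add,
    Matrix.trace_mul_comm y x, two_mul]

theorem traceForm₄_offBlock (Z : Fin 4 → Matrix m n ℂ) (V : Fin 4 → Matrix n m ℂ) :
    traceForm₄ (firstProj m n) (fun l => offBlock (Z l) (V l)) =
      2 * Matrix.trace ((Z 0 * V 1 - Z 1 * V 0) * (Z 2 * V 3 - Z 3 * V 2)) -
      2 * Matrix.trace ((Z 0 * V 2 - Z 2 * V 0) * (Z 1 * V 3 - Z 3 * V 1)) +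
      2 * Matrix.trace ((Z 0 * V 3 - Z 3 * V 0) * (Z 1 * V 2 - Z 2 * V 1)) := by
  simp only [traceForm₄, quarticForm, AlternatingMap.coe_mk, MultilinearMap.coe_mk, quarticValue,
    commutatorMap_offBlock, symTrace₂_fromBlocks]

theorem eq_offBlock_of_anticommute {a b : ℕ} {X : Matrix (Fin a ⊕ Fin b) (Fin a ⊕ Fin b) ℂ}
    (h : X * sigMat a b + sigMat a b * X = 0) : X = offBlock X.toBlocks₁₂ X.toBlocks₂₁ := by
  rw [← Matrix.fromBlocks_toBlocks X, sigMat, Matrix.fromBlocks_multiply,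
    Matrix.fromBlocks_multiply, Matrix.fromBlocks_add, ← Matrix.fromBlocks_zero,
    Matrix.fromBlocks_inj] at h
  obtain ⟨h1, -, -, h4⟩ := h
  simp only [Matrix.mul_one, Matrix.mul_zero, Matrix.zero_mul, Matrix.one_mul, Matrix.mul_neg,
    Matrix.neg_mul, zero_add, add_zero] at h1 h4
  nth_rw 1 [← Matrix.fromBlocks_toBlocks X]
  rw [Matrix.fromBlocks_inj]
  refine ⟨?_, rfl, rfl, ?_⟩
  · rw [← two_smul ℂ] at h1
    exact (smul_eq_zero.1 h1).resolve_left two_ne_zero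
  · rw [← neg_add, neg_eq_zero, ← two_smul ℂ] at h4
    exact (smul_eq_zero.1 h4).resolve_left two_ne_zero

theorem IsComplexHerm.eq_offBlock {a b : ℕ}
    {𝔤 : Submodule ℝ (Matrix (Fin a ⊕ Fin b) (Fin a ⊕ Fin b) ℂ)}
    (h : ∀ x ∈ 𝔤, x.conjTranspose = x → x * sigMat a b + sigMat a b * x = 0)
    {X : Matrix (Fin a ⊕ Fin b) (Fin a ⊕ Fin b) ℂ} (hX : IsComplexHerm 𝔤 X) :
    X = offBlock X.toBlocks₁₂ X.toBlocks₂₁ := by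
  obtain ⟨x, y, rfl⟩ := hX
  refine eq_offBlock_of_anticommute ?_
  have hx := h _ x.toMatrix_mem x.toMatrix_conjTranspose
  have hy := h _ y.toMatrix_mem y.toMatrix_conjTranspose
  rw [add_mul, mul_add, add_add_add_comm, hx, smul_mul_assoc, mul_smul_comm, ← smul_add, hy]
  simp

theorem isComplexHerm_suLie_offBlock {a b : ℕ} (Z : Matrix (Fin a) (Fin b) ℂ)
    (V : Matrix (Fin b) (Fin a) ℂ) : IsComplexHerm (suLie a b) (offBlock Z V) := by
  have h : ∀ Z : Matrix (Fin a) (Fin b) ℂ, offBlock Z Z.conjTranspose ∈ suLie a b := by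
    intro Z
    refine ⟨by simp [trace_fromBlocks], ?_⟩
    simp [sigMat, Matrix.fromBlocks_conjTranspose, Matrix.fromBlocks_multiply,
      Matrix.fromBlocks_add]
  refine isComplexHerm_of_mem ?_ ?_
  · convert h (Z + V.conjTranspose) using 1
    simp [Matrix.fromBlocks_conjTranspose, Matrix.fromBlocks_add, add_comm]
  · convert h (Complex.I • (Z - V.conjTranspose)) using 1
    rw [Matrix.fromBlocks_conjTranspose, sub_eq_add_neg, Matrix.fromBlocks_neg,
      Matrix.fromBlocks_add, Matrix.fromBlocks_smul, Matrix.conjTranspose_smul, Complex.star_def,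
      Complex.conj_I]
    simp [Matrix.conjTranspose_sub, smul_sub, sub_eq_add_neg, add_comm]

theorem eq_offBlock_of_suLie {a b : ℕ} {X : Matrix (Fin a ⊕ Fin b) (Fin a ⊕ Fin b) ℂ}
    (hX : IsComplexHerm (suLie a b) X) : X = offBlock X.toBlocks₁₂ X.toBlocks₂₁ :=
  hX.eq_offBlock fun x hx hx' => by
    have := hx.2
    rwa [hx'] at this

/-- The projection to the first block commutes with the block-diagonal matrices. -/
theorem firstProj_comm {a b : ℕ} {κ : Matrix (Fin a ⊕ Fin b) (Fin a ⊕ Fin b) ℂ}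
    (h : κ * sigMat a b = sigMat a b * κ) :
    firstProj (Fin a) (Fin b) * κ = κ * firstProj (Fin a) (Fin b) := by
  have hP : firstProj (Fin a) (Fin b) = (1 / 2 : ℂ) • (1 + sigMat a b) := by
    rw [sigMat, ← Matrix.fromBlocks_one, Matrix.fromBlocks_add, Matrix.fromBlocks_smul,
      add_neg_cancel, ← two_smul ℂ (1 : Matrix (Fin a) (Fin a) ℂ), smul_smul]
    simp
  rw [hP, smul_mul_assoc, mul_smul_comm, add_mul, mul_add, h, one_mul, mul_one]

theorem firstProj_comm_suLie {a b : ℕ} {κ : Matrix (Fin a ⊕ Fin b) (Fin a ⊕ Fin b) ℂ}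
    (hκ : κ ∈ suLie a b) (hκ' : κ.conjTranspose = -κ) :
    firstProj (Fin a) (Fin b) * κ = κ * firstProj (Fin a) (Fin b) := by
  have h := hκ.2
  rw [hκ', neg_mul, neg_add_eq_zero] at h
  exact firstProj_comm h

theorem trace_mul_single_apply {m n : Type*} [Fintype m] [Fintype n] [DecidableEq m]
    [DecidableEq n] (X : Matrix m n ℂ) (i : n) (j : m) :
    Matrix.trace (X * Matrix.single i j (1 : ℂ)) = X j i := by
  simp [Matrix.trace_mul_single]

theorem update_offBlock {d : ℕ} (Z : Fin d → Matrix m n ℂ) (V : Fin d → Matrix n m ℂ) (l : Fin d)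
    (z : Matrix m n ℂ) (v : Matrix n m ℂ) :
    Function.update (fun l => offBlock (Z l) (V l)) l (offBlock z v) =
      fun i => offBlock (Function.update Z l z i) (Function.update V l v i) := by
  funext i
  by_cases h : i = l
  · subst h; simp
  · simp [h]

theorem traceForm₂_offBlock' (Z : Fin 2 → Matrix m n ℂ) (V : Fin 2 → Matrix n m ℂ) :
    traceForm₂ (firstProj m n) (fun l => offBlock (Z l) (V l)) =
      Matrix.trace (Z 0 * V 1) - Matrix.trace (Z 1 * V 0) := by
  rw [← traceForm₂_offBlock]
  congr 1
  funext l
  fin_cases l <;> rfl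

variable {k : ℕ} {A : Module.End ℝ (Chart (suLie 3 k))}

/-- Self-adjointness and annihilation of the Kähler form `traceForm₂` constrain the same entry with
opposite signs. Thus `A` is antilinear for the complex structure and maps `𝔭⁺`, the upper blocks,
into `𝔭⁻`. -/
theorem suLie_complexify_toBlocks₁₂ (hA : IsSymmetricAnnihilator A) (Z : Matrix (Fin 3) (Fin k) ℂ) :
    (complexify A (offBlock Z 0)).toBlocks₁₂ = 0 := by
  ext i j
  have hX := isComplexHerm_suLie_offBlock Z 0
  have hY := isComplexHerm_suLie_offBlock 0 (Matrix.single j i (1 : ℂ))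
  have h1 := hA.trace_complexify_mul hX hY
  have h2 := hA.sum_complexify (traceForm₂ (firstProj (Fin 3) (Fin k)))
    (fun κ hκ hκ' v => sum_traceForm₂_update (firstProj_comm_suLie hκ hκ') _)
    (X := fun l => offBlock (![Z, 0] l) (![0, Matrix.single j i (1 : ℂ)] l))
    (fun l => isComplexHerm_suLie_offBlock _ _)
  rw [Fin.sum_univ_two] at h2
  simp only [Matrix.cons_val_zero, Matrix.cons_val_one] at h2
  rw [eq_offBlock_of_suLie hX.complexify, eq_offBlock_of_suLie hY.complexify] at h1 h2
  simp only [update_offBlock, traceForm₂_offBlock'] at h2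
  simp [Function.update, Matrix.fromBlocks_multiply, trace_fromBlocks] at h1 h2
  rw [trace_mul_single_apply] at h1 h2
  rw [Matrix.zero_apply]
  linear_combination (h1 + h2) / 2

theorem suLie_complexify_upper (hA : IsSymmetricAnnihilator A) (Z : Matrix (Fin 3) (Fin k) ℂ) :
    complexify A (offBlock Z 0) = offBlock 0 (complexify A (offBlock Z 0)).toBlocks₂₁ := by
  conv_lhs => rw [eq_offBlock_of_suLie (isComplexHerm_suLie_offBlock Z 0).complexify,
    suLie_complexify_toBlocks₁₂ hA]

/-- Conjugate transposition is the complex conjugation which fixes `𝔭`; it exchanges the two blocks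
and commutes with the extension of `A`. -/
theorem suLie_complexify_lower (hA : IsSymmetricAnnihilator A) (V : Matrix (Fin k) (Fin 3) ℂ) :
    complexify A (offBlock 0 V) =
      offBlock (complexify A (offBlock V.conjTranspose 0)).toBlocks₂₁.conjTranspose 0 := by
  have h := (isComplexHerm_suLie_offBlock V.conjTranspose 0).complexify_conjTranspose (A := A)
  rw [suLie_complexify_upper hA] at h
  simpa [Matrix.fromBlocks_conjTranspose] using h

/-- `tr F²` is evaluated on three vectors of `𝔭⁺` and one of `𝔭⁻`. If `A` acts on the last vector,
all four lie in `𝔭⁺` and the form vanishes, so only the images `N l` appear. Letting the last vector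
run over matrix units gives a matrix identity. -/
theorem suLie_complexify_cyclic (hA : IsSymmetricAnnihilator A)
    (Z : Fin 3 → Matrix (Fin 3) (Fin k) ℂ) (N : Fin 3 → Matrix (Fin k) (Fin 3) ℂ)
    (hN : ∀ l, complexify A (offBlock (Z l) 0) = offBlock 0 (N l)) :
    Z 2 * N 0 * Z 1 - Z 1 * N 0 * Z 2 + (Z 0 * N 1 * Z 2 - Z 2 * N 1 * Z 0) +
      (Z 1 * N 2 * Z 0 - Z 0 * N 2 * Z 1) = 0 := by
  ext i j
  have hY := isComplexHerm_suLie_offBlock 0 (Matrix.single j i (1 : ℂ))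
  obtain ⟨M, hM⟩ : ∃ M, complexify A (offBlock 0 (Matrix.single j i (1 : ℂ))) = offBlock M 0 :=
    ⟨_, suLie_complexify_lower hA _⟩
  have h2 := hA.sum_complexify (traceForm₄ (firstProj (Fin 3) (Fin k)))
    (fun κ hκ hκ' v => sum_traceForm₄_update (firstProj_comm_suLie hκ hκ') _)
    (X := fun l => offBlock (![Z 0, Z 1, Z 2, 0] l) (![0, 0, 0, Matrix.single j i (1 : ℂ)] l))
    (fun l => isComplexHerm_suLie_offBlock _ _)
  rw [Fin.sum_univ_four] at h2
  simp only [Matrix.cons_val_zero, Matrix.cons_val_one, Matrix.cons_val] at h2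
  rw [hN, hN, hN, hM] at h2
  simp only [update_offBlock, traceForm₄_offBlock] at h2
  simp [Function.update, Fin.ext_iff] at h2
  rw [Matrix.trace_mul_comm (Z 0 * Matrix.single j i 1) (Z 2 * N 1),
    Matrix.trace_mul_comm (Z 0 * Matrix.single j i 1) (Z 1 * N 2)] at h2
  simp only [← Matrix.mul_assoc, trace_mul_single_apply] at h2
  simp only [Matrix.add_apply, Matrix.sub_apply, Matrix.zero_apply]
  linear_combination h2 / 2

/-- With `Z 0, Z 1, Z 2` the units at `(a, α), (b, β), (c, γ)`, the entry `(b, γ)` of the cyclic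
identity receives only `Z 1 * N 0 * Z 2`, which is the entry `(β, c)` of `N 0`. Choosing `b`
different from `a` and `c` takes three rows, and choosing `γ ≠ α` takes `2 ≤ k`. -/
theorem suLie_complexify_single (hk : 2 ≤ k) (hA : IsSymmetricAnnihilator A) (a : Fin 3)
    (α : Fin k) : complexify A (offBlock (Matrix.single a α 1) 0) = 0 := by
  rw [suLie_complexify_upper hA, ← Matrix.fromBlocks_zero, Matrix.fromBlocks_inj]
  refine ⟨rfl, rfl, ?_, rfl⟩
  ext β c
  obtain ⟨b, hb, hb'⟩ : ∃ b : Fin 3, b ≠ a ∧ b ≠ c := by revert a c; decide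
  obtain ⟨γ, hγ⟩ : ∃ γ : Fin k, γ ≠ α := by
    have : Nontrivial (Fin k) := Fin.nontrivial_iff_two_le.2 hk
    exact exists_ne α
  have h := suLie_complexify_cyclic hA ![Matrix.single a α 1, Matrix.single b β 1,
    Matrix.single c γ 1] (fun l => (complexify A (offBlock (![Matrix.single a α 1, Matrix.single b β 1,
    Matrix.single c γ 1] l) 0)).toBlocks₂₁) (fun l => suLie_complexify_upper hA _)
  have h' := congrFun (congrFun h b) γ
  simp [Matrix.single_mul_mul_single, Matrix.single_apply, hb, hb', hb.symm, hb'.symm, hγ, hγ.symm] at h'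
  simpa using h'

theorem suLie_symmetricAnnihilator_eq_zero (hk : 2 ≤ k) (hA : IsSymmetricAnnihilator A) :
    A = 0 := by
  have hU := suLie_complexify_single hk hA
  refine hA.eq_zero_of_complexify (S := {Y | ∃ (a : Fin 3) (α : Fin k),
    Y = offBlock (Matrix.single a α 1) 0 ∨ Y = offBlock 0 (Matrix.single α a 1)}) ?_ ?_ ?_
  · rintro _ ⟨a, α, rfl | rfl⟩ <;> exact isComplexHerm_suLie_offBlock _ _
  · rintro _ ⟨a, α, rfl | rfl⟩
    · exact hU a α
    · rw [suLie_complexify_lower hA, Matrix.conjTranspose_single, star_one, hU]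
      have h0 : (0 : Matrix (Fin 3 ⊕ Fin k) (Fin 3 ⊕ Fin k) ℂ).toBlocks₂₁ = 0 := rfl
      rw [h0, Matrix.conjTranspose_zero]
      exact Matrix.fromBlocks_zero
  · intro X hX h
    rw [eq_offBlock_of_suLie hX] at h ⊢
    rw [← Matrix.fromBlocks_zero, Matrix.fromBlocks_inj]
    refine ⟨rfl, ?_, ?_, rfl⟩
    · ext a α
      have := h _ ⟨a, α, Or.inr rfl⟩
      rw [Matrix.fromBlocks_multiply, trace_fromBlocks] at this
      simpa [trace_mul_single_apply] using this
    · ext α a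
      have := h _ ⟨a, α, Or.inl rfl⟩
      rw [Matrix.fromBlocks_multiply, trace_fromBlocks] at this
      simpa [trace_mul_single_apply] using this

end SpecialUnitary

end Sugra

set_option linter.unusedSimpArgs false
set_option linter.unusedSectionVars false

namespace Sugra

/-! ### The Euler form of `SO(6,k)` and its invariance. -/

section SpecialOrthogonal

/-- The hafnian of a symmetric matrix of size 6, in terms of its strictly upper triangular part. -/
def hafnian₆ (g : Fin 6 → Fin 6 → ℂ) : ℂ :=
  g 0 1 * g 2 3 * g 4 5 + g 0 1 * g 2 4 * g 3 5 + g 0 1 * g 2 5 * g 3 4 +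
  g 0 2 * g 1 3 * g 4 5 + g 0 2 * g 1 4 * g 3 5 + g 0 2 * g 1 5 * g 3 4 +
  g 0 3 * g 1 2 * g 4 5 + g 0 3 * g 1 4 * g 2 5 + g 0 3 * g 1 5 * g 2 4 +
  g 0 4 * g 1 2 * g 3 5 + g 0 4 * g 1 3 * g 2 5 + g 0 4 * g 1 5 * g 2 3 +
  g 0 5 * g 1 2 * g 3 4 + g 0 5 * g 1 3 * g 2 4 + g 0 5 * g 1 4 * g 2 3

theorem hafnian₆_swap {g : Fin 6 → Fin 6 → ℂ} (hg : ∀ i j, g i j = g j i) {i j : Fin 6}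
    (hij : i < j) :
    hafnian₆ (fun a b => g (Equiv.swap i j a) (Equiv.swap i j b)) = hafnian₆ g := by
  unfold hafnian₆
  fin_cases i <;> fin_cases j <;> simp at hij <;>
    simp [Equiv.swap_apply_def, Fin.ext_iff] <;>
    simp only [hg 1 0, hg 2 0, hg 3 0, hg 4 0, hg 5 0, hg 2 1, hg 3 1, hg 4 1, hg 5 1, hg 3 2,
      hg 4 2, hg 5 2, hg 4 3, hg 5 3, hg 5 4] <;>
    ring

variable {n : Type*} [Fintype n] [DecidableEq n]

/-- The number of perfect matchings of six points which match equal colours. -/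
def matchingNumber (c : Fin 6 → n) : ℂ := hafnian₆ fun i j => if c i = c j then 1 else 0

theorem matchingNumber_swap (c : Fin 6 → n) {i j : Fin 6} (hij : i < j) :
    matchingNumber (c ∘ Equiv.swap i j) = matchingNumber c :=
  hafnian₆_swap (g := fun i j => if c i = c j then 1 else 0) (fun i j => by simp [eq_comm]) hij

/-- Every matching joins `l` to exactly one other point `j`, and summing over the colour of `l`
replaces the Kronecker symbol of that edge by `a (c j)`. -/
theorem sum_mul_matchingNumber_update (a : n → ℂ) (c : Fin 6 → n) (l : Fin 6) :
    ∑ β, a β * matchingNumber (Function.update c l β) =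
      hafnian₆ fun i j => if i = l then a (c j) else if j = l then a (c i) else
        if c i = c j then 1 else 0 := by
  unfold matchingNumber hafnian₆
  have h1 : ∀ (γ : n) (x y : ℂ), ∑ β, a β * ((if β = γ then 1 else 0) * x * y) =
      a γ * x * y := by
    intro γ x y; simp [mul_assoc]
  have h1' : ∀ (γ : n) (x y : ℂ), ∑ β, a β * ((if γ = β then 1 else 0) * x * y) =
      a γ * x * y := by
    intro γ x y; simp [mul_assoc]
  have h2 : ∀ (γ : n) (x y : ℂ), ∑ β, a β * (x * (if β = γ then 1 else 0) * y) =
      x * a γ * y := by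
    intro γ x y; simp; ring
  have h2' : ∀ (γ : n) (x y : ℂ), ∑ β, a β * (x * (if γ = β then 1 else 0) * y) =
      x * a γ * y := by
    intro γ x y; simp; ring
  have h3 : ∀ (γ : n) (x y : ℂ), ∑ β, a β * (x * y * (if β = γ then 1 else 0)) =
      x * y * a γ := by
    intro γ x y; simp; ring
  have h3' : ∀ (γ : n) (x y : ℂ), ∑ β, a β * (x * y * (if γ = β then 1 else 0)) =
      x * y * a γ := by
    intro γ x y; simp; ring
  fin_cases l <;>
    simp only [Function.update_apply, mul_add, Finset.sum_add_distrib, Fin.ext_iff, Fin.isValue,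
      Fin.zero_eta, Fin.mk_one, Fin.reduceFinMk, Fin.reduceEq, if_true, if_false, reduceIte,
      zero_ne_one, one_ne_zero, Fin.coe_ofNat_eq_mod, Nat.reduceMod, OfNat.ofNat_ne_zero, OfNat.ofNat_ne_one, Nat.reduceEqDiff, OfNat.zero_ne_ofNat, OfNat.one_ne_ofNat,
      h1, h1', h2, h2', h3, h3']

/-- An edge `{i, j}` of a matching receives `κ (c j) (c i) + κ (c i) (c j)`, which is zero:
contraction with the Kronecker symbol is orthogonally invariant. -/
theorem sum_matchingNumber_derivation {κ : Matrix n n ℂ} (hκ : κ.transpose = -κ) (c : Fin 6 → n) :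
    ∑ l, ∑ β, κ β (c l) * matchingNumber (Function.update c l β) = 0 := by
  have h : ∀ i j, κ i j = -κ j i := fun i j => congrFun (congrFun hκ j) i
  simp only [fun l => sum_mul_matchingNumber_update (fun β => κ β (c l)) c l]
  rw [Fin.sum_univ_six]
  simp only [hafnian₆]
  simp only [Fin.isValue, Fin.reduceEq, if_true, if_false, reduceIte,
      zero_ne_one, one_ne_zero]
  rw [h (c 1) (c 0), h (c 2) (c 0), h (c 3) (c 0), h (c 4) (c 0), h (c 5) (c 0), h (c 2) (c 1),
    h (c 3) (c 1), h (c 4) (c 1), h (c 5) (c 1), h (c 3) (c 2), h (c 4) (c 2), h (c 5) (c 2),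
    h (c 4) (c 3), h (c 5) (c 3), h (c 5) (c 4)]
  ring

theorem det_updateRow_eq_sum (M : Matrix (Fin 6) (Fin 6) ℂ) (l : Fin 6) (r : Fin 6 → ℂ) :
    (M.updateRow l r).det = (M.transpose.adjugate.mulVec r) l := by
  rw [← Matrix.cramer_eq_adjugate_mulVec, Matrix.cramer_transpose_apply]

/-- By Cramer's rule the sum is the trace of `adj(Mᵀ) K Mᵀ`, and `Mᵀ adj(Mᵀ)` is the determinant
times the identity. -/
theorem sum_det_updateRow_mulVec (M K : Matrix (Fin 6) (Fin 6) ℂ) :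
    ∑ l, (M.updateRow l (K.mulVec (M l))).det = K.trace * M.det := by
  have h : ∀ l, (M.updateRow l (K.mulVec (M l))).det =
      (M.transpose.adjugate * (K * M.transpose)) l l := by
    intro l
    rw [det_updateRow_eq_sum, Matrix.mul_apply]
    rfl
  simp only [h]
  change Matrix.trace _ = _
  rw [Matrix.trace_mul_comm, Matrix.mul_assoc, Matrix.mul_adjugate, Matrix.det_transpose]
  simp [mul_comm]

/-- The other five rows are the unit vectors different from the one at `π l`, so only that component
of the new row counts. -/
theorem det_updateRow_single (π : Equiv.Perm (Fin 6)) (l : Fin 6) (r : Fin 6 → ℂ) :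
    (Matrix.updateRow (Matrix.of fun i => Pi.single (π i) (1 : ℂ)) l r).det =
      (Matrix.of fun i => Pi.single (π i) (1 : ℂ)).det * r (π l) := by
  set M : Matrix (Fin 6) (Fin 6) ℂ := Matrix.of fun i => Pi.single (π i) (1 : ℂ) with hM
  have hr : r = M.transpose.mulVec (fun i => r (π i)) := by
    funext a
    simp only [Matrix.mulVec, dotProduct, hM, Matrix.transpose_apply, Matrix.of_apply,
      Pi.single_apply]
    rw [Finset.sum_eq_single (π.symm a)]
    · simp
    · intro b _ hb
      rw [if_neg, zero_mul]
      rintro rfl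
      simp at hb
    · simp
  conv_lhs => rw [hr]
  rw [det_updateRow_eq_sum, Matrix.mulVec_mulVec, Matrix.adjugate_mul, Matrix.det_transpose]
  simp [Matrix.smul_mulVec]

/-- The matrix whose rows are columns of the upper right blocks of six matrices. -/
def columnMatrix (X : Fin 6 → Matrix (Fin 6 ⊕ n) (Fin 6 ⊕ n) ℂ) (c : Fin 6 → n) :
    Matrix (Fin 6) (Fin 6) ℂ :=
  Matrix.of fun i a => X i (Sum.inl a) (Sum.inr (c i))

theorem columnMatrix_update (X : Fin 6 → Matrix (Fin 6 ⊕ n) (Fin 6 ⊕ n) ℂ) (c : Fin 6 → n)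
    (l : Fin 6) (Y : Matrix (Fin 6 ⊕ n) (Fin 6 ⊕ n) ℂ) :
    columnMatrix (Function.update X l Y) c =
      (columnMatrix X c).updateRow l fun a => Y (Sum.inl a) (Sum.inr (c l)) := by
  ext i a
  by_cases h : i = l
  · subst h; simp [columnMatrix]
  · simp [columnMatrix, h]

theorem columnMatrix_update_column (X : Fin 6 → Matrix (Fin 6 ⊕ n) (Fin 6 ⊕ n) ℂ) (c : Fin 6 → n)
    (l : Fin 6) (β : n) :
    columnMatrix X (Function.update c l β) =
      (columnMatrix X c).updateRow l fun a => X l (Sum.inl a) (Sum.inr β) := by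
  ext i a
  by_cases h : i = l
  · subst h; simp [columnMatrix]
  · simp [columnMatrix, h]

/-- The 6-form on `Hom(ℂⁿ, ℂ⁶)` which is the determinant in `ℂ⁶` and the hafnian in `ℂⁿ`: the
Pfaffian of the curvature of the tautological `SO(6)`-bundle. -/
def hafnianForm (n : Type*) [Fintype n] [DecidableEq n] :
    Matrix (Fin 6 ⊕ n) (Fin 6 ⊕ n) ℂ [⋀^Fin 6]→ₗ[ℂ] ℂ where
  toFun X := ∑ c : Fin 6 → n, matchingNumber c * (columnMatrix X c).det
  map_update_add' {inst} X l x y := by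
    obtain rfl := Subsingleton.elim inst (instDecidableEqFin 6)
    rw [← Finset.sum_add_distrib]
    refine Finset.sum_congr rfl fun c _ => ?_
    rw [columnMatrix_update, columnMatrix_update, columnMatrix_update, ← mul_add,
      ← Matrix.det_updateRow_add]
    rfl
  map_update_smul' {inst} X l a x := by
    obtain rfl := Subsingleton.elim inst (instDecidableEqFin 6)
    rw [smul_eq_mul, Finset.mul_sum]
    refine Finset.sum_congr rfl fun c _ => ?_
    rw [columnMatrix_update, columnMatrix_update, mul_left_comm]
    exact congrArg (matchingNumber c * ·) (Matrix.det_updateRow_smul (columnMatrix X c) l a _)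
  map_eq_zero_of_eq' X i j hij hne := by
    have key : ∀ i j : Fin 6, i < j → X i = X j →
        ∑ c : Fin 6 → n, matchingNumber c * (columnMatrix X c).det = 0 := by
      intro i j hlt h
      -- Exchanging the colours of slots `i` and `j` preserves the matching number and, as `X i = X
      -- j`, negates the determinant. The sum is therefore its own negative.
      have h1 : ∑ c : Fin 6 → n, matchingNumber c * (columnMatrix X c).det =
          ∑ c : Fin 6 → n, matchingNumber (c ∘ Equiv.swap i j) *
            (columnMatrix X (c ∘ Equiv.swap i j)).det :=
        ((Equiv.arrowCongr (Equiv.swap i j) (Equiv.refl n)).sum_comp fun c =>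
          matchingNumber c * (columnMatrix X c).det).symm.trans (by simp [Equiv.arrowCongr])
      have h2 : ∀ c : Fin 6 → n, (columnMatrix X (c ∘ Equiv.swap i j)).det =
          -(columnMatrix X c).det := by
        intro c
        have : columnMatrix X (c ∘ Equiv.swap i j) =
            (columnMatrix X c).submatrix (Equiv.swap i j) id := by
          ext l a
          have : X l = X (Equiv.swap i j l) := by
            rcases eq_or_ne l i with rfl | hl
            · simpa using h
            rcases eq_or_ne l j with rfl | hl'
            · simpa using h.symm
            rw [Equiv.swap_apply_of_ne_of_ne hl hl']
          simp only [columnMatrix, Matrix.of_apply, Matrix.submatrix_apply, Function.comp_apply, id]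
          rw [this]
        rw [this, Matrix.det_permute, Equiv.Perm.sign_swap hlt.ne]
        simp
      simp only [h2, matchingNumber_swap _ hlt, mul_neg, Finset.sum_neg_distrib] at h1
      exact self_eq_neg.1 h1
    rcases lt_or_gt_of_ne hne with h | h
    · exact key i j h hij
    · exact key j i h hij.symm

theorem hafnianForm_update (X : Fin 6 → Matrix (Fin 6 ⊕ n) (Fin 6 ⊕ n) ℂ) (l : Fin 6)
    (Y : Matrix (Fin 6 ⊕ n) (Fin 6 ⊕ n) ℂ) :
    hafnianForm n (Function.update X l Y) = ∑ c : Fin 6 → n, matchingNumber c *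
      ((columnMatrix X c).updateRow l fun a => Y (Sum.inl a) (Sum.inr (c l))).det :=
  Finset.sum_congr rfl fun c _ => by rw [columnMatrix_update]

/-- The block `κ₁` acts on `ℂ⁶` through the determinant and contributes its trace; the block `κ₂`
acts on the colours, where the hafnian is invariant under skew matrices. -/
theorem sum_hafnianForm_update {κ₁ : Matrix (Fin 6) (Fin 6) ℂ} {κ₂ : Matrix n n ℂ}
    (h₁ : κ₁.trace = 0) (h₂ : κ₂.transpose = -κ₂)
    (X : Fin 6 → Matrix (Fin 6 ⊕ n) (Fin 6 ⊕ n) ℂ) :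
    ∑ l, hafnianForm n (Function.update X l (Matrix.fromBlocks κ₁ 0 0 κ₂ * X l -
      X l * Matrix.fromBlocks κ₁ 0 0 κ₂)) = 0 := by
  simp only [AlternatingMap.map_update_sub, Finset.sum_sub_distrib]
  have e1 : ∑ l, hafnianForm n (Function.update X l (Matrix.fromBlocks κ₁ 0 0 κ₂ * X l)) = 0 := by
    simp only [hafnianForm_update]
    rw [Finset.sum_comm]
    refine Finset.sum_eq_zero fun c _ => ?_
    rw [← Finset.mul_sum]
    have := sum_det_updateRow_mulVec (columnMatrix X c) κ₁
    rw [h₁, zero_mul] at this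
    rw [mul_eq_zero]
    right
    rw [← this]
    refine Finset.sum_congr rfl fun l _ => ?_
    congr 2
    funext a
    simp [Matrix.mul_apply, Matrix.mulVec, dotProduct, columnMatrix]
  have e2 : ∑ l, hafnianForm n (Function.update X l (X l * Matrix.fromBlocks κ₁ 0 0 κ₂)) = 0 := by
    have hl : ∀ l, hafnianForm n (Function.update X l (X l * Matrix.fromBlocks κ₁ 0 0 κ₂)) =
        ∑ c : Fin 6 → n, ∑ β, (κ₂ (c l) β * matchingNumber (Function.update c l β)) *
          (columnMatrix X c).det := by
      intro l
      rw [hafnianForm_update]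
      have : ∀ c : Fin 6 → n, matchingNumber c * ((columnMatrix X c).updateRow l fun a =>
          (X l * Matrix.fromBlocks κ₁ 0 0 κ₂) (Sum.inl a) (Sum.inr (c l))).det =
          ∑ β, (κ₂ β (c l) * matchingNumber c) * (columnMatrix X (Function.update c l β)).det := by
        intro c
        simp only [columnMatrix_update_column, det_updateRow_eq_sum]
        simp only [Matrix.mulVec, dotProduct, Finset.mul_sum, Matrix.mul_apply,
          Fintype.sum_sum_type, Matrix.fromBlocks_apply₁₂, Matrix.fromBlocks_apply₂₂,
          Matrix.zero_apply, mul_zero, Finset.sum_const_zero, zero_add]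
        rw [Finset.sum_comm]
        refine Finset.sum_congr rfl fun β _ => Finset.sum_congr rfl fun a _ => by ring
      simp only [this]
      -- Relabelling exchanges the summed colour with the colour of slot `l`, which moves `κ₂` from
      -- the columns to the matching number.
      rw [sum_update_swap l]
      simp
    simp only [hl]
    rw [Finset.sum_comm]
    refine Finset.sum_eq_zero fun c _ => ?_
    simp only [← Finset.sum_mul]
    have hκ : ∀ i j, κ₂ i j = -κ₂ j i := fun i j => congrFun (congrFun h₂ j) i
    have := sum_matchingNumber_derivation h₂ c
    have h' : ∑ l, ∑ β, κ₂ (c l) β * matchingNumber (Function.update c l β) = 0 := by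
      rw [← neg_eq_zero, ← this]
      simp only [← Finset.sum_neg_distrib]
      refine Finset.sum_congr rfl fun l _ => Finset.sum_congr rfl fun β _ => ?_
      rw [hκ (c l) β]; ring
    rw [h', zero_mul]
  rw [e1, e2, sub_zero]

end SpecialOrthogonal

end Sugra

set_option linter.unusedSimpArgs false
set_option linter.unusedSectionVars false

namespace Sugra

/-! ### Rigidity for `SO(6,k)`. -/

section SpecialOrthogonalRigidity

variable {n : Type*} [Fintype n] [DecidableEq n]

/-- The element of `𝔭` of `𝔰𝔬(6,k)` with upper right block `u ⊗ e_α`. -/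
def soElem (u : Fin 6 → ℂ) (α : n) : Matrix (Fin 6 ⊕ n) (Fin 6 ⊕ n) ℂ :=
  offBlock (Matrix.vecMulVec u (Pi.single α 1)) (Matrix.vecMulVec (Pi.single α 1) u)

theorem soElem_apply₁₂ (u : Fin 6 → ℂ) (α : n) (a : Fin 6) (β : n) :
    soElem u α (Sum.inl a) (Sum.inr β) = if β = α then u a else 0 := by
  simp [soElem, Matrix.vecMulVec_apply, Pi.single_apply]

theorem soElem_zero (α : n) : soElem 0 α = 0 := by
  ext (i | i) (j | j) <;> simp [soElem, Matrix.vecMulVec_apply]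

/-- A colouring that differs from `α` at a slot other than `l` selects a zero column there, so only
the colour of slot `l` remains to be summed. -/
theorem hafnianForm_update_soElem (b : Fin 6 → Fin 6) (α : Fin 6 → n) (l : Fin 6)
    (Y : Matrix (Fin 6 ⊕ n) (Fin 6 ⊕ n) ℂ) :
    hafnianForm n (Function.update (fun i => soElem (Pi.single (b i) 1) (α i)) l Y) =
      ∑ β, matchingNumber (Function.update α l β) *
        (Matrix.updateRow (Matrix.of fun i => Pi.single (b i) (1 : ℂ)) l
          fun a => Y (Sum.inl a) (Sum.inr β)).det := by
  rw [hafnianForm_update]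
  symm
  refine Finset.sum_of_injOn (fun β => Function.update α l β) ?_ (by simp) ?_ ?_
  · intro β _ β' _ h
    simpa using congrFun h l
  · intro c _ hc
    obtain ⟨i, hi, hci⟩ : ∃ i, i ≠ l ∧ c i ≠ α i := by
      by_contra! h
      refine hc ⟨c l, by simp, ?_⟩
      funext i
      by_cases hi : i = l
      · subst hi; simp
      · simp [hi, h i hi]
    rw [Matrix.det_eq_zero_of_row_eq_zero i, mul_zero]
    intro a
    rw [Matrix.updateRow_ne hi]
    simp [columnMatrix, soElem_apply₁₂, hci]
  · intro β _
    congr 2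
    ext i a
    by_cases hi : i = l
    · subst hi; simp
    · simp [hi, columnMatrix, soElem_apply₁₂]

/-- The first Pontryagin form on vectors of two alternating colours reduces to scalar products in
`ℂ⁶`. This is what finally constrains the action of `A` on the `ℂ⁶` factor. -/
theorem traceForm₄_soElem (u : Fin 4 → Fin 6 → ℂ) {α β : n} (hαβ : α ≠ β) :
    traceForm₄ (firstProj (Fin 6) n) (fun l => soElem (u l) (![α, β, α, β] l)) =
      4 * ((u 2 ⬝ᵥ u 3) * (u 0 ⬝ᵥ u 1) - (u 2 ⬝ᵥ u 1) * (u 0 ⬝ᵥ u 3)) := by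
  simp only [soElem, traceForm₄_offBlock]
  simp [Matrix.vecMulVec_mul_vecMulVec, hαβ, hαβ.symm, mul_sub, sub_mul, Matrix.trace_sub]
  simp only [dotProduct_comm (u 3), dotProduct_comm (u 2) (u 1), dotProduct_comm (u 2) (u 0), dotProduct_comm (u 1) (u 0)]
  ring

variable {k : ℕ} {A : Module.End ℝ (Chart (soLie 6 k))}

theorem mem_soLie_offBlock {a b : ℕ} {Z : Matrix (Fin a) (Fin b) ℂ} (hZ : ∀ i j, (Z i j).im = 0) :
    offBlock Z Z.transpose ∈ soLie a b := by
  refine ⟨?_, ?_⟩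
  · rintro (i | i) (j | j) <;> simp [hZ]
  · simp [sigMat, Matrix.fromBlocks_transpose, Matrix.fromBlocks_multiply,
      Matrix.fromBlocks_add]

theorem isComplexHerm_soLie_offBlock {a b : ℕ} (Z : Matrix (Fin a) (Fin b) ℂ) :
    IsComplexHerm (soLie a b) (offBlock Z Z.transpose) := by
  refine isComplexHerm_of_mem ?_ ?_
  · convert mem_soLie_offBlock (Z := Z + Z.map star) (fun i j => by simp) using 1
    rw [Matrix.fromBlocks_conjTranspose, Matrix.fromBlocks_add]
    rw [Matrix.fromBlocks_inj]
    refine ⟨by simp, ?_, ?_, by simp⟩ <;> ext i j <;> simp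
  · convert mem_soLie_offBlock (Z := Complex.I • (Z - Z.map star)) (fun i j => by simp) using 1
    rw [Matrix.fromBlocks_conjTranspose, sub_eq_add_neg, Matrix.fromBlocks_neg,
      Matrix.fromBlocks_add, Matrix.fromBlocks_smul, Matrix.fromBlocks_inj]
    refine ⟨by simp, ?_, ?_, by simp⟩ <;> ext i j <;> simp [sub_eq_add_neg, mul_add]

theorem isComplexHerm_soElem (u : Fin 6 → ℂ) (α : Fin k) :
    IsComplexHerm (soLie 6 k) (soElem u α) := by
  rw [soElem, ← Matrix.transpose_vecMulVec]
  exact isComplexHerm_soLie_offBlock _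

theorem conjTranspose_eq_transpose_of_soLie {a b : ℕ}
    {x : Matrix (Fin a ⊕ Fin b) (Fin a ⊕ Fin b) ℂ} (hx : x ∈ soLie a b) :
    x.conjTranspose = x.transpose := by
  ext i j
  exact Complex.conj_eq_iff_im.2 (hx.1 j i)

theorem eq_offBlock_of_soLie {a b : ℕ} {X : Matrix (Fin a ⊕ Fin b) (Fin a ⊕ Fin b) ℂ}
    (hX : IsComplexHerm (soLie a b) X) :
    X = offBlock X.toBlocks₁₂ X.toBlocks₁₂.transpose := by
  have h1 := hX.eq_offBlock fun x hx hx' => by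
    have := hx.2
    rwa [← conjTranspose_eq_transpose_of_soLie hx, hx'] at this
  have h2 : X.transpose = X := by
    obtain ⟨x, y, rfl⟩ := hX
    rw [Matrix.transpose_add, Matrix.transpose_smul,
      ← conjTranspose_eq_transpose_of_soLie x.toMatrix_mem,
      ← conjTranspose_eq_transpose_of_soLie y.toMatrix_mem, x.toMatrix_conjTranspose,
      y.toMatrix_conjTranspose]
  have h3 : X.toBlocks₂₁ = X.toBlocks₁₂.transpose := by
    ext i j
    exact (congrFun (congrFun h2 (Sum.inr i)) (Sum.inl j)).symm
  rw [← h3]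
  exact h1

theorem soLie_skew {a b : ℕ} {κ : Matrix (Fin a ⊕ Fin b) (Fin a ⊕ Fin b) ℂ}
    (hκ : κ ∈ soLie a b) (hκ' : κ.conjTranspose = -κ) :
    firstProj (Fin a) (Fin b) * κ = κ * firstProj (Fin a) (Fin b) ∧ κ.transpose = -κ := by
  have h := hκ.2
  have ht := conjTranspose_eq_transpose_of_soLie hκ
  rw [← ht, hκ', neg_mul, neg_add_eq_zero] at h
  exact ⟨firstProj_comm h, by rw [← ht, hκ']⟩

theorem fromBlocks_eq_of_firstProj_comm {m : Type*} [Fintype m] [DecidableEq m]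
    {κ : Matrix (m ⊕ n) (m ⊕ n) ℂ} (h : firstProj m n * κ = κ * firstProj m n) :
    κ = Matrix.fromBlocks κ.toBlocks₁₁ 0 0 κ.toBlocks₂₂ := by
  rw [← Matrix.fromBlocks_toBlocks κ, Matrix.fromBlocks_multiply, Matrix.fromBlocks_multiply,
    Matrix.fromBlocks_inj] at h
  obtain ⟨-, h1, h2, -⟩ := h
  simp only [Matrix.mul_one, Matrix.mul_zero, Matrix.zero_mul, Matrix.one_mul, add_zero] at h1 h2
  conv_lhs => rw [← Matrix.fromBlocks_toBlocks κ, h1, ← h2]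

theorem hafnianForm_invariant {κ : Matrix (Fin 6 ⊕ Fin k) (Fin 6 ⊕ Fin k) ℂ}
    (hκ : κ ∈ soLie 6 k) (hκ' : κ.conjTranspose = -κ)
    (X : Fin 6 → Matrix (Fin 6 ⊕ Fin k) (Fin 6 ⊕ Fin k) ℂ) :
    ∑ l, hafnianForm (Fin k) (Function.update X l (κ * X l - X l * κ)) = 0 := by
  obtain ⟨h1, h2⟩ := soLie_skew hκ hκ'
  rw [fromBlocks_eq_of_firstProj_comm h1]
  refine sum_hafnianForm_update ?_ ?_ X
  · refine Finset.sum_eq_zero fun i _ => ?_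
    have := congrFun (congrFun h2 (Sum.inl i)) (Sum.inl i)
    exact self_eq_neg.1 this
  · ext i j
    exact congrFun (congrFun h2 (Sum.inr i)) (Sum.inr j)

/-- The coefficients of an endomorphism of `𝔭` of `𝔰𝔬(6,k)`. -/
def soCoeff (A : Module.End ℝ (Chart (soLie 6 k))) (b : Fin 6) (β : Fin k) (a : Fin 6)
    (α : Fin k) : ℂ :=
  complexify A (soElem (Pi.single a 1) α) (Sum.inl b) (Sum.inr β)

theorem trace_mul_soElem {X : Matrix (Fin 6 ⊕ Fin k) (Fin 6 ⊕ Fin k) ℂ}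
    (hX : IsComplexHerm (soLie 6 k) X) (b : Fin 6) (β : Fin k) :
    Matrix.trace (X * soElem (Pi.single b 1) β) = 2 * X (Sum.inl b) (Sum.inr β) := by
  rw [eq_offBlock_of_soLie hX, soElem, Matrix.fromBlocks_multiply, trace_fromBlocks]
  simp [Matrix.mul_vecMulVec, Matrix.trace_vecMulVec, two_mul]

theorem soCoeff_comm (hA : IsSymmetricAnnihilator A) (b : Fin 6) (β : Fin k) (a : Fin 6)
    (α : Fin k) : soCoeff A b β a α = soCoeff A a α b β := by
  have hX := isComplexHerm_soElem (Pi.single a 1) α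
  have hY := isComplexHerm_soElem (Pi.single b 1) β
  have h := hA.trace_complexify_mul hX hY
  rw [Matrix.trace_mul_comm (soElem _ _)] at h
  rw [trace_mul_soElem hX.complexify, trace_mul_soElem hY.complexify] at h
  exact mul_left_cancel₀ two_ne_zero h

theorem soCoeff_sum_eq_zero (hA : IsSymmetricAnnihilator A) (b : Fin 6 → Fin 6)
    (α : Fin 6 → Fin k) :
    ∑ l, ∑ β, matchingNumber (Function.update α l β) *
      (Matrix.updateRow (Matrix.of fun i => Pi.single (b i) (1 : ℂ)) l
        fun a => soCoeff A a β (b l) (α l)).det = 0 := by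
  have h := hA.sum_complexify (hafnianForm (Fin k))
    (fun κ hκ hκ' v => hafnianForm_invariant hκ hκ' _)
    (X := fun i => soElem (Pi.single (b i) 1) (α i)) (fun l => isComplexHerm_soElem _ _)
  simp only [hafnianForm_update_soElem] at h
  exact h

theorem det_single_perm_ne_zero (π : Equiv.Perm (Fin 6)) :
    (Matrix.of fun i => Pi.single (π i) (1 : ℂ)).det ≠ 0 := by
  have h : (Matrix.of fun i => Pi.single (π i) (1 : ℂ)) = (1 : Matrix (Fin 6) (Fin 6) ℂ).submatrix π id := by
    ext i j
    simp [Pi.single_apply, Matrix.one_apply, eq_comm]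
  rw [h, Matrix.det_permute, Matrix.det_one, mul_one]
  rcases Int.units_eq_one_or (Equiv.Perm.sign π) with h | h <;> simp [h]

/-- The Euler form on `e_0 ⊗ α_0, …, e_5 ⊗ α_5`: replacing slot `l` gives a nonzero determinant only
through the component along `e_l`, so only coefficients with equal `ℂ⁶` indices occur. -/
theorem soCoeff_sum_diag (hA : IsSymmetricAnnihilator A) (α : Fin 6 → Fin k) :
    ∑ l, hafnian₆ (fun i j => if i = l then soCoeff A l (α j) l (α l) else
      if j = l then soCoeff A l (α i) l (α l) else if α i = α j then 1 else 0) = 0 := by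
  have h := soCoeff_sum_eq_zero hA (Equiv.refl (Fin 6)) α
  simp only [det_updateRow_single] at h
  simp only [← fun l => sum_mul_matchingNumber_update (fun β => soCoeff A l β l (α l)) α l]
  rw [← mul_right_inj' (det_single_perm_ne_zero (Equiv.refl _)), mul_zero, ← h, Finset.mul_sum]
  refine Finset.sum_congr rfl fun l _ => ?_
  rw [Finset.mul_sum]
  refine Finset.sum_congr rfl fun β _ => ?_
  simp only [Equiv.refl_apply]
  ring

theorem exists_perm_apply_eq {a b : Fin 6} (hab : a ≠ b) :
    ∃ π : Equiv.Perm (Fin 6), π 0 = b ∧ π 1 = a := by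
  refine ⟨Equiv.swap (Equiv.swap 0 b 1) a * Equiv.swap 0 b, ?_, ?_⟩
  · rw [Equiv.Perm.mul_apply, Equiv.swap_apply_left, Equiv.swap_apply_of_ne_of_ne _ hab.symm]
    intro h
    have : Equiv.swap 0 b 0 = Equiv.swap 0 b 1 := by rw [← h, Equiv.swap_apply_left]
    simpa using (Equiv.injective _) this
  · simp

/-- The Euler form on a tuple with `e_a` in slots 0 and 1 and with `e_b` missing. A replaced slot
contributes only if it is 0 or 1, and then through its `e_b` component; the two contributions have
opposite signs. -/
theorem soCoeff_hafnian_eq (hA : IsSymmetricAnnihilator A) {a b : Fin 6} (hab : a ≠ b)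
    (α : Fin 6 → Fin k) :
    hafnian₆ (fun i j => if i = 0 then soCoeff A b (α j) a (α 0) else
      if j = 0 then soCoeff A b (α i) a (α 0) else if α i = α j then 1 else 0) =
    hafnian₆ (fun i j => if i = 1 then soCoeff A b (α j) a (α 1) else
      if j = 1 then soCoeff A b (α i) a (α 1) else if α i = α j then 1 else 0) := by
  obtain ⟨π, rfl, rfl⟩ := exists_perm_apply_eq hab
  have h := soCoeff_sum_eq_zero hA (Function.update π 0 (π 1)) α
  rw [← sum_mul_matchingNumber_update (fun β => soCoeff A (π 0) β (π 1) (α 0)),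
    ← sum_mul_matchingNumber_update (fun β => soCoeff A (π 0) β (π 1) (α 1))]
  set M : Matrix (Fin 6) (Fin 6) ℂ :=
    Matrix.of fun i => Pi.single (Function.update π 0 (π 1) i) (1 : ℂ) with hM
  set D := (Matrix.of fun i => Pi.single (π i) (1 : ℂ)).det with hD
  have h0 : ∀ r : Fin 6 → ℂ, (M.updateRow 0 r).det = D * r (π 0) := by
    intro r
    rw [hD, ← det_updateRow_single]
    congr 1
    ext i j
    by_cases hi : i = 0
    · subst hi; simp
    · simp [hM, hi]
  have h1 : ∀ r : Fin 6 → ℂ, (M.updateRow 1 r).det = -(D * r (π 0)) := by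
    intro r
    have : M.updateRow 1 r = (Matrix.updateRow (Matrix.of fun i => Pi.single (π i) (1 : ℂ)) 0
        r).submatrix (Equiv.swap 0 1) id := by
      ext i j
      rcases eq_or_ne i 0 with rfl | hi
      · simp [hM]
      rcases eq_or_ne i 1 with rfl | hi'
      · simp
      · simp [hM, hi, hi', Equiv.swap_apply_of_ne_of_ne hi hi']
    rw [this, Matrix.det_permute, det_updateRow_single, Equiv.Perm.sign_swap (by decide)]
    simp [hD]
  have h2 : ∀ l, l ≠ 0 → l ≠ 1 → ∀ r : Fin 6 → ℂ, (M.updateRow l r).det = 0 := by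
    intro l hl hl' r
    refine Matrix.det_zero_of_row_eq (i := 0) (j := 1) (by decide) ?_
    rw [Matrix.updateRow_ne hl.symm, Matrix.updateRow_ne hl'.symm]
    funext j
    simp [hM]
  rw [Fin.sum_univ_six] at h
  simp only [h0, h1, h2 2 (by decide) (by decide), h2 3 (by decide) (by decide),
    h2 4 (by decide) (by decide), h2 5 (by decide) (by decide), mul_zero, Finset.sum_const_zero,
    add_zero, Function.update_self, ne_eq, one_ne_zero, not_false_eq_true,
    Function.update_of_ne] at h
  rw [← mul_right_inj' (det_single_perm_ne_zero π), ← sub_eq_zero, ← h, Finset.mul_sum,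
    Finset.mul_sum, sub_eq_add_neg, ← Finset.sum_neg_distrib]
  congr 1 <;> refine Finset.sum_congr rfl fun β _ => ?_ <;> rw [← hD] <;> ring

theorem soCoeff_offDiag_row (hA : IsSymmetricAnnihilator A) {a b : Fin 6} (hab : a ≠ b)
    {α γ : Fin k} (h : α ≠ γ) :
    soCoeff A b α a γ = 0 ∧ soCoeff A b γ a γ = soCoeff A b α a α := by
  have key : ∀ {α γ : Fin k}, α ≠ γ → 5 * soCoeff A b α a γ = soCoeff A b γ a α := by
    intro α γ h
    -- All fifteen matchings contribute on the left; on the right only the three which join slots 0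
    -- and 1.
    have := soCoeff_hafnian_eq hA hab ![γ, α, α, α, α, α]
    simp [hafnian₆, h, h.symm] at this
    linear_combination this / 3
  refine ⟨?_, ?_⟩
  -- The relations `5x = y` and `5y = x` force `x = 0`; the denominator is `25 - 1`.
  · linear_combination (5 * key h + key h.symm) / 24
  -- Slots 0 and 2 carry the colour `γ` and must be joined, which leaves three matchings on each
  -- side.
  · have := soCoeff_hafnian_eq hA hab ![γ, α, γ, α, α, α]
    simp [hafnian₆, h, h.symm] at this
    linear_combination this / 3

/-- Write `x_j` for the coefficient with `ℂ⁶` index `j`. Colouring only slot `l` with `γ` gives `15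
x_l + 3 ∑_{j ≠ l} x_j = 0`. Summed over `l` this is 30 times the total, so the total vanishes and
then each `x_l` does. -/
theorem soCoeff_offDiag_same (hA : IsSymmetricAnnihilator A) (l : Fin 6) {α γ : Fin k}
    (h : α ≠ γ) : soCoeff A l α l γ = 0 := by
  have key : ∀ l, 12 * soCoeff A l α l γ + 3 * ∑ j, soCoeff A j α j γ = 0 := by
    intro l
    have := soCoeff_sum_diag hA (Function.update (fun _ => α) l γ)
    rw [Fin.sum_univ_six] at this ⊢
    have hs := fun l => soCoeff_comm hA l γ l α
    fin_cases l <;> simp [hafnian₆, h, h.symm, Function.update_apply, Fin.ext_iff, hs] at this ⊢ <;>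
      linear_combination this
  have hsum : ∑ l : Fin 6, (12 * soCoeff A l α l γ + 3 * ∑ j, soCoeff A j α j γ) = 0 :=
    Finset.sum_eq_zero fun l _ => key l
  rw [Finset.sum_add_distrib, ← Finset.mul_sum] at hsum
  simp at hsum
  linear_combination (key l - 3 / 30 * hsum) / 12

/-- Colouring exactly slots `i` and `j` with `γ` and comparing with the one-colour relation shows
`δ_i + δ_j = 0` for the differences `δ` of the two sides. The triangle of pairs in slots 0, 1, 2
kills the first three differences, and pairs with slot 0 kill the others. -/
theorem soCoeff_diag_same (hA : IsSymmetricAnnihilator A) (l : Fin 6) {α γ : Fin k}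
    (h : α ≠ γ) : soCoeff A l γ l γ = soCoeff A l α l α := by
  have h0 := soCoeff_sum_diag hA fun _ => α
  have h01 := soCoeff_sum_diag hA ![γ, γ, α, α, α, α]
  have h02 := soCoeff_sum_diag hA ![γ, α, γ, α, α, α]
  have h12 := soCoeff_sum_diag hA ![α, γ, γ, α, α, α]
  have h03 := soCoeff_sum_diag hA ![γ, α, α, γ, α, α]
  have h04 := soCoeff_sum_diag hA ![γ, α, α, α, γ, α]
  have h05 := soCoeff_sum_diag hA ![γ, α, α, α, α, γ]
  rw [Fin.sum_univ_six] at h0 h01 h02 h12 h03 h04 h05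
  simp [hafnian₆, h, h.symm] at h0 h01 h02 h12 h03 h04 h05
  fin_cases l
  · change soCoeff A 0 γ 0 γ = soCoeff A 0 α 0 α
    linear_combination (h01 + h02 - h12) / 6 - h0 / 30
  · change soCoeff A 1 γ 1 γ = soCoeff A 1 α 1 α
    linear_combination (h01 - h02 + h12) / 6 - h0 / 30
  · change soCoeff A 2 γ 2 γ = soCoeff A 2 α 2 α
    linear_combination (h02 + h12 - h01) / 6 - h0 / 30
  · change soCoeff A 3 γ 3 γ = soCoeff A 3 α 3 α
    linear_combination h03 / 3 - (h01 + h02 - h12) / 6 - h0 / 30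
  · change soCoeff A 4 γ 4 γ = soCoeff A 4 α 4 α
    linear_combination h04 / 3 - (h01 + h02 - h12) / 6 - h0 / 30
  · change soCoeff A 5 γ 5 γ = soCoeff A 5 α 5 α
    linear_combination h05 / 3 - (h01 + h02 - h12) / 6 - h0 / 30

/-- This collects the consequences of the Euler form: `A = s ⊗ 1`, where `s` acts on `ℂ⁶` and can be
read off in any one colour `α₀`. -/
theorem soLie_complexify_soElem (hA : IsSymmetricAnnihilator A) (α₀ : Fin k) (a : Fin 6)
    (α : Fin k) : complexify A (soElem (Pi.single a 1) α) =
      soElem (fun b => soCoeff A b α₀ a α₀) α := by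
  have hX := isComplexHerm_soElem (Pi.single a (1 : ℂ)) α
  have hY := isComplexHerm_soElem (fun b => soCoeff A b α₀ a α₀) α
  have hZ : (complexify A (soElem (Pi.single a (1 : ℂ)) α)).toBlocks₁₂ =
      (soElem (fun b => soCoeff A b α₀ a α₀) α).toBlocks₁₂ := by
    ext b β
    change soCoeff A b β a α =
      soElem (fun b => soCoeff A b α₀ a α₀) α (Sum.inl b) (Sum.inr β)
    rw [soElem_apply₁₂]
    split_ifs with h
    · subst h
      rcases eq_or_ne α₀ β with rfl | h
      · rfl
      rcases eq_or_ne a b with rfl | hab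
      · exact soCoeff_diag_same hA a h
      · exact (soCoeff_offDiag_row hA hab h).2
    · rcases eq_or_ne a b with rfl | hab
      · exact soCoeff_offDiag_same hA a h
      · exact (soCoeff_offDiag_row hA hab h).1
  rw [eq_offBlock_of_soLie hX.complexify, eq_offBlock_of_soLie hY, hZ]

theorem soLie_symmetricAnnihilator_eq_zero (hk : 2 ≤ k) (hA : IsSymmetricAnnihilator A) :
    A = 0 := by
  have : Nontrivial (Fin k) := Fin.nontrivial_iff_two_le.2 hk
  obtain ⟨α, β, hαβ⟩ := exists_pair_ne (Fin k)
  let s : Fin 6 → (Fin 6 → ℂ) := fun a b => soCoeff A b α a α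
  have hs : ∀ a b, s a b = s b a := fun a b => soCoeff_comm hA _ _ _ _
  have hAs : ∀ a α, complexify A (soElem (Pi.single a 1) α) = soElem (s a) α :=
    soLie_complexify_soElem hA α
  have h4 : ∀ a : Fin 4 → Fin 6, ∑ l, traceForm₄ (firstProj (Fin 6) (Fin k))
      (fun i => soElem (Function.update (β := fun _ => Fin 6 → ℂ) (fun i => Pi.single (a i) 1) l (s (a l)) i)
        (![α, β, α, β] i)) = 0 := by
    intro a
    have h := hA.sum_complexify (traceForm₄ (firstProj (Fin 6) (Fin k)))
      (fun κ hκ hκ' v => sum_traceForm₄_update (soLie_skew hκ hκ').1 _)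
      (X := fun i => soElem (Pi.single (a i) 1) (![α, β, α, β] i))
      (fun l => isComplexHerm_soElem _ _)
    rw [← h]
    refine Finset.sum_congr rfl fun l _ => congrArg _ ?_
    funext i
    by_cases hi : i = l
    · subst hi; simp [hAs]
    · simp [hi]
  simp only [traceForm₄_soElem _ hαβ, Fin.sum_univ_four] at h4
  -- With `ℂ⁶` indices `a, a, b, d`, all distinct but for the repetition, only the last two slots
  -- contribute, and each contributes an entry of `s` between `b` and `d`.
  have hoff : ∀ b d, b ≠ d → s b d = 0 := by
    intro b d hbd
    obtain ⟨a, ha, ha'⟩ : ∃ a : Fin 6, a ≠ b ∧ a ≠ d := by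
      revert b d; decide
    have := h4 ![a, a, b, d]
    simp [ha, ha', ha.symm, ha'.symm, hbd, hbd.symm, hs d b] at this
    exact this
  -- The indices `b, b, d, d` give vanishing sums of two diagonal entries; three distinct indices
  -- then make each entry vanish.
  have hdiag : ∀ b d, b ≠ d → s b b + s d d = 0 := by
    intro b d hbd
    have := h4 ![b, b, d, d]
    simp [hbd, hbd.symm] at this
    linear_combination this / 8
  have hzero : s = 0 := by
    funext a b
    rcases eq_or_ne a b with rfl | hab
    · obtain ⟨b, c, h1, h2, h3⟩ : ∃ b c : Fin 6, b ≠ a ∧ c ≠ a ∧ b ≠ c := by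
        revert a; decide
      simp only [Pi.zero_apply]
      linear_combination (hdiag _ _ h1 + hdiag _ _ h2 - hdiag _ _ h3) / 2
    · exact hoff a b hab
  refine hA.eq_zero_of_complexify (S := {Y | ∃ (a : Fin 6) (α : Fin k),
    Y = soElem (Pi.single a 1) α}) ?_ ?_ ?_
  · rintro _ ⟨a, α, rfl⟩; exact isComplexHerm_soElem _ _
  · rintro _ ⟨a, α, rfl⟩
    rw [hAs, hzero]
    exact soElem_zero α
  · intro X hX h
    rw [eq_offBlock_of_soLie hX]
    have : X.toBlocks₁₂ = 0 := by
      ext a α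
      have := h _ ⟨a, α, rfl⟩
      rw [trace_mul_soElem hX, mul_eq_zero] at this
      exact this.resolve_left two_ne_zero
    rw [this]
    exact Matrix.fromBlocks_zero

end SpecialOrthogonalRigidity

end Sugra

set_option linter.unusedSimpArgs false
set_option linter.unusedSectionVars false

namespace Sugra

/-! ### `𝔰𝔬*(2n)` in an eigenbasis of the symplectic matrix. -/

section SpecialOrthogonalStar

variable {n : ℕ}

theorem sympMat_conjTranspose (n : ℕ) : (sympMat n).conjTranspose = -sympMat n := by
  rw [sympMat, Matrix.fromBlocks_conjTranspose, Matrix.fromBlocks_neg]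
  simp

/-- For Hermitian matrices the condition `Aᴴ J + J A = 0` becomes the complex-linear condition of
anticommuting with `J`. Both linear conditions are preserved by conjugate transposition, so they cut
out the complexification. -/
theorem isComplexHerm_soStarLie_iff {X : Matrix (Fin n ⊕ Fin n) (Fin n ⊕ Fin n) ℂ} :
    IsComplexHerm (soStarLie n) X ↔
      X.transpose = -X ∧ X * sympMat n + sympMat n * X = 0 := by
  constructor
  · rintro ⟨x, y, rfl⟩
    have hx := x.toMatrix_mem
    have hy := y.toMatrix_mem
    have hx2 := hx.2
    have hy2 := hy.2
    rw [x.toMatrix_conjTranspose] at hx2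
    rw [y.toMatrix_conjTranspose] at hy2
    refine ⟨?_, ?_⟩
    · rw [Matrix.transpose_add, Matrix.transpose_smul, eq_neg_of_add_eq_zero_left hx.1,
        eq_neg_of_add_eq_zero_left hy.1]
      simp [add_comm]
    · rw [add_mul, mul_add, add_add_add_comm, hx2, smul_mul_assoc, mul_smul_comm, ← smul_add, hy2]
      simp
  · rintro ⟨h1, h2⟩
    have h1' : X.conjTranspose.transpose = -X.conjTranspose := by
      rw [← Matrix.conjTranspose_neg, ← h1]; rfl
    have h2' : X.conjTranspose * sympMat n + sympMat n * X.conjTranspose = 0 := by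
      have := congrArg Matrix.conjTranspose h2
      simp only [Matrix.conjTranspose_add, Matrix.conjTranspose_mul, sympMat_conjTranspose,
        Matrix.conjTranspose_zero, neg_mul, mul_neg] at this
      rw [← neg_add, neg_eq_zero, add_comm] at this
      exact this
    refine isComplexHerm_of_mem ⟨?_, ?_⟩ ⟨?_, ?_⟩
    · rw [Matrix.transpose_add, h1, h1']; abel
    · rw [Matrix.conjTranspose_add, Matrix.conjTranspose_conjTranspose, add_comm X.conjTranspose,
        add_mul, mul_add, add_add_add_comm, h2, h2', add_zero]
    · rw [Matrix.transpose_smul, Matrix.transpose_sub, h1, h1', ← smul_add]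
      simp
    · rw [Matrix.conjTranspose_smul, Matrix.conjTranspose_sub,
        Matrix.conjTranspose_conjTranspose, Complex.star_def, Complex.conj_I,
        show (-Complex.I) • (X.conjTranspose - X) = Complex.I • (X - X.conjTranspose) by module,
        smul_mul_assoc, mul_smul_comm, ← smul_add, sub_mul, mul_sub, sub_add_sub_comm, h2, h2']
      simp

/-- The eigenvectors of the symplectic matrix. -/
def sympBasis (n : ℕ) : Matrix (Fin n ⊕ Fin n) (Fin n ⊕ Fin n) ℂ :=
  Matrix.fromBlocks 1 1 (Complex.I • 1) (-Complex.I • 1)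

/-- The inverse of `sympBasis`. -/
def sympBasisInv (n : ℕ) : Matrix (Fin n ⊕ Fin n) (Fin n ⊕ Fin n) ℂ :=
  (1 / 2 : ℂ) • Matrix.fromBlocks 1 (-Complex.I • 1) 1 (Complex.I • 1)

theorem fromBlocks_two_smul (n : ℕ) : Matrix.fromBlocks ((2 : ℂ) • 1) 0 0 ((2 : ℂ) • 1) =
    (2 : ℂ) • (1 : Matrix (Fin n ⊕ Fin n) (Fin n ⊕ Fin n) ℂ) := by
  rw [← Matrix.fromBlocks_one, Matrix.fromBlocks_smul]; simp

theorem sympBasis_mul_inv (n : ℕ) : sympBasis n * sympBasisInv n = 1 := by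
  rw [sympBasis, sympBasisInv, mul_smul_comm, Matrix.fromBlocks_multiply]
  simp only [Matrix.mul_one, Matrix.one_mul, Matrix.smul_mul, Matrix.mul_smul, smul_smul]
  have h : Complex.I * -Complex.I = 1 := by simp
  have h' : -Complex.I * Complex.I = 1 := by simp
  rw [h, h', ← two_smul ℂ (1 : Matrix (Fin n) (Fin n) ℂ), one_smul, ← two_smul ℂ (1 : Matrix (Fin n) (Fin n) ℂ), ← add_smul, ← add_smul]
  simp [fromBlocks_two_smul, smul_smul]

theorem sympBasisInv_mul (n : ℕ) : sympBasisInv n * sympBasis n = 1 :=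
  mul_eq_one_comm.1 (sympBasis_mul_inv n)

theorem sympMat_mul_sympBasis (n : ℕ) :
    sympMat n * sympBasis n = sympBasis n * (Complex.I • sigMat n n) := by
  rw [sympMat, sympBasis, sigMat, mul_smul_comm, Matrix.fromBlocks_multiply,
    Matrix.fromBlocks_multiply, Matrix.fromBlocks_smul, Matrix.fromBlocks_inj]
  simp [smul_smul]

theorem sympBasis_transpose_mul (n : ℕ) :
    (sympBasis n).transpose * sympBasis n = (2 : ℂ) • Matrix.fromBlocks 0 1 1 0 := by
  rw [sympBasis, Matrix.fromBlocks_transpose, Matrix.fromBlocks_multiply, Matrix.fromBlocks_smul,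
    Matrix.fromBlocks_inj]
  simp [smul_smul, two_smul]

theorem sympBasis_conjTranspose (n : ℕ) :
    (sympBasis n).conjTranspose = (2 : ℂ) • sympBasisInv n := by
  rw [sympBasis, sympBasisInv, Matrix.fromBlocks_conjTranspose]
  simp [smul_smul]

theorem sympBasisInv_conjTranspose (n : ℕ) :
    (sympBasisInv n).conjTranspose = (1 / 2 : ℂ) • sympBasis n := by
  rw [sympBasis, sympBasisInv, Matrix.conjTranspose_smul, Matrix.fromBlocks_conjTranspose]
  simp [smul_smul]

theorem sympBasisInv_mul_sympMat (n : ℕ) :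
    sympBasisInv n * sympMat n = (Complex.I • sigMat n n) * sympBasisInv n := by
  rw [← mul_one (sympBasisInv n * sympMat n), ← sympBasis_mul_inv, mul_assoc, ← mul_assoc (sympMat n),
    sympMat_mul_sympBasis, ← mul_assoc, ← mul_assoc, sympBasisInv_mul, one_mul]

/-- In the eigenbasis, anticommuting with `J` means being block off-diagonal. Since `Tᵀ T` is twice
the exchange of the blocks, antisymmetry of the conjugated matrix becomes antisymmetry of each
off-diagonal block. -/
theorem isComplexHerm_soStarLie_conj_iff {Y : Matrix (Fin n ⊕ Fin n) (Fin n ⊕ Fin n) ℂ} :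
    IsComplexHerm (soStarLie n) (sympBasis n * Y * sympBasisInv n) ↔
      ∃ Z V : Matrix (Fin n) (Fin n) ℂ, Z.transpose = -Z ∧ V.transpose = -V ∧
        Y = offBlock Z V := by
  set T := sympBasis n with hT
  set T' := sympBasisInv n with hT'
  have h1 : T * T' = 1 := sympBasis_mul_inv n
  have h2 : T' * T = 1 := sympBasisInv_mul n
  have h1t : T'.transpose * T.transpose = 1 := by
    rw [← Matrix.transpose_mul, h1, Matrix.transpose_one]
  have h2t : T.transpose * T'.transpose = 1 := by
    rw [← Matrix.transpose_mul, h2, Matrix.transpose_one]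
  have hs := sympBasis_transpose_mul n
  rw [← hT] at hs
  set s : Matrix (Fin n ⊕ Fin n) (Fin n ⊕ Fin n) ℂ := Matrix.fromBlocks 0 1 1 0 with hsdef
  have e1 : (T * Y * T').transpose = -(T * Y * T') ↔ Y.transpose * s = -(s * Y) := by
    have : T.transpose * (T * Y * T').transpose * T = (2 : ℂ) • (Y.transpose * s) := by
      rw [Matrix.transpose_mul, Matrix.transpose_mul, ← mul_assoc, h2t, one_mul, mul_assoc, hs,
        mul_smul_comm]
    have h' : T.transpose * (T * Y * T') * T = (2 : ℂ) • (s * Y) := by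
      rw [mul_assoc, mul_assoc (T * Y), h2, mul_one, ← mul_assoc, hs, smul_mul_assoc]
    constructor
    · intro h
      rw [h, mul_neg, neg_mul, h', ← smul_neg] at this
      exact (smul_right_injective _ two_ne_zero this).symm
    · intro h
      rw [h, smul_neg, ← h', ← neg_mul, ← mul_neg] at this
      have h3 := congrArg (fun M => T'.transpose * M * T') this
      simp only [mul_assoc, h1, mul_one] at h3
      simp only [← mul_assoc, h1t, one_mul] at h3
      exact h3
  have e2 : T * Y * T' * sympMat n + sympMat n * (T * Y * T') = 0 ↔
      Y * sigMat n n + sigMat n n * Y = 0 := by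
    have : T * Y * T' * sympMat n + sympMat n * (T * Y * T') =
        Complex.I • (T * (Y * sigMat n n + sigMat n n * Y) * T') := by
      rw [mul_assoc, sympBasisInv_mul_sympMat, mul_assoc T Y T', ← mul_assoc (sympMat n),
        sympMat_mul_sympBasis]
      simp only [mul_add, add_mul, smul_mul_assoc, mul_smul_comm, smul_add, ← hT, ← hT', mul_assoc]
    rw [this]
    constructor
    · intro h
      have h3 := (smul_eq_zero.1 h).resolve_left Complex.I_ne_zero
      have h4 := congrArg (fun M => T' * M * T) h3
      simp only [mul_assoc, h2, mul_one] at h4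
      simpa only [← mul_assoc, h2, one_mul, mul_zero, zero_mul] using h4
    · intro h
      rw [h]; simp
  rw [isComplexHerm_soStarLie_iff, e1, e2]
  constructor
  · rintro ⟨ht, hσ⟩
    have hY := eq_offBlock_of_anticommute hσ
    rw [hY, hsdef, Matrix.fromBlocks_transpose, Matrix.fromBlocks_multiply,
      Matrix.fromBlocks_multiply, Matrix.fromBlocks_neg, Matrix.fromBlocks_inj] at ht
    refine ⟨_, _, ?_, ?_, hY⟩
    · simpa using ht.2.2.2
    · simpa using ht.1
  · rintro ⟨Z, V, hZ, hV, rfl⟩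
    refine ⟨?_, ?_⟩
    · rw [hsdef, Matrix.fromBlocks_transpose, Matrix.fromBlocks_multiply,
        Matrix.fromBlocks_multiply, Matrix.fromBlocks_neg]
      simp [hZ, hV]
    · rw [sigMat, Matrix.fromBlocks_multiply, Matrix.fromBlocks_multiply, Matrix.fromBlocks_add]
      simp

/-- An endomorphism of `𝔭` of `𝔰𝔬*(2n)`, in an eigenbasis of the symplectic matrix. -/
def soStarComplexify (A : Module.End ℝ (Chart (soStarLie n)))
    (Y : Matrix (Fin n ⊕ Fin n) (Fin n ⊕ Fin n) ℂ) : Matrix (Fin n ⊕ Fin n) (Fin n ⊕ Fin n) ℂ :=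
  sympBasisInv n * complexify A (sympBasis n * Y * sympBasisInv n) * sympBasis n

variable {A : Module.End ℝ (Chart (soStarLie n))}

theorem complexify_sympBasis (Y : Matrix (Fin n ⊕ Fin n) (Fin n ⊕ Fin n) ℂ) :
    complexify A (sympBasis n * Y * sympBasisInv n) =
      sympBasis n * soStarComplexify A Y * sympBasisInv n := by
  rw [soStarComplexify]
  generalize complexify A (sympBasis n * Y * sympBasisInv n) = W
  rw [mul_assoc, mul_assoc, sympBasis_mul_inv, mul_one, ← mul_assoc, sympBasis_mul_inv, one_mul]

theorem exists_soStarComplexify {Z V : Matrix (Fin n) (Fin n) ℂ} (hZ : Z.transpose = -Z)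
    (hV : V.transpose = -V) : ∃ Z' V' : Matrix (Fin n) (Fin n) ℂ, Z'.transpose = -Z' ∧
      V'.transpose = -V' ∧ soStarComplexify A (offBlock Z V) = offBlock Z' V' := by
  have h := (isComplexHerm_soStarLie_conj_iff.2 ⟨Z, V, hZ, hV, rfl⟩).complexify (A := A)
  rw [complexify_sympBasis] at h
  exact isComplexHerm_soStarLie_conj_iff.1 h

theorem sympBasis_conj_mul (Y Y' : Matrix (Fin n ⊕ Fin n) (Fin n ⊕ Fin n) ℂ) :
    (sympBasis n * Y * sympBasisInv n) * (sympBasis n * Y' * sympBasisInv n) =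
      sympBasis n * (Y * Y') * sympBasisInv n := by
  have h : sympBasisInv n * (sympBasis n * (Y' * sympBasisInv n)) = Y' * sympBasisInv n := by
    rw [← mul_assoc, sympBasisInv_mul, one_mul]
  simp only [mul_assoc, h]

theorem sympBasisInv_conj (Y : Matrix (Fin n ⊕ Fin n) (Fin n ⊕ Fin n) ℂ) :
    sympBasisInv n * (sympBasis n * Y * sympBasisInv n) * sympBasis n = Y := by
  rw [mul_assoc, mul_assoc, mul_assoc, sympBasisInv_mul, mul_one, ← mul_assoc, sympBasisInv_mul,
    one_mul]

theorem trace_sympBasis_conj (Y Y' : Matrix (Fin n ⊕ Fin n) (Fin n ⊕ Fin n) ℂ) :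
    Matrix.trace ((sympBasis n * Y * sympBasisInv n) * (sympBasis n * Y' * sympBasisInv n)) =
      Matrix.trace (Y * Y') := by
  rw [sympBasis_conj_mul, Matrix.trace_mul_comm, ← mul_assoc, sympBasisInv_mul, one_mul]

theorem IsSymmetricAnnihilator.trace_soStarComplexify (hA : IsSymmetricAnnihilator A)
    {Z V Z' V' : Matrix (Fin n) (Fin n) ℂ} (hZ : Z.transpose = -Z) (hV : V.transpose = -V)
    (hZ' : Z'.transpose = -Z') (hV' : V'.transpose = -V') :
    Matrix.trace (soStarComplexify A (offBlock Z V) * offBlock Z' V') =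
      Matrix.trace (offBlock Z V * soStarComplexify A (offBlock Z' V')) := by
  rw [← trace_sympBasis_conj, ← trace_sympBasis_conj (offBlock Z V), ← complexify_sympBasis,
    ← complexify_sympBasis]
  exact hA.trace_complexify_mul (isComplexHerm_soStarLie_conj_iff.2 ⟨Z, V, hZ, hV, rfl⟩)
    (isComplexHerm_soStarLie_conj_iff.2 ⟨Z', V', hZ', hV', rfl⟩)

/-- Conjugation by `sympBasis` as a linear map. -/
def sympConj (n : ℕ) : Matrix (Fin n ⊕ Fin n) (Fin n ⊕ Fin n) ℂ →ₗ[ℂ]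
    Matrix (Fin n ⊕ Fin n) (Fin n ⊕ Fin n) ℂ :=
  (LinearMap.mulRight ℂ (sympBasis n)).comp (LinearMap.mulLeft ℂ (sympBasisInv n))

theorem sympConj_apply (X : Matrix (Fin n ⊕ Fin n) (Fin n ⊕ Fin n) ℂ) :
    sympConj n X = sympBasisInv n * X * sympBasis n := rfl

theorem sympConj_mul (X Y : Matrix (Fin n ⊕ Fin n) (Fin n ⊕ Fin n) ℂ) :
    sympConj n (X * Y) = sympConj n X * sympConj n Y := by
  simp only [sympConj_apply]
  have h : sympBasis n * (sympBasisInv n * (Y * sympBasis n)) = Y * sympBasis n := by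
    rw [← mul_assoc, sympBasis_mul_inv, one_mul]
  simp only [mul_assoc, h]

/-- Elements of `𝔨` commute with `J`, so in the eigenbasis they commute with `firstProj`; the forms
invariant under such matrices pull back to `𝔨`-invariant forms. -/
theorem IsSymmetricAnnihilator.sum_soStarComplexify (hA : IsSymmetricAnnihilator A) {k : ℕ}
    (φ : Matrix (Fin n ⊕ Fin n) (Fin n ⊕ Fin n) ℂ [⋀^Fin k]→ₗ[ℂ] ℂ)
    (hφ : ∀ κ, firstProj (Fin n) (Fin n) * κ = κ * firstProj (Fin n) (Fin n) → ∀ v,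
      ∑ l, φ (Function.update v l (κ * v l - v l * κ)) = 0)
    (Z V : Fin k → Matrix (Fin n) (Fin n) ℂ) (hZ : ∀ l, (Z l).transpose = -Z l)
    (hV : ∀ l, (V l).transpose = -V l) :
    ∑ l, φ (Function.update (fun l => offBlock (Z l) (V l)) l
      (soStarComplexify A (offBlock (Z l) (V l)))) = 0 := by
  have hu : ∀ (X : Fin k → Matrix (Fin n ⊕ Fin n) (Fin n ⊕ Fin n) ℂ) l Y,
      (φ.compLinearMap (sympConj n)) (Function.update X l Y) =
        φ (Function.update (fun i => sympConj n (X i)) l (sympConj n Y)) := by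
    intro X l Y
    rw [AlternatingMap.compLinearMap_apply]
    congr 1
    funext i
    by_cases hi : i = l
    · subst hi; simp
    · simp [hi]
  have h := hA.sum_complexify (φ.compLinearMap (sympConj n)) (fun κ hκ hκ' v => ?_)
    (X := fun l => sympBasis n * offBlock (Z l) (V l) * sympBasisInv n)
    (fun l => isComplexHerm_soStarLie_conj_iff.2 ⟨_, _, hZ l, hV l, rfl⟩)
  · rw [← h]
    refine Finset.sum_congr rfl fun l _ => ?_
    rw [hu]
    simp only [sympConj_apply, sympBasisInv_conj]
    rfl
  · have hκ2 := hκ.2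
    rw [hκ', neg_mul, neg_add_eq_zero] at hκ2
    have hc : sympConj n κ * sigMat n n = sigMat n n * sympConj n κ := by
      have hσ : sigMat n n = (-Complex.I) • sympConj n (sympMat n) := by
        rw [sympConj_apply, mul_assoc, sympMat_mul_sympBasis, ← mul_assoc, sympBasisInv_mul,
          one_mul, smul_smul]
        simp
      rw [hσ, mul_smul_comm, smul_mul_assoc, ← sympConj_mul, ← sympConj_mul, hκ2]
    rw [← hφ (sympConj n κ) (firstProj_comm hc) (fun l => sympConj n (Chart.toMatrix _ (v l)))]
    refine Finset.sum_congr rfl fun l _ => ?_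
    rw [hu, map_sub, sympConj_mul, sympConj_mul]

/-- The eigenbasis is unitary up to a scalar, so conjugation by it commutes with conjugate
transposition. -/
theorem soStarComplexify_conjTranspose {Z V : Matrix (Fin n) (Fin n) ℂ} (hZ : Z.transpose = -Z)
    (hV : V.transpose = -V) : soStarComplexify A (offBlock Z V).conjTranspose =
      (soStarComplexify A (offBlock Z V)).conjTranspose := by
  have h := (isComplexHerm_soStarLie_conj_iff.2 ⟨Z, V, hZ, hV, rfl⟩).complexify_conjTranspose
    (A := A)
  have hc : ∀ Y : Matrix (Fin n ⊕ Fin n) (Fin n ⊕ Fin n) ℂ,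
      (sympBasis n * Y * sympBasisInv n).conjTranspose =
        sympBasis n * Y.conjTranspose * sympBasisInv n := by
    intro Y
    rw [Matrix.conjTranspose_mul, Matrix.conjTranspose_mul, sympBasis_conjTranspose,
      sympBasisInv_conjTranspose, mul_smul_comm, mul_smul_comm, smul_mul_assoc, smul_smul, mul_assoc]
    norm_num
  rw [complexify_sympBasis, hc, hc, complexify_sympBasis] at h
  rw [← sympBasisInv_conj (soStarComplexify A (offBlock Z V).conjTranspose), h, sympBasisInv_conj]

/-- Upper blocks are enough, because conjugate transposition carries them to lower blocks, and the
elementary antisymmetric matrices detect every antisymmetric block under the trace. -/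
theorem IsSymmetricAnnihilator.eq_zero_of_soStarComplexify (hA : IsSymmetricAnnihilator A)
    (h : ∀ a b, soStarComplexify A (offBlock (Matrix.single a b 1 - Matrix.single b a 1) 0) = 0) :
    A = 0 := by
  have ht : ∀ a b : Fin n, (Matrix.single a b (1 : ℂ) - Matrix.single b a 1).transpose =
      -(Matrix.single a b (1 : ℂ) - Matrix.single b a 1) := by
    intro a b; simp
  have ht' : ∀ a b : Fin n, (Matrix.single a b (1 : ℂ) - Matrix.single b a 1).conjTranspose =
      -(Matrix.single a b (1 : ℂ) - Matrix.single b a 1) := by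
    intro a b; simp
  refine hA.eq_zero_of_complexify (S := {X | ∃ a b, X = sympBasis n *
    offBlock (Matrix.single a b 1 - Matrix.single b a 1) 0 * sympBasisInv n ∨ X = sympBasis n *
    offBlock 0 (Matrix.single a b 1 - Matrix.single b a 1) * sympBasisInv n}) ?_ ?_ ?_
  · rintro _ ⟨a, b, rfl | rfl⟩
    · exact isComplexHerm_soStarLie_conj_iff.2 ⟨_, _, ht a b, by simp, rfl⟩
    · exact isComplexHerm_soStarLie_conj_iff.2 ⟨_, _, by simp, ht a b, rfl⟩
  · rintro _ ⟨a, b, rfl | rfl⟩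
    · rw [complexify_sympBasis, h]; simp
    · have h1 := soStarComplexify_conjTranspose (A := A) (ht b a) (V := 0) (by simp)
      rw [h, Matrix.fromBlocks_conjTranspose, ht'] at h1
      simp only [Matrix.conjTranspose_zero, neg_sub] at h1
      rw [complexify_sympBasis, h1]; simp
  · intro X hX hX0
    obtain ⟨Y, rfl⟩ : ∃ Y, X = sympBasis n * Y * sympBasisInv n :=
      ⟨sympConj n X, by
        rw [sympConj_apply, mul_assoc, mul_assoc, sympBasis_mul_inv, mul_one, ← mul_assoc,
          sympBasis_mul_inv, one_mul]⟩
    obtain ⟨Z, V, hZ, hV, rfl⟩ := isComplexHerm_soStarLie_conj_iff.1 hX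
    have hz : ∀ {Z : Matrix (Fin n) (Fin n) ℂ}, Z.transpose = -Z →
        (∀ a b, Matrix.trace (Z * (Matrix.single a b 1 - Matrix.single b a 1)) = 0) → Z = 0 := by
      intro Z hZ h
      ext a b
      have h1 := h b a
      rw [mul_sub, Matrix.trace_sub, trace_mul_single_apply, trace_mul_single_apply] at h1
      have h2 : Z b a = -Z a b := congrFun (congrFun hZ a) b
      rw [Matrix.zero_apply]
      linear_combination (h1 + h2) / 2
    have hZ0 : Z = 0 := hz hZ fun a b => by
      have := hX0 _ ⟨a, b, Or.inr rfl⟩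
      rw [trace_sympBasis_conj, Matrix.fromBlocks_multiply, trace_fromBlocks] at this
      simpa using this
    have hV0 : V = 0 := hz hV fun a b => by
      have := hX0 _ ⟨a, b, Or.inl rfl⟩
      rw [trace_sympBasis_conj, Matrix.fromBlocks_multiply, trace_fromBlocks] at this
      simpa using this
    rw [hZ0, hV0, show (offBlock 0 0 : Matrix (Fin n ⊕ Fin n) (Fin n ⊕ Fin n) ℂ) = 0 from
      Matrix.fromBlocks_zero]
    simp

end SpecialOrthogonalStar

end Sugra

set_option linter.unusedSimpArgs false
set_option linter.unusedSectionVars false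

namespace Sugra

/-! ### Rigidity for `SO*(12)`. -/

section SoStarRigidity

variable {n : Type*} [Fintype n] [DecidableEq n]

/-- The elementary antisymmetric matrices. -/
def altUnit (a b : n) : Matrix n n ℂ := Matrix.single a b 1 - Matrix.single b a 1

theorem altUnit_transpose (a b : n) : (altUnit a b).transpose = -altUnit a b := by
  simp [altUnit]

theorem altUnit_apply (a b i j : n) : altUnit a b i j =
    (if a = i ∧ b = j then 1 else 0) - (if b = i ∧ a = j then 1 else 0) := by
  simp [altUnit, Matrix.single_apply]

theorem eq_zero_of_trace_mul_altUnit {Z : Matrix n n ℂ} (hZ : Z.transpose = -Z)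
    (h : ∀ a b, Matrix.trace (Z * altUnit a b) = 0) : Z = 0 := by
  ext a b
  have h1 := h b a
  rw [altUnit, mul_sub, Matrix.trace_sub, trace_mul_single_apply, trace_mul_single_apply] at h1
  have h2 : Z b a = -Z a b := congrFun (congrFun hZ a) b
  rw [Matrix.zero_apply]
  linear_combination (h1 + h2) / 2

theorem trace_symProd₃ {K : Type*} [CommRing K] (x y z : Matrix n n K) :
    Matrix.trace (symProd₃ x y z) =
      3 * (Matrix.trace (x * y * z) + Matrix.trace (x * z * y)) := by
  simp only [symProd₃, Matrix.trace_add]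
  rw [Matrix.trace_mul_cycle y x z, Matrix.trace_mul_cycle z y x, Matrix.trace_mul_cycle y z x,
    Matrix.trace_mul_cycle z x y, Matrix.trace_mul_cycle y z x]
  ring

theorem trace_single_mul_three (a b c d e f : n) (w₁ w₂ w₃ : Matrix n n ℂ) :
    Matrix.trace (Matrix.single a b 1 * w₁ * (Matrix.single c d 1 * w₂) *
      (Matrix.single e f 1 * w₃)) = w₁ b c * w₂ d e * w₃ f a := by
  rw [← Matrix.mul_assoc, ← Matrix.mul_assoc, Matrix.single_mul_mul_single,
    Matrix.single_mul_mul_single, Matrix.trace_single_mul]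
  simp

theorem trace_altUnit_mul_three (a b c d e f : n) (w₁ w₂ w₃ : Matrix n n ℂ) :
    Matrix.trace (altUnit a b * w₁ * (altUnit c d * w₂) * (altUnit e f * w₃)) =
      w₁ b c * w₂ d e * w₃ f a - w₁ a c * w₂ d e * w₃ f b - w₁ b d * w₂ c e * w₃ f a +
      w₁ a d * w₂ c e * w₃ f b - w₁ b c * w₂ d f * w₃ e a + w₁ a c * w₂ d f * w₃ e b +
      w₁ b d * w₂ c f * w₃ e a - w₁ a d * w₂ c f * w₃ e b := by
  simp only [altUnit, Matrix.sub_mul, Matrix.mul_sub, Matrix.trace_sub, trace_single_mul_three]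
  ring

theorem symTrace₃_fromBlocks {m : Type*} [Fintype m] [DecidableEq m] (x y z : Matrix m m ℂ)
    (x' y' z' : Matrix n n ℂ) :
    symTrace₃ (firstProj m n) (Matrix.fromBlocks x 0 0 x') (Matrix.fromBlocks y 0 0 y')
      (Matrix.fromBlocks z 0 0 z') = Matrix.trace (symProd₃ x y z) := by
  simp [symProd₃, Matrix.fromBlocks_multiply, Matrix.fromBlocks_add, trace_fromBlocks]

theorem traceForm₆_offBlock {m : Type*} [Fintype m] [DecidableEq m] (Z : Fin 6 → Matrix m n ℂ)
    (V : Fin 6 → Matrix n m ℂ) :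
    traceForm₆ (firstProj m n) (fun l => offBlock (Z l) (V l)) =
      sexticValue (fun i j => Z i * V j - Z j * V i)
        (fun x y z => Matrix.trace (symProd₃ x y z)) id := by
  simp only [traceForm₆, sexticForm, AlternatingMap.coe_mk, MultilinearMap.coe_mk, sexticValue,
    commutatorMap_offBlock, symTrace₃_fromBlocks, id]

theorem symProd₃_zero_left {K : Type*} [CommRing K] (y z : Matrix n n K) :
    symProd₃ 0 y z = 0 := by simp [symProd₃]

theorem symProd₃_zero_mid {K : Type*} [CommRing K] (y z : Matrix n n K) :
    symProd₃ y 0 z = 0 := by simp [symProd₃]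

theorem symProd₃_zero_right {K : Type*} [CommRing K] (y z : Matrix n n K) :
    symProd₃ y z 0 = 0 := by simp [symProd₃]

theorem symProd₃_neg {K : Type*} [CommRing K] (x y z : Matrix n n K) :
    symProd₃ (-x) y z = -symProd₃ x y z ∧ symProd₃ x (-y) z = -symProd₃ x y z ∧
      symProd₃ x y (-z) = -symProd₃ x y z := by
  refine ⟨?_, ?_, ?_⟩ <;> simp only [symProd₃] <;> noncomm_ring

variable {n : ℕ} {A : Module.End ℝ (Chart (soStarLie n))}

/-- As in the unitary case, self-adjointness and the Kähler form give the same pairing with opposite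
signs, so `A` maps `𝔭⁺` into `𝔭⁻`. -/
theorem exists_soStarComplexify_upper (hA : IsSymmetricAnnihilator A) {Z : Matrix (Fin n) (Fin n) ℂ}
    (hZ : Z.transpose = -Z) : ∃ N : Matrix (Fin n) (Fin n) ℂ, N.transpose = -N ∧
      soStarComplexify A (offBlock Z 0) = offBlock 0 N := by
  obtain ⟨Z', N, hZ', hN, h⟩ := exists_soStarComplexify (A := A) hZ (V := 0) (by simp)
  refine ⟨N, hN, ?_⟩
  suffices hz : Z' = 0 by rw [h, hz]
  refine eq_zero_of_trace_mul_altUnit hZ' fun a b => ?_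
  have hU := altUnit_transpose a b
  obtain ⟨Z₁, V₁, hZ₁, hV₁, h₁⟩ := exists_soStarComplexify (A := A) (Z := 0) (by simp) hU
  have e1 := hA.trace_soStarComplexify hZ (V := 0) (by simp) (Z' := 0) (by simp) hU
  have e2 := hA.sum_soStarComplexify (traceForm₂ (firstProj (Fin n) (Fin n)))
    (fun κ hκ v => sum_traceForm₂_update hκ v) ![Z, 0] ![0, altUnit a b]
    (by intro l; fin_cases l <;> simp [hZ]) (by intro l; fin_cases l <;> simp [hU])
  rw [Fin.sum_univ_two] at e2
  simp only [Matrix.cons_val_zero, Matrix.cons_val_one] at e2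
  rw [h, h₁] at e1 e2
  simp only [update_offBlock, traceForm₂_offBlock'] at e2
  simp [Function.update, Matrix.fromBlocks_multiply, trace_fromBlocks] at e1 e2
  linear_combination (e1 + e2) / 2

theorem exists_soStarComplexify_lower (hA : IsSymmetricAnnihilator A) {V : Matrix (Fin n) (Fin n) ℂ}
    (hV : V.transpose = -V) : ∃ M : Matrix (Fin n) (Fin n) ℂ,
      soStarComplexify A (offBlock 0 V) = offBlock M 0 := by
  have hV' : V.conjTranspose.transpose = -V.conjTranspose := by
    rw [← Matrix.conjTranspose_neg, ← hV]; rfl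
  obtain ⟨N, -, hN⟩ := exists_soStarComplexify_upper hA hV'
  have h := soStarComplexify_conjTranspose (A := A) hV' (V := 0) (by simp)
  rw [hN] at h
  refine ⟨N.conjTranspose, ?_⟩
  simpa [Matrix.fromBlocks_conjTranspose] using h

/-- `tr F³` is evaluated on four vectors of `𝔭⁺` and two of `𝔭⁻`. Since it needs three of each type,
the images of `w₀` and `w₁` drop out and only the images `N i` contribute. -/
theorem soStar_sexticValue_sum (hA : IsSymmetricAnnihilator A) {z : Fin 4 → Matrix (Fin n) (Fin n) ℂ}
    (hz : ∀ i, (z i).transpose = -z i) {N : Fin 4 → Matrix (Fin n) (Fin n) ℂ}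
    (hN : ∀ i, soStarComplexify A (offBlock (z i) 0) = offBlock 0 (N i))
    {w₀ w₁ : Matrix (Fin n) (Fin n) ℂ} (hw₀ : w₀.transpose = -w₀) (hw₁ : w₁.transpose = -w₁) :
    (symProd₃ (z 1 * N 0) (z 2 * w₀) (z 3 * w₁)).trace - (symProd₃ (z 1 * N 0) (z 2 * w₁) (z 3 * w₀)).trace -
      (symProd₃ (z 2 * N 0) (z 1 * w₀) (z 3 * w₁)).trace + (symProd₃ (z 2 * N 0) (z 1 * w₁) (z 3 * w₀)).trace +
      (symProd₃ (z 3 * N 0) (z 1 * w₀) (z 2 * w₁)).trace - (symProd₃ (z 3 * N 0) (z 1 * w₁) (z 2 * w₀)).trace -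
      (symProd₃ (z 0 * N 1) (z 2 * w₀) (z 3 * w₁)).trace + (symProd₃ (z 0 * N 1) (z 2 * w₁) (z 3 * w₀)).trace +
      (symProd₃ (z 0 * w₀) (z 2 * N 1) (z 3 * w₁)).trace - (symProd₃ (z 0 * w₀) (z 3 * N 1) (z 2 * w₁)).trace -
      (symProd₃ (z 0 * w₁) (z 2 * N 1) (z 3 * w₀)).trace + (symProd₃ (z 0 * w₁) (z 3 * N 1) (z 2 * w₀)).trace +
      (symProd₃ (z 0 * N 2) (z 1 * w₀) (z 3 * w₁)).trace - (symProd₃ (z 0 * N 2) (z 1 * w₁) (z 3 * w₀)).trace -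
      (symProd₃ (z 0 * w₀) (z 1 * N 2) (z 3 * w₁)).trace + (symProd₃ (z 0 * w₀) (z 1 * w₁) (z 3 * N 2)).trace +
      (symProd₃ (z 0 * w₁) (z 1 * N 2) (z 3 * w₀)).trace - (symProd₃ (z 0 * w₁) (z 1 * w₀) (z 3 * N 2)).trace -
      (symProd₃ (z 0 * N 3) (z 1 * w₀) (z 2 * w₁)).trace + (symProd₃ (z 0 * N 3) (z 1 * w₁) (z 2 * w₀)).trace +
      (symProd₃ (z 0 * w₀) (z 1 * N 3) (z 2 * w₁)).trace - (symProd₃ (z 0 * w₀) (z 1 * w₁) (z 2 * N 3)).trace -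
      (symProd₃ (z 0 * w₁) (z 1 * N 3) (z 2 * w₀)).trace + (symProd₃ (z 0 * w₁) (z 1 * w₀) (z 2 * N 3)).trace = 0 := by
  obtain ⟨M₀, hM₀⟩ := exists_soStarComplexify_lower hA hw₀
  obtain ⟨M₁, hM₁⟩ := exists_soStarComplexify_lower hA hw₁
  have h := hA.sum_soStarComplexify (traceForm₆ (firstProj (Fin n) (Fin n)))
    (fun κ hκ v => sum_traceForm₆_update hκ v) ![z 0, z 1, z 2, z 3, 0, 0] ![0, 0, 0, 0, w₀, w₁]
    (by intro l; fin_cases l <;> simp [hz]) (by intro l; fin_cases l <;> simp [hw₀, hw₁])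
  rw [Fin.sum_univ_six] at h
  simp only [Matrix.cons_val_zero, Matrix.cons_val_one, Matrix.cons_val] at h
  rw [hN, hN, hN, hN, hM₀, hM₁] at h
  simp only [update_offBlock, traceForm₆_offBlock] at h
  simp [sexticValue, Function.update, Fin.ext_iff, symProd₃_zero_left, symProd₃_zero_mid,
    symProd₃_zero_right, symProd₃_neg] at h
  linear_combination h

/-- A basis of the antisymmetric matrices in a permuted basis of `ℂ⁶`. -/
theorem altUnit_perm (π : Equiv.Perm (Fin 6)) (a b i j : Fin 6) :
    altUnit (π a) (π b) (π i) (π j) = altUnit a b i j := by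
  simp [altUnit_apply]

/-- The elementary matrices are chosen by torus weight. The weights of `z 1, z 2, z 3` minus those
of `w₀, w₁` leave `e_0 + e_1`, whereas leaving out another `z` leaves no weight of the form `e_i +
e_j`. The images `F` therefore drop out and a single entry of `N` survives. The same choice by
weight isolates entries sharing one index with the pair, and entries disjoint from it. -/
theorem soStarComplexify_altUnit_equal {A : Module.End ℝ (Chart (soStarLie 6))}
    (hA : IsSymmetricAnnihilator A) (π : Equiv.Perm (Fin 6)) {N : Matrix (Fin 6) (Fin 6) ℂ}
    (hN : soStarComplexify A (offBlock (altUnit (π 0) (π 1)) 0) = offBlock 0 N)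
    (hNt : N.transpose = -N) : N (π 0) (π 1) = 0 := by
  choose F hF hF' using fun a b => exists_soStarComplexify_upper hA (altUnit_transpose a b)
  have h := soStar_sexticValue_sum hA (z := ![altUnit (π 0) (π 1), altUnit (π 0) (π 2), altUnit (π 0) (π 3), altUnit (π 1) (π 4)])
    (by intro i; fin_cases i <;> exact altUnit_transpose _ _)
    (N := ![N, F (π 0) (π 2), F (π 0) (π 3), F (π 1) (π 4)])
    (by intro i; fin_cases i; exacts [hN, hF' _ _, hF' _ _, hF' _ _])
    (altUnit_transpose (π 0) (π 2)) (altUnit_transpose (π 3) (π 4))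
  simp only [Matrix.cons_val_zero, Matrix.cons_val_one, Matrix.cons_val, trace_symProd₃,
    trace_altUnit_mul_three, altUnit_perm] at h
  simp [altUnit_apply] at h
  have h' : N (π 1) (π 0) = -N (π 0) (π 1) := congrFun (congrFun hNt (π 0)) (π 1)
  linear_combination (3 * h' - h) / 6

theorem soStarComplexify_altUnit_left {A : Module.End ℝ (Chart (soStarLie 6))}
    (hA : IsSymmetricAnnihilator A) (π : Equiv.Perm (Fin 6)) {N : Matrix (Fin 6) (Fin 6) ℂ}
    (hN : soStarComplexify A (offBlock (altUnit (π 0) (π 1)) 0) = offBlock 0 N)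
    (hNt : N.transpose = -N) : N (π 0) (π 3) = 0 := by
  choose F hF hF' using fun a b => exists_soStarComplexify_upper hA (altUnit_transpose a b)
  have h := soStar_sexticValue_sum hA (z := ![altUnit (π 0) (π 1), altUnit (π 0) (π 2), altUnit (π 0) (π 3), altUnit (π 1) (π 4)])
    (by intro i; fin_cases i <;> exact altUnit_transpose _ _)
    (N := ![N, F (π 0) (π 2), F (π 0) (π 3), F (π 1) (π 4)])
    (by intro i; fin_cases i; exacts [hN, hF' _ _, hF' _ _, hF' _ _])
    (altUnit_transpose (π 0) (π 1)) (altUnit_transpose (π 2) (π 4))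
  simp only [Matrix.cons_val_zero, Matrix.cons_val_one, Matrix.cons_val, trace_symProd₃,
    trace_altUnit_mul_three, altUnit_perm] at h
  simp [altUnit_apply] at h
  have h' : N (π 3) (π 0) = -N (π 0) (π 3) := congrFun (congrFun hNt (π 0)) (π 3)
  linear_combination (3 * h' - h) / 6

theorem soStarComplexify_altUnit_right {A : Module.End ℝ (Chart (soStarLie 6))}
    (hA : IsSymmetricAnnihilator A) (π : Equiv.Perm (Fin 6)) {N : Matrix (Fin 6) (Fin 6) ℂ}
    (hN : soStarComplexify A (offBlock (altUnit (π 0) (π 1)) 0) = offBlock 0 N)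
    (hNt : N.transpose = -N) : N (π 1) (π 3) = 0 := by
  choose F hF hF' using fun a b => exists_soStarComplexify_upper hA (altUnit_transpose a b)
  have h := soStar_sexticValue_sum hA (z := ![altUnit (π 0) (π 1), altUnit (π 1) (π 2), altUnit (π 1) (π 3), altUnit (π 0) (π 4)])
    (by intro i; fin_cases i <;> exact altUnit_transpose _ _)
    (N := ![N, F (π 1) (π 2), F (π 1) (π 3), F (π 0) (π 4)])
    (by intro i; fin_cases i; exacts [hN, hF' _ _, hF' _ _, hF' _ _])
    (altUnit_transpose (π 0) (π 1)) (altUnit_transpose (π 2) (π 4))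
  simp only [Matrix.cons_val_zero, Matrix.cons_val_one, Matrix.cons_val, trace_symProd₃,
    trace_altUnit_mul_three, altUnit_perm] at h
  simp [altUnit_apply] at h
  have h' : N (π 3) (π 1) = -N (π 1) (π 3) := congrFun (congrFun hNt (π 1)) (π 3)
  linear_combination (3 * h' + h) / 6

/-- Here the unknown image belongs to `z 3`: the weights of `z 0, z 1, z 2` minus those of `w₀, w₁`
leave `e_1 + e_3`. All six indices of `ℂ⁶` are used. -/
theorem soStarComplexify_altUnit_disjoint {A : Module.End ℝ (Chart (soStarLie 6))}
    (hA : IsSymmetricAnnihilator A) (π : Equiv.Perm (Fin 6)) {N : Matrix (Fin 6) (Fin 6) ℂ}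
    (hN : soStarComplexify A (offBlock (altUnit (π 4) (π 5)) 0) = offBlock 0 N)
    (hNt : N.transpose = -N) : N (π 1) (π 3) = 0 := by
  choose F hF hF' using fun a b => exists_soStarComplexify_upper hA (altUnit_transpose a b)
  have h := soStar_sexticValue_sum hA (z := ![altUnit (π 0) (π 1), altUnit (π 0) (π 2), altUnit (π 1) (π 3), altUnit (π 4) (π 5)])
    (by intro i; fin_cases i <;> exact altUnit_transpose _ _)
    (N := ![F (π 0) (π 1), F (π 0) (π 2), F (π 1) (π 3), N])
    (by intro i; fin_cases i; exacts [hF' _ _, hF' _ _, hF' _ _, hN])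
    (altUnit_transpose (π 0) (π 1)) (altUnit_transpose (π 0) (π 2))
  simp only [Matrix.cons_val_zero, Matrix.cons_val_one, Matrix.cons_val, trace_symProd₃,
    trace_altUnit_mul_three, altUnit_perm] at h
  simp [altUnit_apply] at h
  have h' : N (π 3) (π 1) = -N (π 1) (π 3) := congrFun (congrFun hNt (π 1)) (π 3)
  linear_combination (3 * h' - h) / 6

theorem exists_perm_apply_eq₄ {n : ℕ} {a b c d : Fin n} (h : Function.Injective ![a, b, c, d])
    (i j k l : Fin n) (h' : Function.Injective ![i, j, k, l]) :
    ∃ π : Equiv.Perm (Fin n), π i = a ∧ π j = b ∧ π k = c ∧ π l = d := by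
  have := Equiv.Perm.isMultiplyPretransitive (Fin n) 4
  obtain ⟨π, hπ⟩ := MulAction.exists_smul_eq (Equiv.Perm (Fin n))
    (⟨![i, j, k, l], h'⟩ : Fin 4 ↪ Fin n) ⟨![a, b, c, d], h⟩
  have hp : ∀ x : Fin 4, π (![i, j, k, l] x) = ![a, b, c, d] x := fun x =>
    DFunLike.congr_fun hπ x
  exact ⟨π, hp 0, hp 1, hp 2, hp 3⟩

theorem injective_vec₄ {n : ℕ} {a b c d : Fin n} (hab : a ≠ b) (hac : a ≠ c) (had : a ≠ d) (hbc : b ≠ c)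
    (hbd : b ≠ d) (hcd : c ≠ d) : Function.Injective ![a, b, c, d] := by
  intro x y h
  fin_cases x <;> fin_cases y <;> simp_all

theorem soStarLie_symmetricAnnihilator_eq_zero {A : Module.End ℝ (Chart (soStarLie 6))}
    (hA : IsSymmetricAnnihilator A) : A = 0 := by
  refine hA.eq_zero_of_soStarComplexify fun a b => ?_
  change soStarComplexify A (offBlock (altUnit a b) 0) = 0
  rcases eq_or_ne a b with rfl | hab
  · have h0 : complexify A 0 = 0 := by simpa using complexify_toMatrix A 0
    rw [altUnit, sub_self, show (offBlock 0 0 : Matrix (Fin 6 ⊕ Fin 6) (Fin 6 ⊕ Fin 6) ℂ) = 0 from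
      Matrix.fromBlocks_zero, soStarComplexify, mul_zero, zero_mul, h0, mul_zero, zero_mul]
  obtain ⟨N, hNt, hN⟩ := exists_soStarComplexify_upper hA (altUnit_transpose a b)
  have hanti : ∀ i j, N i j = -N j i := fun i j => congrFun (congrFun hNt j) i
  have third : ∀ {j}, j ≠ a → j ≠ b →
      ∃ π : Equiv.Perm (Fin 6), π 0 = a ∧ π 1 = b ∧ π 3 = j := by
    intro j hja hjb
    obtain ⟨c, h1, h2, h3⟩ : ∃ c : Fin 6, c ≠ a ∧ c ≠ b ∧ c ≠ j := by
      clear hNt hN hanti hab hja hjb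
      revert a b j; decide
    obtain ⟨π, h⟩ := exists_perm_apply_eq₄ (injective_vec₄ hab hja.symm h1.symm hjb.symm h2.symm
      h3.symm) 0 1 3 2 (by decide)
    exact ⟨π, h.1, h.2.1, h.2.2.1⟩
  have hl : ∀ j, j ≠ a → N a j = 0 := by
    intro j hja
    rcases eq_or_ne j b with rfl | hjb
    · obtain ⟨π, h0, h1⟩ := exists_perm_apply_eq hab.symm
      rw [← h0, ← h1] at hN ⊢
      exact soStarComplexify_altUnit_equal hA π hN hNt
    · obtain ⟨π, h0, h1, h3⟩ := third hja hjb
      rw [← h0, ← h1] at hN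
      rw [← h0, ← h3]
      exact soStarComplexify_altUnit_left hA π hN hNt
  have hr : ∀ j, j ≠ b → N b j = 0 := by
    intro j hjb
    rcases eq_or_ne j a with rfl | hja
    · rw [hanti, hl b hab.symm, neg_zero]
    · obtain ⟨π, h0, h1, h3⟩ := third hja hjb
      rw [← h0, ← h1] at hN
      rw [← h1, ← h3]
      exact soStarComplexify_altUnit_right hA π hN hNt
  have hN0 : N = 0 := by
    ext i j
    rw [Matrix.zero_apply]
    rcases eq_or_ne i j with rfl | hij
    · exact self_eq_neg.1 (hanti i i)
    rcases eq_or_ne i a with rfl | hia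
    · exact hl j hij.symm
    rcases eq_or_ne i b with rfl | hib
    · exact hr j hij.symm
    rcases eq_or_ne j a with rfl | hja
    · rw [hanti, hl i hij, neg_zero]
    rcases eq_or_ne j b with rfl | hjb
    · rw [hanti, hr i hij, neg_zero]
    obtain ⟨π, h4, h5, h1, h3⟩ := exists_perm_apply_eq₄ (injective_vec₄ hab hia.symm hja.symm
      hib.symm hjb.symm hij) 4 5 1 3 (by decide)
    rw [← h4, ← h5] at hN
    rw [← h1, ← h3]
    exact soStarComplexify_altUnit_disjoint hA π hN hNt
  rw [hN, hN0]
  exact Matrix.fromBlocks_zero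

end SoStarRigidity

end Sugra

set_option linter.unusedSimpArgs false

namespace Sugra

/-! ### The Lie algebra `𝔢₇₍₇₎` -/

theorem sum_pair8 (f : Fin 8 → Fin 8 → ℂ) :
    ∑ p : Pair8, f p.1.1 p.1.2 = ∑ a, ∑ b, if a < b then f a b else 0 := by
  rw [← Fintype.sum_prod_type' (f := fun a b : Fin 8 => if a < b then f a b else 0),
    ← Finset.sum_filter, Finset.sum_subtype (p := fun x : Fin 8 × Fin 8 => x.1 < x.2) _ (by simp)]

theorem two_mul_sum_pair8 {f : Fin 8 → Fin 8 → ℂ} (hf : ∀ a b, f a b = f b a) (h0 : ∀ a, f a a = 0) :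
    2 * ∑ p : Pair8, f p.1.1 p.1.2 = ∑ a, ∑ b, f a b := by
  rw [two_mul, sum_pair8]
  nth_rewrite 2 [Finset.sum_comm]
  rw [← Finset.sum_add_distrib]
  refine Finset.sum_congr rfl fun a _ => ?_
  rw [← Finset.sum_add_distrib]
  refine Finset.sum_congr rfl fun b _ => ?_
  rcases lt_trichotomy a b with h | rfl | h
  · simp [h, h.not_gt]
  · simp [h0]
  · simp [h, h.not_gt, hf a b]

theorem sum_pair8_perm {f : Fin 8 → Fin 8 → ℂ} (hf : ∀ a b, f a b = f b a) (h0 : ∀ a, f a a = 0)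
    (π : Equiv.Perm (Fin 8)) :
    ∑ p : Pair8, f p.1.1 p.1.2 = ∑ p : Pair8, f (π p.1.1) (π p.1.2) := by
  have h1 := two_mul_sum_pair8 hf h0
  have h2 := two_mul_sum_pair8 (f := fun a b => f (π a) (π b)) (fun a b => hf _ _) (fun a => h0 _)
  rw [Equiv.sum_comp π (fun a => ∑ b, f a (π b))] at h2
  simp only [Equiv.sum_comp π (f _)] at h2
  exact mul_left_cancel₀ two_ne_zero (h1.trans h2.symm)

theorem sum_pair8_explicit (f : Fin 8 → Fin 8 → ℂ) :
    ∑ p : Pair8, f p.1.1 p.1.2 =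
      f 0 1 + f 0 2 + f 0 3 + f 0 4 + f 0 5 + f 0 6 + f 0 7 + f 1 2 + f 1 3 + f 1 4 + f 1 5 + f 1 6
      + f 1 7 + f 2 3 + f 2 4 + f 2 5 + f 2 6 + f 2 7 + f 3 4 + f 3 5 + f 3 6 + f 3 7 + f 4 5
      + f 4 6 + f 4 7 + f 5 6 + f 5 7 + f 6 7 := by
  rw [sum_pair8]
  simp [Fin.sum_univ_eight]
  ring

/-- The entries of `wedgeTwo L` at arbitrary index pairs. -/
def wedgeTwoFun (L : Matrix (Fin 8) (Fin 8) ℂ) (a b c d : Fin 8) : ℂ :=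
  L a c * (if b = d then 1 else 0) + (if a = c then 1 else 0) * L b d
    - L a d * (if b = c then 1 else 0) - (if a = d then 1 else 0) * L b c

theorem wedgeTwo_apply (L : Matrix (Fin 8) (Fin 8) ℂ) (p r : Pair8) :
    wedgeTwo L p r = wedgeTwoFun L p.1.1 p.1.2 r.1.1 r.1.2 := rfl

theorem wedgeTwoFun_swap (L : Matrix (Fin 8) (Fin 8) ℂ) (a b c d : Fin 8) :
    wedgeTwoFun L a b d c = -wedgeTwoFun L a b c d := by
  simp only [wedgeTwoFun]; ring

theorem wedgeTwoFun_swap' (L : Matrix (Fin 8) (Fin 8) ℂ) (a b c d : Fin 8) :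
    wedgeTwoFun L b a c d = -wedgeTwoFun L a b c d := by
  simp only [wedgeTwoFun]; ring

/-- For antisymmetric `h` the sum over ordered pairs is half the full double sum, whose four terms
agree in twos and leave one action of `L` per slot. -/
theorem sum_wedgeTwo_mul (L : Matrix (Fin 8) (Fin 8) ℂ) {h : Fin 8 → Fin 8 → ℂ}
    (hh : ∀ a b, h b a = -h a b) (p : Pair8) :
    ∑ q : Pair8, wedgeTwo L p q * h q.1.1 q.1.2 =
      ∑ a, L p.1.1 a * h a p.1.2 + ∑ a, L p.1.2 a * h p.1.1 a := by
  have hd : ∀ a, h a a = 0 := fun a => self_eq_neg.1 (hh a a)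
  have h1 := two_mul_sum_pair8 (f := fun c d => wedgeTwoFun L p.1.1 p.1.2 c d * h c d)
    (fun a b => by rw [wedgeTwoFun_swap, hh, neg_mul_neg]) (fun a => by rw [hd, mul_zero])
  refine mul_left_cancel₀ (two_ne_zero (α := ℂ)) (h1.trans ?_)
  simp only [wedgeTwoFun, sub_mul, add_mul, Finset.sum_sub_distrib, Finset.sum_add_distrib, mul_ite,
    ite_mul, mul_one, one_mul, mul_zero, zero_mul, Finset.sum_ite_eq, Finset.mem_univ, if_true,
    Finset.sum_const_zero]
  simp only [hh p.1.1, Finset.sum_ite_irrel, Finset.sum_const_zero, Finset.sum_ite_eq,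
    Finset.mem_univ, if_true]
  have e : ∀ a, h p.1.2 a = -h a p.1.2 := fun a => hh _ _
  simp only [e, mul_neg, Finset.sum_neg_distrib]
  ring

/-- The actions of `L` and `M` on different slots of a bivector commute, so only the commutator in
each single slot is left. -/
theorem wedgeTwo_mul_sub (L M : Matrix (Fin 8) (Fin 8) ℂ) :
    wedgeTwo L * wedgeTwo M - wedgeTwo M * wedgeTwo L = wedgeTwo (L * M - M * L) := by
  ext p r
  rw [Matrix.sub_apply, Matrix.mul_apply, Matrix.mul_apply]
  simp only [fun N q => wedgeTwo_apply N q r]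
  rw [sum_wedgeTwo_mul L (h := fun a b => wedgeTwoFun M a b r.1.1 r.1.2)
      (fun a b => wedgeTwoFun_swap' _ _ _ _ _),
    sum_wedgeTwo_mul M (h := fun a b => wedgeTwoFun L a b r.1.1 r.1.2)
      (fun a b => wedgeTwoFun_swap' _ _ _ _ _)]
  simp only [wedgeTwoFun, Matrix.sub_apply, Matrix.mul_apply, mul_add, mul_sub, mul_ite,
    ite_mul, mul_one, one_mul, mul_zero, zero_mul, Finset.sum_add_distrib, Finset.sum_sub_distrib,
    Finset.sum_ite_eq, Finset.sum_ite_eq', Finset.mem_univ, if_true, Finset.sum_ite_irrel,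
    Finset.sum_const_zero]
  generalize p.1.1 = a, p.1.2 = b, r.1.1 = c, r.1.2 = d
  split_ifs <;> subst_vars <;> simp <;> ring

/-- The components of a self-dual 4-form in a basis of `ℂ⁸` of orientation `ε`. -/
structure IsDualFour (ε : ℂ) (T : Fin 8 → Fin 8 → Fin 8 → Fin 8 → ℂ) : Prop where
  swap₁ : ∀ a b c d, T b a c d = -T a b c d
  swap₂ : ∀ a b c d, T a c b d = -T a b c d
  swap₃ : ∀ a b c d, T a b d c = -T a b c d
  dual : ∀ s : Equiv.Perm (Fin 8), star (T (s 0) (s 1) (s 2) (s 3)) =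
    ε * ((Equiv.Perm.sign s : ℤ) : ℂ) * T (s 4) (s 5) (s 6) (s 7)

/-- Antisymmetry of a four-index tensor. -/
def IsAlternatingFour (t : (Fin 4 → Fin 8) → ℂ) : Prop :=
  ∀ (v : Fin 4 → Fin 8) (s : Equiv.Perm (Fin 4)), t (v ∘ s) = ((Equiv.Perm.sign s : ℤ) : ℂ) * t v

theorem IsAlternatingFour.swap {t : (Fin 4 → Fin 8) → ℂ} (ht : IsAlternatingFour t)
    (v : Fin 4 → Fin 8) {i j : Fin 4} (hij : i ≠ j) : t (v ∘ Equiv.swap i j) = -t v := by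
  rw [ht, Equiv.Perm.sign_swap hij]
  simp

theorem IsAlternatingFour.swap₁ {t : (Fin 4 → Fin 8) → ℂ} (ht : IsAlternatingFour t)
    (a b c d : Fin 8) : t ![b, a, c, d] = -t ![a, b, c, d] := by
  rw [← ht.swap _ (show (0 : Fin 4) ≠ 1 by decide)]
  congr 1
  ext i; fin_cases i <;> rfl

theorem IsAlternatingFour.swap₂ {t : (Fin 4 → Fin 8) → ℂ} (ht : IsAlternatingFour t)
    (a b c d : Fin 8) : t ![a, c, b, d] = -t ![a, b, c, d] := by
  rw [← ht.swap _ (show (1 : Fin 4) ≠ 2 by decide)]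
  congr 1
  ext i; fin_cases i <;> rfl

theorem IsAlternatingFour.swap₃ {t : (Fin 4 → Fin 8) → ℂ} (ht : IsAlternatingFour t)
    (a b c d : Fin 8) : t ![a, b, d, c] = -t ![a, b, c, d] := by
  rw [← ht.swap _ (show (2 : Fin 4) ≠ 3 by decide)]
  congr 1
  ext i; fin_cases i <;> rfl

theorem IsAlternatingFour.rotate {t : (Fin 4 → Fin 8) → ℂ} (ht : IsAlternatingFour t)
    (a b c d : Fin 8) : t ![c, d, a, b] = t ![a, b, c, d] := by
  rw [ht.swap₂, ht.swap₁ a c d b, ht.swap₃ a c b d, ht.swap₂]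
  ring

/-- Relabelling the basis by `π` changes the orientation by the sign of `π`. This allows contraction
identities to be checked at fixed indices only. -/
theorem IsSelfDualFour.isDualFour {t : (Fin 4 → Fin 8) → ℂ} (ht : IsSelfDualFour t)
    (π : Equiv.Perm (Fin 8)) :
    IsDualFour ((Equiv.Perm.sign π : ℤ) : ℂ) (fun a b c d => t ![π a, π b, π c, π d]) where
  swap₁ a b c d := IsAlternatingFour.swap₁ ht.1 _ _ _ _
  swap₂ a b c d := IsAlternatingFour.swap₂ ht.1 _ _ _ _
  swap₃ a b c d := IsAlternatingFour.swap₃ ht.1 _ _ _ _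
  dual s := by
    have h := ht.2 (π * s)
    simpa [Equiv.Perm.sign_mul] using h

section DualFour

variable {ε : ℂ} {T T' : Fin 8 → Fin 8 → Fin 8 → Fin 8 → ℂ}

theorem IsDualFour.self₁ (hT : IsDualFour ε T) (a c d : Fin 8) : T a a c d = 0 :=
  self_eq_neg.1 (hT.swap₁ a a c d)

theorem IsDualFour.self₂ (hT : IsDualFour ε T) (a b d : Fin 8) : T a b b d = 0 :=
  self_eq_neg.1 (hT.swap₂ a b b d)

theorem IsDualFour.self₃ (hT : IsDualFour ε T) (a b c : Fin 8) : T a b c c = 0 :=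
  self_eq_neg.1 (hT.swap₃ a b c c)

theorem IsDualFour.rotate (hT : IsDualFour ε T) (a b c d : Fin 8) : T c d a b = T a b c d := by
  rw [hT.swap₂, hT.swap₁ a c d b, hT.swap₃ a c b d, hT.swap₂]
  ring

theorem IsDualFour.dual_of (hT : IsDualFour ε T) (v w : Fin 8 → Fin 8)
    (h₁ : Function.LeftInverse w v) (h₂ : Function.RightInverse w v)
    (hs : Equiv.Perm.sign (⟨v, w, h₁, h₂⟩ : Equiv.Perm (Fin 8)) = 1) :
    star (T (v 0) (v 1) (v 2) (v 3)) = ε * T (v 4) (v 5) (v 6) (v 7) := by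
  have h := hT.dual ⟨v, w, h₁, h₂⟩
  rw [hs, Units.val_one, Int.cast_one, mul_one] at h
  exact h

set_option maxRecDepth 4000 in
theorem IsDualFour.dual_disjoint (hT : IsDualFour ε T) :
    star (T 4 5 2 3) = ε * T 0 1 6 7 ∧
    star (T 4 6 2 3) = ε * T 0 1 7 5 ∧
    star (T 4 7 2 3) = ε * T 0 1 5 6 ∧
    star (T 5 6 2 3) = ε * T 0 1 4 7 ∧
    star (T 5 7 2 3) = ε * T 0 1 6 4 ∧
    star (T 6 7 2 3) = ε * T 0 1 4 5 :=
  ⟨hT.dual_of ![4, 5, 2, 3, 0, 1, 6, 7] ![4, 5, 2, 3, 0, 1, 6, 7] (by decide) (by decide) (by decide),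
    hT.dual_of ![4, 6, 2, 3, 0, 1, 7, 5] ![4, 5, 2, 3, 0, 7, 1, 6] (by decide) (by decide) (by decide),
    hT.dual_of ![4, 7, 2, 3, 0, 1, 5, 6] ![4, 5, 2, 3, 0, 6, 7, 1] (by decide) (by decide) (by decide),
    hT.dual_of ![5, 6, 2, 3, 0, 1, 4, 7] ![4, 5, 2, 3, 6, 0, 1, 7] (by decide) (by decide) (by decide),
    hT.dual_of ![5, 7, 2, 3, 0, 1, 6, 4] ![4, 5, 2, 3, 7, 0, 6, 1] (by decide) (by decide) (by decide),
    hT.dual_of ![6, 7, 2, 3, 0, 1, 4, 5] ![4, 5, 2, 3, 6, 7, 0, 1] (by decide) (by decide) (by decide)⟩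

set_option maxRecDepth 4000 in
theorem IsDualFour.dual_adjacent (hT : IsDualFour ε T) :
    star (T 1 4 0 3) = ε * T 2 5 7 6 ∧
    star (T 1 5 0 3) = ε * T 2 4 6 7 ∧
    star (T 1 6 0 3) = ε * T 2 4 7 5 ∧
    star (T 1 7 0 3) = ε * T 2 4 5 6 ∧
    star (T 4 5 0 3) = ε * T 1 2 6 7 ∧
    star (T 4 6 0 3) = ε * T 1 2 7 5 ∧
    star (T 4 7 0 3) = ε * T 1 2 5 6 ∧
    star (T 5 6 0 3) = ε * T 1 2 4 7 ∧
    star (T 5 7 0 3) = ε * T 1 2 6 4 ∧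
    star (T 6 7 0 3) = ε * T 1 2 4 5 ∧
    star (T 0 4 1 3) = ε * T 2 5 6 7 ∧
    star (T 0 5 1 3) = ε * T 2 4 7 6 ∧
    star (T 0 6 1 3) = ε * T 2 4 5 7 ∧
    star (T 0 7 1 3) = ε * T 2 4 6 5 ∧
    star (T 4 5 1 3) = ε * T 0 2 7 6 ∧
    star (T 4 6 1 3) = ε * T 0 2 5 7 ∧
    star (T 4 7 1 3) = ε * T 0 2 6 5 ∧
    star (T 5 6 1 3) = ε * T 0 2 7 4 ∧
    star (T 5 7 1 3) = ε * T 0 2 4 6 ∧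
    star (T 6 7 1 3) = ε * T 0 2 5 4 :=
  ⟨hT.dual_of ![1, 4, 0, 3, 2, 5, 7, 6] ![2, 0, 4, 3, 1, 5, 7, 6] (by decide) (by decide) (by decide),
    hT.dual_of ![1, 5, 0, 3, 2, 4, 6, 7] ![2, 0, 4, 3, 5, 1, 6, 7] (by decide) (by decide) (by decide),
    hT.dual_of ![1, 6, 0, 3, 2, 4, 7, 5] ![2, 0, 4, 3, 5, 7, 1, 6] (by decide) (by decide) (by decide),
    hT.dual_of ![1, 7, 0, 3, 2, 4, 5, 6] ![2, 0, 4, 3, 5, 6, 7, 1] (by decide) (by decide) (by decide),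
    hT.dual_of ![4, 5, 0, 3, 1, 2, 6, 7] ![2, 4, 5, 3, 0, 1, 6, 7] (by decide) (by decide) (by decide),
    hT.dual_of ![4, 6, 0, 3, 1, 2, 7, 5] ![2, 4, 5, 3, 0, 7, 1, 6] (by decide) (by decide) (by decide),
    hT.dual_of ![4, 7, 0, 3, 1, 2, 5, 6] ![2, 4, 5, 3, 0, 6, 7, 1] (by decide) (by decide) (by decide),
    hT.dual_of ![5, 6, 0, 3, 1, 2, 4, 7] ![2, 4, 5, 3, 6, 0, 1, 7] (by decide) (by decide) (by decide),
    hT.dual_of ![5, 7, 0, 3, 1, 2, 6, 4] ![2, 4, 5, 3, 7, 0, 6, 1] (by decide) (by decide) (by decide),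
    hT.dual_of ![6, 7, 0, 3, 1, 2, 4, 5] ![2, 4, 5, 3, 6, 7, 0, 1] (by decide) (by decide) (by decide),
    hT.dual_of ![0, 4, 1, 3, 2, 5, 6, 7] ![0, 2, 4, 3, 1, 5, 6, 7] (by decide) (by decide) (by decide),
    hT.dual_of ![0, 5, 1, 3, 2, 4, 7, 6] ![0, 2, 4, 3, 5, 1, 7, 6] (by decide) (by decide) (by decide),
    hT.dual_of ![0, 6, 1, 3, 2, 4, 5, 7] ![0, 2, 4, 3, 5, 6, 1, 7] (by decide) (by decide) (by decide),
    hT.dual_of ![0, 7, 1, 3, 2, 4, 6, 5] ![0, 2, 4, 3, 5, 7, 6, 1] (by decide) (by decide) (by decide),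
    hT.dual_of ![4, 5, 1, 3, 0, 2, 7, 6] ![4, 2, 5, 3, 0, 1, 7, 6] (by decide) (by decide) (by decide),
    hT.dual_of ![4, 6, 1, 3, 0, 2, 5, 7] ![4, 2, 5, 3, 0, 6, 1, 7] (by decide) (by decide) (by decide),
    hT.dual_of ![4, 7, 1, 3, 0, 2, 6, 5] ![4, 2, 5, 3, 0, 7, 6, 1] (by decide) (by decide) (by decide),
    hT.dual_of ![5, 6, 1, 3, 0, 2, 7, 4] ![4, 2, 5, 3, 7, 0, 1, 6] (by decide) (by decide) (by decide),
    hT.dual_of ![5, 7, 1, 3, 0, 2, 4, 6] ![4, 2, 5, 3, 6, 0, 7, 1] (by decide) (by decide) (by decide),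
    hT.dual_of ![6, 7, 1, 3, 0, 2, 5, 4] ![4, 2, 5, 3, 7, 6, 0, 1] (by decide) (by decide) (by decide)⟩

/-- The contraction `T_{ijpq} T'^*_{pqkl} - T'_{ijpq} T^*_{pqkl}` over `p < q`. -/
def fourContract (T T' : Fin 8 → Fin 8 → Fin 8 → Fin 8 → ℂ) (i j k l : Fin 8) : ℂ :=
  ∑ p : Pair8, (T i j p.1.1 p.1.2 * star (T' p.1.1 p.1.2 k l)
    - T' i j p.1.1 p.1.2 * star (T p.1.1 p.1.2 k l))

theorem IsDualFour.self₁₃ (hT : IsDualFour ε T) (a b d : Fin 8) : T a b a d = 0 := by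
  rw [hT.swap₂, hT.self₁, neg_zero]

theorem IsDualFour.self₁₄ (hT : IsDualFour ε T) (a b c : Fin 8) : T a b c a = 0 := by
  rw [hT.swap₃, hT.self₁₃, neg_zero]

theorem IsDualFour.self₂₄ (hT : IsDualFour ε T) (a b c : Fin 8) : T a b c b = 0 := by
  rw [hT.swap₃, hT.self₂, neg_zero]

theorem IsDualFour.swap₁₃ (hT : IsDualFour ε T) (a b c d : Fin 8) : T c b a d = -T a b c d := by
  rw [hT.swap₁, hT.swap₂, hT.swap₁]
  ring

theorem IsDualFour.swap₃_literals (hT : IsDualFour ε T) (a b : Fin 8) :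
    T a b 5 4 = -T a b 4 5 ∧ T a b 6 4 = -T a b 4 6 ∧ T a b 7 4 = -T a b 4 7 ∧
    T a b 6 5 = -T a b 5 6 ∧ T a b 7 5 = -T a b 5 7 ∧ T a b 7 6 = -T a b 6 7 :=
  ⟨hT.swap₃ _ _ _ _, hT.swap₃ _ _ _ _, hT.swap₃ _ _ _ _, hT.swap₃ _ _ _ _, hT.swap₃ _ _ _ _,
    hT.swap₃ _ _ _ _⟩

/-- Only pairs inside `{4, 5, 6, 7}` contribute. Duality replaces the conjugated component by the
one on `0, 1` and the complementary pair, after which complementary pairs cancel. -/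
theorem fourContract_disjoint (hT : IsDualFour ε T) (hT' : IsDualFour ε T') :
    fourContract T T' 0 1 2 3 = 0 := by
  rw [fourContract, sum_pair8_explicit (fun p q => T 0 1 p q * star (T' p q 2 3)
    - T' 0 1 p q * star (T p q 2 3))]
  simp only [hT.self₁, hT.self₂, hT.self₃, hT.self₁₃, hT.self₁₄, hT.self₂₄, hT'.self₁, hT'.self₂,
    hT'.self₃, hT'.self₁₃, hT'.self₁₄, hT'.self₂₄, star_zero, mul_zero, zero_mul, sub_zero, zero_add,
    add_zero, hT.dual_disjoint, hT'.dual_disjoint]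
  simp only [hT.swap₃ 0 1 4 5, hT'.swap₃ 0 1 4 5, hT.swap₃ 0 1 4 6, hT'.swap₃ 0 1 4 6,
    hT.swap₃ 0 1 4 7, hT'.swap₃ 0 1 4 7, hT.swap₃ 0 1 5 6, hT'.swap₃ 0 1 5 6, hT.swap₃ 0 1 5 7,
    hT'.swap₃ 0 1 5 7, hT.swap₃ 0 1 6 7, hT'.swap₃ 0 1 6 7]
  ring

/-- After dualising the conjugated factors, both sides are the same bilinear expression. That the
shared index does not matter is what makes the contraction a matrix entry. -/
theorem fourContract_adjacent (hT : IsDualFour ε T) (hT' : IsDualFour ε T') :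
    fourContract T T' 0 2 0 3 = fourContract T T' 1 2 1 3 := by
  rw [fourContract, fourContract, sum_pair8_explicit (fun p q => T 0 2 p q * star (T' p q 0 3)
    - T' 0 2 p q * star (T p q 0 3)), sum_pair8_explicit (fun p q => T 1 2 p q * star (T' p q 1 3)
    - T' 1 2 p q * star (T p q 1 3))]
  simp only [hT.self₁, hT.self₂, hT.self₃, hT.self₁₃, hT.self₁₄, hT.self₂₄, hT'.self₁, hT'.self₂,
    hT'.self₃, hT'.self₁₃, hT'.self₁₄, hT'.self₂₄, star_zero, mul_zero, zero_mul, sub_zero, zero_add,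
    add_zero, hT.dual_adjacent, hT'.dual_adjacent]
  simp only [hT.swap₃_literals, hT'.swap₃_literals, hT.swap₁₃ 0 2 1, hT'.swap₁₃ 0 2 1]
  ring

/-- A symmetric function of four indices which is odd under complementation. -/
structure IsOddQuadFun (X : Fin 8 → Fin 8 → Fin 8 → Fin 8 → ℂ) : Prop where
  swap₁ : ∀ a b c d, X a b c d = X b a c d
  swap₂ : ∀ a b c d, X a b c d = X a c b d
  swap₃ : ∀ a b c d, X a b c d = X a b d c
  self : ∀ a b c, X a a b c = 0
  compl : ∀ s : Equiv.Perm (Fin 8), X (s 0) (s 1) (s 2) (s 3) = -X (s 4) (s 5) (s 6) (s 7)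

theorem IsOddQuadFun.compl_of {X : Fin 8 → Fin 8 → Fin 8 → Fin 8 → ℂ} (hX : IsOddQuadFun X)
    (v : Fin 8 → Fin 8) (hv : Function.Injective v) :
    X (v 0) (v 1) (v 2) (v 3) + X (v 4) (v 5) (v 6) (v 7) = 0 := by
  have h := hX.compl (Equiv.ofBijective v (Finite.injective_iff_bijective.1 hv))
  simp only [Equiv.ofBijective_apply] at h
  rw [h, neg_add_cancel]

/-- The first sum on the right counts each quadruple containing 0 three times, and the second does
so for 1. Quadruples containing both give the factor six; one containing only 0 cancels against its
complement, which contains only 1. -/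
theorem IsOddQuadFun.six_mul_sum {X : Fin 8 → Fin 8 → Fin 8 → Fin 8 → ℂ} (hX : IsOddQuadFun X) :
    6 * ∑ p : Pair8, X 0 1 p.1.1 p.1.2 =
      ∑ k, ∑ p : Pair8, X k 0 p.1.1 p.1.2 + ∑ k, ∑ p : Pair8, X k 1 p.1.1 p.1.2 := by
  have z2 : ∀ a b c, X a b b c = 0 := fun a b c => by rw [hX.swap₁, hX.swap₂, hX.self]
  have z3 : ∀ a b c, X a b c c = 0 := fun a b c => by rw [hX.swap₂, hX.swap₃, z2]
  simp only [fun a b => sum_pair8_explicit (X a b), Fin.sum_univ_eight, hX.self, z2, z3]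
  simp only [hX.swap₁, hX.swap₂, hX.swap₃, hX.self, z2, z3, add_zero, zero_add]
  have h234 := hX.compl_of ![0, 2, 3, 4, 1, 5, 6, 7] (by decide)
  have h235 := hX.compl_of ![0, 2, 3, 5, 1, 4, 6, 7] (by decide)
  have h236 := hX.compl_of ![0, 2, 3, 6, 1, 4, 5, 7] (by decide)
  have h237 := hX.compl_of ![0, 2, 3, 7, 1, 4, 5, 6] (by decide)
  have h245 := hX.compl_of ![0, 2, 4, 5, 1, 3, 6, 7] (by decide)
  have h246 := hX.compl_of ![0, 2, 4, 6, 1, 3, 5, 7] (by decide)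
  have h247 := hX.compl_of ![0, 2, 4, 7, 1, 3, 5, 6] (by decide)
  have h256 := hX.compl_of ![0, 2, 5, 6, 1, 3, 4, 7] (by decide)
  have h257 := hX.compl_of ![0, 2, 5, 7, 1, 3, 4, 6] (by decide)
  have h267 := hX.compl_of ![0, 2, 6, 7, 1, 3, 4, 5] (by decide)
  have h345 := hX.compl_of ![0, 3, 4, 5, 1, 2, 6, 7] (by decide)
  have h346 := hX.compl_of ![0, 3, 4, 6, 1, 2, 5, 7] (by decide)
  have h347 := hX.compl_of ![0, 3, 4, 7, 1, 2, 5, 6] (by decide)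
  have h356 := hX.compl_of ![0, 3, 5, 6, 1, 2, 4, 7] (by decide)
  have h357 := hX.compl_of ![0, 3, 5, 7, 1, 2, 4, 6] (by decide)
  have h367 := hX.compl_of ![0, 3, 6, 7, 1, 2, 4, 5] (by decide)
  have h456 := hX.compl_of ![0, 4, 5, 6, 1, 2, 3, 7] (by decide)
  have h457 := hX.compl_of ![0, 4, 5, 7, 1, 2, 3, 6] (by decide)
  have h467 := hX.compl_of ![0, 4, 6, 7, 1, 2, 3, 5] (by decide)
  have h567 := hX.compl_of ![0, 5, 6, 7, 1, 2, 3, 4] (by decide)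
  simp only [Matrix.cons_val_zero, Matrix.cons_val_one, Matrix.cons_val] at h234 h235 h236 h237 h245 h246 h247 h256 h257 h267 h345 h346 h347 h356 h357 h367 h456 h457 h467 h567
  linear_combination -3 * (h234 + h235 + h236 + h237 + h245 + h246 + h247 + h256 + h257 + h267 + h345 + h346 + h347 + h356 + h357 + h367 + h456 + h457 + h467 + h567)

/-- The summand `T T'^* - T' T^*` at equal index quadruples is symmetric in the four indices, and
duality exchanges its two terms under complementation; `IsOddQuadFun.six_mul_sum` applies. -/
theorem fourContract_equal (hε : star ε * ε = 1) (hT : IsDualFour ε T) (hT' : IsDualFour ε T') :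
    6 * fourContract T T' 0 1 0 1 =
      ∑ k, fourContract T T' k 0 k 0 + ∑ k, fourContract T T' k 1 k 1 := by
  have hX : IsOddQuadFun fun a b c d => T a b c d * star (T' a b c d)
      - T' a b c d * star (T a b c d) :=
    { swap₁ := fun a b c d => by simp only [hT.swap₁ a b, hT'.swap₁ a b, star_neg, neg_mul_neg]
      swap₂ := fun a b c d => by simp only [hT.swap₂ a b, hT'.swap₂ a b, star_neg, neg_mul_neg]
      swap₃ := fun a b c d => by simp only [hT.swap₃ a b c, hT'.swap₃ a b c, star_neg, neg_mul_neg]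
      self := fun a b c => by simp only [hT.self₁, hT'.self₁, zero_mul, sub_zero]
      compl := fun s => by
        have h := hT.dual s
        have h' := hT'.dual s
        have e : ∀ {x y : ℂ}, star x = y → x = star y := fun h => by rw [← h, star_star]
        have hs : (((Equiv.Perm.sign s : ℤˣ) : ℤ) : ℂ) * ((Equiv.Perm.sign s : ℤ) : ℂ) = 1 := by
          rw [← Int.cast_mul, Int.units_coe_mul_self, Int.cast_one]
        have hs' : star (((Equiv.Perm.sign s : ℤˣ) : ℤ) : ℂ) = ((Equiv.Perm.sign s : ℤ) : ℂ) := by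
          simp
        simp only [h, h', e h, e h', star_mul', hs', star_star]
        linear_combination (((Equiv.Perm.sign s : ℤˣ) : ℤ) : ℂ) * ((Equiv.Perm.sign s : ℤ) : ℂ) *
          (star (T (s 4) (s 5) (s 6) (s 7)) * T' (s 4) (s 5) (s 6) (s 7)
            - star (T' (s 4) (s 5) (s 6) (s 7)) * T (s 4) (s 5) (s 6) (s 7)) * hε
          + (star (T (s 4) (s 5) (s 6) (s 7)) * T' (s 4) (s 5) (s 6) (s 7)
            - star (T' (s 4) (s 5) (s 6) (s 7)) * T (s 4) (s 5) (s 6) (s 7)) * hs }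
  have h := hX.six_mul_sum
  simpa only [fourContract, hT.rotate, hT'.rotate] using h

theorem fourContract_swap (hT : IsDualFour ε T) (hT' : IsDualFour ε T') (i j k l : Fin 8) :
    fourContract T T' j i k l = -fourContract T T' i j k l := by
  simp only [fourContract, hT.swap₁ i j, hT'.swap₁ i j, ← Finset.sum_neg_distrib]
  exact Finset.sum_congr rfl fun p _ => by ring

theorem fourContract_swap' (hT : IsDualFour ε T) (hT' : IsDualFour ε T') (i j k l : Fin 8) :
    fourContract T T' i j l k = -fourContract T T' i j k l := by
  simp only [fourContract, hT.swap₃ _ _ k l, hT'.swap₃ _ _ k l, ← Finset.sum_neg_distrib, star_neg]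
  exact Finset.sum_congr rfl fun p _ => by ring

theorem star_fourContract (hT : IsDualFour ε T) (hT' : IsDualFour ε T') (i j k l : Fin 8) :
    star (fourContract T T' i j k l) = -fourContract T T' k l i j := by
  rw [fourContract, fourContract, star_sum, ← Finset.sum_neg_distrib]
  refine Finset.sum_congr rfl fun p _ => ?_
  rw [hT.rotate i j, hT'.rotate i j, ← hT.rotate k l, ← hT'.rotate k l]
  simp only [star_sub, star_mul', star_star]
  ring

theorem fourContract_perm (hT : IsDualFour ε T) (hT' : IsDualFour ε T') (π : Equiv.Perm (Fin 8))
    (i j k l : Fin 8) :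
    fourContract T T' (π i) (π j) (π k) (π l) =
      fourContract (fun a b c d => T (π a) (π b) (π c) (π d))
        (fun a b c d => T' (π a) (π b) (π c) (π d)) i j k l :=
  sum_pair8_perm (f := fun p q => T (π i) (π j) p q * star (T' p q (π k) (π l))
    - T' (π i) (π j) p q * star (T p q (π k) (π l)))
    (fun a b => by
      rw [hT.swap₁ a b, hT'.swap₁ a b, hT.swap₃ _ _ a b, hT'.swap₃ _ _ a b]
      simp only [star_neg, neg_mul_neg])
    (fun a => by rw [hT.self₁, hT'.self₁, star_zero, mul_zero, mul_zero, sub_zero]) π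

end DualFour

/-- The derivation action of a matrix on a tensor with four indices. -/
def fourAct (L : Matrix (Fin 8) (Fin 8) ℂ) (t : (Fin 4 → Fin 8) → ℂ) (v : Fin 4 → Fin 8) : ℂ :=
  ∑ i, ∑ a, L (v i) a * t (Function.update v i a)

theorem fourAct_vec (L : Matrix (Fin 8) (Fin 8) ℂ) (t : (Fin 4 → Fin 8) → ℂ) (a b c d : Fin 8) :
    fourAct L t ![a, b, c, d] = ∑ x, L a x * t ![x, b, c, d] + ∑ x, L b x * t ![a, x, c, d]
      + ∑ x, L c x * t ![a, b, x, d] + ∑ x, L d x * t ![a, b, c, x] := by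
  have e : ∀ x, Function.update ![a, b, c, d] 0 x = ![x, b, c, d] ∧
      Function.update ![a, b, c, d] 1 x = ![a, x, c, d] ∧
      Function.update ![a, b, c, d] 2 x = ![a, b, x, d] ∧
      Function.update ![a, b, c, d] 3 x = ![a, b, c, x] := by
    intro x
    refine ⟨?_, ?_, ?_, ?_⟩ <;> (ext i; fin_cases i <;> rfl)
  rw [fourAct, Fin.sum_univ_four]
  simp only [(e _).1, (e _).2.1, (e _).2.2.1, (e _).2.2.2]
  rfl

theorem fourAct_vec_perm (L : Matrix (Fin 8) (Fin 8) ℂ) (t : (Fin 4 → Fin 8) → ℂ)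
    (π : Equiv.Perm (Fin 8)) (a b c d : Fin 8) :
    fourAct L t ![π a, π b, π c, π d] = ∑ x, L (π a) (π x) * t ![π x, π b, π c, π d]
      + ∑ x, L (π b) (π x) * t ![π a, π x, π c, π d]
      + ∑ x, L (π c) (π x) * t ![π a, π b, π x, π d]
      + ∑ x, L (π d) (π x) * t ![π a, π b, π c, π x] := by
  rw [fourAct_vec, ← Equiv.sum_comp π fun x => L (π a) x * t ![x, π b, π c, π d],
    ← Equiv.sum_comp π fun x => L (π b) x * t ![π a, x, π c, π d],
    ← Equiv.sum_comp π fun x => L (π c) x * t ![π a, π b, x, π d],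
    ← Equiv.sum_comp π fun x => L (π d) x * t ![π a, π b, π c, x]]

theorem fourMat_transpose {t : (Fin 4 → Fin 8) → ℂ} (ht : IsAlternatingFour t) :
    (fourMat t).transpose = fourMat t := by
  ext p r
  exact ht.rotate p.1.1 p.1.2 r.1.1 r.1.2

/-- Left multiplication acts on the first two indices and right multiplication by the transpose on
the last two; together they give the derivation on all four. -/
theorem wedgeTwo_mul_fourMat {t : (Fin 4 → Fin 8) → ℂ} (ht : IsAlternatingFour t)
    (L : Matrix (Fin 8) (Fin 8) ℂ) :
    wedgeTwo L * fourMat t + fourMat t * (wedgeTwo L).transpose = fourMat (fourAct L t) := by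
  have h1 : wedgeTwo L * fourMat t = Matrix.of fun p r =>
      ∑ x, L p.1.1 x * t ![x, p.1.2, r.1.1, r.1.2] +
      ∑ x, L p.1.2 x * t ![p.1.1, x, r.1.1, r.1.2] := by
    ext p r
    exact sum_wedgeTwo_mul L (h := fun a b => t ![a, b, r.1.1, r.1.2])
      (fun a b => ht.swap₁ a b r.1.1 r.1.2) p
  have h2 : fourMat t * (wedgeTwo L).transpose = (wedgeTwo L * fourMat t).transpose := by
    rw [Matrix.transpose_mul, fourMat_transpose ht]
  rw [h2, h1]
  ext p r
  rw [fourMat, Matrix.of_apply, fourAct_vec, Matrix.add_apply, Matrix.transpose_apply,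
    Matrix.of_apply, Matrix.of_apply]
  simp only [ht.rotate p.1.1 p.1.2]
  ring

theorem IsAlternatingFour.fourAct {t : (Fin 4 → Fin 8) → ℂ} (ht : IsAlternatingFour t)
    (L : Matrix (Fin 8) (Fin 8) ℂ) : IsAlternatingFour (fourAct L t) := by
  intro v s
  rw [Sugra.fourAct, Sugra.fourAct, Finset.mul_sum,
    ← Equiv.sum_comp s fun i => _ * ∑ a, L (v i) a * t (Function.update v i a)]
  refine Finset.sum_congr rfl fun i _ => ?_
  rw [Finset.mul_sum]
  refine Finset.sum_congr rfl fun a _ => ?_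
  rw [Function.comp_apply, ← Function.update_comp_eq_of_injective v s.injective, ht]
  ring

/-- Conjugation turns `L` into minus its transpose. Entries of `L` between the two halves of the
indices then match under duality, while the diagonal entries of the two halves differ by the trace,
which vanishes. -/
theorem isSelfDualFour_fourAct {t : (Fin 4 → Fin 8) → ℂ} (ht : IsSelfDualFour t)
    {L : Matrix (Fin 8) (Fin 8) ℂ} (hL : L.conjTranspose + L = 0) (htr : L.trace = 0) :
    IsSelfDualFour (fourAct L t) := by
  refine ⟨IsAlternatingFour.fourAct ht.1 L, fun π => ?_⟩
  have hL' : ∀ i j, star (L i j) = -L j i := by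
    intro i j
    have h := congrFun (congrFun hL j) i
    rw [Matrix.add_apply, Matrix.conjTranspose_apply, Matrix.zero_apply] at h
    linear_combination h
  have hT := ht.isDualFour π
  have htr' : ∑ i, L (π i) (π i) = 0 := by rw [Equiv.sum_comp π fun i => L i i]; exact htr
  rw [fourAct_vec_perm, fourAct_vec_perm]
  generalize ((Equiv.Perm.sign π : ℤ) : ℂ) = ε at hT ⊢
  generalize hTT : (fun a b c d => t ![π a, π b, π c, π d]) = T at hT
  have e : ∀ a b c d, t ![π a, π b, π c, π d] = T a b c d := fun a b c d => by rw [← hTT]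
  simp only [e]
  generalize hM : (fun a b => L (π a) (π b)) = M
  have e' : ∀ a b, L (π a) (π b) = M a b := fun a b => by rw [← hM]
  simp only [e'] at htr' ⊢
  have hMs : ∀ i j, star (M i j) = -M j i := by intro i j; rw [← e', ← e', hL']
  have hd : star (T 0 1 2 3) = ε * T 4 5 6 7 := by simpa using hT.dual 1
  -- These are the components produced by entries of `L` which exchange an index of the first half
  -- with one of the second.
  have hs : ∀ a b : Fin 8, a ≠ b → ∀ v : Fin 8 → Fin 8, (∀ i, v i = Equiv.swap a b i) →
      star (T (v 0) (v 1) (v 2) (v 3)) = -(ε * T (v 4) (v 5) (v 6) (v 7)) := by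
    intro a b hab v hv
    have := hT.dual (Equiv.swap a b)
    rw [Equiv.Perm.sign_swap hab] at this
    simp only [hv, this]
    simp
  have h04 := hs 0 4 (by decide) ![4, 1, 2, 3, 0, 5, 6, 7] (by decide)
  have h05 := hs 0 5 (by decide) ![5, 1, 2, 3, 4, 0, 6, 7] (by decide)
  have h06 := hs 0 6 (by decide) ![6, 1, 2, 3, 4, 5, 0, 7] (by decide)
  have h07 := hs 0 7 (by decide) ![7, 1, 2, 3, 4, 5, 6, 0] (by decide)
  have h14 := hs 1 4 (by decide) ![0, 4, 2, 3, 1, 5, 6, 7] (by decide)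
  have h15 := hs 1 5 (by decide) ![0, 5, 2, 3, 4, 1, 6, 7] (by decide)
  have h16 := hs 1 6 (by decide) ![0, 6, 2, 3, 4, 5, 1, 7] (by decide)
  have h17 := hs 1 7 (by decide) ![0, 7, 2, 3, 4, 5, 6, 1] (by decide)
  have h24 := hs 2 4 (by decide) ![0, 1, 4, 3, 2, 5, 6, 7] (by decide)
  have h25 := hs 2 5 (by decide) ![0, 1, 5, 3, 4, 2, 6, 7] (by decide)
  have h26 := hs 2 6 (by decide) ![0, 1, 6, 3, 4, 5, 2, 7] (by decide)
  have h27 := hs 2 7 (by decide) ![0, 1, 7, 3, 4, 5, 6, 2] (by decide)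
  have h34 := hs 3 4 (by decide) ![0, 1, 2, 4, 3, 5, 6, 7] (by decide)
  have h35 := hs 3 5 (by decide) ![0, 1, 2, 5, 4, 3, 6, 7] (by decide)
  have h36 := hs 3 6 (by decide) ![0, 1, 2, 6, 4, 5, 3, 7] (by decide)
  have h37 := hs 3 7 (by decide) ![0, 1, 2, 7, 4, 5, 6, 3] (by decide)
  simp only [Matrix.cons_val_zero, Matrix.cons_val_one, Matrix.cons_val] at h04 h05 h06 h07 h14 h15 h16 h17 h24 h25 h26 h27 h34 h35 h36 h37
  have z1 : ∀ a b c, T a b a c = 0 := fun a b c => by rw [hT.swap₂, hT.self₁, neg_zero]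
  have z2 : ∀ a b c, T a b c a = 0 := fun a b c => by rw [hT.swap₃, z1, neg_zero]
  have z3 : ∀ a b c, T b a c a = 0 := fun a b c => by rw [hT.swap₃, hT.self₂, neg_zero]
  simp only [Fin.sum_univ_eight, hT.self₁, hT.self₂, hT.self₃, z1, z2, z3, mul_zero, add_zero,
    zero_add, star_add, star_mul', hMs, hd, h04, h05, h06, h07, h14, h15, h16, h17, h24, h25, h26,
    h27, h34, h35, h36, h37] at htr' ⊢
  linear_combination (-(ε * T 4 5 6 7)) * htr'

section FourBracket

variable {t t' : (Fin 4 → Fin 8) → ℂ}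

/-- A four-index tensor as a function of four arguments. -/
def curryFour (t : (Fin 4 → Fin 8) → ℂ) (a b c d : Fin 8) : ℂ := t ![a, b, c, d]

/-- The component in `𝔰𝔲(8)` of the bracket of two self-dual 4-forms. -/
def fourBracket (t t' : (Fin 4 → Fin 8) → ℂ) : Matrix (Fin 8) (Fin 8) ℂ :=
  Matrix.of fun j l => (1 / 6 : ℂ) * ∑ k, fourContract (curryFour t) (curryFour t') k j k l

theorem IsSelfDualFour.curryFour (ht : IsSelfDualFour t) : IsDualFour 1 (curryFour t) := by
  have h := ht.isDualFour 1
  rw [Equiv.Perm.sign_one, Units.val_one, Int.cast_one] at h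
  exact h

theorem fourContract_of_disjoint (ht : IsSelfDualFour t) (ht' : IsSelfDualFour t')
    {a b c d : Fin 8} (h : Function.Injective ![a, b, c, d]) :
    fourContract (curryFour t) (curryFour t') a b c d = 0 := by
  obtain ⟨π, rfl, rfl, rfl, rfl⟩ := exists_perm_apply_eq₄ h 0 1 2 3 (by decide)
  rw [fourContract_perm ht.curryFour ht'.curryFour]
  exact fourContract_disjoint (ht.isDualFour π) (ht'.isDualFour π)

theorem fourContract_of_adjacent (ht : IsSelfDualFour t) (ht' : IsSelfDualFour t')
    {a b d k : Fin 8} (h : Function.Injective ![a, k, b, d]) :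
    fourContract (curryFour t) (curryFour t') k b k d =
      fourContract (curryFour t) (curryFour t') a b a d := by
  obtain ⟨π, rfl, rfl, rfl, rfl⟩ := exists_perm_apply_eq₄ h 0 1 2 3 (by decide)
  rw [fourContract_perm ht.curryFour ht'.curryFour, fourContract_perm ht.curryFour ht'.curryFour]
  exact (fourContract_adjacent (ht.isDualFour π) (ht'.isDualFour π)).symm

/-- The six shared indices different from `b` and `d` give equal contractions, which cancels the
factor `1/6` in `fourBracket`. -/
theorem fourBracket_of_ne (ht : IsSelfDualFour t) (ht' : IsSelfDualFour t') {a b d : Fin 8}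
    (hab : a ≠ b) (had : a ≠ d) (hbd : b ≠ d) :
    fourBracket t t' b d = fourContract (curryFour t) (curryFour t') a b a d := by
  have h1 := ht.curryFour
  have h2 := ht'.curryFour
  have hk : ∀ k, fourContract (curryFour t) (curryFour t') k b k d =
      if k = b ∨ k = d then 0 else fourContract (curryFour t) (curryFour t') a b a d := by
    intro k
    split_ifs with h
    · rcases h with rfl | rfl
      · exact self_eq_neg.1 (fourContract_swap h1 h2 _ _ _ _)
      · exact self_eq_neg.1 (fourContract_swap' h1 h2 _ _ _ _)
    · rcases eq_or_ne k a with rfl | hka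
      · rfl
      · rw [not_or] at h
        exact fourContract_of_adjacent ht ht' (injective_vec₄ hka.symm hab had h.1 h.2 hbd)
  have hcard : ((Finset.univ.filter fun k => ¬(k = b ∨ k = d)).card : ℂ) = 6 := by
    have : (Finset.univ.filter fun k : Fin 8 => ¬(k = b ∨ k = d)).card = 6 := by
      clear hk hab had
      revert b d; decide
    rw [this]; norm_num
  rw [fourBracket, Matrix.of_apply]
  rw [Finset.sum_congr rfl fun k _ => hk k, Finset.sum_ite, Finset.sum_const_zero, zero_add, Finset.sum_const, nsmul_eq_mul, hcard]
  ring

theorem fourBracket_add_diag (ht : IsSelfDualFour t) (ht' : IsSelfDualFour t') {a b : Fin 8}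
    (hab : a ≠ b) :
    fourBracket t t' a a + fourBracket t t' b b =
      fourContract (curryFour t) (curryFour t') a b a b := by
  obtain ⟨π, rfl, rfl⟩ : ∃ π : Equiv.Perm (Fin 8), π 0 = a ∧ π 1 = b := by
    refine ⟨Equiv.swap 0 a * Equiv.swap 1 (Equiv.swap 0 a b), ?_⟩
    clear ht ht'
    revert a b; decide
  have h := fourContract_equal (ε := ((Equiv.Perm.sign π : ℤ) : ℂ)) (by
    rw [star_intCast, ← Int.cast_mul, Int.units_coe_mul_self, Int.cast_one])
    (ht.isDualFour π) (ht'.isDualFour π)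
  have e := fourContract_perm ht.curryFour ht'.curryFour π
  simp only [curryFour] at e
  simp only [← e] at h
  rw [Equiv.sum_comp π (fun k => fourContract (curryFour t) (curryFour t') k (π 0) k (π 0)),
    Equiv.sum_comp π (fun k => fourContract (curryFour t) (curryFour t') k (π 1) k (π 1))] at h
  simp only [fourBracket, Matrix.of_apply]
  change 6 * fourContract (curryFour t) (curryFour t') _ _ _ _ = _ at h
  linear_combination -(1 / 6 : ℂ) * h

/-- The contraction has the index pattern of an induced action on bivectors: zero for disjoint
pairs, one matrix entry for pairs which share an index, the sum of two diagonal entries for equal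
pairs. The remaining cases are antisymmetry. -/
theorem fourContract_eq_wedgeTwoFun (ht : IsSelfDualFour t) (ht' : IsSelfDualFour t')
    {a b c d : Fin 8} (hab : a ≠ b) (hcd : c ≠ d) :
    fourContract (curryFour t) (curryFour t') a b c d = wedgeTwoFun (fourBracket t t') a b c d := by
  have h1 := ht.curryFour
  have h2 := ht'.curryFour
  have share : ∀ {a b d : Fin 8}, a ≠ b → a ≠ d →
      fourContract (curryFour t) (curryFour t') a b a d =
        wedgeTwoFun (fourBracket t t') a b a d := by
    intro a b d hab had
    rcases eq_or_ne b d with rfl | hbd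
    · rw [← fourBracket_add_diag ht ht' hab]
      simp [wedgeTwoFun, hab, hab.symm]
    · rw [← fourBracket_of_ne ht ht' hab had hbd]
      simp [wedgeTwoFun, hab.symm, had, hbd]
  rcases eq_or_ne a c with rfl | hac
  · exact share hab hcd
  rcases eq_or_ne a d with rfl | had
  · rw [fourContract_swap' h1 h2, wedgeTwoFun_swap, share hab hcd.symm]
  rcases eq_or_ne b c with rfl | hbc
  · rw [fourContract_swap h1 h2, wedgeTwoFun_swap', share hab.symm hcd]
  rcases eq_or_ne b d with rfl | hbd
  · rw [fourContract_swap h1 h2, wedgeTwoFun_swap', fourContract_swap' h1 h2, wedgeTwoFun_swap,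
      share hab.symm hcd.symm]
  · rw [fourContract_of_disjoint ht ht' (injective_vec₄ hab hac had hbc hbd hcd)]
    simp [wedgeTwoFun, hac, had, hbc, hbd]

/-- This closes the bracket: two elements of the noncompact part commute into `𝔰𝔲(8)`. -/
theorem fourMat_mul_sub (ht : IsSelfDualFour t) (ht' : IsSelfDualFour t') :
    fourMat t * (fourMat t').map star - fourMat t' * (fourMat t).map star =
      wedgeTwo (fourBracket t t') := by
  ext p r
  rw [wedgeTwo_apply, ← fourContract_eq_wedgeTwoFun ht ht' p.2.ne r.2.ne, fourContract,
    Finset.sum_sub_distrib]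
  rfl

/-- Inserting the diagonal relation into the definition of the entry `m` at `(0, 0)` gives `6 m = tr
+ 8 m - 2 m`. -/
theorem trace_fourBracket (ht : IsSelfDualFour t) (ht' : IsSelfDualFour t') :
    (fourBracket t t').trace = 0 := by
  have h : ∀ k, fourContract (curryFour t) (curryFour t') k 0 k 0 =
      fourBracket t t' k k + fourBracket t t' 0 0 - if k = 0 then 2 * fourBracket t t' 0 0 else 0 := by
    intro k
    split_ifs with hk
    · subst hk
      rw [self_eq_neg.1 (fourContract_swap ht.curryFour ht'.curryFour 0 0 0 0)]
      ring
    · rw [fourBracket_add_diag ht ht' hk, sub_zero]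
  have h0 : fourBracket t t' 0 0 =
      (1 / 6 : ℂ) * ∑ k, fourContract (curryFour t) (curryFour t') k 0 k 0 := rfl
  simp only [h, Finset.sum_sub_distrib, Finset.sum_add_distrib, Finset.sum_ite_eq', Finset.mem_univ,
    if_true, Finset.sum_const, Finset.card_univ, Fintype.card_fin, nsmul_eq_mul] at h0
  change ∑ k, fourBracket t t' k k = 0
  push_cast at h0
  linear_combination -6 * h0

theorem conjTranspose_fourBracket (ht : IsSelfDualFour t) (ht' : IsSelfDualFour t') :
    (fourBracket t t').conjTranspose + fourBracket t t' = 0 := by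
  ext j l
  simp only [Matrix.add_apply, Matrix.conjTranspose_apply, fourBracket, Matrix.of_apply, star_mul',
    star_sum, star_fourContract ht.curryFour ht'.curryFour, Finset.sum_neg_distrib, Matrix.zero_apply]
  simp

end FourBracket

theorem wedgeTwo_conjTranspose (L : Matrix (Fin 8) (Fin 8) ℂ) :
    (wedgeTwo L).conjTranspose = wedgeTwo L.conjTranspose := by
  ext p r
  simp only [Matrix.conjTranspose_apply, wedgeTwo_apply, wedgeTwoFun, star_sub, star_add, star_mul',
    apply_ite star, star_one, star_zero, eq_comm (a := r.1.1), eq_comm (a := r.1.2)]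
  ring

theorem map_star_mul {m n o : Type*} [Fintype n] (X : Matrix m n ℂ) (Y : Matrix n o ℂ) :
    (X * Y).map star = X.map star * Y.map star := by
  ext i j
  simp [Matrix.mul_apply]

theorem isSelfAdjointLie_e77Lie : IsSelfAdjointLie e77Lie where
  conjTranspose := by
    rintro _ ⟨L, t, hL, htr, ht, rfl⟩
    have hL' : L.conjTranspose = -L := eq_neg_of_add_eq_zero_left hL
    refine ⟨-L, t, by rw [Matrix.conjTranspose_neg, hL', neg_neg, add_neg_cancel],
      by rw [Matrix.trace_neg, htr, neg_zero], ht, ?_⟩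
    have h1 : (wedgeTwo L).conjTranspose = wedgeTwo (-L) := by rw [wedgeTwo_conjTranspose, hL']
    have h2 : ((fourMat t).map star).conjTranspose = fourMat t := by
      conv_rhs => rw [← fourMat_transpose ht.1]
      ext i j
      simp
    have h3 : (fourMat t).conjTranspose = (fourMat t).map star := by
      conv_rhs => rw [← fourMat_transpose ht.1]
      rfl
    have h4 : ((wedgeTwo L).map star).conjTranspose = (wedgeTwo (-L)).map star := by
      rw [← h1]
      rfl
    rw [Matrix.fromBlocks_conjTranspose, h1, h2, h3, h4]
  bracket := by
    rintro _ ⟨L, t, hL, htr, ht, rfl⟩ _ ⟨L', t', hL', htr', ht', rfl⟩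
    have hS : ∀ {M : Matrix (Fin 8) (Fin 8) ℂ}, M.conjTranspose + M = 0 →
        (wedgeTwo M).map star = -(wedgeTwo M).transpose := by
      intro M hM
      have h1 : (wedgeTwo M).map star = (wedgeTwo M).conjTranspose.transpose := rfl
      rw [h1, wedgeTwo_conjTranspose, eq_neg_of_add_eq_zero_left hM]
      ext p r
      simp only [Matrix.transpose_apply, Matrix.neg_apply, wedgeTwo_apply, wedgeTwoFun]
      ring
    have hd := isSelfDualFour_fourAct ht' hL htr
    have hd' := isSelfDualFour_fourAct ht hL' htr'
    have hF : fourMat (fourAct L t' - fourAct L' t) = wedgeTwo L * fourMat t' +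
        fourMat t * (wedgeTwo L').map star - (wedgeTwo L' * fourMat t +
        fourMat t' * (wedgeTwo L).map star) := by
      have e : fourMat (fourAct L t' - fourAct L' t) =
        fourMat (fourAct L t') - fourMat (fourAct L' t) := rfl
      rw [e, ← wedgeTwo_mul_fourMat ht'.1, ← wedgeTwo_mul_fourMat ht.1, hS hL, hS hL', mul_neg, mul_neg]
      abel
    have hW : wedgeTwo (L * L' - L' * L + fourBracket t t') = wedgeTwo L * wedgeTwo L' +
        fourMat t * (fourMat t').map star - (wedgeTwo L' * wedgeTwo L +
        fourMat t' * (fourMat t).map star) := by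
      rw [wedgeTwo_add, ← wedgeTwo_mul_sub, ← fourMat_mul_sub ht ht']
      abel
    have hm : ∀ X Y : Matrix Pair8 Pair8 ℂ, (X - Y).map star = X.map star - Y.map star := by
      intro X Y; ext; simp
    have hp : ∀ X Y : Matrix Pair8 Pair8 ℂ, (X + Y).map star = X.map star + Y.map star := by
      intro X Y; ext; simp
    have hss : ∀ X : Matrix Pair8 Pair8 ℂ, (X.map star).map star = X := by
      intro X; ext; simp
    refine ⟨L * L' - L' * L + fourBracket t t', fourAct L t' - fourAct L' t, ?_, ?_, ⟨?_, ?_⟩, ?_⟩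
    · rw [Matrix.conjTranspose_add, Matrix.conjTranspose_sub, Matrix.conjTranspose_mul,
        Matrix.conjTranspose_mul, eq_neg_of_add_eq_zero_left hL, eq_neg_of_add_eq_zero_left hL',
        eq_neg_of_add_eq_zero_left (conjTranspose_fourBracket ht ht'), neg_mul_neg, neg_mul_neg]
      abel
    · rw [Matrix.trace_add, Matrix.trace_sub, Matrix.trace_mul_comm, sub_self, zero_add,
        trace_fourBracket ht ht']
    · intro v s
      rw [Pi.sub_apply, Pi.sub_apply, hd.1, hd'.1, mul_sub]
    · intro s
      rw [Pi.sub_apply, Pi.sub_apply, star_sub, hd.2, hd'.2, mul_sub]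
    · rw [Matrix.fromBlocks_multiply, Matrix.fromBlocks_multiply, sub_eq_add_neg,
        Matrix.fromBlocks_neg, Matrix.fromBlocks_add, hF, hW, hm, hm, hp, hp, hp, hp, map_star_mul,
        map_star_mul, map_star_mul, map_star_mul, map_star_mul, map_star_mul, map_star_mul,
        map_star_mul, hss, hss, hss, hss]
      congr 1 <;> abel

end Sugra

set_option linter.unusedSimpArgs false

namespace Sugra

/-! ### Commutators with `𝔨` on the complexified tangent space. -/

section ComplexifyCommutator

variable {ι : Type*} [Fintype ι] [DecidableEq ι] {𝔤 : Submodule ℝ (Matrix ι ι ℂ)}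

theorem IsComplexHerm.complexify_smul_I {A : Module.End ℝ (Chart 𝔤)} {X : Matrix ι ι ℂ}
    (hX : IsComplexHerm 𝔤 X) :
    Sugra.complexify A (Complex.I • X) = Complex.I • Sugra.complexify A X := by
  obtain ⟨a, b, rfl⟩ := hX
  have h : Complex.I • (Chart.toMatrix 𝔤 a + Complex.I • Chart.toMatrix 𝔤 b) =
      Chart.toMatrix 𝔤 (-b) + Complex.I • Chart.toMatrix 𝔤 a := by
    rw [smul_add, smul_smul, Complex.I_mul_I, map_neg]
    module
  rw [h, complexify_apply, complexify_apply, smul_add, smul_smul, Complex.I_mul_I, map_neg, map_neg]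
  module

theorem IsComplexHerm.smul_I {X : Matrix ι ι ℂ} (hX : IsComplexHerm 𝔤 X) :
    IsComplexHerm 𝔤 (Complex.I • X) := by
  obtain ⟨a, b, rfl⟩ := hX
  refine ⟨-b, a, ?_⟩
  rw [smul_add, smul_smul, Complex.I_mul_I, map_neg]
  module

theorem IsComplexHerm.complexify_neg {A : Module.End ℝ (Chart 𝔤)} {X : Matrix ι ι ℂ}
    (hX : IsComplexHerm 𝔤 X) : Sugra.complexify A (-X) = -Sugra.complexify A X := by
  have h : ∀ Y : Matrix ι ι ℂ, -Y = Complex.I • Complex.I • Y := by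
    intro Y
    rw [smul_smul, Complex.I_mul_I, neg_one_smul]
  rw [h, hX.smul_I.complexify_smul_I, hX.complexify_smul_I, ← h]

theorem IsComplexHerm.commutator (h𝔤 : IsSelfAdjointLie 𝔤) {κ X : Matrix ι ι ℂ} (hκ : κ ∈ 𝔤)
    (hκ' : κ.conjTranspose = -κ) (hX : IsComplexHerm 𝔤 X) : IsComplexHerm 𝔤 (κ * X - X * κ) := by
  obtain ⟨a, b, rfl⟩ := hX
  refine ⟨adjointEnd 𝔤 κ a, adjointEnd 𝔤 κ b, ?_⟩
  rw [toMatrix_adjointEnd h𝔤 hκ hκ', toMatrix_adjointEnd h𝔤 hκ hκ']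
  simp only [mul_add, add_mul, mul_smul_comm, smul_mul_assoc]
  module

theorem IsComplexHerm.complexify_commutator (h𝔤 : IsSelfAdjointLie 𝔤) {κ X : Matrix ι ι ℂ}
    (hκ : κ ∈ 𝔤) (hκ' : κ.conjTranspose = -κ) (hX : IsComplexHerm 𝔤 X)
    (A : Module.End ℝ (Chart 𝔤)) :
    Sugra.complexify (adjointEnd 𝔤 κ * A - A * adjointEnd 𝔤 κ) X =
      κ * Sugra.complexify A X - Sugra.complexify A X * κ - Sugra.complexify A (κ * X - X * κ) := by
  obtain ⟨a, b, rfl⟩ := hX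
  have h : κ * (Chart.toMatrix 𝔤 a + Complex.I • Chart.toMatrix 𝔤 b) -
      (Chart.toMatrix 𝔤 a + Complex.I • Chart.toMatrix 𝔤 b) * κ =
      Chart.toMatrix 𝔤 (adjointEnd 𝔤 κ a) + Complex.I • Chart.toMatrix 𝔤 (adjointEnd 𝔤 κ b) := by
    rw [toMatrix_adjointEnd h𝔤 hκ hκ', toMatrix_adjointEnd h𝔤 hκ hκ']
    simp only [mul_add, add_mul, mul_smul_comm, smul_mul_assoc]
    module
  rw [h, complexify_apply, complexify_apply, complexify_apply]
  simp only [LinearMap.sub_apply, Module.End.mul_apply, map_sub,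
    toMatrix_adjointEnd h𝔤 hκ hκ' (A a), toMatrix_adjointEnd h𝔤 hκ hκ' (A b)]
  simp only [mul_add, add_mul, mul_smul_comm, smul_mul_assoc]
  module

end ComplexifyCommutator

/-! ### The complexified tangent space of `E₇₍₇₎/SU(8)` -/

/-- Pairs of 4-forms of `ℂ⁸` which are dual to each other; these pairs form the complexification of
the self-dual 4-forms. -/
structure IsDualPair (t u : (Fin 4 → Fin 8) → ℂ) : Prop where
  left : IsAlternatingFour t
  right : IsAlternatingFour u
  dual : ∀ s : Equiv.Perm (Fin 8), u ![s 0, s 1, s 2, s 3] =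
    ((Equiv.Perm.sign s : ℤ) : ℂ) * t ![s 4, s 5, s 6, s 7]

/-- The permutation which exchanges the two halves of `Fin 8`. -/
def halfSwap : Equiv.Perm (Fin 8) := Equiv.addRight 4

theorem sign_halfSwap : Equiv.Perm.sign halfSwap = 1 := by decide

theorem sign_mul_self_cast {α : Type*} [Fintype α] [DecidableEq α] (s : Equiv.Perm α) :
    ((Equiv.Perm.sign s : ℤ) : ℂ) * ((Equiv.Perm.sign s : ℤ) : ℂ) = 1 := by
  rw [← Int.cast_mul, Int.units_coe_mul_self, Int.cast_one]

theorem IsDualPair.symm {t u : (Fin 4 → Fin 8) → ℂ} (h : IsDualPair t u) : IsDualPair u t where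
  left := h.right
  right := h.left
  dual s := by
    have h1 := h.dual (s * halfSwap)
    rw [Equiv.Perm.sign_mul, sign_halfSwap, mul_one] at h1
    change u ![s 4, s 5, s 6, s 7] = _ * t ![s 0, s 1, s 2, s 3] at h1
    rw [h1, ← mul_assoc, sign_mul_self_cast, one_mul]

theorem IsAlternatingFour.eq_zero_of_not_injective {t : (Fin 4 → Fin 8) → ℂ}
    (ht : IsAlternatingFour t) {v : Fin 4 → Fin 8} (hv : ¬Function.Injective v) : t v = 0 := by
  rw [Function.Injective] at hv
  push Not at hv
  obtain ⟨i, j, hij, hne⟩ := hv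
  refine self_eq_neg.1 ?_
  rw [← ht.swap v hne]
  congr 1
  funext k
  rw [Function.comp_apply, Equiv.swap_apply_def]
  split_ifs with h1 h2
  · rw [h1, hij]
  · rw [h2, hij]
  · rfl

theorem vec_four_eta {α : Type*} (v : Fin 4 → α) : ![v 0, v 1, v 2, v 3] = v := by
  ext i; fin_cases i <;> rfl

/-- An injective quadruple is the first half of an even permutation. -/
theorem exists_even_perm {v : Fin 4 → Fin 8} (hv : Function.Injective v) :
    ∃ π : Equiv.Perm (Fin 8), Equiv.Perm.sign π = 1 ∧ v = ![π 0, π 1, π 2, π 3] := by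
  rw [← vec_four_eta v] at hv
  obtain ⟨π, h0, h1, h2, h3⟩ := exists_perm_apply_eq₄ hv 0 1 2 3 (by decide)
  rcases Int.units_eq_one_or (Equiv.Perm.sign π) with hs | hs
  · exact ⟨π, hs, by rw [h0, h1, h2, h3, vec_four_eta]⟩
  -- An odd permutation is corrected by exchanging its last two values, which the quadruple does not
  -- see.
  · refine ⟨π * Equiv.swap 6 7, ?_, ?_⟩
    · rw [Equiv.Perm.sign_mul, hs, Equiv.Perm.sign_swap (by decide)]
      rfl
    · rw [← vec_four_eta v, ← h0, ← h1, ← h2, ← h3]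
      rfl

theorem IsAlternatingFour.eq_zero {t : (Fin 4 → Fin 8) → ℂ} (ht : IsAlternatingFour t)
    (h : ∀ π : Equiv.Perm (Fin 8), Equiv.Perm.sign π = 1 → t ![π 0, π 1, π 2, π 3] = 0) : t = 0 := by
  funext v
  by_cases hv : Function.Injective v
  · obtain ⟨π, hs, rfl⟩ := exists_even_perm hv
    exact h π hs
  · exact ht.eq_zero_of_not_injective hv

theorem IsAlternatingFour.sub {t t' : (Fin 4 → Fin 8) → ℂ} (ht : IsAlternatingFour t)
    (ht' : IsAlternatingFour t') : IsAlternatingFour (t - t') := fun v s => by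
  rw [Pi.sub_apply, Pi.sub_apply, ht, ht', mul_sub]

theorem IsDualPair.right_eq {t u u' : (Fin 4 → Fin 8) → ℂ} (h : IsDualPair t u)
    (h' : IsDualPair t u') : u = u' :=
  sub_eq_zero.1 ((h.right.sub h'.right).eq_zero fun π _ => by
    rw [Pi.sub_apply, h.dual, h'.dual, sub_self])

/-- The matrix of a pair of 4-forms. -/
abbrev dualPairMat (t u : (Fin 4 → Fin 8) → ℂ) : Matrix (Pair8 ⊕ Pair8) (Pair8 ⊕ Pair8) ℂ :=
  offBlock (fourMat t) (fourMat u)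

theorem wedgeTwo_zero : wedgeTwo 0 = 0 := by
  ext p r
  simp [wedgeTwo]

theorem mem_e77Lie_of_isSelfDualFour {t : (Fin 4 → Fin 8) → ℂ} (ht : IsSelfDualFour t) :
    dualPairMat t (star t) ∈ e77Lie := by
  refine ⟨0, t, by simp, by simp, ht, ?_⟩
  rw [wedgeTwo_zero]
  ext (i | i) (j | j) <;> simp [fourMat]

theorem fourMat_conjTranspose {t : (Fin 4 → Fin 8) → ℂ} (ht : IsAlternatingFour t) :
    (fourMat t).conjTranspose = fourMat (star t) := by
  conv_rhs => rw [← fourMat_transpose (t := star t) (fun v s => by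
    rw [Pi.star_apply, Pi.star_apply, ht, star_mul', star_intCast])]
  rfl

/-- For a complex number `a` the form `a t + (a u)^*` is self-dual. The values `a = 1` and `a = i`
supply the two Hermitian parts of the matrix. -/
theorem isComplexHerm_dualPairMat {t u : (Fin 4 → Fin 8) → ℂ} (h : IsDualPair t u) :
    IsComplexHerm e77Lie (dualPairMat t u) := by
  have key : ∀ (a : ℂ), a ≠ 0 → IsSelfDualFour (a • t + star (a • u)) := by
    intro a _
    refine ⟨fun v s => ?_, fun s => ?_⟩
    · simp only [Pi.add_apply, Pi.smul_apply, Pi.star_apply, smul_eq_mul, h.left v s, h.right v s,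
        star_mul', star_intCast]
      ring
    · simp only [Pi.add_apply, Pi.smul_apply, Pi.star_apply, smul_eq_mul, h.dual s, h.symm.dual s,
        star_mul', star_intCast, star_add, star_star]
      ring
  have hmat : ∀ a : ℂ, a ≠ 0 → a • dualPairMat t u + (a • dualPairMat t u).conjTranspose ∈ e77Lie := by
    intro a ha
    convert mem_e77Lie_of_isSelfDualFour (key a ha) using 1
    rw [Matrix.conjTranspose_smul, Matrix.fromBlocks_conjTranspose, fourMat_conjTranspose h.left,
      fourMat_conjTranspose h.right, Matrix.conjTranspose_zero]
    ext (i | i) (j | j) <;> simp [fourMat]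
    ring
  refine isComplexHerm_of_mem ?_ ?_
  · simpa using hmat 1 one_ne_zero
  · convert hmat Complex.I Complex.I_ne_zero using 1
    rw [Matrix.conjTranspose_smul, Complex.star_def, Complex.conj_I]
    module

theorem exists_of_mem_hermPart {X : Matrix (Pair8 ⊕ Pair8) (Pair8 ⊕ Pair8) ℂ} (hX : X ∈ e77Lie)
    (hX' : X.conjTranspose = X) : ∃ t, IsSelfDualFour t ∧ X = dualPairMat t (star t) := by
  obtain ⟨L, t, hL, -, ht, rfl⟩ := hX
  refine ⟨t, ht, ?_⟩
  rw [Matrix.fromBlocks_conjTranspose, Matrix.fromBlocks_inj, wedgeTwo_conjTranspose,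
    eq_neg_of_add_eq_zero_left hL] at hX'
  have h0 : wedgeTwo L = 0 := by
    have h1 := hX'.1
    ext p r
    have h2 := congrFun (congrFun h1 p) r
    have h3 : wedgeTwo (-L) p r = -wedgeTwo L p r := by
      simp only [wedgeTwo_apply, wedgeTwoFun, Matrix.neg_apply]; ring
    rw [h3] at h2
    exact self_eq_neg.1 h2.symm
  rw [h0]
  ext (i | i) (j | j) <;> simp [fourMat]

theorem IsComplexHerm.exists_dualPair {X : Matrix (Pair8 ⊕ Pair8) (Pair8 ⊕ Pair8) ℂ}
    (hX : IsComplexHerm e77Lie X) : ∃ t u, IsDualPair t u ∧ X = dualPairMat t u := by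
  obtain ⟨a, b, rfl⟩ := hX
  obtain ⟨t, ht, hta⟩ := exists_of_mem_hermPart (Chart.toMatrix_mem a)
    (Chart.toMatrix_conjTranspose a)
  obtain ⟨t', ht', htb⟩ := exists_of_mem_hermPart (Chart.toMatrix_mem b)
    (Chart.toMatrix_conjTranspose b)
  refine ⟨t + Complex.I • t', star t + Complex.I • star t', ⟨fun v s => ?_, fun v s => ?_,
    fun s => ?_⟩, ?_⟩
  · simp only [Pi.add_apply, Pi.smul_apply, smul_eq_mul, ht.1 v s, ht'.1 v s]
    ring
  · simp only [Pi.add_apply, Pi.smul_apply, Pi.star_apply, smul_eq_mul, ht.1 v s, ht'.1 v s,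
      star_mul', star_intCast]
    ring
  · simp only [Pi.add_apply, Pi.smul_apply, Pi.star_apply, smul_eq_mul, ht.2 s, ht'.2 s]
    ring
  · rw [hta, htb]
    ext (i | i) (j | j) <;> simp [fourMat]

theorem firstProj_comm_e77Lie {κ : Matrix (Pair8 ⊕ Pair8) (Pair8 ⊕ Pair8) ℂ} (hκ : κ ∈ e77Lie)
    (hκ' : κ.conjTranspose = -κ) : firstProj Pair8 Pair8 * κ = κ * firstProj Pair8 Pair8 := by
  obtain ⟨L, t, hL, -, ht, rfl⟩ := hκ
  rw [Matrix.fromBlocks_conjTranspose, Matrix.fromBlocks_neg, Matrix.fromBlocks_inj] at hκ'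
  have h0 : fourMat t = 0 := by
    have h1 := hκ'.2.1
    ext p r
    have h2 := congrFun (congrFun h1 p) r
    have h3 : ((fourMat t).map star).conjTranspose p r = fourMat t p r := by
      conv_rhs => rw [← fourMat_transpose ht.1]
      simp
    rw [h3] at h2
    exact self_eq_neg.1 h2
  rw [h0, Matrix.fromBlocks_multiply, Matrix.fromBlocks_multiply]
  simp [Matrix.map_zero]

/-! ### Decomposable 4-forms -/

/-- The 4-form `e_{v0} ∧ e_{v1} ∧ e_{v2} ∧ e_{v3}`. -/
def unitFour (v w : Fin 4 → Fin 8) : ℂ :=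
  Matrix.det (Matrix.of fun i j => if w i = v j then (1 : ℂ) else 0)

theorem isAlternatingFour_unitFour (v : Fin 4 → Fin 8) : IsAlternatingFour (unitFour v) :=
  fun w s => Matrix.det_permute s (Matrix.of fun i j => if w i = v j then (1 : ℂ) else 0)

theorem unitFour_comp (v : Fin 4 → Fin 8) (s : Equiv.Perm (Fin 4)) :
    unitFour (v ∘ s) = ((Equiv.Perm.sign s : ℤ) : ℂ) • unitFour v :=
  funext fun w => Matrix.det_permute' s (Matrix.of fun i j => if w i = v j then (1 : ℂ) else 0)

theorem unitFour_eq_zero {v w : Fin 4 → Fin 8} {i : Fin 4} (h : ∀ j, w i ≠ v j) :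
    unitFour v w = 0 :=
  Matrix.det_eq_zero_of_row_eq_zero i fun j => by simp [h j]

/-- Complementary minors of a permutation matrix. If `r` preserves the halves it is a sum of two
permutations, whose signs multiply to that of `r`; otherwise one minor has a zero row and the other
a zero column. -/
theorem det_halves (r : Equiv.Perm (Fin 4 ⊕ Fin 4)) :
    Matrix.det (Matrix.of fun i j => if r (Sum.inr i) = Sum.inr j then (1 : ℂ) else 0) =
      ((Equiv.Perm.sign r : ℤ) : ℂ) *
        Matrix.det (Matrix.of fun i j => if r (Sum.inl i) = Sum.inl j then (1 : ℂ) else 0) := by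
  have hdet : ∀ σ : Equiv.Perm (Fin 4), Matrix.det (Matrix.of fun i j =>
      if σ i = j then (1 : ℂ) else 0) = ((Equiv.Perm.sign σ : ℤ) : ℂ) := by
    intro σ
    rw [← Matrix.det_permutation]
    congr 1
    ext i j
    simp [Equiv.Perm.permMatrix, PEquiv.toMatrix_apply, eq_comm]
  by_cases h : Set.MapsTo r (Set.range (Sum.inl : Fin 4 → Fin 4 ⊕ Fin 4)) (Set.range Sum.inl)
  · obtain ⟨⟨σ, τ⟩, rfl⟩ := Equiv.Perm.mem_sumCongrHom_range_of_perm_mapsTo_inl h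
    simp only [Equiv.Perm.sumCongrHom_apply, Equiv.Perm.sumCongr_apply, Sum.map_inl, Sum.map_inr,
      Sum.inl.injEq, Sum.inr.injEq, hdet, Equiv.Perm.sign_sumCongr]
    push_cast
    linear_combination -((Equiv.Perm.sign τ : ℤ) : ℂ) * sign_mul_self_cast σ
  · rw [Set.MapsTo] at h
    push Not at h
    obtain ⟨_, ⟨i, rfl⟩, hi⟩ := h
    obtain ⟨k, hk⟩ : ∃ k, r (Sum.inl i) = Sum.inr k := by
      rcases hr : r (Sum.inl i) with k | k
      · exact absurd ⟨k, hr.symm⟩ hi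
      · exact ⟨k, rfl⟩
    rw [Matrix.det_eq_zero_of_row_eq_zero (A := Matrix.of fun i j =>
        if r (Sum.inl i) = Sum.inl j then (1 : ℂ) else 0) i (fun j => by simp [hk]), mul_zero]
    refine Matrix.det_eq_zero_of_column_eq_zero k fun j => ?_
    rw [Matrix.of_apply, if_neg]
    rw [← hk, r.injective.eq_iff]
    exact Sum.inr_ne_inl

/-- The dual of a decomposable form is decomposable on the complementary indices. The sign comes
from `det_halves` for `π⁻¹ s`, with the halves exchanged by `halfSwap` so that the first four values
of `s` meet the last four of `π`. -/
theorem isDualPair_unitFour {π : Equiv.Perm (Fin 8)} (hπ : Equiv.Perm.sign π = 1) :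
    IsDualPair (unitFour ![π 0, π 1, π 2, π 3]) (unitFour ![π 4, π 5, π 6, π 7]) where
  left := isAlternatingFour_unitFour _
  right := isAlternatingFour_unitFour _
  dual s := by
    have h := det_halves ((finSumFinEquiv (m := 4) (n := 4)).permCongr.symm (π⁻¹ * s * halfSwap))
    have hs : Equiv.Perm.sign ((finSumFinEquiv (m := 4) (n := 4)).permCongr.symm (π⁻¹ * s * halfSwap)) =
        Equiv.Perm.sign s := by
      rw [Equiv.permCongr_symm, Equiv.Perm.sign_permCongr, Equiv.Perm.sign_mul, Equiv.Perm.sign_mul,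
        sign_halfSwap, Equiv.Perm.sign_inv, hπ, one_mul, mul_one]
    have hr : ∀ x y, (finSumFinEquiv (m := 4) (n := 4)).permCongr.symm (π⁻¹ * s * halfSwap) x = y ↔
        s (halfSwap (finSumFinEquiv (m := 4) (n := 4) x)) = π (finSumFinEquiv (m := 4) (n := 4) y) := by
      intro x y
      rw [Equiv.permCongr_symm, Equiv.permCongr_apply, Equiv.symm_symm, Equiv.symm_apply_eq,
        Equiv.Perm.mul_apply, Equiv.Perm.mul_apply, Equiv.Perm.inv_eq_iff_eq]
    have e₁ : ∀ i : Fin 4, halfSwap (![4, 5, 6, 7] i) = ![0, 1, 2, 3] i := by decide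
    have e₂ : ∀ i : Fin 4, halfSwap (![0, 1, 2, 3] i) = ![4, 5, 6, 7] i := by decide
    have e₃ : ∀ i : Fin 4, finSumFinEquiv (m := 4) (n := 4) (Sum.inr i) = ![4, 5, 6, 7] i := by decide
    have e₄ : ∀ i : Fin 4, finSumFinEquiv (m := 4) (n := 4) (Sum.inl i) = ![0, 1, 2, 3] i := by decide
    have e₅ : ∀ (f : Fin 8 → Fin 8) (i : Fin 4), f (![0, 1, 2, 3] i) = ![f 0, f 1, f 2, f 3] i := by
      intro f i; fin_cases i <;> rfl
    have e₆ : ∀ (f : Fin 8 → Fin 8) (i : Fin 4), f (![4, 5, 6, 7] i) = ![f 4, f 5, f 6, f 7] i := by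
      intro f i; fin_cases i <;> rfl
    rw [hs] at h
    simp only [hr, e₁, e₂, e₃, e₄, e₅ s, e₆ s, e₅ π, e₆ π] at h
    rw [unitFour, unitFour]
    convert h

end Sugra

set_option linter.unusedSimpArgs false

/-! ### Bivectors and decomposable 4-forms as matrices on `Λ²ℂ⁸`. -/

namespace Sugra

/-- The coordinates of `e_a ∧ e_b`. -/
def pairVec (a b : Fin 8) (p : Pair8) : ℂ :=
  (if p.1.1 = a then 1 else 0) * (if p.1.2 = b then 1 else 0)
    - (if p.1.1 = b then 1 else 0) * (if p.1.2 = a then 1 else 0)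

theorem pairVec_dot (a b : Fin 8) {h : Fin 8 → Fin 8 → ℂ} (hh : ∀ a b, h b a = -h a b) :
    pairVec a b ⬝ᵥ (fun p : Pair8 => h p.1.1 p.1.2) = h a b := by
  have hd : ∀ a, h a a = 0 := fun a => self_eq_neg.1 (hh a a)
  have h1 := two_mul_sum_pair8 (f := fun c d => ((if c = a then 1 else 0) * (if d = b then 1 else 0)
    - (if c = b then 1 else 0) * (if d = a then 1 else 0)) * h c d)
    (fun c d => by rw [hh c d]; ring) (fun c => by rw [hd, mul_zero])
  refine mul_left_cancel₀ (two_ne_zero (α := ℂ)) (h1.trans ?_)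
  simp only [sub_mul, Finset.sum_sub_distrib, ite_mul, mul_ite, one_mul, mul_one, zero_mul, mul_zero,
    Finset.sum_ite_eq', Finset.sum_ite_irrel, Finset.sum_const_zero, Finset.mem_univ, if_true]
  rw [hh a b]
  ring

theorem pairVec_dot_pairVec (a b c d : Fin 8) : pairVec a b ⬝ᵥ pairVec c d =
    (if a = c then 1 else 0) * (if b = d then 1 else 0)
      - (if a = d then 1 else 0) * (if b = c then 1 else 0) :=
  pairVec_dot a b (h := fun x y => (if x = c then 1 else 0) * (if y = d then 1 else 0)
    - (if x = d then 1 else 0) * (if y = c then 1 else 0)) fun x y => by ring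

theorem pairVec_dot_fourMat {t : (Fin 4 → Fin 8) → ℂ} (ht : IsAlternatingFour t)
    (a b c d : Fin 8) : pairVec a b ⬝ᵥ (Matrix.mulVec (fourMat t) (pairVec c d)) = t ![a, b, c, d] := by
  have h : Matrix.mulVec (fourMat t) (pairVec c d) = fun p : Pair8 => t ![p.1.1, p.1.2, c, d] := by
    funext p
    rw [Matrix.mulVec, dotProduct_comm]
    exact pairVec_dot c d (h := fun x y => t ![p.1.1, p.1.2, x, y]) fun x y => ht.swap₃ _ _ _ _
  rw [h]
  exact pairVec_dot a b (h := fun x y => t ![x, y, c, d]) fun x y => ht.swap₁ _ _ _ _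

theorem det_fin_four (M : Matrix (Fin 4) (Fin 4) ℂ) : M.det =
    (M 0 0 * M 1 1 - M 0 1 * M 1 0) * (M 2 2 * M 3 3 - M 2 3 * M 3 2)
    - (M 0 0 * M 1 2 - M 0 2 * M 1 0) * (M 2 1 * M 3 3 - M 2 3 * M 3 1)
    + (M 0 0 * M 1 3 - M 0 3 * M 1 0) * (M 2 1 * M 3 2 - M 2 2 * M 3 1)
    + (M 0 1 * M 1 2 - M 0 2 * M 1 1) * (M 2 0 * M 3 3 - M 2 3 * M 3 0)
    - (M 0 1 * M 1 3 - M 0 3 * M 1 1) * (M 2 0 * M 3 2 - M 2 2 * M 3 0)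
    + (M 0 2 * M 1 3 - M 0 3 * M 1 2) * (M 2 0 * M 3 1 - M 2 1 * M 3 0) := by
  rw [Matrix.det_succ_row_zero]
  simp [Fin.sum_univ_four, Matrix.det_fin_three, Fin.succAbove]
  ring

theorem fourMat_unitFour (a b c d : Fin 8) : fourMat (unitFour ![a, b, c, d]) =
    Matrix.vecMulVec (pairVec a b) (pairVec c d) - Matrix.vecMulVec (pairVec a c) (pairVec b d)
    + Matrix.vecMulVec (pairVec a d) (pairVec b c) + Matrix.vecMulVec (pairVec b c) (pairVec a d)
    - Matrix.vecMulVec (pairVec b d) (pairVec a c) + Matrix.vecMulVec (pairVec c d) (pairVec a b) := by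
  ext p r
  rw [fourMat, Matrix.of_apply, unitFour, det_fin_four]
  simp only [Matrix.of_apply, Matrix.add_apply, Matrix.sub_apply, Matrix.vecMulVec_apply, pairVec]
  rfl

theorem trace_mul_vecMulVec (M : Matrix Pair8 Pair8 ℂ) (x y : Pair8 → ℂ) :
    Matrix.trace (M * Matrix.vecMulVec x y) = y ⬝ᵥ Matrix.mulVec M x := by
  rw [Matrix.mul_vecMulVec, Matrix.trace_vecMulVec, dotProduct_comm]

/-- The factor six counts the ordered splittings of the four indices into two pairs; by antisymmetry
they contribute equally. -/
theorem trace_fourMat_mul_unitFour {t : (Fin 4 → Fin 8) → ℂ} (ht : IsAlternatingFour t)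
    (a b c d : Fin 8) :
    Matrix.trace (fourMat t * fourMat (unitFour ![a, b, c, d])) = 6 * t ![a, b, c, d] := by
  rw [fourMat_unitFour]
  simp only [mul_add, mul_sub, Matrix.trace_add, Matrix.trace_sub, trace_mul_vecMulVec,
    pairVec_dot_fourMat ht]
  have h1 : t ![b, d, a, c] = -t ![a, b, c, d] := by
    rw [ht.swap₂ b a d c, ht.swap₁ a b d c, ht.swap₃ a b c d]; ring
  have h2 : t ![b, c, a, d] = t ![a, b, c, d] := by
    rw [ht.swap₂ b a c d, ht.swap₁ a b c d]; ring
  rw [ht.rotate a b c d, h1, h2, ht.rotate b c a d, h2, ht.rotate b d a c, h1]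
  ring

/-! ### Four disjoint pairs of indices -/

/-- The first index of the `i`-th pair. -/
def pairFst (i : Fin 4) : Fin 8 := ⟨2 * i, by omega⟩

/-- The second index of the `i`-th pair. -/
def pairSnd (i : Fin 4) : Fin 8 := ⟨2 * i + 1, by omega⟩

theorem pairFst_inj {i j : Fin 4} : pairFst i = pairFst j ↔ i = j := by
  simp only [pairFst, Fin.ext_iff]; omega

theorem pairSnd_inj {i j : Fin 4} : pairSnd i = pairSnd j ↔ i = j := by
  simp only [pairSnd, Fin.ext_iff]; omega

theorem pairFst_ne {i j : Fin 4} : pairFst i ≠ pairSnd j := by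
  simp only [pairFst, pairSnd, ne_eq, Fin.ext_iff]; omega

section Blocks

variable (π : Equiv.Perm (Fin 8)) {i j k l : Fin 4}

/-- The quadruple formed by the `i`-th and the `j`-th pair in a permuted basis. -/
abbrev blockQuad (i j : Fin 4) : Fin 4 → Fin 8 :=
  ![π (pairFst i), π (pairSnd i), π (pairFst j), π (pairSnd j)]

/-- The bivector of the `i`-th pair. -/
abbrev blockVec (i : Fin 4) : Pair8 → ℂ := pairVec (π (pairFst i)) (π (pairSnd i))

/-- The matrix of the 4-form of the `i`-th and the `j`-th pair. -/
abbrev blockMat (i j : Fin 4) : Matrix Pair8 Pair8 ℂ := fourMat (unitFour (blockQuad π i j))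

theorem blockMat_comm (i j : Fin 4) : blockMat π i j = blockMat π j i := by
  rw [blockMat, blockMat, fourMat_unitFour, fourMat_unitFour]
  have h : ∀ a b, pairVec a b = -pairVec b a := by
    intro a b; funext p; simp only [pairVec, Pi.neg_apply]; ring
  rw [h (π (pairFst i)) (π (pairFst j)), h (π (pairFst i)) (π (pairSnd j)),
    h (π (pairSnd i)) (π (pairFst j)), h (π (pairSnd i)) (π (pairSnd j))]
  simp only [Matrix.vecMulVec_neg, Matrix.neg_vecMulVec, neg_neg]
  abel

theorem blockMat_mulVec (hij : i ≠ j) : Matrix.mulVec (blockMat π i j) (blockVec π j) =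
    blockVec π i := by
  rw [blockMat, fourMat_unitFour]
  simp [Matrix.add_mulVec, Matrix.sub_mulVec, Matrix.vecMulVec_mulVec, pairVec_dot_pairVec,
    pairFst_inj, pairSnd_inj, pairFst_ne, pairFst_ne.symm, hij, hij.symm]

theorem blockMat_mulVec_of_ne (hik : i ≠ k) (hjk : j ≠ k) :
    Matrix.mulVec (blockMat π i j) (blockVec π k) = 0 := by
  rw [blockMat, fourMat_unitFour]
  simp [Matrix.add_mulVec, Matrix.sub_mulVec, Matrix.vecMulVec_mulVec, pairVec_dot_pairVec,
    pairFst_inj, pairSnd_inj, pairFst_ne, pairFst_ne.symm, hik, hjk]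

/-- The two quadruples share only the `j`-th pair, hence only one bivector, and the product has rank
one. -/
theorem blockMat_mul (hij : i ≠ j) (hjk : j ≠ k) (hik : i ≠ k) :
    blockMat π i j * blockMat π j k = Matrix.vecMulVec (blockVec π i) (blockVec π k) := by
  rw [blockMat, blockMat, fourMat_unitFour, fourMat_unitFour]
  simp [mul_add, add_mul, mul_sub, sub_mul, Matrix.vecMulVec_mul_vecMulVec, pairVec_dot_pairVec,
    pairFst_inj, pairSnd_inj, pairFst_ne, pairFst_ne.symm, hij, hij.symm, hjk, hjk.symm, hik,
    hik.symm]

theorem vecMulVec_pairVec_self {a b : Fin 8} (hab : a ≠ b) :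
    Matrix.vecMulVec (pairVec a b) (pairVec a b) = Matrix.diagonal fun p : Pair8 =>
      if p.1.1 = a ∧ p.1.2 = b ∨ p.1.1 = b ∧ p.1.2 = a then (1 : ℂ) else 0 := by
  ext ⟨⟨p, p'⟩, hp⟩ ⟨⟨r, r'⟩, hr⟩
  simp only at hp hr
  rw [Matrix.vecMulVec_apply, Matrix.diagonal_apply]
  simp only [pairVec, Subtype.mk.injEq, Prod.mk.injEq]
  grind

theorem sum_ite_pairs {α : Type*} [DecidableEq α] {a b c d p q : α} (hab : a ≠ b) (hac : a ≠ c)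
    (had : a ≠ d) (hbc : b ≠ c) (hbd : b ≠ d) (hcd : c ≠ d) (hpq : p ≠ q) :
    (if p = a ∧ q = b ∨ p = b ∧ q = a then (1 : ℂ) else 0)
      + (if p = a ∧ q = c ∨ p = c ∧ q = a then 1 else 0)
      + (if p = a ∧ q = d ∨ p = d ∧ q = a then 1 else 0)
      + (if p = b ∧ q = c ∨ p = c ∧ q = b then 1 else 0)
      + (if p = b ∧ q = d ∨ p = d ∧ q = b then 1 else 0)
      + (if p = c ∧ q = d ∨ p = d ∧ q = c then 1 else 0) =
      if (p = a ∨ p = b ∨ p = c ∨ p = d) ∧ (q = a ∨ q = b ∨ q = c ∨ q = d) then 1 else 0 := by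
  grind

/-- The pair to which an index belongs, in a permuted basis. -/
def blockOf (a : Fin 8) : Fin 4 := ⟨(π.symm a : ℕ) / 2, by omega⟩

/-- Up to sign the matrix exchanges complementary bivectors of the quadruple and kills all others,
so its square is the projection to the six bivectors of the quadruple. -/
theorem blockMat_mul_self (hij : i ≠ j) : blockMat π i j * blockMat π i j =
    Matrix.diagonal fun p : Pair8 =>
      if (blockOf π p.1.1 = i ∨ blockOf π p.1.1 = j) ∧ (blockOf π p.1.2 = i ∨ blockOf π p.1.2 = j)
      then (1 : ℂ) else 0 := by
  have hS : ∀ a, (blockOf π a = i ∨ blockOf π a = j) ↔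
      a = π (pairFst i) ∨ a = π (pairSnd i) ∨ a = π (pairFst j) ∨ a = π (pairSnd j) := by
    intro a
    obtain ⟨x, rfl⟩ := π.surjective a
    simp only [blockOf, Equiv.symm_apply_apply, π.injective.eq_iff, pairFst, pairSnd, Fin.ext_iff]
    omega
  have h1 : blockMat π i j * blockMat π i j =
      Matrix.vecMulVec (pairVec (π (pairFst i)) (π (pairSnd i))) (pairVec (π (pairFst i)) (π (pairSnd i)))
      + Matrix.vecMulVec (pairVec (π (pairFst i)) (π (pairFst j))) (pairVec (π (pairFst i)) (π (pairFst j)))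
      + Matrix.vecMulVec (pairVec (π (pairFst i)) (π (pairSnd j))) (pairVec (π (pairFst i)) (π (pairSnd j)))
      + Matrix.vecMulVec (pairVec (π (pairSnd i)) (π (pairFst j))) (pairVec (π (pairSnd i)) (π (pairFst j)))
      + Matrix.vecMulVec (pairVec (π (pairSnd i)) (π (pairSnd j))) (pairVec (π (pairSnd i)) (π (pairSnd j)))
      + Matrix.vecMulVec (pairVec (π (pairFst j)) (π (pairSnd j)))
        (pairVec (π (pairFst j)) (π (pairSnd j))) := by
    rw [blockMat, fourMat_unitFour]
    simp [mul_add, add_mul, mul_sub, sub_mul, Matrix.vecMulVec_mul_vecMulVec, pairVec_dot_pairVec,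
      pairFst_inj, pairSnd_inj, pairFst_ne, pairFst_ne.symm, hij, hij.symm]
    abel
  have hne : ∀ {x y : Fin 8}, x ≠ y → π x ≠ π y := fun h => π.injective.ne h
  have d1 := hne (pairFst_ne (i := i) (j := i))
  have d2 := hne (mt pairFst_inj.1 hij)
  have d3 := hne (pairFst_ne (i := i) (j := j))
  have d4 := hne (pairFst_ne (i := j) (j := i)).symm
  have d5 := hne (mt pairSnd_inj.1 hij)
  have d6 := hne (pairFst_ne (i := j) (j := j))
  rw [h1, vecMulVec_pairVec_self d1, vecMulVec_pairVec_self d2, vecMulVec_pairVec_self d3,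
    vecMulVec_pairVec_self d4, vecMulVec_pairVec_self d5, vecMulVec_pairVec_self d6,
    Matrix.diagonal_add, Matrix.diagonal_add, Matrix.diagonal_add, Matrix.diagonal_add,
    Matrix.diagonal_add]
  congr 1
  funext ⟨⟨p, p'⟩, hp⟩
  have hpp : p ≠ p' := ne_of_lt hp
  simp only [hS]
  exact sum_ite_pairs d1 d2 d3 d4 d5 d6 hpp

theorem blockOf_eq_iff (a : Fin 8) : blockOf π a = i ↔ a = π (pairFst i) ∨ a = π (pairSnd i) := by
  obtain ⟨x, rfl⟩ := π.surjective a
  simp only [blockOf, Equiv.symm_apply_apply, π.injective.eq_iff, pairFst, pairSnd, Fin.ext_iff]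
  omega

theorem vecMulVec_blockVec_self (i : Fin 4) : Matrix.vecMulVec (blockVec π i) (blockVec π i) =
    Matrix.diagonal fun p : Pair8 =>
      if blockOf π p.1.1 = i ∧ blockOf π p.1.2 = i then (1 : ℂ) else 0 := by
  have h := π.injective.ne (pairFst_ne (i := i) (j := i))
  rw [blockVec, vecMulVec_pairVec_self h]
  congr 1
  funext ⟨⟨p, q⟩, hp⟩
  have hpq : p ≠ q := ne_of_lt hp
  simp only [blockOf_eq_iff]
  grind

/-- The curvature of two complementary blocks. -/
abbrev blockCurv (i j k l : Fin 4) : Matrix Pair8 Pair8 ℂ :=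
  blockMat π i j * blockMat π i j - blockMat π k l * blockMat π k l

/-- Each factor is diagonal, with value `1` on bivectors inside one union of two pairs, `-1` inside
the complementary union, and `0` otherwise. Two different groupings of the four pairs are both
nonzero only on bivectors inside a single pair. -/
theorem blockCurv_mul (h : Function.Injective ![i, j, k, l]) :
    blockCurv π i k j l * blockCurv π i l j k =
      Matrix.vecMulVec (blockVec π i) (blockVec π i) + Matrix.vecMulVec (blockVec π j) (blockVec π j)
      - Matrix.vecMulVec (blockVec π k) (blockVec π k)
      - Matrix.vecMulVec (blockVec π l) (blockVec π l) := by
  have hij : i ≠ j := fun e => absurd (@h 0 1 e) (by decide)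
  have hik : i ≠ k := fun e => absurd (@h 0 2 e) (by decide)
  have hil : i ≠ l := fun e => absurd (@h 0 3 e) (by decide)
  have hjk : j ≠ k := fun e => absurd (@h 1 2 e) (by decide)
  have hjl : j ≠ l := fun e => absurd (@h 1 3 e) (by decide)
  have hkl : k ≠ l := fun e => absurd (@h 2 3 e) (by decide)
  have hcov : ∀ m, m = i ∨ m = j ∨ m = k ∨ m = l := by
    intro m
    obtain ⟨x, rfl⟩ := (Finite.injective_iff_surjective.1 h) m
    fin_cases x <;> simp
  rw [blockCurv, blockCurv, blockMat_mul_self π hik, blockMat_mul_self π hjl,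
    blockMat_mul_self π hil, blockMat_mul_self π hjk, vecMulVec_blockVec_self,
    vecMulVec_blockVec_self, vecMulVec_blockVec_self, vecMulVec_blockVec_self, Matrix.diagonal_sub,
    Matrix.diagonal_sub, Matrix.diagonal_mul_diagonal, Matrix.diagonal_add, Matrix.diagonal_sub,
    Matrix.diagonal_sub]
  congr 1
  funext p
  rcases hcov (blockOf π p.1.1) with h1 | h1 | h1 | h1 <;>
    rcases hcov (blockOf π p.1.2) with h2 | h2 | h2 | h2 <;>
    simp [h1, h2, hij, hik, hil, hjk, hjl, hkl, hij.symm, hik.symm, hil.symm, hjk.symm, hjl.symm,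
      hkl.symm]

theorem trace_mul_blockMat_mul {t : (Fin 4 → Fin 8) → ℂ} (ht : IsAlternatingFour t)
    (h : Function.Injective ![i, j, k, l]) :
    Matrix.trace (fourMat t * blockMat π i j * (blockCurv π i k j l * blockCurv π i l j k)) =
      2 * t (blockQuad π i j) := by
  have hij : i ≠ j := fun e => absurd (@h 0 1 e) (by decide)
  have hik : i ≠ k := fun e => absurd (@h 0 2 e) (by decide)
  have hil : i ≠ l := fun e => absurd (@h 0 3 e) (by decide)
  have hjk : j ≠ k := fun e => absurd (@h 1 2 e) (by decide)
  have hjl : j ≠ l := fun e => absurd (@h 1 3 e) (by decide)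
  rw [blockCurv_mul π h]
  simp only [mul_add, mul_sub, Matrix.trace_add, Matrix.trace_sub, trace_mul_vecMulVec,
    ← Matrix.mulVec_mulVec]
  rw [blockMat_mulVec π hij, blockMat_mulVec_of_ne π hik hjk, blockMat_mulVec_of_ne π hil hjl,
    blockMat_comm π i j, blockMat_mulVec π hij.symm, Matrix.mulVec_zero, dotProduct_zero,
    dotProduct_zero, pairVec_dot_fourMat ht, pairVec_dot_fourMat ht, ht.rotate]
  ring

/-- The last two factors commute, so all six orderings of the symmetrized product have the same
trace. By `trace_mul_blockMat_mul` the terms of `t` and `u` each contribute twice a component,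
whence `12 = 6 · 2`. -/
theorem trace_symProd₃_slot {t u : (Fin 4 → Fin 8) → ℂ} (ht : IsAlternatingFour t)
    (hu : IsAlternatingFour u) (h : Function.Injective ![i, j, k, l]) :
    Matrix.trace (symProd₃ (fourMat t * blockMat π i j - blockMat π k l * fourMat u)
      (blockCurv π i k j l) (blockCurv π i l j k)) =
      12 * (t (blockQuad π i j) + u (blockQuad π k l)) := by
  have h₁ : Function.Injective ![k, l, i, j] := by
    have e : ![k, l, i, j] = ![i, j, k, l] ∘ ![2, 3, 0, 1] := by ext x; fin_cases x <;> rfl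
    rw [e]; exact h.comp (by decide)
  have h₂ : Function.Injective ![i, j, l, k] := by
    have e : ![i, j, l, k] = ![i, j, k, l] ∘ ![0, 1, 3, 2] := by ext x; fin_cases x <;> rfl
    rw [e]; exact h.comp (by decide)
  have e₂ : blockCurv π i l j k * blockCurv π i k j l =
      blockCurv π i k j l * blockCurv π i l j k := by
    rw [blockCurv_mul π h, blockCurv_mul π h₂]; abel
  have e₁ : blockCurv π i k j l * blockCurv π i l j k =
      -(blockCurv π k i l j * blockCurv π k j l i) := by
    rw [blockCurv_mul π h, blockCurv_mul π h₁]; abel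
  have hsymm : (blockCurv π i k j l * blockCurv π i l j k).transpose =
      blockCurv π i k j l * blockCurv π i l j k := by
    rw [blockCurv_mul π h]
    simp only [Matrix.transpose_add, Matrix.transpose_sub, Matrix.transpose_vecMulVec]
  have hu' : Matrix.trace (blockMat π k l * fourMat u *
      (blockCurv π i k j l * blockCurv π i l j k)) = -(2 * u (blockQuad π k l)) := by
    rw [← Matrix.trace_transpose, Matrix.transpose_mul, hsymm, Matrix.transpose_mul,
      fourMat_transpose hu, fourMat_transpose (isAlternatingFour_unitFour _), Matrix.trace_mul_comm,
      e₁, mul_neg, Matrix.trace_neg, trace_mul_blockMat_mul π hu h₁]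
  rw [trace_symProd₃, mul_assoc, mul_assoc, e₂, sub_mul, Matrix.trace_sub, hu',
    trace_mul_blockMat_mul π ht h]
  ring

theorem blockMat_mul_apply₁ (hij : i ≠ j) (hjk : j ≠ k) (hik : i ≠ k) :
    blockMat π j i * blockMat π j k = Matrix.vecMulVec (blockVec π i) (blockVec π k) := by
  rw [blockMat_comm, blockMat_mul π hij hjk hik]

theorem blockMat_mul_apply₂ (hij : i ≠ j) (hjk : j ≠ k) (hik : i ≠ k) :
    blockMat π i j * blockMat π k j = Matrix.vecMulVec (blockVec π i) (blockVec π k) := by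
  rw [blockMat_comm π k, blockMat_mul π hij hjk hik]

theorem blockMat_mul_apply₃ (hij : i ≠ j) (hjk : j ≠ k) (hik : i ≠ k) :
    blockMat π j i * blockMat π k j = Matrix.vecMulVec (blockVec π i) (blockVec π k) := by
  rw [blockMat_comm π k, blockMat_comm, blockMat_mul π hij hjk hik]

end Blocks

/-- The slots are grouped as `{0,1}, {2,3}, {4,5}`, and curvatures between different groups vanish.
If the updated slot is matched outside its group, its partner in the group is matched outside as
well and gives zero, so only the matching by groups is left. -/
theorem sexticValue_update_blocks {m : Type*} [Fintype m] [DecidableEq m] (Z V : Fin 6 → Matrix m m ℂ)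
    (z w : Fin 6 → Matrix m m ℂ)
    (h : ∀ i j : Fin 6, (i : ℕ) / 2 ≠ (j : ℕ) / 2 → Z i * V j - Z j * V i = 0) :
    ∑ l, sexticValue (fun i j => Function.update Z l (z l) i * Function.update V l (w l) j -
        Function.update Z l (z l) j * Function.update V l (w l) i)
        (fun x y z => Matrix.trace (symProd₃ x y z)) id =
      Matrix.trace (symProd₃ (z 0 * V 1 - Z 1 * w 0) (Z 2 * V 3 - Z 3 * V 2) (Z 4 * V 5 - Z 5 * V 4))
      + Matrix.trace (symProd₃ (Z 0 * w 1 - z 1 * V 0) (Z 2 * V 3 - Z 3 * V 2)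
        (Z 4 * V 5 - Z 5 * V 4))
      + Matrix.trace (symProd₃ (Z 0 * V 1 - Z 1 * V 0) (z 2 * V 3 - Z 3 * w 2)
        (Z 4 * V 5 - Z 5 * V 4))
      + Matrix.trace (symProd₃ (Z 0 * V 1 - Z 1 * V 0) (Z 2 * w 3 - z 3 * V 2)
        (Z 4 * V 5 - Z 5 * V 4))
      + Matrix.trace (symProd₃ (Z 0 * V 1 - Z 1 * V 0) (Z 2 * V 3 - Z 3 * V 2)
        (z 4 * V 5 - Z 5 * w 4))
      + Matrix.trace (symProd₃ (Z 0 * V 1 - Z 1 * V 0) (Z 2 * V 3 - Z 3 * V 2)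
        (Z 4 * w 5 - z 5 * V 4)) := by
  have h02 := h 0 2 (by decide)
  have h03 := h 0 3 (by decide)
  have h04 := h 0 4 (by decide)
  have h05 := h 0 5 (by decide)
  have h12 := h 1 2 (by decide)
  have h13 := h 1 3 (by decide)
  have h14 := h 1 4 (by decide)
  have h15 := h 1 5 (by decide)
  have h24 := h 2 4 (by decide)
  have h25 := h 2 5 (by decide)
  have h34 := h 3 4 (by decide)
  have h35 := h 3 5 (by decide)
  rw [Fin.sum_univ_six]
  simp only [sexticValue, id, Function.update_apply, Fin.reduceEq, if_true, if_false, h02, h03, h04,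
    h05, h12, h13, h14, h15, h24, h25, h34, h35, symProd₃_zero_left, symProd₃_zero_mid,
    symProd₃_zero_right, Matrix.trace_zero, sub_zero, add_zero, zero_sub, zero_add, neg_zero]

end Sugra

set_option linter.unusedSimpArgs false

/-! ### Diagonal matrix elements for `E₇₍₇₎` and the Fano plane. -/

namespace Sugra

theorem trace_symProd₃_swap {n : Type*} [Fintype n] [DecidableEq n] (x y z : Matrix n n ℂ) :
    Matrix.trace (symProd₃ x y z) = Matrix.trace (symProd₃ y x z) := by
  have h := symTrace₃_comm 1 x y z
  rw [symTrace₃_apply, symTrace₃_apply, one_mul, one_mul] at h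
  exact h

theorem trace_symProd₃_swap' {n : Type*} [Fintype n] [DecidableEq n] (x y z : Matrix n n ℂ) :
    Matrix.trace (symProd₃ x y z) = Matrix.trace (symProd₃ x z y) := by
  have h := symTrace₃_comm' 1 x y z
  rw [symTrace₃_apply, symTrace₃_apply, one_mul, one_mul] at h
  exact h

/-- The weight vector of the complexified tangent space at `π{0,1,2,3}`. -/
abbrev weightMat (π : Equiv.Perm (Fin 8)) : Matrix (Pair8 ⊕ Pair8) (Pair8 ⊕ Pair8) ℂ :=
  dualPairMat (unitFour ![π 0, π 1, π 2, π 3]) (unitFour ![π 4, π 5, π 6, π 7])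

theorem isComplexHerm_weightMat {π : Equiv.Perm (Fin 8)} (hπ : Equiv.Perm.sign π = 1) :
    IsComplexHerm e77Lie (weightMat π) :=
  isComplexHerm_dualPairMat (isDualPair_unitFour hπ)

/-- The components of the 4-form in the upper right block of a matrix. -/
def fourCoeff (X : Matrix (Pair8 ⊕ Pair8) (Pair8 ⊕ Pair8) ℂ) (w : Fin 4 → Fin 8) : ℂ :=
  pairVec (w 0) (w 1) ⬝ᵥ Matrix.mulVec X.toBlocks₁₂ (pairVec (w 2) (w 3))

theorem fourCoeff_dualPairMat {t u : (Fin 4 → Fin 8) → ℂ} (ht : IsAlternatingFour t)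
    (w : Fin 4 → Fin 8) : fourCoeff (dualPairMat t u) w = t w := by
  rw [fourCoeff, Matrix.toBlocks_fromBlocks₁₂, pairVec_dot_fourMat ht, vec_four_eta]

theorem fourCoeff_neg (X : Matrix (Pair8 ⊕ Pair8) (Pair8 ⊕ Pair8) ℂ) (w : Fin 4 → Fin 8) :
    fourCoeff (-X) w = -fourCoeff X w := by
  have h : (-X).toBlocks₁₂ = -X.toBlocks₁₂ := rfl
  rw [fourCoeff, fourCoeff, h, Matrix.neg_mulVec, dotProduct_neg]

section Diagonal

variable {A : Module.End ℝ (Chart e77Lie)} {π : Equiv.Perm (Fin 8)}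

/-- The diagonal matrix element of an endomorphism at a weight vector. -/
def diagCoeff (A : Module.End ℝ (Chart e77Lie)) (π : Equiv.Perm (Fin 8)) : ℂ :=
  fourCoeff (complexify A (weightMat π)) ![π 0, π 1, π 2, π 3]

theorem trace_mul_weightMat {t u : (Fin 4 → Fin 8) → ℂ} (h : IsDualPair t u)
    (hπ : Equiv.Perm.sign π = 1) :
    Matrix.trace (dualPairMat t u * weightMat π) = 12 * t ![π 4, π 5, π 6, π 7] := by
  have hd := h.dual π
  rw [hπ, Units.val_one, Int.cast_one, one_mul] at hd
  rw [Matrix.fromBlocks_multiply, trace_fromBlocks]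
  simp only [Matrix.zero_mul, Matrix.mul_zero, zero_add, add_zero]
  rw [trace_fourMat_mul_unitFour h.left, trace_fourMat_mul_unitFour h.right, hd]
  ring

theorem trace_complexify_mul_halfSwap (hπ : Equiv.Perm.sign π = 1) :
    Matrix.trace (complexify A (weightMat π) * weightMat (π * halfSwap)) = 12 * diagCoeff A π := by
  obtain ⟨t, u, h, hX⟩ := (isComplexHerm_weightMat hπ).complexify (A := A) |>.exists_dualPair
  rw [diagCoeff, hX, trace_mul_weightMat h (by rw [Equiv.Perm.sign_mul, hπ, sign_halfSwap, one_mul]),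
    fourCoeff_dualPairMat h.left]
  rfl

theorem halfSwap_mul_self : halfSwap * halfSwap = 1 := by decide

/-- The trace form pairs the weight vector of a quadruple with that of its complement, so
self-adjointness equates the two diagonal elements. -/
theorem diagCoeff_halfSwap (hA : IsSymmetricAnnihilator A) (hπ : Equiv.Perm.sign π = 1) :
    diagCoeff A (π * halfSwap) = diagCoeff A π := by
  have hπ' : Equiv.Perm.sign (π * halfSwap) = 1 := by
    rw [Equiv.Perm.sign_mul, hπ, sign_halfSwap, one_mul]
  have h1 := trace_complexify_mul_halfSwap (A := A) hπ
  have h2 := trace_complexify_mul_halfSwap (A := A) hπ'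
  rw [mul_assoc, halfSwap_mul_self, mul_one] at h2
  rw [hA.trace_complexify_mul (isComplexHerm_weightMat hπ) (isComplexHerm_weightMat hπ'),
    Matrix.trace_mul_comm, h2] at h1
  exact mul_left_cancel₀ (by norm_num) h1

/-- The permutation which exchanges the second and the third pair. -/
def swapSecondThird : Equiv.Perm (Fin 8) :=
  ⟨![0, 1, 4, 5, 2, 3, 6, 7], ![0, 1, 4, 5, 2, 3, 6, 7], by decide, by decide⟩

/-- The permutation which moves the last pair to the second place. -/
def lastToSecond : Equiv.Perm (Fin 8) :=
  ⟨![0, 1, 6, 7, 2, 3, 4, 5], ![0, 1, 4, 5, 6, 7, 2, 3], by decide, by decide⟩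

set_option maxRecDepth 4000 in
theorem sign_swapSecondThird : Equiv.Perm.sign swapSecondThird = 1 := by decide

set_option maxRecDepth 4000 in
theorem sign_lastToSecond : Equiv.Perm.sign lastToSecond = 1 := by decide

theorem exists_complexify_block {π' : Equiv.Perm (Fin 8)} {i j k l : Fin 4}
    (hπ : Equiv.Perm.sign π' = 1) (h1 : ![π' 0, π' 1, π' 2, π' 3] = blockQuad π i j)
    (h2 : ![π' 4, π' 5, π' 6, π' 7] = blockQuad π k l) :
    IsComplexHerm e77Lie (offBlock (blockMat π i j) (blockMat π k l)) ∧ ∃ t u, IsDualPair t u ∧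
      complexify A (offBlock (blockMat π i j) (blockMat π k l)) = offBlock (fourMat t) (fourMat u) ∧
      t (blockQuad π i j) = diagCoeff A π' ∧ u (blockQuad π k l) = diagCoeff A π' := by
  have hH := isComplexHerm_weightMat hπ
  obtain ⟨t, u, h, hX⟩ := hH.complexify (A := A) |>.exists_dualPair
  have hd := h.symm.dual π'
  rw [hπ, Units.val_one, Int.cast_one, one_mul, h1, h2] at hd
  have ht : t (blockQuad π i j) = diagCoeff A π' := by
    rw [diagCoeff, hX, fourCoeff_dualPairMat h.left, h1]
  rw [weightMat, h1, h2] at hX hH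
  exact ⟨hH, t, u, h, hX, ht, by rw [← hd, ht]⟩

/-- `tr F³` is evaluated on the weight vectors of the three groupings of four disjoint pairs into
two quadruples, each grouping giving a quadruple and its complement. Curvatures between different
groupings vanish, and each of the six slots contributes 24 times a diagonal element. -/
theorem diagCoeff_sum_six (hA : IsSymmetricAnnihilator A) (hπ : Equiv.Perm.sign π = 1) :
    diagCoeff A π + diagCoeff A (π * halfSwap) + diagCoeff A (π * swapSecondThird)
      + diagCoeff A (π * swapSecondThird * halfSwap) + diagCoeff A (π * lastToSecond)
      + diagCoeff A (π * lastToSecond * halfSwap) = 0 := by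
  have hs₁ : Equiv.Perm.sign (π * halfSwap) = 1 := by
    rw [Equiv.Perm.sign_mul, hπ, sign_halfSwap, one_mul]
  have hs₂ : Equiv.Perm.sign (π * swapSecondThird) = 1 := by
    rw [Equiv.Perm.sign_mul, hπ, sign_swapSecondThird, one_mul]
  have hs₃ : Equiv.Perm.sign (π * swapSecondThird * halfSwap) = 1 := by
    rw [Equiv.Perm.sign_mul, hs₂, sign_halfSwap, one_mul]
  have hs₄ : Equiv.Perm.sign (π * lastToSecond) = 1 := by
    rw [Equiv.Perm.sign_mul, hπ, sign_lastToSecond, one_mul]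
  have hs₅ : Equiv.Perm.sign (π * lastToSecond * halfSwap) = 1 := by
    rw [Equiv.Perm.sign_mul, hs₄, sign_halfSwap, one_mul]
  obtain ⟨h₀, t₀, u₀, d₀, hX₀, ht₀, hu₀⟩ := exists_complexify_block (A := A) (π := π) (i := 0) (j := 1)
    (k := 2) (l := 3) hπ rfl rfl
  obtain ⟨h₁, t₁, u₁, d₁, hX₁, ht₁, hu₁⟩ := exists_complexify_block (A := A) (π := π) (i := 2) (j := 3)
    (k := 0) (l := 1) hs₁ rfl rfl
  obtain ⟨h₂, t₂, u₂, d₂, hX₂, ht₂, hu₂⟩ := exists_complexify_block (A := A) (π := π) (i := 0) (j := 2)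
    (k := 1) (l := 3) hs₂ rfl rfl
  obtain ⟨h₃, t₃, u₃, d₃, hX₃, ht₃, hu₃⟩ := exists_complexify_block (A := A) (π := π) (i := 1) (j := 3)
    (k := 0) (l := 2) hs₃ rfl rfl
  obtain ⟨h₄, t₄, u₄, d₄, hX₄, ht₄, hu₄⟩ := exists_complexify_block (A := A) (π := π) (i := 0) (j := 3)
    (k := 1) (l := 2) hs₄ rfl rfl
  obtain ⟨h₅, t₅, u₅, d₅, hX₅, ht₅, hu₅⟩ := exists_complexify_block (A := A) (π := π) (i := 1) (j := 2)
    (k := 0) (l := 3) hs₅ rfl rfl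
  let Z : Fin 6 → Matrix Pair8 Pair8 ℂ := ![blockMat π 0 1, blockMat π 2 3, blockMat π 0 2,
    blockMat π 1 3, blockMat π 0 3, blockMat π 1 2]
  let V : Fin 6 → Matrix Pair8 Pair8 ℂ := ![blockMat π 2 3, blockMat π 0 1, blockMat π 1 3,
    blockMat π 0 2, blockMat π 1 2, blockMat π 0 3]
  let z : Fin 6 → Matrix Pair8 Pair8 ℂ := ![fourMat t₀, fourMat t₁, fourMat t₂, fourMat t₃,
    fourMat t₄, fourMat t₅]
  let w : Fin 6 → Matrix Pair8 Pair8 ℂ := ![fourMat u₀, fourMat u₁, fourMat u₂, fourMat u₃,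
    fourMat u₄, fourMat u₅]
  have hXl : ∀ l, complexify A (offBlock (Z l) (V l)) = offBlock (z l) (w l) := by
    intro l
    fin_cases l
    exacts [hX₀, hX₁, hX₂, hX₃, hX₄, hX₅]
  have hH : ∀ l, IsComplexHerm e77Lie (offBlock (Z l) (V l)) := by
    intro l
    fin_cases l
    exacts [h₀, h₁, h₂, h₃, h₄, h₅]
  have hcross : ∀ i j : Fin 6, (i : ℕ) / 2 ≠ (j : ℕ) / 2 → Z i * V j - Z j * V i = 0 := by
    intro i j hij
    fin_cases i <;> fin_cases j <;> first
      | exact absurd rfl hij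
      | (simp only [Z, V, Matrix.cons_val, Fin.reduceFinMk, Fin.zero_eta, Fin.mk_one,
          Matrix.cons_val_zero, Matrix.cons_val_one]
         simp (disch := decide) only [blockMat_mul, blockMat_mul_apply₁, blockMat_mul_apply₂,
          blockMat_mul_apply₃, sub_self])
  have h := hA.sum_complexify (traceForm₆ (firstProj Pair8 Pair8))
    (fun κ hκ hκ' v => sum_traceForm₆_update (firstProj_comm_e77Lie hκ hκ') _) hH
  simp only [hXl, update_offBlock, traceForm₆_offBlock] at h
  rw [sexticValue_update_blocks Z V z w hcross] at h
  have s₀ := trace_symProd₃_slot π d₀.left d₀.right (i := 0) (j := 1) (k := 2) (l := 3) (by decide)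
  have s₁ := trace_symProd₃_slot π d₁.left d₁.right (i := 2) (j := 3) (k := 0) (l := 1) (by decide)
  have s₂ := trace_symProd₃_slot π d₂.left d₂.right (i := 0) (j := 2) (k := 1) (l := 3) (by decide)
  have s₃ := trace_symProd₃_slot π d₃.left d₃.right (i := 1) (j := 3) (k := 0) (l := 2) (by decide)
  have s₄ := trace_symProd₃_slot π d₄.left d₄.right (i := 0) (j := 3) (k := 1) (l := 2) (by decide)
  have s₅ := trace_symProd₃_slot π d₅.left d₅.right (i := 1) (j := 2) (k := 0) (l := 3) (by decide)
  simp only [Z, V, z, w, Matrix.cons_val, Matrix.cons_val_zero, Matrix.cons_val_one] at h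
  clear_value Z V z w
  unfold blockCurv at s₀ s₁ s₂ s₃ s₄ s₅
  have c := blockMat_comm π
  have hneg : ∀ x y z : Matrix Pair8 Pair8 ℂ, Matrix.trace (symProd₃ (-x) y (-z)) =
      Matrix.trace (symProd₃ x y z) := fun x y z => by
    rw [(symProd₃_neg _ _ _).1, (symProd₃_neg _ _ _).2.2, neg_neg]
  rw [ht₀, hu₀] at s₀
  rw [ht₁, hu₁, c 2 0, c 3 1, c 2 1, c 3 0, ← hneg, neg_sub, neg_sub] at s₁
  rw [ht₂, hu₂, c 2 1, trace_symProd₃_swap] at s₂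
  rw [ht₃, hu₃, c 1 0, c 3 2, c 3 0, ← hneg, neg_sub, neg_sub, trace_symProd₃_swap] at s₃
  rw [ht₄, hu₄, c 3 2, c 3 1, trace_symProd₃_swap, trace_symProd₃_swap'] at s₄
  rw [ht₅, hu₅, c 1 0, c 2 0, ← hneg, neg_sub, neg_sub, trace_symProd₃_swap,
    trace_symProd₃_swap'] at s₅
  rw [s₀, s₁, s₂, s₃, s₄, s₅] at h
  linear_combination h / 24

theorem diagCoeff_sum (hA : IsSymmetricAnnihilator A) (hπ : Equiv.Perm.sign π = 1) :
    diagCoeff A π + diagCoeff A (π * swapSecondThird) + diagCoeff A (π * lastToSecond) = 0 := by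
  have h := diagCoeff_sum_six hA hπ
  rw [diagCoeff_halfSwap hA hπ,
    diagCoeff_halfSwap hA (by rw [Equiv.Perm.sign_mul, hπ, sign_swapSecondThird, one_mul]),
    diagCoeff_halfSwap hA (by rw [Equiv.Perm.sign_mul, hπ, sign_lastToSecond, one_mul])] at h
  linear_combination h / 2

/-- The diagonal coefficient depends only on the set of the first four indices. -/
theorem diagCoeff_congr {π' : Equiv.Perm (Fin 8)} (hπ : Equiv.Perm.sign π = 1)
    (hπ' : Equiv.Perm.sign π' = 1) (σ : Equiv.Perm (Fin 4))
    (h : ![π' 0, π' 1, π' 2, π' 3] = ![π 0, π 1, π 2, π 3] ∘ σ) :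
    diagCoeff A π' = diagCoeff A π := by
  have h1 : unitFour ![π' 0, π' 1, π' 2, π' 3] =
      ((Equiv.Perm.sign σ : ℤ) : ℂ) • unitFour ![π 0, π 1, π 2, π 3] := by
    rw [h, unitFour_comp]
  have hd := isDualPair_unitFour hπ
  have h2 : unitFour ![π' 4, π' 5, π' 6, π' 7] =
      ((Equiv.Perm.sign σ : ℤ) : ℂ) • unitFour ![π 4, π 5, π 6, π 7] := by
    have hd' := isDualPair_unitFour hπ'
    rw [h1] at hd'
    refine hd'.right_eq ⟨hd'.left, fun v s => ?_, fun s => ?_⟩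
    · rw [Pi.smul_apply, Pi.smul_apply, hd.right, smul_eq_mul, smul_eq_mul, mul_left_comm]
    · rw [Pi.smul_apply, Pi.smul_apply, hd.dual, smul_eq_mul, smul_eq_mul, mul_left_comm]
  have hX := isComplexHerm_weightMat hπ
  obtain ⟨t, u, htu, hY⟩ := hX.complexify (A := A) |>.exists_dualPair
  rw [diagCoeff, diagCoeff, weightMat, h1, h2]
  rcases Int.units_eq_one_or (Equiv.Perm.sign σ) with hs | hs
  · simp only [hs, Units.val_one, Int.cast_one, one_smul]
    rw [hY, fourCoeff_dualPairMat htu.left, fourCoeff_dualPairMat htu.left, h, htu.left, hs]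
    simp
  · have e : dualPairMat ((-1 : ℂ) • unitFour ![π 0, π 1, π 2, π 3])
        ((-1 : ℂ) • unitFour ![π 4, π 5, π 6, π 7]) = -weightMat π := by
      ext (i | i) (j | j) <;> simp [fourMat]
    simp only [hs, Units.val_neg, Units.val_one, Int.cast_neg, Int.cast_one]
    rw [e, hX.complexify_neg, fourCoeff_neg, hY, fourCoeff_dualPairMat htu.left,
      fourCoeff_dualPairMat htu.left, h, htu.left, hs]
    simp

/-- Permutations whose first four values are the lines of the Fano plane, together with `0`. -/
def fanoPerm : Fin 7 → Equiv.Perm (Fin 8) :=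
  ![1,
    ⟨![0, 2, 4, 6, 1, 3, 5, 7], ![0, 4, 1, 5, 2, 6, 3, 7], by decide, by decide⟩,
    ⟨![0, 3, 4, 7, 1, 2, 5, 6], ![0, 4, 5, 1, 2, 6, 7, 3], by decide, by decide⟩,
    ⟨![0, 4, 1, 5, 2, 6, 3, 7], ![0, 2, 4, 6, 1, 3, 5, 7], by decide, by decide⟩,
    ⟨![0, 5, 2, 7, 1, 4, 3, 6], ![0, 4, 2, 6, 5, 1, 7, 3], by decide, by decide⟩,
    ⟨![0, 6, 3, 5, 1, 7, 2, 4], ![0, 4, 6, 2, 7, 3, 1, 5], by decide, by decide⟩,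
    ⟨![0, 7, 1, 6, 2, 5, 3, 4], ![0, 2, 4, 6, 7, 5, 3, 1], by decide, by decide⟩]

set_option maxRecDepth 8000 in
theorem sign_fanoPerm : ∀ d, Equiv.Perm.sign (fanoPerm d) = 1 := by decide

/-- With `Fin 8` read in binary as `𝔽₂³`, the consecutive pairs of `fanoPerm d` are the cosets of a
one-dimensional subspace, and regrouping them gives another plane through that line. The table in
the statement records which plane. -/
theorem exists_fano_swap : ∀ d, ∃ σ : Equiv.Perm (Fin 4), ∀ i : Fin 4,
    fanoPerm d (swapSecondThird (Fin.castAdd 4 i)) =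
      fanoPerm (![3, 0, 0, 1, 3, 6, 4] d) (Fin.castAdd 4 (σ i)) := by decide

theorem exists_fano_last : ∀ d, ∃ σ : Equiv.Perm (Fin 4), ∀ i : Fin 4,
    fanoPerm d (lastToSecond (Fin.castAdd 4 i)) =
      fanoPerm (![6, 4, 5, 2, 5, 1, 2] d) (Fin.castAdd 4 (σ i)) := by decide

theorem diagCoeff_fano (hA : IsSymmetricAnnihilator A) (hπ : Equiv.Perm.sign π = 1) (d : Fin 7) :
    diagCoeff A (π * fanoPerm d) + diagCoeff A (π * fanoPerm (![3, 0, 0, 1, 3, 6, 4] d))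
      + diagCoeff A (π * fanoPerm (![6, 4, 5, 2, 5, 1, 2] d)) = 0 := by
  have hs : ∀ d, Equiv.Perm.sign (π * fanoPerm d) = 1 := fun d => by
    rw [Equiv.Perm.sign_mul, hπ, sign_fanoPerm, one_mul]
  have h := diagCoeff_sum hA (hs d)
  obtain ⟨σ, hσ⟩ := exists_fano_swap d
  obtain ⟨τ, hτ⟩ := exists_fano_last d
  have key : ∀ (ρ : Equiv.Perm (Fin 8)) (e : Fin 7) (σ : Equiv.Perm (Fin 4)),
      (∀ i : Fin 4, fanoPerm d (ρ (Fin.castAdd 4 i)) = fanoPerm e (Fin.castAdd 4 (σ i))) →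
      Equiv.Perm.sign ρ = 1 →
      diagCoeff A (π * fanoPerm d * ρ) = diagCoeff A (π * fanoPerm e) := by
    intro ρ e σ hσ hρ
    refine diagCoeff_congr (hs e) (by rw [Equiv.Perm.sign_mul, hs, hρ, one_mul]) σ ?_
    have hv : ∀ ρ : Equiv.Perm (Fin 8), ![ρ 0, ρ 1, ρ 2, ρ 3] = fun i => ρ (Fin.castAdd 4 i) := by
      intro ρ; ext i; fin_cases i <;> rfl
    rw [hv, hv]
    funext i
    exact congrArg π (hσ i)
  rw [key _ _ σ hσ sign_swapSecondThird, key _ _ τ hτ sign_lastToSecond] at h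
  exact h

/-- There is one unknown for each line of the Fano plane, and for each point the three unknowns of
the lines through it add up to zero. Adding the relations at the points of one line gives twice its
unknown plus the total; adding all seven gives three times the total. -/
theorem diagCoeff_eq_zero (hA : IsSymmetricAnnihilator A) (hπ : Equiv.Perm.sign π = 1) :
    diagCoeff A π = 0 := by
  have h := diagCoeff_fano hA hπ
  have h0 := h 0
  have h1 := h 1
  have h2 := h 2
  have h3 := h 3
  have h4 := h 4
  have h5 := h 5
  have h6 := h 6
  simp only [Matrix.cons_val, Matrix.cons_val_zero, Matrix.cons_val_one] at h0 h1 h2 h3 h4 h5 h6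
  have e : π * fanoPerm 0 = π := mul_one π
  rw [e] at h0 h1 h2
  linear_combination (h0 + h1 + h2) / 2 - (h0 + h1 + h2 + h3 + h4 + h5 + h6) / 6

end Diagonal

end Sugra

set_option linter.unusedSimpArgs false

/-! ### Raising operators of `𝔰𝔲(8)` and rigidity for `E₇₍₇₎`. -/

namespace Sugra

/-- The element of `𝔢₇₍₇₎` given by an element of `𝔰𝔲(8)`. -/
def unitaryMat (L : Matrix (Fin 8) (Fin 8) ℂ) : Matrix (Pair8 ⊕ Pair8) (Pair8 ⊕ Pair8) ℂ :=
  Matrix.fromBlocks (wedgeTwo L) 0 0 (wedgeTwo (L.map star))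

theorem wedgeTwo_map_star (L : Matrix (Fin 8) (Fin 8) ℂ) :
    (wedgeTwo L).map star = wedgeTwo (L.map star) := by
  ext p r
  simp only [Matrix.map_apply, wedgeTwo_apply, wedgeTwoFun, star_sub, star_add, star_mul',
    apply_ite star, star_one, star_zero]

theorem unitaryMat_mem {L : Matrix (Fin 8) (Fin 8) ℂ} (hL : L.conjTranspose + L = 0)
    (htr : L.trace = 0) : unitaryMat L ∈ e77Lie := by
  refine ⟨L, 0, hL, htr, ⟨by simp, by simp⟩, ?_⟩
  rw [unitaryMat, wedgeTwo_map_star]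
  congr 1
  ext i j
  simp [fourMat]

theorem unitaryMat_conjTranspose {L : Matrix (Fin 8) (Fin 8) ℂ} (hL : L.conjTranspose + L = 0) :
    (unitaryMat L).conjTranspose = -unitaryMat L := by
  have hw : ∀ M : Matrix (Fin 8) (Fin 8) ℂ, wedgeTwo (-M) = -wedgeTwo M := by
    intro M; ext p r; simp only [wedgeTwo_apply, wedgeTwoFun, Matrix.neg_apply]; ring
  have h1 : L.conjTranspose = -L := eq_neg_of_add_eq_zero_left hL
  have h2 : (L.map star).conjTranspose = -(L.map star) := by
    rw [← Matrix.map_neg star (by simp), ← h1]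
    rfl
  rw [unitaryMat, Matrix.fromBlocks_conjTranspose, wedgeTwo_conjTranspose, wedgeTwo_conjTranspose,
    h1, h2, hw, hw, Matrix.fromBlocks_neg]
  simp

/-- For skew-Hermitian `L` the second diagonal block is minus the transpose of the first. Each
off-diagonal block of the commutator then has the shape of `wedgeTwo_mul_fourMat`. -/
theorem unitaryMat_commutator {L : Matrix (Fin 8) (Fin 8) ℂ} (hL : L.conjTranspose + L = 0)
    {t u : (Fin 4 → Fin 8) → ℂ} (ht : IsAlternatingFour t) (hu : IsAlternatingFour u) :
    unitaryMat L * dualPairMat t u - dualPairMat t u * unitaryMat L =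
      dualPairMat (fourAct L t) (fourAct (L.map star) u) := by
  have hw : ∀ M : Matrix (Fin 8) (Fin 8) ℂ, (wedgeTwo M).transpose = wedgeTwo M.transpose := by
    intro M; ext p r
    simp only [Matrix.transpose_apply, wedgeTwo_apply, wedgeTwoFun, eq_comm (a := r.1.1),
      eq_comm (a := r.1.2)]
    ring
  have hn : ∀ M : Matrix (Fin 8) (Fin 8) ℂ, wedgeTwo (-M) = -wedgeTwo M := by
    intro M; ext p r; simp only [wedgeTwo_apply, wedgeTwoFun, Matrix.neg_apply]; ring
  have h1 : L.conjTranspose = -L := eq_neg_of_add_eq_zero_left hL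
  have h2 : (wedgeTwo (L.map star)) = -(wedgeTwo L).transpose := by
    rw [hw, ← hn, ← Matrix.transpose_neg, ← h1]
    rfl
  have h3 : wedgeTwo L = -(wedgeTwo (L.map star)).transpose := by
    rw [h2, Matrix.transpose_neg, Matrix.transpose_transpose, neg_neg]
  have e1 := wedgeTwo_mul_fourMat ht L
  have e2 := wedgeTwo_mul_fourMat hu (L.map star)
  rw [unitaryMat, Matrix.fromBlocks_multiply, Matrix.fromBlocks_multiply, dualPairMat, offBlock, ← e1,
    ← e2,
    sub_eq_add_neg, Matrix.fromBlocks_neg, Matrix.fromBlocks_add]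
  simp only [Matrix.mul_zero, Matrix.zero_mul, add_zero, zero_add, neg_zero]
  congr 1
  · conv_lhs => rw [h2, mul_neg, neg_neg]
  · conv_lhs => rw [h3, mul_neg, neg_neg]

theorem fourAct_single (a b : Fin 8) (t : (Fin 4 → Fin 8) → ℂ) (v : Fin 4 → Fin 8) :
    fourAct (Matrix.single a b 1) t v =
      ∑ i, if v i = a then t (Function.update v i b) else 0 := by
  refine Finset.sum_congr rfl fun i _ => ?_
  simp [Matrix.single_apply, ite_and, eq_comm]

theorem fourAct_add (L M : Matrix (Fin 8) (Fin 8) ℂ) (t : (Fin 4 → Fin 8) → ℂ) :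
    fourAct (L + M) t = fourAct L t + fourAct M t := by
  funext v
  simp [fourAct, add_mul, Finset.sum_add_distrib]

theorem fourAct_smul (c : ℂ) (L : Matrix (Fin 8) (Fin 8) ℂ) (t : (Fin 4 → Fin 8) → ℂ) :
    fourAct (c • L) t = c • fourAct L t := by
  funext v
  simp [fourAct, mul_assoc, Finset.mul_sum]

/-- The real rotation in the plane of two basis vectors. -/
def realRot (a b : Fin 8) : Matrix (Fin 8) (Fin 8) ℂ :=
  Matrix.single a b 1 - Matrix.single b a 1

/-- The imaginary rotation in the plane of two basis vectors. -/
def imagRot (a b : Fin 8) : Matrix (Fin 8) (Fin 8) ℂ :=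
  Complex.I • (Matrix.single a b 1 + Matrix.single b a 1)

theorem realRot_conjTranspose (a b : Fin 8) : (realRot a b).conjTranspose + realRot a b = 0 := by
  simp [realRot, Matrix.conjTranspose_single]

theorem imagRot_conjTranspose (a b : Fin 8) : (imagRot a b).conjTranspose + imagRot a b = 0 := by
  rw [imagRot, Matrix.conjTranspose_smul, Matrix.conjTranspose_add, Matrix.conjTranspose_single,
    Matrix.conjTranspose_single, star_one, Complex.star_def, Complex.conj_I,
    add_comm (Matrix.single b a (1 : ℂ))]
  module

theorem realRot_trace {a b : Fin 8} (hab : a ≠ b) : (realRot a b).trace = 0 := by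
  simp [realRot, Matrix.trace_single_eq_of_ne, hab, hab.symm]

theorem imagRot_trace {a b : Fin 8} (hab : a ≠ b) : (imagRot a b).trace = 0 := by
  simp [imagRot, Matrix.trace_single_eq_of_ne, hab, hab.symm]

/-- The raising operator `E_ab` does not lie in `𝔰𝔲(8)`, but it is a complex combination of two of
its elements. -/
theorem fourAct_realRot_sub (a b : Fin 8) (t : (Fin 4 → Fin 8) → ℂ) :
    fourAct (realRot a b) t - Complex.I • fourAct (imagRot a b) t =
      (2 : ℂ) • fourAct (Matrix.single a b 1) t := by
  have h : (2 : ℂ) • Matrix.single a b (1 : ℂ) = realRot a b + (-Complex.I) • imagRot a b := by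
    rw [realRot, imagRot, smul_smul, neg_mul, Complex.I_mul_I, neg_neg, one_smul]
    module
  rw [← fourAct_smul 2, h, fourAct_add, fourAct_smul]
  module

/-- On the conjugate block the same combination acts through `E_ba` with the opposite sign, as on
the dual representation. -/
theorem fourAct_realRot_star_sub (a b : Fin 8) (t : (Fin 4 → Fin 8) → ℂ) :
    fourAct ((realRot a b).map star) t - Complex.I • fourAct ((imagRot a b).map star) t =
      (-2 : ℂ) • fourAct (Matrix.single b a 1) t := by
  have h1 : (realRot a b).map star = realRot a b := by
    ext i j
    simp only [realRot, Matrix.map_apply, Matrix.sub_apply, Matrix.single_apply, star_sub,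
      apply_ite star, star_one, star_zero]
  have hI : star Complex.I = -Complex.I := Complex.conj_I
  have h2 : (imagRot a b).map star = (-1 : ℂ) • imagRot a b := by
    ext i j
    simp only [imagRot, Matrix.map_apply, Matrix.smul_apply, Matrix.add_apply, Matrix.single_apply,
      star_add, star_mul', smul_eq_mul, apply_ite star, star_one, star_zero, hI]
    ring
  have h : (-2 : ℂ) • Matrix.single b a (1 : ℂ) =
      realRot a b + (-Complex.I) • (-1 : ℂ) • imagRot a b := by
    rw [realRot, imagRot, smul_smul, smul_smul, mul_neg_one, neg_neg, Complex.I_mul_I]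
    module
  rw [h1, h2, ← fourAct_smul (-2), h, fourAct_add, fourAct_smul (-Complex.I)]
  module

theorem fourAct_single_unitFour {a b : Fin 8} {v : Fin 4 → Fin 8} (h : ∀ j, b ≠ v j) :
    fourAct (Matrix.single a b 1) (unitFour v) = 0 := by
  funext w
  rw [fourAct_single]
  refine Finset.sum_eq_zero fun i _ => ?_
  rw [unitFour_eq_zero (i := i) (by simpa using h), ite_self]

/-- The raising operators move the matrix elements of a symmetric annihilator. -/
theorem exists_symmetricAnnihilator_raise {A : Module.End ℝ (Chart e77Lie)}
    (hA : IsSymmetricAnnihilator A) {π : Equiv.Perm (Fin 8)} (hπ : Equiv.Perm.sign π = 1)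
    {a b : Fin 8} (ha : ∀ j, a ≠ ![π 4, π 5, π 6, π 7] j) (hb : ∀ j, b ≠ ![π 0, π 1, π 2, π 3] j)
    (hab : a ≠ b) (v : Fin 4 → Fin 8)
    (h : ∀ B : Module.End ℝ (Chart e77Lie), IsSymmetricAnnihilator B →
      fourCoeff (complexify B (weightMat π)) v = 0)
    {t u : (Fin 4 → Fin 8) → ℂ} (htu : IsDualPair t u)
    (hX : complexify A (weightMat π) = dualPairMat t u) :
    fourAct (Matrix.single a b 1) t v = 0 := by
  have h𝔤 := isSelfAdjointLie_e77Lie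
  have hH := isComplexHerm_weightMat hπ
  have m₁ := unitaryMat_mem (realRot_conjTranspose a b) (realRot_trace hab)
  have s₁ := unitaryMat_conjTranspose (realRot_conjTranspose a b)
  have m₂ := unitaryMat_mem (imagRot_conjTranspose a b) (imagRot_trace hab)
  have s₂ := unitaryMat_conjTranspose (imagRot_conjTranspose a b)
  have h₁ := h _ (hA.commutator h𝔤 m₁ s₁)
  have h₂ := h _ (hA.commutator h𝔤 m₂ s₂)
  have hw := isDualPair_unitFour hπ
  -- The complex combination of rotations which is the raising operator kills the weight vector, so
  -- applying it to the image under `A` is the same as applying the commutator with `A` to the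
  -- weight vector.
  have hcomm : unitaryMat (realRot a b) * weightMat π - weightMat π * unitaryMat (realRot a b) =
      Complex.I • (unitaryMat (imagRot a b) * weightMat π - weightMat π * unitaryMat (imagRot a b)) := by
    rw [unitaryMat_commutator (realRot_conjTranspose a b) hw.left hw.right,
      unitaryMat_commutator (imagRot_conjTranspose a b) hw.left hw.right]
    have e₁ := fourAct_realRot_sub a b (unitFour ![π 0, π 1, π 2, π 3])
    have e₂ := fourAct_realRot_star_sub a b (unitFour ![π 4, π 5, π 6, π 7])
    rw [fourAct_single_unitFour hb, smul_zero, sub_eq_zero] at e₁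
    rw [fourAct_single_unitFour ha, smul_zero, sub_eq_zero] at e₂
    rw [e₁, e₂]
    ext (i | i) (j | j) <;> simp [fourMat]
  rw [hH.complexify_commutator h𝔤 m₁ s₁, hcomm, (hH.commutator h𝔤 m₂ s₂).complexify_smul_I, hX,
    unitaryMat_commutator (realRot_conjTranspose a b) htu.left htu.right] at h₁
  rw [hH.complexify_commutator h𝔤 m₂ s₂, hX,
    unitaryMat_commutator (imagRot_conjTranspose a b) htu.left htu.right] at h₂
  have hlin : ∀ (X Y : Matrix (Pair8 ⊕ Pair8) (Pair8 ⊕ Pair8) ℂ), fourCoeff (X - Y) v =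
      fourCoeff X v - fourCoeff Y v := by
    intro X Y
    have e : (X - Y).toBlocks₁₂ = X.toBlocks₁₂ - Y.toBlocks₁₂ := rfl
    rw [fourCoeff, fourCoeff, fourCoeff, e, Matrix.sub_mulVec, dotProduct_sub]
  have hsmul : ∀ (X : Matrix (Pair8 ⊕ Pair8) (Pair8 ⊕ Pair8) ℂ), fourCoeff (Complex.I • X) v =
      Complex.I * fourCoeff X v := by
    intro X
    have e : (Complex.I • X).toBlocks₁₂ = Complex.I • X.toBlocks₁₂ := rfl
    rw [fourCoeff, fourCoeff, e, Matrix.smul_mulVec, dotProduct_smul, smul_eq_mul]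
  rw [hlin, hsmul, fourCoeff_dualPairMat (htu.left.fourAct _)] at h₁
  rw [hlin, fourCoeff_dualPairMat (htu.left.fourAct _)] at h₂
  have e := congrFun (fourAct_realRot_sub a b t) v
  simp only [Pi.sub_apply, Pi.smul_apply, smul_eq_mul] at e
  linear_combination (h₁ - Complex.I * h₂ - e) / 2

/-- Induction, for all symmetric annihilators at once, on the number of entries of `w` outside
`π{0,1,2,3}`. With none outside, the coefficient is a diagonal element up to sign. Otherwise some
element of the quadruple is missing from `w`; raising an outside entry to it turns the coefficient
into one of the commutators of `A`, with one entry fewer outside. -/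
theorem fourCoeff_complexify_eq_zero {π : Equiv.Perm (Fin 8)} (hπ : Equiv.Perm.sign π = 1) (n : ℕ) :
    ∀ {A : Module.End ℝ (Chart e77Lie)}, IsSymmetricAnnihilator A → ∀ w : Fin 4 → Fin 8,
      (Finset.univ.filter fun k => ∀ j, w k ≠ ![π 0, π 1, π 2, π 3] j).card = n →
      fourCoeff (complexify A (weightMat π)) w = 0 := by
  induction n with
  | zero =>
    intro A hA w hw
    obtain ⟨t, u, htu, hX⟩ := (isComplexHerm_weightMat hπ).complexify (A := A) |>.exists_dualPair
    rw [hX, fourCoeff_dualPairMat htu.left]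
    by_cases hinj : Function.Injective w
    swap
    · exact htu.left.eq_zero_of_not_injective hinj
    rw [Finset.card_eq_zero, Finset.filter_eq_empty_iff] at hw
    have hw' : ∀ k, ∃ j, w k = ![π 0, π 1, π 2, π 3] j := fun k => by
      simpa using hw (Finset.mem_univ k)
    choose f hf using hw'
    have hfi : Function.Injective f := fun x y hxy => hinj (by rw [hf, hf, hxy])
    have e : w = ![π 0, π 1, π 2, π 3] ∘ Equiv.ofBijective f (Finite.injective_iff_bijective.1 hfi) :=
      funext hf
    have h0 := diagCoeff_eq_zero hA hπ
    rw [diagCoeff, hX, fourCoeff_dualPairMat htu.left] at h0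
    rw [e, htu.left, h0, mul_zero]
  | succ n ih =>
    intro A hA w hw
    obtain ⟨t, u, htu, hX⟩ := (isComplexHerm_weightMat hπ).complexify (A := A) |>.exists_dualPair
    rw [hX, fourCoeff_dualPairMat htu.left]
    by_cases hinj : Function.Injective w
    swap
    · exact htu.left.eq_zero_of_not_injective hinj
    obtain ⟨i, hi⟩ := Finset.card_pos.1 (show 0 < _ by rw [hw]; exact Nat.succ_pos n)
    have hi' := (Finset.mem_filter.1 hi).2
    obtain ⟨j, hj⟩ : ∃ j, ∀ k, w k ≠ ![π 0, π 1, π 2, π 3] j := by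
      by_contra! hcon
      choose f hf using hcon
      have hv : Function.Injective ![π 0, π 1, π 2, π 3] := by
        have e : ![π 0, π 1, π 2, π 3] = π ∘ ![0, 1, 2, 3] := by ext x; fin_cases x <;> rfl
        rw [e]
        exact π.injective.comp (by decide)
      have hfi : Function.Injective f := fun x y hxy => hv (by rw [← hf, ← hf, hxy])
      obtain ⟨j, hj⟩ := (Finite.injective_iff_surjective.1 hfi) i
      exact hi' j (by rw [← hj, hf])
    have ha : ∀ k, ![π 0, π 1, π 2, π 3] j ≠ ![π 4, π 5, π 6, π 7] k := by
      intro k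
      fin_cases j <;> fin_cases k <;> exact π.injective.ne (by decide)
    have hcard : (Finset.univ.filter fun k => ∀ l,
        Function.update w i (![π 0, π 1, π 2, π 3] j) k ≠ ![π 0, π 1, π 2, π 3] l).card = n := by
      have e : (Finset.univ.filter fun k => ∀ l,
          Function.update w i (![π 0, π 1, π 2, π 3] j) k ≠ ![π 0, π 1, π 2, π 3] l) =
          (Finset.univ.filter fun k => ∀ l, w k ≠ ![π 0, π 1, π 2, π 3] l).erase i := by
        ext k
        rw [Finset.mem_filter, Finset.mem_erase, Finset.mem_filter]
        by_cases hk : k = i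
        · subst hk
          simp
        · simp [hk]
      rw [e, Finset.card_erase_of_mem hi, hw, Nat.add_sub_cancel]
    have h := exists_symmetricAnnihilator_raise hA hπ ha hi' (hi' j).symm
      (Function.update w i (![π 0, π 1, π 2, π 3] j)) (fun B hB => ih hB _ hcard) htu hX
    -- The inserted value was missing from `w`, so slot `i` is the only one which carries it and the
    -- derivation has a single term.
    rw [fourAct_single, Finset.sum_eq_single i] at h
    · simpa using h
    · intro k _ hk
      rw [Function.update_of_ne hk, if_neg (hj k)]
    · simp

theorem e77Lie_symmetricAnnihilator_eq_zero {A : Module.End ℝ (Chart e77Lie)}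
    (hA : IsSymmetricAnnihilator A) : A = 0 := by
  refine hA.eq_zero_of_complexify
    (S := {Y | ∃ π : Equiv.Perm (Fin 8), Equiv.Perm.sign π = 1 ∧ Y = weightMat π}) ?_ ?_ ?_
  · rintro _ ⟨π, hπ, rfl⟩
    exact isComplexHerm_weightMat hπ
  · rintro _ ⟨π, hπ, rfl⟩
    obtain ⟨t, u, htu, hX⟩ := (isComplexHerm_weightMat hπ).complexify (A := A) |>.exists_dualPair
    have ht : t = 0 := funext fun w => by
      rw [← fourCoeff_dualPairMat (u := u) htu.left, ← hX,
        fourCoeff_complexify_eq_zero hπ _ hA w rfl, Pi.zero_apply]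
    have hu : u = 0 := htu.right.eq_zero fun σ _ => by
      rw [htu.dual, ht, Pi.zero_apply, mul_zero]
    rw [hX, ht, hu]
    exact Matrix.fromBlocks_zero
  · intro X hX h
    obtain ⟨t, u, htu, rfl⟩ := hX.exists_dualPair
    have hu : u = 0 := htu.right.eq_zero fun π hπ => by
      have h1 := h _ ⟨π, hπ, rfl⟩
      rw [trace_mul_weightMat htu hπ] at h1
      rw [htu.dual, (mul_eq_zero.1 h1).resolve_left (by norm_num), mul_zero]
    have ht : t = 0 := htu.left.eq_zero fun σ _ => by
      rw [htu.symm.dual, hu, Pi.zero_apply, mul_zero]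
    rw [ht, hu]
    exact Matrix.fromBlocks_zero

end Sugra

end

/-! ### The four families together. -/

theorem mainTheorem9 (S : Sugra.SugraSpace) (c : ℝ) (hc : 0 < c) :
    (∀ x : S.Space, Sugra.annihilator (S.metric c) x ⊓ Sugra.symTwo (S.metric c) x = ⊥) ∧
    ∀ (n : ℕ) (Y : Type*) [TopologicalSpace Y] [ChartedSpace (EuclideanSpace ℝ (Fin n)) Y]
      [IsManifold (𝓡 n) ∞ Y]
      (h : Bundle.ContMDiffRiemannianMetric (𝓡 n) ∞ (EuclideanSpace ℝ (Fin n))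
        (fun y : Y => TangentSpace (𝓡 n) y))
      (f : S.Space → Y),
      Sugra.IsTamed (S.metric c) h f → Sugra.IsTotallyGeodesic (S.metric c) h f := by
  cases S with
  | e77 =>
    exact Sugra.annihilator_and_isTotallyGeodesic Sugra.isSelfAdjointLie_e77Lie hc
      (fun A hA => Sugra.e77Lie_symmetricAnnihilator_eq_zero hA)
  | soStar12 =>
    exact Sugra.annihilator_and_isTotallyGeodesic (Sugra.isSelfAdjointLie_soStarLie 6) hc
      (fun A hA => Sugra.soStarLie_symmetricAnnihilator_eq_zero hA)
  | so6 k hk =>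
    exact Sugra.annihilator_and_isTotallyGeodesic (Sugra.isSelfAdjointLie_soLie 6 k) hc
      (fun A hA => Sugra.soLie_symmetricAnnihilator_eq_zero hk hA)
  | su3 k hk =>
    exact Sugra.annihilator_and_isTotallyGeodesic (Sugra.isSelfAdjointLie_suLie 3 k) hc
      (fun A hA => Sugra.suLie_symmetricAnnihilator_eq_zero hk hA)
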